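/- Let $p$ be a prime number and put $J=\begin{pmatrix}0&1\\-1&0\end{pmatrix}$, $$H=\Big\{h\in \mathrm{GL}_4(\mathbb{Q}_p) : {}^t h\begin{pmatrix}0&J\\-J&0\end{pmatrix}h=\begin{pmatrix}0&J\\-J&0\end{pmatrix}\Big\},\qquad G=\Big\{g\in \mathrm{GL}_4(\mathbb{Q}_p) : {}^t g\begin{pmatrix}0&1_2\\-1_2&0\end{pmatrix}g=\begin{pmatrix}0&1_2\\-1_2&0\end{pmatrix}\Big\},$$ $U=H\cap \mathrm{GL}_4(\mathbb{Z}_p)$, $K=G\cap\mathrm{GL}_4(\mathbb{Z}_p)$. (These are the local groups $H_p\supset U_p$ and $G_p\supset K_p$ attached to a definite quaternion algebra $B$ over $\mathbb{Q}$ at a prime $p$ not dividing its discriminant $d_B$, after identifying $B\otimes\mathbb{Q}_p$ with $\mathrm{M}_2(\mathbb{Q}_p)$.) Let $dh$ and $dg$ be the Haar measures on $H$ and $G$ with $\mathrm{vol}(U)=\mathrm{vol}(K)=1$. Let $\psi$ be the additive character of $\mathbb{Q}_p$ that is trivial on $\mathbb{Z}_p$ and satisfies $\psi(m/p^k)=e^{-2\pi\sqrt{-1}\,m/p^k}$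 for $m\in\mathbb{Z}$, $k\ge 0$. Write elements of $\mathbb{Q}_p^{(2,4)}$ (the $2\times 4$ matrices) as $(x,y)$ with $x,y\in\mathrm{M}_2(\mathbb{Q}_p)$ and elements of $\mathbb{Q}_p^{(4,2)}$ as $\binom{x}{z}$. Let $r'$ be the Weil representation of $H\times G$ on Schwartz–Bruhat functions on $\mathbb{Q}_p^{(2,4)}$: $r'(1,g)\phi(x,y)=\phi((x,y)g)$ for $g\in G$, and $r'(h,1)=I\circ r(h)\circ I^{-1}$ for $h\in H$, where $r(h)\varphi(X)=\varphi({}^t hX)$ for functions $\varphi$ on $\mathbb{Q}_p^{(4,2)}$, $$I\varphi(x,y)=\int_{\mathrm{M}_2(\mathbb{Q}_p)}\psi\big(\mathrm{Tr}({}^t zJy)\big)\,\varphi\tbinom{x}{z}\,dz,\qquad I^{-1}\phi\tbinom{x}{z}=\int_{\mathrm{M}_2(\mathbb{Q}_p)}\psi\big(-\mathrm{Tr}({}^t zJy)\big)\,\phi(x,y)\,dy,$$ and the Haar measure on $\mathrm{M}_2(\mathbb{Q}_p)$ is normalized by $\mathrm{vol}(\mathrm{M}_2(\mathbb{Z}_p))=1$.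 (Thus $r'\big(\begin{smallmatrix}A&0\\0&J^{-1}\,{}^tA^{-1}J\end{smallmatrix},1\big)\phi(x,y)=|\det A|_p^2\,\phi({}^tAx,{}^tAy)$ for $A\in \mathrm{GL}_2(\mathbb{Q}_p)$, and $r'\big(\begin{smallmatrix}1_2&b1_2\\0&1_2\end{smallmatrix},1\big)\phi(x,y)=\psi(-b\,\mathrm{Tr}({}^txJy))\phi(x,y)$ for $b\in\mathbb{Q}_p$.) Let $\phi_0$ be the characteristic function of $\mathbb{Z}_p^{(2,4)}$. For $i=1,2$ let $T_i^H$ (resp. $T_i^G$) be the set of $h\in H$ (resp. $g\in G$) such that $ph$ (resp. $pg$) lies in $\mathrm{M}_4(\mathbb{Z}_p)$ and its reduction modulo $p$ has rank $i$ over $\mathbb{F}_p$, and for $x,y\in\mathrm{M}_2(\mathbb{Q}_p)$ put $$J_i^H(x,y)=\int_{T_i^H}r'(h,1)\phi_0(x,y)\,dh,\qquad J_i^G(x,y)=\int_{T_i^G}r'(1,g)\phi_0(x,y)\,dg .$$ Then for all $x,y\in\mathrm{M}_2(\mathbb{Q}_p)$ the integrals $J_i^H(x,y)$ and $J_i^G(x,y)$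 $(i=1,2)$ converge absolutely, and $$J_1^G(x,y)=p\,J_1^H(x,y)+(p^2-1)\,\phi_0(x,y),$$ $$J_2^G(x,y)=(p^2-p)\,J_1^H(x,y)+p^2\,J_2^H(x,y).$$ -/

import Mathlib

open MeasureTheory Matrix

namespace EichlerUnramified

noncomputable section

/-- `J = (0 1; -1 0)`. -/
def J (R : Type*) [CommRing R] : Matrix (Fin 2) (Fin 2) R := !![0, 1; -1, 0]

/-! ### Matrices over the `p`-adic integers inside matrices over the `p`-adic numbers -/

/-- The set of matrices with entries in `ℤ_p`, as a subset of the matrices over `ℚ_p`. -/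
def intMat (p : ℕ) [Fact p.Prime] (m n : Type*) : Set (Matrix m n ℚ_[p]) :=
  Set.range fun A : Matrix m n ℤ_[p] => A.map (algebraMap ℤ_[p] ℚ_[p])

theorem mem_intMat_iff {p : ℕ} [Fact p.Prime] {m n : Type*} {A : Matrix m n ℚ_[p]} :
    A ∈ intMat p m n ↔ ∀ i j, ‖A i j‖ ≤ 1 := by
  constructor
  · rintro ⟨B, rfl⟩ i j
    exact (B i j).2
  · intro h
    exact ⟨Matrix.of fun i j => ⟨A i j, h i j⟩, by ext i j; rfl⟩

theorem isCompact_intMat (p : ℕ) [Fact p.Prime] (m n : Type*) : IsCompact (intMat p m n) := by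
  have h : intMat p m n
      = Set.univ.pi fun _ : m => Set.univ.pi fun _ : n => Metric.closedBall (0 : ℚ_[p]) 1 := by
    ext A
    exact mem_intMat_iff.trans ⟨fun h i _ j _ => mem_closedBall_zero_iff.2 (h i j),
      fun h i j => mem_closedBall_zero_iff.1 (h i trivial j trivial)⟩
  rw [h]
  exact isCompact_univ_pi fun _ => isCompact_univ_pi fun _ => isCompact_closedBall _ _

theorem isOpen_intMat (p : ℕ) [Fact p.Prime] (m n : Type*) [Finite m] [Finite n] :
    IsOpen (intMat p m n) := by
  have h : intMat p m n
      = Set.univ.pi fun _ : m => Set.univ.pi fun _ : n => Metric.closedBall (0 : ℚ_[p]) 1 := by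
    ext A
    exact mem_intMat_iff.trans ⟨fun h i _ j _ => mem_closedBall_zero_iff.2 (h i j),
      fun h i j => mem_closedBall_zero_iff.1 (h i trivial j trivial)⟩
  rw [h]
  exact isOpen_set_pi Set.finite_univ fun _ _ =>
    isOpen_set_pi Set.finite_univ fun _ _ =>
      IsUltrametricDist.isOpen_closedBall _ one_ne_zero

/-! ### Isometry groups, their integral points and their Haar measures -/

/-- The subgroup `{g ∈ GL_n(R) ∣ ᵗg S g = S}`. -/
def isometryGroup {n R : Type*} [Fintype n] [DecidableEq n] [CommRing R] (S : Matrix n n R) :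
    Subgroup (GL n R) where
  carrier := {g | (g : Matrix n n R)ᵀ * S * (g : Matrix n n R) = S}
  one_mem' := by simp
  mul_mem' := by
    intro a b ha hb
    simp only [Set.mem_ofPred_eq] at ha hb ⊢
    calc ((a * b : GL n R) : Matrix n n R)ᵀ * S * ((a * b : GL n R) : Matrix n n R)
        = (b : Matrix n n R)ᵀ * ((a : Matrix n n R)ᵀ * S * (a : Matrix n n R))
            * (b : Matrix n n R) := by
          simp only [Units.val_mul, Matrix.transpose_mul, Matrix.mul_assoc]
      _ = S := by rw [ha, hb]
  inv_mem' := by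
    intro a ha
    simp only [Set.mem_ofPred_eq] at ha ⊢
    have h1 : (a : Matrix n n R) * ((a⁻¹ : GL n R) : Matrix n n R) = 1 := a.mul_inv
    have h2 : ((a⁻¹ : GL n R) : Matrix n n R)ᵀ * (a : Matrix n n R)ᵀ = 1 := by
      rw [← Matrix.transpose_mul, h1, Matrix.transpose_one]
    calc ((a⁻¹ : GL n R) : Matrix n n R)ᵀ * S * ((a⁻¹ : GL n R) : Matrix n n R)
        = ((a⁻¹ : GL n R) : Matrix n n R)ᵀ * ((a : Matrix n n R)ᵀ * S * (a : Matrix n n R))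
            * ((a⁻¹ : GL n R) : Matrix n n R) := by rw [ha]
      _ = (((a⁻¹ : GL n R) : Matrix n n R)ᵀ * (a : Matrix n n R)ᵀ) * S
            * ((a : Matrix n n R) * ((a⁻¹ : GL n R) : Matrix n n R)) := by
          simp only [Matrix.mul_assoc]
      _ = S := by rw [h1, h2, Matrix.one_mul, Matrix.mul_one]

section Groups

variable {p : ℕ} [Fact p.Prime] {n : Type*} [Fintype n] [DecidableEq n]

/-- The intersection of `{g ∈ GL_n(ℚ_p) ∣ ᵗg S g = S}` with `GL_n(ℤ_p)`. -/
def integralPoints (S : Matrix n n ℚ_[p]) : Subgroup (isometryGroup S) :=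
  (GeneralLinearGroup.map (n := n) (algebraMap ℤ_[p] ℚ_[p])).range.subgroupOf (isometryGroup S)

theorem mem_integralPoints_iff {S : Matrix n n ℚ_[p]} {g : isometryGroup S} :
    g ∈ integralPoints S ↔ ((g : GL n ℚ_[p]) : Matrix n n ℚ_[p]) ∈ intMat p n n ∧
      (((g : GL n ℚ_[p])⁻¹ : GL n ℚ_[p]) : Matrix n n ℚ_[p]) ∈ intMat p n n := by
  rw [integralPoints, Subgroup.mem_subgroupOf]
  constructor
  · rintro ⟨u, hu⟩
    rw [← hu, ← map_inv]
    exact ⟨⟨(u : Matrix n n ℤ_[p]), rfl⟩, ⟨((u⁻¹ : GL n ℤ_[p]) : Matrix n n ℤ_[p]), rfl⟩⟩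
  · rintro ⟨⟨A, hA⟩, ⟨B, hB⟩⟩
    have inj : Function.Injective
        (fun C : Matrix n n ℤ_[p] => C.map (algebraMap ℤ_[p] ℚ_[p])) :=
      Matrix.map_injective (FaithfulSMul.algebraMap_injective ℤ_[p] ℚ_[p])
    simp only at hA hB
    have hAB : A * B = 1 := inj (by
      simp only [Matrix.map_mul, hA, hB]
      rw [← Units.val_mul, mul_inv_cancel]
      exact (Matrix.map_one _ (map_zero _) (map_one _)).symm)
    have hBA : B * A = 1 := inj (by
      simp only [Matrix.map_mul, hA, hB]
      rw [← Units.val_mul, inv_mul_cancel]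
      exact (Matrix.map_one _ (map_zero _) (map_one _)).symm)
    exact ⟨⟨A, B, hAB, hBA⟩, Units.ext hA⟩

theorem coe_integralPoints (S : Matrix n n ℚ_[p]) :
    (integralPoints S : Set (isometryGroup S)) =
      (fun g : isometryGroup S => Units.embedProduct (Matrix n n ℚ_[p]) (g : GL n ℚ_[p])) ⁻¹'
        (intMat p n n ×ˢ (MulOpposite.unop ⁻¹' intMat p n n)) := by
  ext g
  simp [mem_integralPoints_iff, Units.embedProduct]

theorem isClosed_isometryGroup (S : Matrix n n ℚ_[p]) :
    IsClosed (isometryGroup S : Set (GL n ℚ_[p])) := by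
  have h : Continuous fun g : GL n ℚ_[p] =>
      (g : Matrix n n ℚ_[p])ᵀ * S * (g : Matrix n n ℚ_[p]) :=
    ((Units.continuous_val.matrix_transpose).mul continuous_const).mul Units.continuous_val
  exact isClosed_eq h continuous_const

theorem isClosedEmbedding_embedProduct :
    Topology.IsClosedEmbedding (Units.embedProduct (Matrix n n ℚ_[p])) := by
  refine ⟨Units.isEmbedding_embedProduct, ?_⟩
  have h : Set.range (Units.embedProduct (Matrix n n ℚ_[p])) =
      {x | x.1 * x.2.unop = 1} ∩ {x | x.2.unop * x.1 = 1} := by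
    ext x
    constructor
    · rintro ⟨u, rfl⟩
      simp [Units.embedProduct]
    · rintro ⟨h1, h2⟩
      exact ⟨⟨x.1, x.2.unop, h1, h2⟩, rfl⟩
  rw [h]
  exact (isClosed_eq (continuous_fst.mul (MulOpposite.continuous_unop.comp continuous_snd))
    continuous_const).inter
    (isClosed_eq ((MulOpposite.continuous_unop.comp continuous_snd).mul continuous_fst)
    continuous_const)

theorem isCompact_integralPoints (S : Matrix n n ℚ_[p]) :
    IsCompact (integralPoints S : Set (isometryGroup S)) := by
  rw [coe_integralPoints]
  refine Topology.IsClosedEmbedding.isCompact_preimage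
    (isClosedEmbedding_embedProduct.comp (isClosed_isometryGroup S).isClosedEmbedding_subtypeVal) ?_
  refine (isCompact_intMat p n n).prod ?_
  exact MulOpposite.opHomeomorph.symm.isClosedEmbedding.isCompact_preimage (isCompact_intMat p n n)

theorem isOpen_integralPoints (S : Matrix n n ℚ_[p]) :
    IsOpen (integralPoints S : Set (isometryGroup S)) := by
  rw [coe_integralPoints]
  refine IsOpen.preimage (Units.continuous_embedProduct.comp continuous_subtype_val) ?_
  exact (isOpen_intMat p n n).prod ((isOpen_intMat p n n).preimage MulOpposite.continuous_unop)

/-- The Borel σ-algebra. -/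
instance (S : Matrix n n ℚ_[p]) : MeasurableSpace (isometryGroup S) := borel _

instance (S : Matrix n n ℚ_[p]) : BorelSpace (isometryGroup S) := ⟨rfl⟩

/-- The Haar measure of `{g ∈ GL_n(ℚ_p) ∣ ᵗg S g = S}` that gives volume one to the subgroup of
its elements in `GL_n(ℤ_p)`. -/
def normalizedHaar (S : Matrix n n ℚ_[p]) : Measure (isometryGroup S) :=
  Measure.haarMeasure
    { carrier := integralPoints S
      isCompact' := isCompact_integralPoints S
      interior_nonempty' := by
        rw [(isOpen_integralPoints S).interior_eq]
        exact ⟨1, (integralPoints S).one_mem⟩ }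

/-- For an integer `i`, the set of the `g` with `ᵗg S g = S` such that `p g` has entries in `ℤ_p`
and the reduction of `p g` modulo `p` has rank `i` over `𝔽_p`. -/
def heckeSet (S : Matrix n n ℚ_[p]) (i : ℕ) : Set (isometryGroup S) :=
  {g | ∃ A : Matrix n n ℤ_[p],
    A.map (algebraMap ℤ_[p] ℚ_[p]) = (p : ℚ_[p]) • ((g : GL n ℚ_[p]) : Matrix n n ℚ_[p]) ∧
    (A.map (PadicInt.toZMod (p := p))).rank = i}

end Groups

/-- The matrix `(0 J; -J 0)`. -/
def formH (p : ℕ) [Fact p.Prime] : Matrix (Fin 2 ⊕ Fin 2) (Fin 2 ⊕ Fin 2) ℚ_[p] :=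
  fromBlocks 0 (J ℚ_[p]) (-J ℚ_[p]) 0

/-- The matrix `(0 1₂; -1₂ 0)`. -/
def formG (p : ℕ) [Fact p.Prime] : Matrix (Fin 2 ⊕ Fin 2) (Fin 2 ⊕ Fin 2) ℚ_[p] :=
  fromBlocks 0 1 (-1) 0

/-- `H = {h ∈ GL₄(ℚ_p) ∣ ᵗh (0 J; -J 0) h = (0 J; -J 0)}`. -/
abbrev H (p : ℕ) [Fact p.Prime] := isometryGroup (formH p)

/-- `G = {g ∈ GL₄(ℚ_p) ∣ ᵗg (0 1₂; -1₂ 0) g = (0 1₂; -1₂ 0)}`. -/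
abbrev G (p : ℕ) [Fact p.Prime] := isometryGroup (formG p)

/-! ### The additive character of `ℚ_p` -/

section Character

variable {p : ℕ} [Fact p.Prime]

/-- `exp(-2π√-1 {x})`, where the fractional part `{x} = c / p ^ k` of `x` is computed from
the truncation `c` modulo `p ^ k` of the `p`-adic integer `p ^ k x`. -/
def psiFun (x : ℚ_[p]) : ℂ :=
  if h : ‖(p : ℚ_[p]) ^ (-x.valuation).toNat * x‖ ≤ 1 then
    Complex.exp (-(2 * Real.pi * Complex.I) *
      ((PadicInt.appr ⟨(p : ℚ_[p]) ^ (-x.valuation).toNat * x, h⟩ (-x.valuation).toNat : ℕ) /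
        (p : ℂ) ^ (-x.valuation).toNat))
  else 1

theorem norm_pow_mul_le_one (x : ℚ_[p]) :
    ‖(p : ℚ_[p]) ^ (-x.valuation).toNat * x‖ ≤ 1 := by
  have hp : (1 : ℝ) < p := by exact_mod_cast (Fact.out : p.Prime).one_lt
  rcases eq_or_ne x 0 with rfl | hx
  · simp
  · rw [norm_mul, norm_pow, Padic.norm_p, Padic.norm_eq_zpow_neg_valuation hx, inv_pow,
      ← zpow_natCast, ← _root_.zpow_neg, ← zpow_add₀ (by positivity)]
    refine zpow_le_one_of_nonpos₀ hp.le ?_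
    have := Int.self_le_toNat (-x.valuation)
    linarith

theorem psiFun_eq_of_norm_sub_le {x : ℚ_[p]} {m : ℤ} {k : ℕ}
    (h : ‖x - m / (p : ℚ_[p]) ^ k‖ ≤ 1) :
    psiFun x = Complex.exp (-(2 * Real.pi * Complex.I) * (m / (p : ℂ) ^ k)) := by
  have hp0 : (p : ℚ_[p]) ≠ 0 := by exact_mod_cast (Fact.out : p.Prime).ne_zero
  have hpC : (p : ℂ) ≠ 0 := by exact_mod_cast (Fact.out : p.Prime).ne_zero
  set n := (-x.valuation).toNat with hn
  have hx := norm_pow_mul_le_one x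
  rw [← hn] at hx
  rw [psiFun, dif_pos hx]
  set c := PadicInt.appr ⟨(p : ℚ_[p]) ^ n * x, hx⟩ n with hc
  have h1 : ‖(p : ℚ_[p]) ^ n * x - c‖ ≤ (p : ℝ) ^ (-n : ℤ) := by
    have h2 := PadicInt.appr_spec n ⟨(p : ℚ_[p]) ^ n * x, hx⟩
    rw [← PadicInt.norm_le_pow_iff_mem_span_pow] at h2
    exact h2
  have h3 : ‖x - c / (p : ℚ_[p]) ^ n‖ ≤ 1 := by
    have e : x - c / (p : ℚ_[p]) ^ n = ((p : ℚ_[p]) ^ n)⁻¹ * ((p : ℚ_[p]) ^ n * x - c) := by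
      field_simp
    have hpR : (0 : ℝ) < p := by exact_mod_cast (Fact.out : p.Prime).pos
    rw [e, norm_mul, norm_inv, norm_pow, Padic.norm_p, inv_pow, inv_inv]
    calc (p : ℝ) ^ n * ‖(p : ℚ_[p]) ^ n * x - c‖ ≤ (p : ℝ) ^ n * (p : ℝ) ^ (-n : ℤ) := by gcongr
      _ = 1 := by rw [_root_.zpow_neg, zpow_natCast, mul_inv_cancel₀ (by positivity)]
  have h4 : ‖((m * p ^ n - c * p ^ k : ℤ) : ℚ_[p])‖ ≤ (p : ℝ) ^ (-(n + k : ℕ) : ℤ) := by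
    have e : ((m * p ^ n - c * p ^ k : ℤ) : ℚ_[p]) = (p : ℚ_[p]) ^ (n + k) *
        ((x - c / (p : ℚ_[p]) ^ n) - (x - m / (p : ℚ_[p]) ^ k)) := by
      push_cast
      field_simp
      ring
    rw [e, norm_mul, norm_pow, Padic.norm_p, _root_.zpow_neg, zpow_natCast, inv_pow]
    refine mul_le_of_le_one_right (by positivity) ?_
    rw [sub_eq_add_neg]
    exact (IsUltrametricDist.norm_add_le_max _ _).trans (max_le h3 (by rwa [norm_neg]))
  rw [Padic.norm_int_le_pow_iff_dvd] at h4
  obtain ⟨d, hd⟩ := h4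
  rw [Complex.exp_eq_exp_iff_exists_int]
  refine ⟨d, ?_⟩
  have hd' : (m : ℂ) * p ^ n - c * p ^ k = p ^ (n + k) * d := by exact_mod_cast hd
  have : (m : ℂ) / p ^ k - c / p ^ n = d := by
    field_simp
    rw [pow_add] at hd'
    linear_combination hd'
  rw [← this]
  ring

theorem exists_norm_sub_le (x : ℚ_[p]) : ∃ (m : ℤ) (k : ℕ), ‖x - m / (p : ℚ_[p]) ^ k‖ ≤ 1 := by
  have hp0 : (p : ℚ_[p]) ≠ 0 := by exact_mod_cast (Fact.out : p.Prime).ne_zero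
  have hpR : (0 : ℝ) < p := by exact_mod_cast (Fact.out : p.Prime).pos
  set n := (-x.valuation).toNat with hn
  have hx := norm_pow_mul_le_one x
  rw [← hn] at hx
  set c := PadicInt.appr ⟨(p : ℚ_[p]) ^ n * x, hx⟩ n with hc
  refine ⟨c, n, ?_⟩
  have h1 : ‖(p : ℚ_[p]) ^ n * x - c‖ ≤ (p : ℝ) ^ (-n : ℤ) := by
    have h2 := PadicInt.appr_spec n ⟨(p : ℚ_[p]) ^ n * x, hx⟩
    rw [← PadicInt.norm_le_pow_iff_mem_span_pow] at h2
    exact h2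
  have e : x - ((c : ℤ) : ℚ_[p]) / (p : ℚ_[p]) ^ n
      = ((p : ℚ_[p]) ^ n)⁻¹ * ((p : ℚ_[p]) ^ n * x - c) := by
    push_cast
    field_simp
  rw [e, norm_mul, norm_inv, norm_pow, Padic.norm_p, inv_pow, inv_inv]
  calc (p : ℝ) ^ n * ‖(p : ℚ_[p]) ^ n * x - c‖ ≤ (p : ℝ) ^ n * (p : ℝ) ^ (-n : ℤ) := by gcongr
    _ = 1 := by rw [_root_.zpow_neg, zpow_natCast, mul_inv_cancel₀ (by positivity)]

variable (p) in
/-- The additive character `ψ` of `ℚ_p`, the local component at `p` of the character of `𝔸/ℚ`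
whose component at infinity is `x ↦ exp(2π√-1 x)`. It is trivial on `ℤ_p` and
`ψ (m / p ^ k) = exp(-2π√-1 m / p ^ k)`. -/
def psi : AddChar ℚ_[p] ℂ where
  toFun := psiFun
  map_zero_eq_one' := by
    have h : ‖(0 : ℚ_[p]) - ((0 : ℤ) : ℚ_[p]) / (p : ℚ_[p]) ^ 0‖ ≤ 1 := by simp
    rw [psiFun_eq_of_norm_sub_le h]
    simp
  map_add_eq_mul' := by
    intro x y
    have hp0 : (p : ℚ_[p]) ≠ 0 := by exact_mod_cast (Fact.out : p.Prime).ne_zero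
    have hpC : (p : ℂ) ≠ 0 := by exact_mod_cast (Fact.out : p.Prime).ne_zero
    obtain ⟨m, k, hx⟩ := exists_norm_sub_le x
    obtain ⟨l, n, hy⟩ := exists_norm_sub_le y
    have hxy : ‖x + y - ((m * p ^ n + l * p ^ k : ℤ) : ℚ_[p]) / (p : ℚ_[p]) ^ (k + n)‖ ≤ 1 := by
      have e : x + y - ((m * p ^ n + l * p ^ k : ℤ) : ℚ_[p]) / (p : ℚ_[p]) ^ (k + n)
          = (x - m / (p : ℚ_[p]) ^ k) + (y - l / (p : ℚ_[p]) ^ n) := by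
        push_cast
        field_simp
        ring
      rw [e]
      exact (IsUltrametricDist.norm_add_le_max _ _).trans (max_le hx hy)
    rw [psiFun_eq_of_norm_sub_le hx, psiFun_eq_of_norm_sub_le hy, psiFun_eq_of_norm_sub_le hxy,
      ← Complex.exp_add]
    congr 1
    push_cast
    field_simp
    ring

end Character

/-! ### The Weil representation

Elements of `ℚ_p^{(2,4)}` are written as `(x, y)` and elements of `ℚ_p^{(4,2)}` as `(x; z)` with
`2 × 2` blocks `x`, `y`, `z`. -/

section Weil

variable {p : ℕ} [Fact p.Prime]

/-- The Borel σ-algebra on `M₂(ℚ_p)`. -/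
instance : MeasurableSpace (Matrix (Fin 2) (Fin 2) ℚ_[p]) := borel _

instance : BorelSpace (Matrix (Fin 2) (Fin 2) ℚ_[p]) := ⟨rfl⟩

variable (p) in
/-- The Haar measure on `M₂(ℚ_p)` that gives volume one to `M₂(ℤ_p)`; it is self-dual for the
pairing `(z, y) ↦ ψ(Tr(ᵗz J y))`. -/
def matHaar : Measure (Matrix (Fin 2) (Fin 2) ℚ_[p]) :=
  Measure.addHaarMeasure
    { carrier := intMat p (Fin 2) (Fin 2)
      isCompact' := isCompact_intMat p _ _
      interior_nonempty' := by
        rw [(isOpen_intMat p (Fin 2) (Fin 2)).interior_eq]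
        exact ⟨0, mem_intMat_iff.2 (by simp)⟩ }

/-- The partial Fourier transform
`(I φ)(x, y) = ∫ ψ(Tr(ᵗz J y)) φ(x; z) dz`, from functions on `ℚ_p^{(4,2)}` to functions on
`ℚ_p^{(2,4)}`. -/
def partialFourier (φ : Matrix (Fin 2 ⊕ Fin 2) (Fin 2) ℚ_[p] → ℂ) :
    Matrix (Fin 2) (Fin 2 ⊕ Fin 2) ℚ_[p] → ℂ :=
  fun X => ∫ z, psi p (trace (zᵀ * J ℚ_[p] * X.toCols₂)) * φ (fromRows X.toCols₁ z) ∂matHaar p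

/-- The inverse partial Fourier transform
`(I⁻¹ φ)(x; z) = ∫ ψ(-Tr(ᵗz J y)) φ(x, y) dy`. -/
def partialFourierInv (φ : Matrix (Fin 2) (Fin 2 ⊕ Fin 2) ℚ_[p] → ℂ) :
    Matrix (Fin 2 ⊕ Fin 2) (Fin 2) ℚ_[p] → ℂ :=
  fun X => ∫ y, psi p (-trace (X.toRows₂ᵀ * J ℚ_[p] * y)) * φ (fromCols X.toRows₁ y) ∂matHaar p

/-- The linear action `(r(h, 1) φ)(X) = φ(ᵗh X)` of `H` on functions on `ℚ_p^{(4,2)}`. -/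
def linearAction (h : H p) (φ : Matrix (Fin 2 ⊕ Fin 2) (Fin 2) ℚ_[p] → ℂ) :
    Matrix (Fin 2 ⊕ Fin 2) (Fin 2) ℚ_[p] → ℂ :=
  fun X => φ (((h : GL (Fin 2 ⊕ Fin 2) ℚ_[p]) : Matrix _ _ ℚ_[p])ᵀ * X)

/-- The operator `r'(h, 1) = I ∘ r(h, 1) ∘ I⁻¹` of the Weil representation on functions on
`ℚ_p^{(2,4)}`. On Schwartz–Bruhat functions it is given by
`φ(x, y) ↦ |det A|² φ(ᵗA x, ᵗA y)` for `h = diag(A, J⁻¹ ᵗA⁻¹ J)` and by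
`φ(x, y) ↦ ψ(-b Tr(ᵗx J y)) φ(x, y)` for `h = (1₂ b1₂; 0 1₂)`. -/
def weilH (h : H p) (φ : Matrix (Fin 2) (Fin 2 ⊕ Fin 2) ℚ_[p] → ℂ) :
    Matrix (Fin 2) (Fin 2 ⊕ Fin 2) ℚ_[p] → ℂ :=
  partialFourier (linearAction h (partialFourierInv φ))

/-- The operator `(r'(1, g) φ)(x, y) = φ((x, y) g)` of the Weil representation. -/
def weilG (g : G p) (φ : Matrix (Fin 2) (Fin 2 ⊕ Fin 2) ℚ_[p] → ℂ) :
    Matrix (Fin 2) (Fin 2 ⊕ Fin 2) ℚ_[p] → ℂ :=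
  fun X => φ (X * ((g : GL (Fin 2 ⊕ Fin 2) ℚ_[p]) : Matrix _ _ ℚ_[p]))

variable (p) in
/-- `φ₀`, the characteristic function of `ℤ_p^{(2,4)}`. -/
def phi0 : Matrix (Fin 2) (Fin 2 ⊕ Fin 2) ℚ_[p] → ℂ :=
  (intMat p (Fin 2) (Fin 2 ⊕ Fin 2)).indicator 1

/-- `J_i^H(x, y) = ∫_{T_i^H} r'(h, 1) φ₀(x, y) dh`. -/
def JH (i : ℕ) (x y : Matrix (Fin 2) (Fin 2) ℚ_[p]) : ℂ :=
  ∫ h in heckeSet (formH p) i, weilH h (phi0 p) (fromCols x y) ∂normalizedHaar (formH p)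

/-- `J_i^G(x, y) = ∫_{T_i^G} r'(1, g) φ₀(x, y) dg`. -/
def JG (i : ℕ) (x y : Matrix (Fin 2) (Fin 2) ℚ_[p]) : ℂ :=
  ∫ g in heckeSet (formG p) i, weilG g (phi0 p) (fromCols x y) ∂normalizedHaar (formG p)

end Weil

end

end EichlerUnramified

namespace EichlerUnramified

noncomputable section

/-! ### Integral matrices and their reduction modulo `p` -/

section Reduction

variable {p : ℕ} [Fact p.Prime]

/-! Both integrands are invariant on the right under the integral points: `φ₀` and its inverse
partial transform, which is the characteristic function of the integral `4 × 2` matrices, are stable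
under integral matrices. Each integral is therefore a finite sum over the left cosets of the
integral points in the Hecke set (`setIntegral_heckeSet`). The theorem becomes a comparison of two
finite sums.

The cosets are read off from the reduction `Ā` modulo `p` of the integral matrix `A = p g`. The
coset determines the image of `Ā`, which is a line or a plane. Given that image, dividing the
isometry relation by `p` once or twice shows what is left to choose. For `G` the image is any line
with one residue `c`, or an isotropic plane with a symmetric matrix over `𝔽_p` (`sum_sympRepOne`,
`sum_sympRepTwo`). For `H` it is an isotropic line of the determinant form, or one of three families
according to the rank of the lower half of `Ā` (`sum_orthRepOne`, `sum_orthRepTwo`). To avoid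
choosing a basis of each line or plane, the sums run over all bases with weights `1/(p - 1)` and
`1/#GL₂(𝔽_p)`.

On the `G` side each term is an integrality condition. On the `H` side all representatives lie in
the Siegel parabolic subgroup, where the Weil representation is a volume times an integrality
condition times a value of `ψ` (`weilH_phi0_parabolic`). The sums of `ψ` become divisibility
conditions on `Tr(ᵗx J y)`. By `mul_symp_mul_transpose` this number is also the symplectic product
of the two rows of `(x, y)`, and this is what links the two sides.

If `p X` is not integral, every term vanishes. Otherwise `X = p⁻¹ Y`, and the cases follow the rank
of `Y` modulo `p`. In rank two both first integrals vanish, while the second ones are `1` for `G`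
and `p⁻²` for `H` if `p²` divides the pairing of `Y`, and `0` otherwise
(`heckeRelations_of_rank_two`). In rank one, both sides are invariant under `SL₂(ℤ_p)` on the left,
so one may take the rows of `Y` to be `v` and `p w`. With `τ` the pairing of `(v, w)` modulo `p`,
the first integrals are `[τ = 0]` for `G` and `p⁻¹ [τ = 0]` for `H`. The second one for `H` is `p⁻²
[τ = 0] + [w ∈ 𝔽_p v]`. The second one for `G` is `p` times the number of isotropic planes killed by
`v` and `w` (`heckeRelations_of_smul_row`). In rank zero, `X` is integral and the values depend only
on the rank and the pairing of `X` modulo `p` (`heckeRelations_of_mem`). The planes are counted in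
`card_frames_ker` through the radical of the symplectic form on a kernel. -/

theorem toZMod_eq_zero_iff (x : ℤ_[p]) : PadicInt.toZMod x = 0 ↔ (p : ℤ_[p]) ∣ x := by
  rw [← RingHom.mem_ker, PadicInt.ker_toZMod, PadicInt.maximalIdeal_eq_span_p,
    Ideal.mem_span_singleton]

theorem exists_toZMod_eq (a : ZMod p) : ∃ x : ℤ_[p], PadicInt.toZMod x = a :=
  ZMod.ringHom_surjective _ a

theorem coe_p_ne_zero : (p : ℤ_[p]) ≠ 0 := by
  exact_mod_cast (Fact.out : p.Prime).ne_zero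

theorem coe_p_ne_zero' : (p : ℚ_[p]) ≠ 0 := by
  exact_mod_cast (Fact.out : p.Prime).ne_zero

theorem norm_coe_le_one_of_dvd_iff (k : ℕ) (x : ℤ_[p]) :
    ‖((p : ℚ_[p]) ^ k)⁻¹ * (x : ℚ_[p])‖ ≤ 1 ↔ (p : ℤ_[p]) ^ k ∣ x := by
  constructor
  · intro h
    refine ⟨⟨_, h⟩, ?_⟩
    apply Subtype.ext
    have hp := coe_p_ne_zero' (p := p)
    change (x : ℚ_[p]) = (((p : ℤ_[p]) ^ k : ℤ_[p]) : ℚ_[p]) * (((p : ℚ_[p]) ^ k)⁻¹ * (x : ℚ_[p]))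
    push_cast
    field_simp
  · rintro ⟨y, rfl⟩
    push_cast
    rw [inv_mul_cancel_left₀ (pow_ne_zero _ coe_p_ne_zero')]
    exact y.2

theorem map_toZMod_eq_zero_iff {m n : Type*} (A : Matrix m n ℤ_[p]) :
    A.map (PadicInt.toZMod (p := p)) = 0 ↔ ∃ B : Matrix m n ℤ_[p], A = (p : ℤ_[p]) • B := by
  constructor
  · intro h
    have h1 : ∀ i j, ∃ b, A i j = p * b := fun i j =>
      (toZMod_eq_zero_iff _).1 (congrFun (congrFun h i) j)
    choose B hB using h1
    exact ⟨Matrix.of B, by ext i j; simpa using hB i j⟩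
  · rintro ⟨B, rfl⟩
    ext i j
    simp

theorem exists_map_toZMod_eq {m n : Type*} (A : Matrix m n (ZMod p)) :
    ∃ B : Matrix m n ℤ_[p], B.map (PadicInt.toZMod (p := p)) = A := by
  choose B hB using fun i j => exists_toZMod_eq (A i j)
  exact ⟨Matrix.of B, by ext i j; simpa using hB i j⟩

theorem emb_injective {m n : Type*} : Function.Injective
    (fun A : Matrix m n ℤ_[p] => A.map (algebraMap ℤ_[p] ℚ_[p])) :=
  Matrix.map_injective (FaithfulSMul.algebraMap_injective ℤ_[p] ℚ_[p])

theorem emb_smul {m n : Type*} (c : ℤ_[p]) (A : Matrix m n ℤ_[p]) :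
    (c • A).map (algebraMap ℤ_[p] ℚ_[p]) = (c : ℚ_[p]) • A.map (algebraMap ℤ_[p] ℚ_[p]) := by
  ext i j
  simp

theorem emb_mem_intMat {m n : Type*} (A : Matrix m n ℤ_[p]) :
    A.map (algebraMap ℤ_[p] ℚ_[p]) ∈ intMat p m n := ⟨A, rfl⟩

theorem mul_mem_intMat {l m n : Type*} [Fintype m] {A : Matrix l m ℚ_[p]} {B : Matrix m n ℚ_[p]}
    (hA : A ∈ intMat p l m) (hB : B ∈ intMat p m n) : A * B ∈ intMat p l n := by
  obtain ⟨A, rfl⟩ := hA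
  obtain ⟨B, rfl⟩ := hB
  exact ⟨A * B, Matrix.map_mul⟩

end Reduction

/-! ### Integrals over Hecke sets as weighted sums over cosets -/

section Isometry

variable {p : ℕ} [Fact p.Prime] {n : Type*} [Fintype n] [DecidableEq n]

theorem isometryGroup_apply {R : Type*} [CommRing R] {S : Matrix n n R} (g : isometryGroup S) :
    ((g : GL n R) : Matrix n n R)ᵀ * S * ((g : GL n R) : Matrix n n R) = S := g.2

/-- The element of the isometry group with a given matrix. -/
def isometryOfMatrix {R : Type*} [CommRing R] {S T : Matrix n n R} (hT : T * S = 1)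
    (M : Matrix n n R) (hM : Mᵀ * S * M = S) : isometryGroup S :=
  ⟨⟨M, T * Mᵀ * S, mul_eq_one_comm.1 (by rw [Matrix.mul_assoc, Matrix.mul_assoc,
      ← Matrix.mul_assoc Mᵀ, hM, hT]), by rw [Matrix.mul_assoc, Matrix.mul_assoc,
      ← Matrix.mul_assoc Mᵀ, hM, hT]⟩, hM⟩

theorem coe_inv_isometryGroup {R : Type*} [CommRing R] {S T : Matrix n n R} (hT : T * S = 1)
    (g : isometryGroup S) : (((g : GL n R)⁻¹ : GL n R) : Matrix n n R)
      = T * ((g : GL n R) : Matrix n n R)ᵀ * S := by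
  have h : T * ((g : GL n R) : Matrix n n R)ᵀ * S * ((g : GL n R) : Matrix n n R) = 1 := by
    rw [Matrix.mul_assoc, Matrix.mul_assoc, ← Matrix.mul_assoc _ᵀ, isometryGroup_apply, hT]
  calc (((g : GL n R)⁻¹ : GL n R) : Matrix n n R)
      = T * ((g : GL n R) : Matrix n n R)ᵀ * S * ((g : GL n R) : Matrix n n R)
        * (((g : GL n R)⁻¹ : GL n R) : Matrix n n R) := by rw [h, Matrix.one_mul]
    _ = _ := by rw [Matrix.mul_assoc, ← Units.val_mul, mul_inv_cancel]; simp

variable {S T : Matrix n n ℤ_[p]}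

theorem emb_mul_eq_one (hT : T * S = 1) :
    T.map (algebraMap ℤ_[p] ℚ_[p]) * S.map (algebraMap ℤ_[p] ℚ_[p]) = 1 := by
  rw [← Matrix.map_mul, hT]
  exact Matrix.map_one _ (map_zero _) (map_one _)

/-- The inverse of `g` is `T ᵗg S` with `S` and `T` integral, so integrality of `g` already gives
that of its inverse. -/
theorem mem_integralPoints_iff_mem_intMat (hT : T * S = 1)
    (g : isometryGroup (S.map (algebraMap ℤ_[p] ℚ_[p]))) :
    g ∈ integralPoints (S.map (algebraMap ℤ_[p] ℚ_[p])) ↔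
      ((g : GL n ℚ_[p]) : Matrix n n ℚ_[p]) ∈ intMat p n n := by
  rw [mem_integralPoints_iff]
  refine ⟨fun h => h.1, fun h => ⟨h, ?_⟩⟩
  rw [coe_inv_isometryGroup (emb_mul_eq_one hT)]
  refine mul_mem_intMat (mul_mem_intMat (emb_mem_intMat T) ?_) (emb_mem_intMat S)
  exact mem_intMat_iff.2 fun i j => mem_intMat_iff.1 h j i

/-- The isometry `p⁻¹ R` attached to an integral matrix with `ᵗR S R = p² S`. -/
def scaledIsometry (hT : T * S = 1) (R : Matrix n n ℤ_[p])
    (hR : Rᵀ * S * R = (p : ℤ_[p]) ^ 2 • S) : isometryGroup (S.map (algebraMap ℤ_[p] ℚ_[p])) :=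
  isometryOfMatrix (emb_mul_eq_one hT) ((p : ℚ_[p])⁻¹ • R.map (algebraMap ℤ_[p] ℚ_[p])) (by
    have h := congrArg (fun A : Matrix n n ℤ_[p] => A.map (algebraMap ℤ_[p] ℚ_[p])) hR
    simp only [Matrix.map_mul, emb_smul] at h
    rw [Matrix.transpose_map] at h
    rw [Matrix.transpose_smul, Matrix.smul_mul, Matrix.smul_mul, Matrix.mul_smul, h, smul_smul,
      smul_smul]
    have : (p : ℚ_[p])⁻¹ * (p : ℚ_[p])⁻¹ * (((p : ℤ_[p]) ^ 2 : ℤ_[p]) : ℚ_[p]) = 1 := by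
      push_cast
      field_simp [coe_p_ne_zero' (p := p)]
    rw [this, one_smul])

theorem coe_scaledIsometry (hT : T * S = 1) (R : Matrix n n ℤ_[p])
    (hR : Rᵀ * S * R = (p : ℤ_[p]) ^ 2 • S) :
    ((scaledIsometry hT R hR : GL n ℚ_[p]) : Matrix n n ℚ_[p])
      = (p : ℚ_[p])⁻¹ • R.map (algebraMap ℤ_[p] ℚ_[p]) := rfl

theorem smul_scaledIsometry (hT : T * S = 1) (R : Matrix n n ℤ_[p])
    (hR : Rᵀ * S * R = (p : ℤ_[p]) ^ 2 • S) :
    (p : ℚ_[p]) • ((scaledIsometry hT R hR : GL n ℚ_[p]) : Matrix n n ℚ_[p])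
      = R.map (algebraMap ℤ_[p] ℚ_[p]) := by
  rw [coe_scaledIsometry, smul_smul, mul_inv_cancel₀ coe_p_ne_zero', one_smul]

/-- The factors `p` cancel in `r⁻¹ g = R⁻¹ A`. Membership in a coset of the integral points thus
becomes left divisibility of integral matrices. -/
theorem scaledIsometry_inv_mul_mem_iff (hT : T * S = 1) (R : Matrix n n ℤ_[p])
    (hR : Rᵀ * S * R = (p : ℤ_[p]) ^ 2 • S)
    (g : isometryGroup (S.map (algebraMap ℤ_[p] ℚ_[p]))) (A : Matrix n n ℤ_[p])
    (hA : A.map (algebraMap ℤ_[p] ℚ_[p]) = (p : ℚ_[p]) • ((g : GL n ℚ_[p]) : Matrix n n ℚ_[p])) :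
    (scaledIsometry hT R hR)⁻¹ * g ∈ integralPoints (S.map (algebraMap ℤ_[p] ℚ_[p])) ↔
      ∃ κ : Matrix n n ℤ_[p], A = R * κ := by
  rw [mem_integralPoints_iff_mem_intMat hT]
  set r := scaledIsometry hT R hR with hr
  have hmul : ((r : GL n ℚ_[p]) : Matrix n n ℚ_[p]) *
      (((r⁻¹ * g : isometryGroup _) : GL n ℚ_[p]) : Matrix n n ℚ_[p])
        = ((g : GL n ℚ_[p]) : Matrix n n ℚ_[p]) := by
    rw [← Units.val_mul, ← Subgroup.coe_mul, mul_inv_cancel_left]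
  have hrR := smul_scaledIsometry hT R hR
  rw [← hr] at hrR
  constructor
  · rintro ⟨κ, hκ⟩
    refine ⟨κ, emb_injective ?_⟩
    simp only at hκ ⊢
    rw [Matrix.map_mul, hκ, hA, ← hmul, ← hrR, Matrix.smul_mul]
  · rintro ⟨κ, rfl⟩
    refine ⟨κ, ?_⟩
    simp only
    rw [Matrix.map_mul, ← hrR, Matrix.smul_mul] at hA
    have h2 := smul_right_injective _ (coe_p_ne_zero' (p := p)) hA
    have h3 : (((r⁻¹ : isometryGroup _) : GL n ℚ_[p]) : Matrix n n ℚ_[p]) *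
        ((r : GL n ℚ_[p]) : Matrix n n ℚ_[p]) = 1 := by
      rw [← Units.val_mul, ← Subgroup.coe_mul, inv_mul_cancel]; rfl
    rw [Subgroup.coe_mul, Units.val_mul, ← h2, ← Matrix.mul_assoc, h3, Matrix.one_mul]

theorem transpose_mul_mul_of_mem_heckeSet
    {g : isometryGroup (S.map (algebraMap ℤ_[p] ℚ_[p]))} {A : Matrix n n ℤ_[p]}
    (hA : A.map (algebraMap ℤ_[p] ℚ_[p]) = (p : ℚ_[p]) • ((g : GL n ℚ_[p]) : Matrix n n ℚ_[p])) :
    Aᵀ * S * A = (p : ℤ_[p]) ^ 2 • S := by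
  apply emb_injective
  simp only [Matrix.map_mul, emb_smul]
  rw [Matrix.transpose_map, hA]
  rw [Matrix.transpose_smul, Matrix.smul_mul, Matrix.smul_mul, Matrix.mul_smul,
    isometryGroup_apply, smul_smul]
  push_cast
  rw [pow_two]

/-- Comparing the two relations shows that `κ` is itself an isometry of `S`, hence invertible over
`ℤ_p` and modulo `p`. -/
theorem rank_map_mul_eq (hT : T * S = 1) {R κ A : Matrix n n ℤ_[p]} (hA : A = R * κ)
    (hR : Rᵀ * S * R = (p : ℤ_[p]) ^ 2 • S) (hAS : Aᵀ * S * A = (p : ℤ_[p]) ^ 2 • S) :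
    (A.map (PadicInt.toZMod (p := p))).rank = (R.map (PadicInt.toZMod (p := p))).rank := by
  have h1 : (p : ℤ_[p]) ^ 2 • (κᵀ * S * κ) = (p : ℤ_[p]) ^ 2 • S := by
    rw [← hAS, hA, Matrix.transpose_mul]
    calc (p : ℤ_[p]) ^ 2 • (κᵀ * S * κ) = κᵀ * ((p : ℤ_[p]) ^ 2 • S) * κ := by
          rw [Matrix.mul_smul, Matrix.smul_mul]
      _ = _ := by rw [← hR]; simp only [Matrix.mul_assoc]
  have h2 : κᵀ * S * κ = S := smul_right_injective _ (pow_ne_zero 2 (coe_p_ne_zero (p := p))) h1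
  have h3 : (T * κᵀ * S) * κ = 1 := by
    rw [Matrix.mul_assoc, Matrix.mul_assoc, ← Matrix.mul_assoc κᵀ, h2, hT]
  have h4 : IsUnit (κ.map (PadicInt.toZMod (p := p))).det := by
    have h5 : IsUnit κ.det := by
      rw [← Matrix.isUnit_iff_isUnit_det]
      exact ⟨⟨κ, _, mul_eq_one_comm.1 h3, h3⟩, rfl⟩
    have := h5.map (PadicInt.toZMod (p := p))
    rwa [RingHom.map_det] at this
  rw [hA, Matrix.map_mul, Matrix.rank_mul_eq_left_of_isUnit_det _ _ h4]

theorem normalizedHaar_integralPoints (S : Matrix n n ℚ_[p]) :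
    normalizedHaar S (integralPoints S : Set (isometryGroup S)) = 1 :=
  Measure.haarMeasure_self

instance (S : Matrix n n ℚ_[p]) : (normalizedHaar S).IsMulLeftInvariant := by
  unfold normalizedHaar; infer_instance

open Classical in
/-- An integral over a Hecke double coset of a function that is invariant under the integral
points on the right is a finite weighted sum over representatives. -/
theorem setIntegral_heckeSet (hT : T * S = 1) {i : ℕ} {ι : Type*} [Fintype ι]
    (R : ι → Matrix n n ℤ_[p]) (hR : ∀ j, (R j)ᵀ * S * R j = (p : ℤ_[p]) ^ 2 • S)
    (hrank : ∀ j, ((R j).map (PadicInt.toZMod (p := p))).rank = i) (w : ι → ℂ)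
    (hw : ∀ A : Matrix n n ℤ_[p], Aᵀ * S * A = (p : ℤ_[p]) ^ 2 • S →
      (A.map (PadicInt.toZMod (p := p))).rank = i →
      ∑ j, (if ∃ κ : Matrix n n ℤ_[p], A = R j * κ then w j else 0) = 1)
    (f : isometryGroup (S.map (algebraMap ℤ_[p] ℚ_[p])) → ℂ)
    (hf : ∀ g, ∀ k ∈ integralPoints (S.map (algebraMap ℤ_[p] ℚ_[p])), f (g * k) = f g) :
    IntegrableOn f (heckeSet (S.map (algebraMap ℤ_[p] ℚ_[p])) i)
        (normalizedHaar (S.map (algebraMap ℤ_[p] ℚ_[p]))) ∧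
      ∫ g in heckeSet (S.map (algebraMap ℤ_[p] ℚ_[p])) i, f g
          ∂normalizedHaar (S.map (algebraMap ℤ_[p] ℚ_[p]))
        = ∑ j, w j * f (scaledIsometry hT (R j) (hR j)) := by
  set r := fun j => scaledIsometry hT (R j) (hR j) with hr
  -- `C j` is the left coset of `r j`: it is open, of volume one, contained in the Hecke set, and
  -- `f` is constant on it.
  let C : ι → Set (isometryGroup (S.map (algebraMap ℤ_[p] ℚ_[p]))) := fun j => (fun g => (r j)⁻¹ * g) ⁻¹' integralPoints (S.map (algebraMap ℤ_[p] ℚ_[p]))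
  have hCo : ∀ j, IsOpen (C j) := fun j =>
    (isOpen_integralPoints (S.map (algebraMap ℤ_[p] ℚ_[p]))).preimage (continuous_const.mul continuous_id)
  have hCT : ∀ j, C j ⊆ heckeSet (S.map (algebraMap ℤ_[p] ℚ_[p])) i := by
    intro j g hg
    have hg' : (r j)⁻¹ * g ∈ integralPoints (S.map (algebraMap ℤ_[p] ℚ_[p])) := hg
    obtain ⟨κ, hκ⟩ := (mem_integralPoints_iff_mem_intMat hT _).1 hg'
    simp only at hκ
    have hA : (R j * κ).map (algebraMap ℤ_[p] ℚ_[p])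
        = (p : ℚ_[p]) • ((g : GL n ℚ_[p]) : Matrix n n ℚ_[p]) := by
      rw [Matrix.map_mul, hκ, ← smul_scaledIsometry hT (R j) (hR j), Matrix.smul_mul,
        ← Units.val_mul, ← Subgroup.coe_mul, mul_inv_cancel_left]
    exact ⟨R j * κ, hA, by
      rw [rank_map_mul_eq hT rfl (hR j) (transpose_mul_mul_of_mem_heckeSet hA), hrank]⟩
  have hvol : ∀ j, normalizedHaar (S.map (algebraMap ℤ_[p] ℚ_[p])) (C j) = 1 := by
    intro j
    rw [measure_preimage_mul, normalizedHaar_integralPoints]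
  have hfC : ∀ j, ∀ g ∈ C j, f g = f (r j) := by
    intro j g hg
    have := hf (r j) _ hg
    rwa [mul_inv_cancel_left] at this
  have hTm : MeasurableSet (heckeSet (S.map (algebraMap ℤ_[p] ℚ_[p])) i) := by
    -- The cosets cover the Hecke set, since the weights of those containing a given point sum to
    -- one and so cannot be an empty sum.
    have : heckeSet (S.map (algebraMap ℤ_[p] ℚ_[p])) i = ⋃ j, C j := by
      refine Set.Subset.antisymm ?_ (Set.iUnion_subset hCT)
      rintro g ⟨A, hA, hAr⟩
      by_contra hg
      have := hw A (transpose_mul_mul_of_mem_heckeSet hA) hAr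
      rw [Finset.sum_eq_zero] at this
      · exact zero_ne_one this
      · intro j _
        rw [if_neg]
        rw [← scaledIsometry_inv_mul_mem_iff hT _ (hR j) g A hA]
        exact fun h => hg (Set.mem_iUnion.2 ⟨j, h⟩)
    rw [this]
    exact (isOpen_iUnion hCo).measurableSet
  -- The same coset may occur for several `j`. The weights turn the indicators of the `C j` into a
  -- partition of unity on the Hecke set.
  have hsum : (heckeSet (S.map (algebraMap ℤ_[p] ℚ_[p])) i).indicator f
      = fun g => ∑ j, (C j).indicator (fun _ => w j * f (r j)) g := by
    ext g
    by_cases hg : g ∈ heckeSet (S.map (algebraMap ℤ_[p] ℚ_[p])) i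
    · rw [Set.indicator_of_mem hg]
      obtain ⟨A, hA, hAr⟩ := hg
      have := hw A (transpose_mul_mul_of_mem_heckeSet hA) hAr
      calc f g = (∑ j, (if ∃ κ : Matrix n n ℤ_[p], A = R j * κ then w j else 0)) * f g := by
            rw [this, one_mul]
        _ = _ := by
            rw [Finset.sum_mul]
            refine Finset.sum_congr rfl fun j _ => ?_
            by_cases hj : g ∈ C j
            · rw [Set.indicator_of_mem hj, if_pos, hfC j g hj]
              exact (scaledIsometry_inv_mul_mem_iff hT _ (hR j) g A hA).1 hj
            · rw [Set.indicator_of_notMem hj, if_neg, zero_mul]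
              exact fun h => hj ((scaledIsometry_inv_mul_mem_iff hT _ (hR j) g A hA).2 h)
    · rw [Set.indicator_of_notMem hg, Finset.sum_eq_zero]
      exact fun j _ => Set.indicator_of_notMem (fun h => hg (hCT j h)) _
  have hint : ∀ j, Integrable ((C j).indicator (fun _ => w j * f (r j))) (normalizedHaar (S.map (algebraMap ℤ_[p] ℚ_[p]))) := by
    intro j
    rw [integrable_indicator_iff (hCo j).measurableSet]
    exact integrableOn_const (by rw [hvol]; simp)
  constructor
  · rw [← integrable_indicator_iff hTm, hsum]
    exact integrable_finsetSum _ fun j _ => hint j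
  · rw [← integral_indicator hTm, hsum, integral_finsetSum _ fun j _ => hint j]
    refine Finset.sum_congr rfl fun j _ => ?_
    rw [integral_indicator (hCo j).measurableSet, setIntegral_const, measureReal_def, hvol]
    simp [hr]

end Isometry

/-! ### Linear algebra over a field -/

section LinearAlgebra

/-- The map factors through its range. In a basis of the range, the inclusion is injective and the
corestriction surjective, and each has a one-sided inverse. -/
theorem exists_rank_factorization {F m n : Type*} [Field F] [Fintype m] [Fintype n] [DecidableEq m]
    [DecidableEq n] (A : Matrix m n F) {r : ℕ} (hA : A.rank = r) :
    ∃ (a : Matrix m (Fin r) F) (P : Matrix (Fin r) n F), A = a * P ∧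
      (∃ N : Matrix (Fin r) m F, N * a = 1) ∧ ∃ N : Matrix n (Fin r) F, P * N = 1 := by
  let f : (n → F) →ₗ[F] (m → F) := Matrix.toLin' A
  have hf : Module.finrank F (LinearMap.range f) = r := hA
  let e := (Module.finBasisOfFinrankEq F (LinearMap.range f) hf).equivFun
  let i : (Fin r → F) →ₗ[F] (m → F) := (LinearMap.range f).subtype ∘ₗ e.symm.toLinearMap
  let s : (n → F) →ₗ[F] (Fin r → F) := e.toLinearMap ∘ₗ f.rangeRestrict
  have hi : LinearMap.ker i = ⊥ := by
    rw [LinearMap.ker_eq_bot]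
    exact Subtype.val_injective.comp e.symm.injective
  have hs : LinearMap.range s = ⊤ := by
    rw [LinearMap.range_eq_top]
    exact e.surjective.comp f.surjective_rangeRestrict
  obtain ⟨l, hl⟩ := i.exists_leftInverse_of_injective hi
  obtain ⟨t, ht⟩ := s.exists_rightInverse_of_surjective hs
  refine ⟨LinearMap.toMatrix' i, LinearMap.toMatrix' s, ?_, ⟨LinearMap.toMatrix' l, ?_⟩,
    ⟨LinearMap.toMatrix' t, ?_⟩⟩
  · rw [← LinearMap.toMatrix'_comp]
    have : i ∘ₗ s = f := by
      refine LinearMap.ext fun x => ?_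
      simp [i, s]
    rw [this]
    simp [f]
  · rw [← LinearMap.toMatrix'_comp, hl, LinearMap.toMatrix'_id]
  · rw [← LinearMap.toMatrix'_comp, ht, LinearMap.toMatrix'_id]

theorem rank_eq_of_left_right_inverse {F m n : Type*} [Field F] [Fintype m] [Fintype n]
    [DecidableEq m] {r : ℕ} {a : Matrix m (Fin r) F} {P : Matrix (Fin r) n F} {N : Matrix (Fin r) m F}
    {M : Matrix n (Fin r) F} (hN : N * a = 1) (hM : P * M = 1) : (a * P).rank = r := by
  refine le_antisymm ((rank_mul_le_left _ _).trans (a.rank_le_card_width.trans_eq (Fintype.card_fin r))) ?_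
  have h : N * (a * P) * M = 1 := by
    rw [← Matrix.mul_assoc, hN, Matrix.one_mul, hM]
  calc r = (N * (a * P) * M).rank := by rw [h, rank_one, Fintype.card_fin]
    _ ≤ (N * (a * P)).rank := rank_mul_le_left _ _
    _ ≤ (a * P).rank := rank_mul_le_right _ _

theorem sum_ite_of_existsUnique {ι : Type*} [Fintype ι] {Q : ι → Prop} [DecidablePred Q]
    (h : ∃! c, Q c) (w : ℂ) : ∑ c, (if Q c then w else 0) = w := by
  obtain ⟨c, hc, hu⟩ := h
  rw [Finset.sum_eq_single c, if_pos hc]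
  · intro b _ hb
    exact if_neg fun h => hb (hu b h)
  · simp

/-- `P` and `Q` proportional if `P ξ` and `Q ξ` are parallel for all `ξ`. -/
theorem existsUnique_eq_smul_of_parallel {F n : Type*} [Field F] [Fintype n] [DecidableEq n]
    (P Q : Matrix (Fin 2) n F) {N : Matrix n (Fin 2) F} (hN : Q * N = 1)
    (h : ∀ ξ : n → F, (P *ᵥ ξ) 0 * (Q *ᵥ ξ) 1 - (P *ᵥ ξ) 1 * (Q *ᵥ ξ) 0 = 0) :
    ∃! b : F, P = b • Q := by
  have hQN : ∀ η : Fin 2 → F, Q *ᵥ (N *ᵥ η) = η := fun η => by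
    rw [mulVec_mulVec, hN, one_mulVec]
  set T := P * N with hT
  have hPN : ∀ η : Fin 2 → F, P *ᵥ (N *ᵥ η) = T *ᵥ η := fun η => by
    rw [mulVec_mulVec]
  have hTη : ∀ η : Fin 2 → F, (T *ᵥ η) 0 * η 1 - (T *ᵥ η) 1 * η 0 = 0 := fun η => by
    have := h (N *ᵥ η)
    rwa [hQN, hPN] at this
  -- An endomorphism of the plane that maps every vector to a parallel one is scalar; it is tested
  -- on the basis vectors and their sum.
  have h10 : T 1 0 = 0 := by simpa [mulVec, dotProduct, Fin.sum_univ_two] using hTη ![1, 0]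
  have h01 : T 0 1 = 0 := by simpa [mulVec, dotProduct, Fin.sum_univ_two] using hTη ![0, 1]
  have h11 : T 0 0 = T 1 1 := by
    have := hTη ![1, 1]
    simp [mulVec, dotProduct, Fin.sum_univ_two, h10, h01] at this
    linear_combination this
  have hTs : ∀ η : Fin 2 → F, T *ᵥ η = T 1 1 • η := fun η => by
    ext i
    fin_cases i <;> simp [mulVec, dotProduct, Fin.sum_univ_two, h10, h01, h11]
  refine ⟨T 1 1, ?_, ?_⟩
  · refine ext_of_mulVec_single fun j => ?_
    set ξ : n → F := Pi.single j 1
    -- Adding `N η` to `ξ` gives `Q` an arbitrary value, so the defect `P ξ - T 1 1 • Q ξ` is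
    -- parallel to every vector. The two choices of `η` below make that value a standard basis
    -- vector.
    have key : ∀ η : Fin 2 → F, ((P *ᵥ ξ) 0 - T 1 1 * (Q *ᵥ ξ) 0) * (η 1 + (Q *ᵥ ξ) 1)
        - ((P *ᵥ ξ) 1 - T 1 1 * (Q *ᵥ ξ) 1) * (η 0 + (Q *ᵥ ξ) 0) = 0 := fun η => by
      have := h (ξ + N *ᵥ η)
      rw [mulVec_add, mulVec_add, hPN, hQN, hTs] at this
      simp only [Pi.add_apply, Pi.smul_apply, smul_eq_mul] at this
      linear_combination this
    have k0 := key ![- (Q *ᵥ ξ) 0, 1 - (Q *ᵥ ξ) 1]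
    have k1 := key ![1 - (Q *ᵥ ξ) 0, - (Q *ᵥ ξ) 1]
    simp at k0 k1
    rw [smul_mulVec]
    ext i
    fin_cases i
    · simpa using sub_eq_zero.1 k0
    · simpa using (sub_eq_zero.1 k1).symm
  · rintro b hb
    have : T = b • (1 : Matrix (Fin 2) (Fin 2) F) := by rw [hT, hb, Matrix.smul_mul, hN]
    rw [this]
    simp

/-- With `P N = 1` the relation gives `Q = ᵗ(Q N) P`. Multiplying by `N` on the right shows that `Q
N` is symmetric, and it is the only candidate. -/
theorem existsUnique_symmetric_mul {F n : Type*} [Field F] [Fintype n] [DecidableEq n]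
    (P Q : Matrix (Fin 2) n F) {N : Matrix n (Fin 2) F} (hN : P * N = 1)
    (h : Pᵀ * Q = Qᵀ * P) : ∃! S : {S : Matrix (Fin 2) (Fin 2) F // Sᵀ = S}, Q = S.1 * P := by
  have h1 : Q = (Q * N)ᵀ * P := by
    calc Q = (P * N)ᵀ * Q := by rw [hN]; simp
      _ = Nᵀ * (Pᵀ * Q) := by rw [transpose_mul, Matrix.mul_assoc]
      _ = _ := by rw [h, ← Matrix.mul_assoc, ← transpose_mul]
  have h2 : Q * N = (Q * N)ᵀ := by
    conv_lhs => rw [h1]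
    rw [Matrix.mul_assoc, hN, Matrix.mul_one]
  refine ⟨⟨Q * N, h2.symm⟩, ?_, ?_⟩
  · simp only
    rwa [← h2] at h1
  · rintro S hS
    apply Subtype.ext
    simp only
    rw [hS, Matrix.mul_assoc, hN, Matrix.mul_one]

end LinearAlgebra

/-! ### The two forms over a general ring -/

section Forms

/-- The matrix `(0 1₂; -1₂ 0)`. -/
def symp (R : Type*) [CommRing R] : Matrix (Fin 2 ⊕ Fin 2) (Fin 2 ⊕ Fin 2) R :=
  fromBlocks 0 1 (-1) 0

/-- The matrix `(0 J; -J 0)`. -/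
def orth (R : Type*) [CommRing R] : Matrix (Fin 2 ⊕ Fin 2) (Fin 2 ⊕ Fin 2) R :=
  fromBlocks 0 (J R) (-J R) 0

theorem neg_symp_mul_symp (R : Type*) [CommRing R] : -symp R * symp R = 1 := by
  simp [symp, fromBlocks_multiply, fromBlocks_neg]

theorem J_mul_J (R : Type*) [CommRing R] : J R * J R = -1 := by
  ext i j
  fin_cases i <;> fin_cases j <;> simp [J]

theorem orth_mul_orth (R : Type*) [CommRing R] : orth R * orth R = 1 := by
  simp [orth, fromBlocks_multiply, J_mul_J]

theorem map_symp {R R' : Type*} [CommRing R] [CommRing R'] (f : R →+* R') :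
    (symp R).map f = symp R' := by
  ext (i | i) (j | j) <;> fin_cases i <;> fin_cases j <;> simp [symp]

theorem map_orth {R R' : Type*} [CommRing R] [CommRing R'] (f : R →+* R') :
    (orth R).map f = orth R' := by
  ext (i | i) (j | j) <;> fin_cases i <;> fin_cases j <;> simp [orth, J]

theorem formG_eq (p : ℕ) [Fact p.Prime] :
    formG p = (symp ℤ_[p]).map (algebraMap ℤ_[p] ℚ_[p]) := by
  rw [map_symp]; rfl

theorem formH_eq (p : ℕ) [Fact p.Prime] :
    formH p = (orth ℤ_[p]).map (algebraMap ℤ_[p] ℚ_[p]) := by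
  rw [map_orth]; rfl

theorem transpose_mul_symp_mul_apply {R m n : Type*} [CommRing R]
    (A : Matrix (Fin 2 ⊕ Fin 2) m R) (B : Matrix (Fin 2 ⊕ Fin 2) n R) (i : m) (j : n) :
    (Aᵀ * symp R * B) i j = A (.inl 0) i * B (.inr 0) j + A (.inl 1) i * B (.inr 1) j
      - A (.inr 0) i * B (.inl 0) j - A (.inr 1) i * B (.inl 1) j := by
  simp [mul_apply, Fintype.sum_sum_type, Fin.sum_univ_two, symp, one_apply]
  ring

end Forms

/-! ### Lifting residues modulo `p` -/

section Lift

variable {p : ℕ} [Fact p.Prime]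

/-- The lift to `ℤ_p` with values in `{0, …, p - 1}`. -/
def lift (c : ZMod p) : ℤ_[p] := (c.val : ℤ_[p])

@[simp] theorem toZMod_lift (c : ZMod p) : PadicInt.toZMod (lift c) = c := by
  simp [lift]

theorem toZMod_eq_iff (x y : ℤ_[p]) :
    PadicInt.toZMod x = PadicInt.toZMod y ↔ (p : ℤ_[p]) ∣ x - y := by
  rw [← toZMod_eq_zero_iff, map_sub, sub_eq_zero]

theorem p_mul_dvd_p_sq_iff (x : ℤ_[p]) : (p : ℤ_[p]) ^ 2 ∣ p * x ↔ (p : ℤ_[p]) ∣ x := by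
  rw [pow_two, mul_dvd_mul_iff_left coe_p_ne_zero]

end Lift

/-! ### Lifting isotropic frames to symplectic matrices over `ℤ_p` -/

section SymplecticFrames

variable {p : ℕ} [Fact p.Prime]

/-- A `4 × 2` matrix over `𝔽_p` is the left half of the reduction of a symplectic matrix
over `ℤ_p`. -/
def HasSympLift (a : Matrix (Fin 2 ⊕ Fin 2) (Fin 2) (ZMod p)) : Prop :=
  ∃ k : Matrix (Fin 2 ⊕ Fin 2) (Fin 2 ⊕ Fin 2) ℤ_[p], kᵀ * symp ℤ_[p] * k = symp ℤ_[p] ∧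
    (k.map (PadicInt.toZMod (p := p))).toCols₁ = a

theorem HasSympLift.of_mul {a : Matrix (Fin 2 ⊕ Fin 2) (Fin 2) (ZMod p)}
    (w : Matrix (Fin 2 ⊕ Fin 2) (Fin 2 ⊕ Fin 2) ℤ_[p])
    (hw : wᵀ * symp ℤ_[p] * w = symp ℤ_[p])
    (h : HasSympLift (w.map (PadicInt.toZMod (p := p)) * a)) : HasSympLift a := by
  obtain ⟨k, hk, hka⟩ := h
  set w' := -symp ℤ_[p] * wᵀ * symp ℤ_[p] with hw'
  have h1 : w' * w = 1 := by
    rw [hw', Matrix.mul_assoc, Matrix.mul_assoc, ← Matrix.mul_assoc wᵀ, hw, neg_symp_mul_symp]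
  have h2 : w * w' = 1 := mul_eq_one_comm.1 h1
  refine ⟨w' * k, ?_, ?_⟩
  · rw [transpose_mul]
    calc kᵀ * w'ᵀ * symp ℤ_[p] * (w' * k)
        = kᵀ * w'ᵀ * (wᵀ * symp ℤ_[p] * w) * (w' * k) := by rw [hw]
      _ = kᵀ * (w * w')ᵀ * symp ℤ_[p] * (w * w') * k := by
          simp only [transpose_mul, Matrix.mul_assoc]
      _ = symp ℤ_[p] := by rw [h2]; simpa using hk
  · have h3 : w'.map (PadicInt.toZMod (p := p)) * w.map (PadicInt.toZMod (p := p)) = 1 := by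
      rw [← Matrix.map_mul, h1]
      exact Matrix.map_one _ (map_zero _) (map_one _)
    calc ((w' * k).map (PadicInt.toZMod (p := p))).toCols₁
        = w'.map (PadicInt.toZMod (p := p)) * (k.map (PadicInt.toZMod (p := p))).toCols₁ := by
          rw [Matrix.map_mul]; rfl
      _ = a := by rw [hka, ← Matrix.mul_assoc, h3, Matrix.one_mul]

theorem exists_symmetric_lift (S : Matrix (Fin 2) (Fin 2) (ZMod p)) (hS : Sᵀ = S) :
    ∃ S' : Matrix (Fin 2) (Fin 2) ℤ_[p], S'ᵀ = S' ∧ S'.map (PadicInt.toZMod (p := p)) = S := by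
  refine ⟨S.map lift, ?_, ?_⟩
  · rw [← Matrix.transpose_map, hS]
  · ext i j
    simp

theorem isUnit_of_toZMod_ne_zero {x : ℤ_[p]} (h : PadicInt.toZMod x ≠ 0) : IsUnit x := by
  by_contra hx
  exact h ((PadicInt.ker_toZMod (p := p)).symm ▸ (IsLocalRing.mem_maximalIdeal x).2 hx :
    x ∈ RingHom.ker (PadicInt.toZMod (p := p)))

/-- If the upper block is invertible, isotropy says that the lower block is `S` times the upper one
with `S` symmetric. Lifting the upper block to `P` and `S` to a symmetric matrix gives the
symplectic matrix `(P 0; S P ᵗP⁻¹)`. -/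
theorem hasSympLift_of_det_ne_zero {a : Matrix (Fin 2 ⊕ Fin 2) (Fin 2) (ZMod p)}
    (h : aᵀ * symp (ZMod p) * a = 0) (hd : a.toRows₁.det ≠ 0) : HasSympLift a := by
  obtain ⟨P, hP⟩ := exists_map_toZMod_eq a.toRows₁
  have hPd : IsUnit P.det := by
    apply isUnit_of_toZMod_ne_zero
    rwa [RingHom.map_det, RingHom.mapMatrix_apply, hP]
  have hu : IsUnit a.toRows₁.det := hd.isUnit
  have hs : a.toRows₁ᵀ * a.toRows₂ = a.toRows₂ᵀ * a.toRows₁ := by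
    ext i j
    have := congrFun (congrFun h i) j
    rw [transpose_mul_symp_mul_apply] at this
    simp [mul_apply, Fin.sum_univ_two] at this ⊢
    linear_combination this
  obtain ⟨S, hSS, hS⟩ := exists_symmetric_lift (a.toRows₂ * a.toRows₁⁻¹) (by
    rw [transpose_mul, transpose_nonsing_inv]
    calc (a.toRows₁ᵀ)⁻¹ * a.toRows₂ᵀ
        = (a.toRows₁ᵀ)⁻¹ * (a.toRows₂ᵀ * a.toRows₁) * a.toRows₁⁻¹ := by
          rw [Matrix.mul_assoc, Matrix.mul_assoc, mul_nonsing_inv _ hu, Matrix.mul_one]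
      _ = _ := by
          rw [← hs, ← Matrix.mul_assoc, nonsing_inv_mul _ (by rwa [det_transpose]),
            Matrix.one_mul])
  refine ⟨fromBlocks P 0 (S * P) (P⁻¹)ᵀ, ?_, ?_⟩
  · rw [symp, fromBlocks_transpose, fromBlocks_multiply, fromBlocks_multiply]
    simp only [Matrix.transpose_zero, Matrix.mul_zero, Matrix.zero_mul, Matrix.mul_one,
      Matrix.mul_neg, Matrix.neg_mul, add_zero, zero_add, transpose_mul, transpose_transpose, hSS,
      Matrix.mul_assoc]
    rw [nonsing_inv_mul _ hPd, ← transpose_mul, nonsing_inv_mul _ hPd, transpose_one]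
    simp
  · ext (i | i) j
    · simpa using congrFun (congrFun hP i) j
    · have : (S * P).map (PadicInt.toZMod (p := p)) = a.toRows₂ := by
        rw [Matrix.map_mul, hS, hP, Matrix.mul_assoc, nonsing_inv_mul _ hu, Matrix.mul_one]
      simpa using congrFun (congrFun this i) j

/-- An isotropic plane projects isomorphically onto at least one of four coordinate planes.
Exchanging conjugate coordinates moves that one to the upper block, where
`hasSympLift_of_det_ne_zero` applies. If all four minors vanished, isotropy would make the other two
vanish as well, against the existence of a left inverse. -/
theorem hasSympLift (a : Matrix (Fin 2 ⊕ Fin 2) (Fin 2) (ZMod p))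
    (h : aᵀ * symp (ZMod p) * a = 0) (hN : ∃ N : Matrix (Fin 2) (Fin 2 ⊕ Fin 2) (ZMod p), N * a = 1) :
    HasSympLift a := by
  -- For `s` and `t` in `{0, 1}` this exchanges, up to sign, the conjugate coordinates of index `0`
  -- if `s = 1` and those of index `1` if `t = 1`.
  let w : ℤ_[p] → ℤ_[p] → Matrix (Fin 2 ⊕ Fin 2) (Fin 2 ⊕ Fin 2) ℤ_[p] := fun s t =>
    fromBlocks (diagonal ![1 - s, 1 - t]) (diagonal ![s, t]) (diagonal ![-s, -t])
      (diagonal ![1 - s, 1 - t])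
  have hw : ∀ s t : ℤ_[p], s * s = s → t * t = t → (w s t)ᵀ * symp ℤ_[p] * w s t = symp ℤ_[p] := by
    intro s t hs ht
    have e1 : (1 - s) * (1 - s) + s * s = 1 := by linear_combination 2 * hs
    have e2 : (1 - t) * (1 - t) + t * t = 1 := by linear_combination 2 * ht
    ext (i | i) (j | j) <;> rw [transpose_mul_symp_mul_apply] <;> fin_cases i <;> fin_cases j <;>
      simp [w, symp] <;> first | linear_combination e1 | linear_combination e2 |
        linear_combination -e1 | linear_combination -e2 | ring
  have hwa : ∀ s t : ℤ_[p], s * s = s → t * t = t →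
      ((w s t).map (PadicInt.toZMod (p := p)) * a).toRows₁.det ≠ 0 → HasSympLift a := by
    intro s t hs ht hd
    refine HasSympLift.of_mul (w s t) (hw s t hs ht) (hasSympLift_of_det_ne_zero ?_ hd)
    have hw' := congrArg (fun A => A.map (PadicInt.toZMod (p := p))) (hw s t hs ht)
    simp only [Matrix.map_mul, map_symp, Matrix.transpose_map] at hw'
    rw [transpose_mul]
    calc _ = aᵀ * (((w s t).map (PadicInt.toZMod (p := p)))ᵀ * symp (ZMod p)
          * (w s t).map (PadicInt.toZMod (p := p))) * a := by simp only [Matrix.mul_assoc]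
      _ = 0 := by rw [hw', h]
  by_contra hcon
  have h00 := not_not.1 fun hd => hcon (hwa 0 0 (by simp) (by simp) hd)
  have h10 := not_not.1 fun hd => hcon (hwa 1 0 (by simp) (by simp) hd)
  have h01 := not_not.1 fun hd => hcon (hwa 0 1 (by simp) (by simp) hd)
  have h11 := not_not.1 fun hd => hcon (hwa 1 1 (by simp) (by simp) hd)
  have hs := congrFun (congrFun h 0) 1
  rw [transpose_mul_symp_mul_apply] at hs
  simp [w, det_fin_two, mul_apply, Fintype.sum_sum_type, Fin.sum_univ_two] at h00 h10 h01 h11 hs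
  obtain ⟨N, hN⟩ := hN
  have hdet : (N * a).det = 1 := by rw [hN, det_one]
  -- Isotropy makes the two remaining minors opposite. The Plücker relation expresses their product
  -- by the four vanishing minors, so the square of this one is zero.
  have hm : (a (.inl 0) 0 * a (.inr 0) 1 - a (.inl 0) 1 * a (.inr 0) 0) = 0 := by
    have h2 : (a (.inl 0) 0 * a (.inr 0) 1 - a (.inl 0) 1 * a (.inr 0) 0) ^ 2 = 0 := by
      linear_combination (a (.inl 0) 0 * a (.inr 0) 1 - a (.inl 0) 1 * a (.inr 0) 0) * hs
        - (a (.inr 0) 0 * a (.inr 1) 1 - a (.inr 0) 1 * a (.inr 1) 0) * h00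
        + (a (.inr 0) 0 * a (.inl 1) 1 - a (.inr 0) 1 * a (.inl 1) 0) * h01
    exact pow_eq_zero_iff two_ne_zero |>.1 h2
  simp only [det_fin_two, mul_apply, Fintype.sum_sum_type, Fin.sum_univ_two] at hdet
  refine one_ne_zero (α := ZMod p) ?_
  -- This is the Cauchy–Binet expansion of `det (N a)` along the six minors of `a`.
  linear_combination -hdet
    + (N 0 (.inl 0) * N 1 (.inl 1) - N 0 (.inl 1) * N 1 (.inl 0)) * h00
    - (N 0 (.inl 1) * N 1 (.inr 0) - N 0 (.inr 0) * N 1 (.inl 1)) * h10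
    + (N 0 (.inl 0) * N 1 (.inr 1) - N 0 (.inr 1) * N 1 (.inl 0)) * h01
    + (N 0 (.inr 0) * N 1 (.inr 1) - N 0 (.inr 1) * N 1 (.inr 0)) * h11
    + (N 0 (.inl 0) * N 1 (.inr 0) - N 0 (.inr 0) * N 1 (.inl 0)) * hm
    + (N 0 (.inl 1) * N 1 (.inr 1) - N 0 (.inr 1) * N 1 (.inl 1)) * (hs - hm)

/-- A nonzero vector is completed to an isotropic frame, which is then lifted. If the vector lies in
one of the two coordinate hyperbolic planes, the second vector comes from the other one. If not, it
is the component of the vector in the first hyperbolic plane, which is orthogonal to it. -/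
theorem exists_symplectic_col (a : Fin 2 ⊕ Fin 2 → ZMod p) (ha : a ≠ 0) :
    ∃ k : Matrix (Fin 2 ⊕ Fin 2) (Fin 2 ⊕ Fin 2) ℤ_[p], kᵀ * symp ℤ_[p] * k = symp ℤ_[p] ∧
      (k.map (PadicInt.toZMod (p := p))) *ᵥ Pi.single (.inl 0) 1 = a := by
  suffices h : ∃ b : Matrix (Fin 2 ⊕ Fin 2) (Fin 2) (ZMod p), (∀ i, b i 0 = a i) ∧
      b (.inl 0) 0 * b (.inr 0) 1 + b (.inl 1) 0 * b (.inr 1) 1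
        - b (.inr 0) 0 * b (.inl 0) 1 - b (.inr 1) 0 * b (.inl 1) 1 = 0 ∧
      ∃ i j, b i 0 * b j 1 - b i 1 * b j 0 ≠ 0 by
    obtain ⟨b, hb, hiso, i, j, hij⟩ := h
    have hiso' : bᵀ * symp (ZMod p) * b = 0 := by
      ext s t
      rw [transpose_mul_symp_mul_apply]
      fin_cases s <;> fin_cases t <;> simp
      · ring
      · linear_combination hiso
      · linear_combination -hiso
      · ring
    have hN : ∃ N : Matrix (Fin 2) (Fin 2 ⊕ Fin 2) (ZMod p), N * b = 1 := by
      have hu : IsUnit (b.submatrix ![i, j] id).det := by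
        rw [det_fin_two]
        exact IsUnit.mk0 _ (by simpa using hij)
      let E : Matrix (Fin 2) (Fin 2 ⊕ Fin 2) (ZMod p) := of fun s t => if ![i, j] s = t then 1 else 0
      have hE : E * b = b.submatrix ![i, j] id := by
        ext s t
        simp [E, mul_apply]
      refine ⟨(b.submatrix ![i, j] id)⁻¹ * E, ?_⟩
      rw [Matrix.mul_assoc, hE]
      exact nonsing_inv_mul _ hu
    obtain ⟨k, hk, hkb⟩ := hasSympLift b hiso' hN
    refine ⟨k, hk, ?_⟩
    ext i
    rw [← hb i, ← hkb]
    simp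
  by_cases h1 : a (.inl 1) = 0 ∧ a (.inr 1) = 0
  · refine ⟨of fun i => ![a i, (Pi.single (.inl 1) 1 : _ → ZMod p) i], fun i => rfl, ?_, ?_⟩
    · simp [h1.1, h1.2]
    · by_cases h0 : a (.inl 0) = 0
      · refine ⟨.inr 0, .inl 1, ?_⟩
        have : a (.inr 0) ≠ 0 := fun h => ha (by
          ext (i | i) <;> fin_cases i <;> simp [h0, h, h1.1, h1.2])
        simpa using this
      · exact ⟨.inl 0, .inl 1, by simpa using h0⟩
  by_cases h0 : a (.inl 0) = 0 ∧ a (.inr 0) = 0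
  · refine ⟨of fun i => ![a i, (Pi.single (.inl 0) 1 : _ → ZMod p) i], fun i => rfl, ?_, ?_⟩
    · simp [h0.1, h0.2]
    · by_cases h2 : a (.inl 1) = 0
      · exact ⟨.inr 1, .inl 0, by simpa [h0.1] using fun h => h1 ⟨h2, h⟩⟩
      · exact ⟨.inl 1, .inl 0, by simpa [h0.1] using h2⟩
  refine ⟨of fun i => ![a i, Sum.elim ![a (.inl 0), 0] ![a (.inr 0), 0] i], fun i => rfl, ?_, ?_⟩
  · simp; ring
  · obtain ⟨i, hi⟩ : ∃ i : Fin 2 ⊕ Fin 2, a i ≠ 0 ∧ (i = .inl 1 ∨ i = .inr 1) := by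
      by_contra hc
      push Not at hc
      exact h1 ⟨by_contra fun h => (hc _ h).1 rfl, by_contra fun h => (hc _ h).2 rfl⟩
    obtain ⟨j, hj⟩ : ∃ i : Fin 2 ⊕ Fin 2, a i ≠ 0 ∧ (i = .inl 0 ∨ i = .inr 0) := by
      by_contra hc
      push Not at hc
      exact h0 ⟨by_contra fun h => (hc _ h).1 rfl, by_contra fun h => (hc _ h).2 rfl⟩
    refine ⟨i, j, ?_⟩
    obtain ⟨hi, rfl | rfl⟩ := hi <;> obtain ⟨hj, rfl | rfl⟩ := hj <;> simp [hi, hj]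

end SymplecticFrames

/-! ### Counting bases of lines and isotropic planes -/

section Counting

variable {p : ℕ} [Fact p.Prime]

theorem isometry_inverse {R n : Type*} [CommRing R] [Fintype n] [DecidableEq n] {S T : Matrix n n R}
    (hT : T * S = 1) {k : Matrix n n R} (hk : kᵀ * S * k = S) :
    ∃ k' : Matrix n n R, k' * k = 1 ∧ k * k' = 1 ∧ k'ᵀ * S * k' = S := by
  have h1 : (T * kᵀ * S) * k = 1 := by
    rw [Matrix.mul_assoc, Matrix.mul_assoc, ← Matrix.mul_assoc kᵀ, hk, hT]
  have h2 := mul_eq_one_comm.1 h1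
  refine ⟨T * kᵀ * S, h1, h2, ?_⟩
  set k' := T * kᵀ * S
  calc k'ᵀ * S * k' = k'ᵀ * (kᵀ * S * k) * k' := by rw [hk]
    _ = (k * k')ᵀ * S * (k * k') := by simp only [transpose_mul, Matrix.mul_assoc]
    _ = S := by rw [h2]; simp

open Classical in
-- The vectors counted are the generators of the image line of the rank one matrix. This is the
-- source of the weight `1/(p - 1)`.
theorem card_parallel {m n : Type*} [Fintype m] {a₀ : m → ZMod p} {r₀ : n → ZMod p} (ha : a₀ ≠ 0)
    (hr : r₀ ≠ 0) :
    (Finset.univ.filter fun a : {a : m → ZMod p // a ≠ 0} =>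
      ∃ r : n → ZMod p, vecMulVec a₀ r₀ = vecMulVec a.1 r).card = p - 1 := by
  have : (Finset.univ.filter fun a : {a : m → ZMod p // a ≠ 0} =>
      ∃ r : n → ZMod p, vecMulVec a₀ r₀ = vecMulVec a.1 r)
      = Finset.univ.image fun u : (ZMod p)ˣ =>
        (⟨(u : ZMod p) • a₀, smul_ne_zero u.ne_zero ha⟩ : {a : m → ZMod p // a ≠ 0}) := by
    ext ⟨a, ha'⟩
    simp only [Finset.mem_filter, Finset.mem_univ, true_and, Finset.mem_image, Subtype.mk.injEq]
    constructor
    · rintro ⟨r, h⟩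
      obtain ⟨j, hj⟩ := Function.ne_iff.1 hr
      obtain ⟨i, hi⟩ := Function.ne_iff.1 ha
      simp only [Pi.zero_apply] at hj hi
      have h1 : ∀ i, a₀ i * r₀ j = a i * r j := fun i => congrFun (congrFun h i) j
      have hrj : r j ≠ 0 := fun h0 => by
        have := h1 i
        rw [h0, mul_zero] at this
        exact mul_ne_zero hi hj this
      refine ⟨Units.mk0 (r₀ j / r j) (div_ne_zero hj hrj), ?_⟩
      ext i
      have := h1 i
      simp only [Units.val_mk0, Pi.smul_apply, smul_eq_mul]
      field_simp
      linear_combination this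
    · rintro ⟨u, rfl⟩
      refine ⟨((u⁻¹ : (ZMod p)ˣ) : ZMod p) • r₀, ?_⟩
      ext i j
      simp only [vecMulVec_apply, Pi.smul_apply, smul_eq_mul]
      have := u.mul_inv
      linear_combination (- a₀ i * r₀ j) * this
  rw [this, Finset.card_image_of_injective, Finset.card_univ, ZMod.card_units]
  intro u v huv
  obtain ⟨i, hi⟩ := Function.ne_iff.1 ha
  have := congrFun (congrArg Subtype.val huv) i
  exact Units.ext (mul_right_cancel₀ hi this)

open Classical in
-- The frames counted are the bases `a₀ g` of the column space, with `g` in `GL₂(𝔽_p)`. They are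
-- isotropic because `P₀` has a right inverse, which carries the isotropy of `a₀ P₀` over to `a₀`.
-- This is the source of the weight `1/#GL₂(𝔽_p)`.
theorem card_frames {m n : Type*} [Fintype m] [DecidableEq m] [Fintype n]
    {a₀ : Matrix m (Fin 2) (ZMod p)} {P₀ : Matrix (Fin 2) n (ZMod p)}
    {N₀ : Matrix (Fin 2) m (ZMod p)} {M₀ : Matrix n (Fin 2) (ZMod p)} (hN : N₀ * a₀ = 1)
    (hM : P₀ * M₀ = 1) (S : Matrix m m (ZMod p)) (hS : (a₀ * P₀)ᵀ * S * (a₀ * P₀) = 0) :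
    (Finset.univ.filter fun a : {a : Matrix m (Fin 2) (ZMod p) // aᵀ * S * a = 0 ∧
        ∃ N : Matrix (Fin 2) m (ZMod p), N * a = 1} =>
      ∃ P : Matrix (Fin 2) n (ZMod p), a₀ * P₀ = a.1 * P).card
        = Nat.card (GL (Fin 2) (ZMod p)) := by
  have hS' : a₀ᵀ * S * a₀ = 0 := by
    calc a₀ᵀ * S * a₀ = (P₀ * M₀)ᵀ * (a₀ᵀ * S * a₀) * (P₀ * M₀) := by rw [hM]; simp
      _ = M₀ᵀ * ((a₀ * P₀)ᵀ * S * (a₀ * P₀)) * M₀ := by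
        simp only [transpose_mul, Matrix.mul_assoc]
      _ = 0 := by rw [hS]; simp
  have hmem : ∀ g : GL (Fin 2) (ZMod p), (a₀ * (g : Matrix (Fin 2) (Fin 2) (ZMod p)))ᵀ * S *
      (a₀ * (g : Matrix (Fin 2) (Fin 2) (ZMod p))) = 0 ∧
      ∃ N : Matrix (Fin 2) m (ZMod p), N * (a₀ * (g : Matrix (Fin 2) (Fin 2) (ZMod p))) = 1 := by
    intro g
    constructor
    · calc _ = (g : Matrix (Fin 2) (Fin 2) (ZMod p))ᵀ * (a₀ᵀ * S * a₀) * (g : Matrix (Fin 2) (Fin 2) (ZMod p)) := by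
            simp only [transpose_mul, Matrix.mul_assoc]
        _ = 0 := by rw [hS']; simp
    · refine ⟨((g⁻¹ : GL (Fin 2) (ZMod p)) : Matrix (Fin 2) (Fin 2) (ZMod p)) * N₀, ?_⟩
      rw [Matrix.mul_assoc, ← Matrix.mul_assoc N₀, hN, Matrix.one_mul, ← Units.val_mul,
        inv_mul_cancel, Units.val_one]
  have : (Finset.univ.filter fun a : {a : Matrix m (Fin 2) (ZMod p) // aᵀ * S * a = 0 ∧
        ∃ N : Matrix (Fin 2) m (ZMod p), N * a = 1} =>
      ∃ P : Matrix (Fin 2) n (ZMod p), a₀ * P₀ = a.1 * P)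
      = Finset.univ.image fun g : GL (Fin 2) (ZMod p) => (⟨_, hmem g⟩ :
        {a : Matrix m (Fin 2) (ZMod p) // aᵀ * S * a = 0 ∧
        ∃ N : Matrix (Fin 2) m (ZMod p), N * a = 1}) := by
    ext ⟨a, ha, N, hNa⟩
    simp only [Finset.mem_filter, Finset.mem_univ, true_and, Finset.mem_image, Subtype.mk.injEq]
    constructor
    · rintro ⟨P, h⟩
      have h1 : a₀ = a * (P * M₀) := by
        rw [← Matrix.mul_assoc, ← h, Matrix.mul_assoc, hM, Matrix.mul_one]
      have h2 : (N₀ * a) * (P * M₀) = 1 := by rw [Matrix.mul_assoc, ← h1, hN]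
      have h3 := mul_eq_one_comm.1 h2
      refine ⟨⟨N₀ * a, P * M₀, h2, h3⟩, ?_⟩
      simp only
      conv_lhs => rw [h1]
      rw [Matrix.mul_assoc, h3, Matrix.mul_one]
    · rintro ⟨g, rfl⟩
      refine ⟨((g⁻¹ : GL (Fin 2) (ZMod p)) : Matrix (Fin 2) (Fin 2) (ZMod p)) * P₀, ?_⟩
      rw [Matrix.mul_assoc, ← Matrix.mul_assoc (g : Matrix (Fin 2) (Fin 2) (ZMod p)), ← Units.val_mul,
        mul_inv_cancel, Units.val_one, Matrix.one_mul]
  rw [this, Finset.card_image_of_injective, Finset.card_univ, Nat.card_eq_fintype_card]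
  intro g g' hgg
  have h1 : a₀ * (g : Matrix (Fin 2) (Fin 2) (ZMod p)) = a₀ * (g' : Matrix (Fin 2) (Fin 2) (ZMod p)) :=
    congrArg Subtype.val hgg
  have h2 := congrArg (fun B => N₀ * B) h1
  simp only [← Matrix.mul_assoc, hN, Matrix.one_mul] at h2
  exact Units.ext h2

end Counting

/-! ### Cosets in the first Hecke set of `G` -/

section SymplecticCosets

variable {p : ℕ} [Fact p.Prime]

/-- The matrix `p n d` with `d = diag(p⁻¹, 1; p, 1)` and `n` lower unipotent with entry `p c`. -/
def sympRepOne (c : ℤ_[p]) : Matrix (Fin 2 ⊕ Fin 2) (Fin 2 ⊕ Fin 2) ℤ_[p] :=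
  fromBlocks (diagonal ![1, (p : ℤ_[p])]) 0 !![p * c, 0; 0, 0]
    (diagonal ![(p : ℤ_[p]) ^ 2, (p : ℤ_[p])])

theorem sympRepOne_isometry (c : ℤ_[p]) : (sympRepOne c)ᵀ * symp ℤ_[p] * sympRepOne c
    = (p : ℤ_[p]) ^ 2 • symp ℤ_[p] := by
  ext (i | i) (j | j) <;> rw [transpose_mul_symp_mul_apply] <;> fin_cases i <;> fin_cases j <;>
    simp [sympRepOne, symp, one_apply] <;> ring

theorem sympRepOne_reduction (c : ℤ_[p]) : (sympRepOne c).map (PadicInt.toZMod (p := p))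
    = vecMulVec (Pi.single (.inl 0) 1) (Pi.single (.inl 0) 1) := by
  ext (i | i) (j | j) <;> fin_cases i <;> fin_cases j <;> simp [sympRepOne, vecMulVec_apply]

theorem isometry_smul_mul {n R : Type*} [CommRing R] [Fintype n] {S k N : Matrix n n R} {c : R}
    (hk : kᵀ * S * k = S) (hN : Nᵀ * S * N = c • S) : (k * N)ᵀ * S * (k * N) = c • S := by
  calc (k * N)ᵀ * S * (k * N) = Nᵀ * (kᵀ * S * k) * N := by
        simp only [transpose_mul, Matrix.mul_assoc]
    _ = c • S := by rw [hk, hN]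

/-- Every row of `A` except the first is divisible by `p`. The symplectic relation, divided by `p`,
makes the third row over `p` proportional modulo `p` to the first row, and the factor is `c`. -/
theorem existsUnique_sympRepOne {A : Matrix (Fin 2 ⊕ Fin 2) (Fin 2 ⊕ Fin 2) ℤ_[p]}
    (hA : Aᵀ * symp ℤ_[p] * A = (p : ℤ_[p]) ^ 2 • symp ℤ_[p]) {ρ : Fin 2 ⊕ Fin 2 → ZMod p}
    (hρ : ρ ≠ 0)
    (hAρ : A.map (PadicInt.toZMod (p := p)) = vecMulVec (Pi.single (.inl 0) 1) ρ) :
    ∃! c : ZMod p, ∃ κ : Matrix (Fin 2 ⊕ Fin 2) (Fin 2 ⊕ Fin 2) ℤ_[p],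
      A = sympRepOne (lift c) * κ := by
  have h0 : ∀ j, PadicInt.toZMod (A (.inl 0) j) = ρ j := fun j => by
    simpa [vecMulVec_apply] using congrFun (congrFun hAρ (.inl 0)) j
  have hdvd : ∀ i, i ≠ .inl 0 → ∀ j, ∃ b, A i j = p * b := fun i hi j => by
    have := congrFun (congrFun hAρ i) j
    rw [vecMulVec_apply, Pi.single_eq_of_ne hi, zero_mul] at this
    exact (toZMod_eq_zero_iff _).1 this
  choose b1 hb1 using hdvd (.inl 1) (by simp)
  choose b2 hb2 using hdvd (.inr 0) (by simp)
  choose b3 hb3 using hdvd (.inr 1) (by simp)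
  have hrel : ∀ i j, ρ i * PadicInt.toZMod (b2 j) = PadicInt.toZMod (b2 i) * ρ j := by
    intro i j
    have := congrFun (congrFun hA i) j
    rw [transpose_mul_symp_mul_apply, hb1, hb1, hb2, hb2, hb3, hb3] at this
    -- Modulo `p²` only the products of the first and third rows survive in the relation.
    have h1 : A (.inl 0) i * b2 j - b2 i * A (.inl 0) j
        = p * (symp ℤ_[p] i j - b1 i * b3 j + b3 i * b1 j) := by
      apply mul_left_cancel₀ (coe_p_ne_zero (p := p))
      simp only [Matrix.smul_apply, smul_eq_mul] at this
      linear_combination this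
    have h2 := congrArg (PadicInt.toZMod (p := p)) h1
    simp only [map_sub, map_mul, h0, map_natCast, CharP.cast_eq_zero, zero_mul] at h2
    exact sub_eq_zero.1 h2
  obtain ⟨i, hi⟩ := Function.ne_iff.1 hρ
  simp only [Pi.zero_apply] at hi
  have hiff : ∀ c : ZMod p, (∃ κ : Matrix (Fin 2 ⊕ Fin 2) (Fin 2 ⊕ Fin 2) ℤ_[p],
      A = sympRepOne (lift c) * κ) ↔ ∀ j, PadicInt.toZMod (b2 j) = c * ρ j := by
    intro c
    constructor
    · rintro ⟨κ, hκ⟩ j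
      have e0 := congrFun (congrFun hκ (.inl 0)) j
      have e2 := congrFun (congrFun hκ (.inr 0)) j
      simp [sympRepOne, mul_apply, Fintype.sum_sum_type, Fin.sum_univ_two] at e0 e2
      rw [hb2, ← e0] at e2
      have e3 : b2 j = lift c * A (.inl 0) j + p * κ (.inr 0) j := by
        apply mul_left_cancel₀ (coe_p_ne_zero (p := p))
        linear_combination e2
      rw [e3]
      simp [h0]
    · intro h
      have h' : ∀ j, ∃ d, b2 j - lift c * A (.inl 0) j = p * d := fun j => by
        rw [← dvd_def, ← toZMod_eq_zero_iff]
        simp [h, h0]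
      choose d hd using h'
      refine ⟨fromRows (of ![A (.inl 0), b1]) (of ![d, b3]), ?_⟩
      ext (i | i) j <;> fin_cases i <;>
        simp [sympRepOne, mul_apply, Fintype.sum_sum_type, Fin.sum_univ_two, hb1, hb3]
      rw [hb2]
      linear_combination (p : ℤ_[p]) * hd j
  refine ⟨PadicInt.toZMod (b2 i) / ρ i, (hiff _).2 fun j => ?_, fun c hc => ?_⟩
  · field_simp
    linear_combination hrel i j
  · rw [(hiff c).1 hc i]
    field_simp

open Classical in
-- Only the `p - 1` generators `a` of the image line of `A` modulo `p` contribute. For each of them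
-- `k a` moves the line to the first coordinate axis, and there exactly one `c` is possible.
theorem sum_sympRepOne
    {k : {a : Fin 2 ⊕ Fin 2 → ZMod p // a ≠ 0} → Matrix (Fin 2 ⊕ Fin 2) (Fin 2 ⊕ Fin 2) ℤ_[p]}
    (hk : ∀ a, (k a)ᵀ * symp ℤ_[p] * k a = symp ℤ_[p])
    (hka : ∀ a, (k a).map (PadicInt.toZMod (p := p)) *ᵥ Pi.single (.inl 0) 1 = a.1)
    {A : Matrix (Fin 2 ⊕ Fin 2) (Fin 2 ⊕ Fin 2) ℤ_[p]}
    (hA : Aᵀ * symp ℤ_[p] * A = (p : ℤ_[p]) ^ 2 • symp ℤ_[p])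
    (hr : (A.map (PadicInt.toZMod (p := p))).rank = 1) :
    ∑ j : {a : Fin 2 ⊕ Fin 2 → ZMod p // a ≠ 0} × ZMod p,
      (if ∃ κ : Matrix (Fin 2 ⊕ Fin 2) (Fin 2 ⊕ Fin 2) ℤ_[p],
        A = k j.1 * sympRepOne (lift j.2) * κ then ((p : ℂ) - 1)⁻¹ else 0) = 1 := by
  obtain ⟨a₀, P₀, hAP, ⟨N₀, hN⟩, M₀, hM⟩ := exists_rank_factorization _ hr
  have hAP' : A.map (PadicInt.toZMod (p := p)) = vecMulVec (fun i => a₀ i 0) (P₀ 0) := by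
    rw [hAP]
    ext i j
    simp [mul_apply, vecMulVec_apply]
  have ha₀ : (fun i => a₀ i 0) ≠ 0 := fun h => by
    have : a₀ = 0 := by ext i j; rw [Subsingleton.elim j 0]; exact congrFun h i
    rw [this, Matrix.mul_zero] at hN
    exact zero_ne_one hN
  have hP₀ : P₀ 0 ≠ 0 := fun h => by
    have : P₀ = 0 := by ext i j; rw [Subsingleton.elim i 0]; exact congrFun h j
    rw [this, Matrix.zero_mul] at hM
    exact zero_ne_one hM
  have hinner : ∀ a : {a : Fin 2 ⊕ Fin 2 → ZMod p // a ≠ 0}, ∑ c : ZMod p,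
      (if ∃ κ : Matrix (Fin 2 ⊕ Fin 2) (Fin 2 ⊕ Fin 2) ℤ_[p],
        A = k a * sympRepOne (lift c) * κ then ((p : ℂ) - 1)⁻¹ else 0)
      = if ∃ r : Fin 2 ⊕ Fin 2 → ZMod p, vecMulVec (fun i => a₀ i 0) (P₀ 0) = vecMulVec a.1 r
        then ((p : ℂ) - 1)⁻¹ else 0 := by
    intro a
    obtain ⟨k', hk1, hk2, hk3⟩ := isometry_inverse (neg_symp_mul_symp _) (hk a)
    have hdiv : ∀ c : ZMod p, (∃ κ : Matrix (Fin 2 ⊕ Fin 2) (Fin 2 ⊕ Fin 2) ℤ_[p],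
        A = k a * sympRepOne (lift c) * κ) ↔
        ∃ κ : Matrix (Fin 2 ⊕ Fin 2) (Fin 2 ⊕ Fin 2) ℤ_[p],
        k' * A = sympRepOne (lift c) * κ := by
      refine fun c => exists_congr fun κ => ⟨fun h => ?_, fun h => ?_⟩
      · rw [h, ← Matrix.mul_assoc, ← Matrix.mul_assoc, hk1, Matrix.one_mul]
      · rw [Matrix.mul_assoc, ← h, ← Matrix.mul_assoc, hk2, Matrix.one_mul]
    split_ifs with h
    · refine sum_ite_of_existsUnique ?_ _
      simp only [hdiv]
      obtain ⟨r, hr'⟩ := h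
      refine existsUnique_sympRepOne (ρ := r) (isometry_smul_mul hk3 hA) ?_ ?_
      · rintro rfl
        rw [hAP', hr', vecMulVec_zero, rank_zero] at hr
        exact zero_ne_one hr
      · rw [Matrix.map_mul, hAP', hr', mul_vecMulVec, ← hka a, mulVec_mulVec, ← Matrix.map_mul, hk1,
          Matrix.map_one _ (map_zero _) (map_one _), one_mulVec]
    · refine Finset.sum_eq_zero fun c _ => if_neg ?_
      rintro ⟨κ, hκ⟩
      apply h
      rw [← hAP', hκ, Matrix.map_mul, Matrix.map_mul, sympRepOne_reduction, mul_vecMulVec, hka,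
        vecMulVec_mul]
      exact ⟨_, rfl⟩
  rw [Fintype.sum_prod_type]
  simp only [hinner]
  have hcard := card_parallel ha₀ hP₀
  rw [← Finset.sum_filter, Finset.sum_const]
  rw [show Finset.card _ = p - 1 by convert hcard, nsmul_eq_mul,
    Nat.cast_sub (Fact.out : p.Prime).one_lt.le, Nat.cast_one]
  refine mul_inv_cancel₀ (sub_ne_zero.2 ?_)
  exact_mod_cast (Fact.out : p.Prime).ne_one

end SymplecticCosets

/-! ### Cosets in the second Hecke set of `G` -/

section SymplecticCosetsTwo

variable {p : ℕ} [Fact p.Prime]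

/-- The matrix `p n d` with `d = diag(p⁻¹, p⁻¹; p, p)` and `n` lower unipotent with block `p S`. -/
def sympRepTwo (S : Matrix (Fin 2) (Fin 2) ℤ_[p]) :
    Matrix (Fin 2 ⊕ Fin 2) (Fin 2 ⊕ Fin 2) ℤ_[p] :=
  fromBlocks 1 0 ((p : ℤ_[p]) • S) ((p : ℤ_[p]) ^ 2 • 1)

theorem sympRepTwo_isometry {S : Matrix (Fin 2) (Fin 2) ℤ_[p]} (hS : Sᵀ = S) :
    (sympRepTwo S)ᵀ * symp ℤ_[p] * sympRepTwo S = (p : ℤ_[p]) ^ 2 • symp ℤ_[p] := by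
  simp [sympRepTwo, symp, fromBlocks_transpose, fromBlocks_multiply, fromBlocks_smul, hS]

theorem sympRepTwo_reduction (S : Matrix (Fin 2) (Fin 2) ℤ_[p]) :
    (sympRepTwo S).map (PadicInt.toZMod (p := p))
      = (fromRows 1 0 : Matrix (Fin 2 ⊕ Fin 2) (Fin 2) (ZMod p))
        * (fromCols 1 0 : Matrix (Fin 2) (Fin 2 ⊕ Fin 2) (ZMod p)) := by
  ext (i | i) (j | j) <;> simp [sympRepTwo, mul_apply, one_apply, apply_ite]

/-- The upper block of `κ` has to be `P`, and the lower one is then `(Q - S P) / p`. -/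
theorem fromRows_smul_eq_sympRepTwo_mul_iff {n : Type*} (S : Matrix (Fin 2) (Fin 2) ℤ_[p])
    (P Q : Matrix (Fin 2) n ℤ_[p]) :
    (∃ κ : Matrix (Fin 2 ⊕ Fin 2) n ℤ_[p],
      fromRows P ((p : ℤ_[p]) • Q) = sympRepTwo S * κ) ↔
      Q.map (PadicInt.toZMod (p := p))
        = S.map (PadicInt.toZMod (p := p)) * P.map (PadicInt.toZMod (p := p)) := by
  have hp := coe_p_ne_zero (p := p)
  constructor
  · rintro ⟨κ, hκ⟩
    rw [← fromRows_toRows κ, sympRepTwo, fromBlocks_mul_fromRows, fromRows_ext_iff] at hκ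
    obtain ⟨h1, h2⟩ := hκ
    simp only [Matrix.one_mul, Matrix.zero_mul, add_zero, Matrix.smul_mul] at h1 h2
    rw [pow_two, ← smul_smul, ← smul_add] at h2
    have h3 : Q = S * κ.toRows₁ + (p : ℤ_[p]) • κ.toRows₂ := by
      ext i j
      exact mul_left_cancel₀ hp (congrFun (congrFun h2 i) j)
    rw [h1, h3]
    ext i j
    simp [mul_apply]
  · intro h
    rw [← Matrix.map_mul, ← sub_eq_zero, ← Matrix.map_sub _ (map_sub _), map_toZMod_eq_zero_iff] at h
    obtain ⟨B, hB⟩ := h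
    refine ⟨fromRows P B, ?_⟩
    rw [sympRepTwo, fromBlocks_mul_fromRows]
    simp only [Matrix.one_mul, Matrix.zero_mul, add_zero, Matrix.smul_mul]
    rw [pow_two, ← smul_smul, ← hB]
    simp [smul_sub]

/-- With `p Q` as lower block, the symplectic relation divided by `p` says that `ᵗP Q` is symmetric
modulo `p`. Hence `Q = S P` modulo `p` for a unique symmetric `S`. -/
theorem existsUnique_sympRepTwo {A : Matrix (Fin 2 ⊕ Fin 2) (Fin 2 ⊕ Fin 2) ℤ_[p]}
    (hA : Aᵀ * symp ℤ_[p] * A = (p : ℤ_[p]) ^ 2 • symp ℤ_[p])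
    {P : Matrix (Fin 2) (Fin 2 ⊕ Fin 2) (ZMod p)} {M : Matrix (Fin 2 ⊕ Fin 2) (Fin 2) (ZMod p)}
    (hM : P * M = 1) (hAP : A.map (PadicInt.toZMod (p := p)) = fromRows P 0) :
    ∃! S : {S : Matrix (Fin 2) (Fin 2) (ZMod p) // Sᵀ = S},
      ∃ κ : Matrix (Fin 2 ⊕ Fin 2) (Fin 2 ⊕ Fin 2) ℤ_[p], A = sympRepTwo (S.1.map lift) * κ := by
  obtain ⟨Q, hQ⟩ := (map_toZMod_eq_zero_iff A.toRows₂).1 (by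
    ext i j; simpa using congrFun (congrFun hAP (.inr i)) j)
  have hP : A.toRows₁.map (PadicInt.toZMod (p := p)) = P := by
    ext i j; simpa using congrFun (congrFun hAP (.inl i)) j
  have hAQ : A = fromRows A.toRows₁ ((p : ℤ_[p]) • Q) := by
    rw [← hQ, fromRows_toRows]
  have hl : ∀ S : Matrix (Fin 2) (Fin 2) (ZMod p),
      (S.map lift).map (PadicInt.toZMod (p := p)) = S := fun S => by ext; simp
  have hiff : ∀ S : Matrix (Fin 2) (Fin 2) (ZMod p),
      (∃ κ : Matrix (Fin 2 ⊕ Fin 2) (Fin 2 ⊕ Fin 2) ℤ_[p], A = sympRepTwo (S.map lift) * κ) ↔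
        Q.map (PadicInt.toZMod (p := p)) = S * P := fun S => by
    conv_lhs => rw [hAQ]
    rw [fromRows_smul_eq_sympRepTwo_mul_iff, hl, hP]
  simp only [hiff]
  refine existsUnique_symmetric_mul P _ hM ?_
  have h1 : A.toRows₁ᵀ * Q - Qᵀ * A.toRows₁ = (p : ℤ_[p]) • symp ℤ_[p] := by
    refine smul_right_injective _ (coe_p_ne_zero (p := p)) ?_
    simp only
    rw [smul_smul, ← pow_two, ← hA]
    conv_rhs => rw [hAQ]
    ext i j
    rw [transpose_mul_symp_mul_apply]
    simp [mul_apply, Fin.sum_univ_two]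
    ring
  have h2 := (map_toZMod_eq_zero_iff _).2 ⟨_, h1⟩
  rw [Matrix.map_sub _ (map_sub _), Matrix.map_mul, Matrix.map_mul, sub_eq_zero,
    Matrix.transpose_map, Matrix.transpose_map, hP] at h2
  exact h2

open Classical in
-- The image plane of `A` modulo `p` is isotropic because the multiplier `p²` reduces to zero. Only
-- its bases contribute, each with exactly one symmetric matrix.
theorem sum_sympRepTwo
    {k : {a : Matrix (Fin 2 ⊕ Fin 2) (Fin 2) (ZMod p) // aᵀ * symp (ZMod p) * a = 0 ∧
      ∃ N : Matrix (Fin 2) (Fin 2 ⊕ Fin 2) (ZMod p), N * a = 1} →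
      Matrix (Fin 2 ⊕ Fin 2) (Fin 2 ⊕ Fin 2) ℤ_[p]}
    (hk : ∀ a, (k a)ᵀ * symp ℤ_[p] * k a = symp ℤ_[p])
    (hka : ∀ a, ((k a).map (PadicInt.toZMod (p := p))).toCols₁ = a.1)
    {A : Matrix (Fin 2 ⊕ Fin 2) (Fin 2 ⊕ Fin 2) ℤ_[p]}
    (hA : Aᵀ * symp ℤ_[p] * A = (p : ℤ_[p]) ^ 2 • symp ℤ_[p])
    (hr : (A.map (PadicInt.toZMod (p := p))).rank = 2) :
    ∑ j : {a : Matrix (Fin 2 ⊕ Fin 2) (Fin 2) (ZMod p) // aᵀ * symp (ZMod p) * a = 0 ∧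
      ∃ N : Matrix (Fin 2) (Fin 2 ⊕ Fin 2) (ZMod p), N * a = 1} ×
        {S : Matrix (Fin 2) (Fin 2) (ZMod p) // Sᵀ = S},
      (if ∃ κ : Matrix (Fin 2 ⊕ Fin 2) (Fin 2 ⊕ Fin 2) ℤ_[p],
        A = k j.1 * sympRepTwo (j.2.1.map lift) * κ
        then (Nat.card (GL (Fin 2) (ZMod p)) : ℂ)⁻¹ else 0) = 1 := by
  obtain ⟨a₀, P₀, hAP, ⟨N₀, hN⟩, M₀, hM⟩ := exists_rank_factorization _ hr
  have hA0 : (a₀ * P₀)ᵀ * symp (ZMod p) * (a₀ * P₀) = 0 := by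
    have := congrArg (fun B => B.map (PadicInt.toZMod (p := p))) hA
    simp only [Matrix.map_mul, map_symp, Matrix.transpose_map, hAP] at this
    rw [this]
    ext i j
    simp
  have hinner : ∀ a : {a : Matrix (Fin 2 ⊕ Fin 2) (Fin 2) (ZMod p) //
      aᵀ * symp (ZMod p) * a = 0 ∧ ∃ N : Matrix (Fin 2) (Fin 2 ⊕ Fin 2) (ZMod p), N * a = 1},
      ∑ S : {S : Matrix (Fin 2) (Fin 2) (ZMod p) // Sᵀ = S},
      (if ∃ κ : Matrix (Fin 2 ⊕ Fin 2) (Fin 2 ⊕ Fin 2) ℤ_[p],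
        A = k a * sympRepTwo (S.1.map lift) * κ
        then (Nat.card (GL (Fin 2) (ZMod p)) : ℂ)⁻¹ else 0)
      = if ∃ P : Matrix (Fin 2) (Fin 2 ⊕ Fin 2) (ZMod p), a₀ * P₀ = a.1 * P
        then (Nat.card (GL (Fin 2) (ZMod p)) : ℂ)⁻¹ else 0 := by
    intro a
    obtain ⟨k', hk1, hk2, hk3⟩ := isometry_inverse (neg_symp_mul_symp _) (hk a)
    have hdiv : ∀ S : Matrix (Fin 2) (Fin 2) (ZMod p),
        (∃ κ : Matrix (Fin 2 ⊕ Fin 2) (Fin 2 ⊕ Fin 2) ℤ_[p],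
        A = k a * sympRepTwo (S.map lift) * κ) ↔
        ∃ κ : Matrix (Fin 2 ⊕ Fin 2) (Fin 2 ⊕ Fin 2) ℤ_[p],
        k' * A = sympRepTwo (S.map lift) * κ := by
      refine fun c => exists_congr fun κ => ⟨fun h => ?_, fun h => ?_⟩
      · rw [h, ← Matrix.mul_assoc, ← Matrix.mul_assoc, hk1, Matrix.one_mul]
      · rw [Matrix.mul_assoc, ← h, ← Matrix.mul_assoc, hk2, Matrix.one_mul]
    have hka' : (k a).map (PadicInt.toZMod (p := p))
        * (fromRows 1 0 : Matrix (Fin 2 ⊕ Fin 2) (Fin 2) (ZMod p)) = a.1 := by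
      rw [← hka a]
      ext i j
      simp [mul_apply, one_apply, Fintype.sum_sum_type]
    split_ifs with h
    · refine sum_ite_of_existsUnique ?_ _
      simp only [hdiv]
      obtain ⟨P, hP⟩ := h
      obtain ⟨N, hNa⟩ := a.2.2
      refine existsUnique_sympRepTwo (P := P) (M := M₀ * (N₀ * a.1)) (isometry_smul_mul hk3 hA) ?_ ?_
      · have h1 : (N₀ * a.1) * (P * M₀) = 1 := by
          calc (N₀ * a.1) * (P * M₀) = N₀ * (a.1 * P) * M₀ := by simp only [Matrix.mul_assoc]
            _ = (N₀ * a₀) * (P₀ * M₀) := by rw [← hP]; simp only [Matrix.mul_assoc]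
            _ = 1 := by rw [hN, hM, Matrix.one_mul]
        rw [← Matrix.mul_assoc]
        exact mul_eq_one_comm.1 h1
      · rw [Matrix.map_mul, hAP, hP]
        nth_rewrite 1 [← hka']
        rw [← Matrix.mul_assoc, ← Matrix.mul_assoc, ← Matrix.map_mul, hk1,
          Matrix.map_one _ (map_zero _) (map_one _), Matrix.one_mul, fromRows_mul, Matrix.one_mul,
          Matrix.zero_mul]
    · refine Finset.sum_eq_zero fun c _ => if_neg ?_
      rintro ⟨κ, hκ⟩
      apply h
      rw [← hAP, hκ, Matrix.map_mul, Matrix.map_mul, sympRepTwo_reduction, ← Matrix.mul_assoc, hka',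
        Matrix.mul_assoc]
      exact ⟨_, rfl⟩
  have hcard := card_frames hN hM _ hA0
  rw [Fintype.sum_prod_type]
  simp only [hinner]
  rw [← Finset.sum_filter, Finset.sum_const]
  rw [show Finset.card _ = Nat.card (GL (Fin 2) (ZMod p)) by convert hcard, nsmul_eq_mul]
  exact mul_inv_cancel₀ (Nat.cast_ne_zero.2 Nat.card_pos.ne')

end SymplecticCosetsTwo

/-! ### Diagonal representatives for `H` -/

section OrthogonalCosets

variable {p : ℕ} [Fact p.Prime]

/-- The matrix relation only gives twice the quadratic relation, and `2` is cancelled over `ℤ_p`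
before reducing. This makes the argument uniform in `p`: for `p = 2` the bilinear relation modulo
`p` would be too weak. -/
theorem orth_quadratic {A : Matrix (Fin 2 ⊕ Fin 2) (Fin 2 ⊕ Fin 2) ℤ_[p]}
    (hA : Aᵀ * orth ℤ_[p] * A = (p : ℤ_[p]) ^ 2 • orth ℤ_[p]) (ξ : Fin 2 ⊕ Fin 2 → ℤ_[p]) :
    (A (.inl 0) ⬝ᵥ ξ) * (A (.inr 1) ⬝ᵥ ξ) - (A (.inl 1) ⬝ᵥ ξ) * (A (.inr 0) ⬝ᵥ ξ)
      = (p : ℤ_[p]) ^ 2 * (ξ (.inl 0) * ξ (.inr 1) - ξ (.inl 1) * ξ (.inr 0)) := by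
  have h : ∀ v : Fin 2 ⊕ Fin 2 → ℤ_[p], v ⬝ᵥ orth ℤ_[p] *ᵥ v
      = 2 * (v (.inl 0) * v (.inr 1) - v (.inl 1) * v (.inr 0)) := by
    intro v
    simp [dotProduct, mulVec, Fintype.sum_sum_type, Fin.sum_univ_two, orth, J]
    ring
  have h1 : (A *ᵥ ξ) ⬝ᵥ orth ℤ_[p] *ᵥ (A *ᵥ ξ) = (p : ℤ_[p]) ^ 2 * (ξ ⬝ᵥ orth ℤ_[p] *ᵥ ξ) := by
    rw [← smul_eq_mul, ← dotProduct_smul, ← smul_mulVec, ← hA, Matrix.mul_assoc, ← mulVec_mulVec,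
      ← mulVec_mulVec, dotProduct_mulVec ξ, vecMul_transpose]
  rw [h, h] at h1
  simp only [mulVec] at h1
  have h2 : (2 : ℤ_[p]) ≠ 0 := two_ne_zero
  apply mul_left_cancel₀ h2
  linear_combination h1

theorem toZMod_dotProduct {n : Type*} [Fintype n] (v : n → ℤ_[p]) (ξ : n → ZMod p) :
    PadicInt.toZMod (v ⬝ᵥ fun j => lift (ξ j)) = (fun j => PadicInt.toZMod (v j)) ⬝ᵥ ξ := by
  simp [dotProduct]

/-- The second form vanishes outside the kernel of the first, and these vectors span the space over
any field, including `𝔽₂`. -/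
theorem eq_zero_of_dotProduct_mul_dotProduct {F n : Type*} [Field F] [Fintype n] [DecidableEq n]
    {r s : n → F} (hr : r ≠ 0) (h : ∀ ξ, (r ⬝ᵥ ξ) * (s ⬝ᵥ ξ) = 0) : s = 0 := by
  obtain ⟨i, hi⟩ := Function.ne_iff.1 hr
  have h1 : ∀ ξ, r ⬝ᵥ ξ ≠ 0 → s ⬝ᵥ ξ = 0 := fun ξ hξ => (mul_eq_zero.1 (h ξ)).resolve_left hξ
  have h2 : r ⬝ᵥ Pi.single i 1 ≠ 0 := by simpa using hi
  ext j
  by_cases hj : r j = 0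
  · have h3 := h1 (Pi.single j 1 + Pi.single i 1) (by
      rw [dotProduct_add]
      simpa [hj] using hi)
    rw [dotProduct_add, h1 _ h2] at h3
    simpa using h3
  · simpa using h1 (Pi.single j 1) (by simpa using hj)

theorem exists_eq_diagonal_mul_iff {R m n : Type*} [CommRing R] [Fintype m] [DecidableEq m]
    (d : m → R) (A : Matrix m n R) :
    (∃ κ : Matrix m n R, A = diagonal d * κ) ↔ ∀ i j, d i ∣ A i j := by
  constructor
  · rintro ⟨κ, rfl⟩ i j
    rw [diagonal_mul]
    exact dvd_mul_right _ _
  · intro h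
    choose κ hκ using h
    exact ⟨of κ, by ext i j; rw [diagonal_mul]; exact hκ i j⟩

/-- The matrix `(A 0; 0 A)`. -/
def levi {R : Type*} [CommRing R] (A : Matrix (Fin 2) (Fin 2) R) :
    Matrix (Fin 2 ⊕ Fin 2) (Fin 2 ⊕ Fin 2) R := fromBlocks A 0 0 A

/-- The matrix `(1 b; 0 1)`. -/
def unip {R : Type*} [CommRing R] (b : R) :
    Matrix (Fin 2 ⊕ Fin 2) (Fin 2 ⊕ Fin 2) R := fromBlocks 1 (b • 1) 0 1

theorem transpose_mul_J_mul {R : Type*} [CommRing R] (A : Matrix (Fin 2) (Fin 2) R) :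
    Aᵀ * J R * A = A.det • J R := by
  ext i j
  fin_cases i <;> fin_cases j <;> simp [J, mul_apply, Fin.sum_univ_two, det_fin_two] <;> ring

theorem levi_isometry {R : Type*} [CommRing R] (A : Matrix (Fin 2) (Fin 2) R) :
    (levi A)ᵀ * orth R * levi A = A.det • orth R := by
  simp [levi, orth, fromBlocks_transpose, fromBlocks_multiply, fromBlocks_smul,
    transpose_mul_J_mul]

theorem unip_isometry {R : Type*} [CommRing R] (b : R) : (unip b)ᵀ * orth R * unip b = orth R := by
  simp [unip, orth, fromBlocks_transpose, fromBlocks_multiply]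

theorem levi_mul {R : Type*} [CommRing R] (A B : Matrix (Fin 2) (Fin 2) R) :
    levi (A * B) = levi A * levi B := by
  simp [levi, fromBlocks_multiply]

theorem levi_one {R : Type*} [CommRing R] : levi (1 : Matrix (Fin 2) (Fin 2) R) = 1 := by
  simp [levi]

theorem map_levi {R R' : Type*} [CommRing R] [CommRing R'] (f : R →+* R')
    (A : Matrix (Fin 2) (Fin 2) R) : (levi A).map f = levi (A.map f) := by
  ext (i | i) (j | j) <;> simp [levi]

theorem exists_specialLinear_col (a : Fin 2 → ZMod p) (ha : a ≠ 0) :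
    ∃ A : Matrix (Fin 2) (Fin 2) ℤ_[p], A.det = 1 ∧ ∀ i, PadicInt.toZMod (A i 0) = a i := by
  by_cases h0 : a 0 = 0
  · have h1 : a 1 ≠ 0 := fun h1 => ha (by ext i; fin_cases i <;> simp [h0, h1])
    obtain ⟨u, hu⟩ := isUnit_of_toZMod_ne_zero (x := lift (a 1)) (by simpa using h1)
    refine ⟨!![0, -((u⁻¹ : ℤ_[p]ˣ) : ℤ_[p]); (u : ℤ_[p]), 0], by simp [det_fin_two], ?_⟩
    intro i
    fin_cases i <;> simp [h0, hu]
  · obtain ⟨u, hu⟩ := isUnit_of_toZMod_ne_zero (x := lift (a 0)) (by simpa using h0)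
    refine ⟨!![(u : ℤ_[p]), 0; lift (a 1), ((u⁻¹ : ℤ_[p]ˣ) : ℤ_[p])], by simp [det_fin_two], ?_⟩
    intro i
    fin_cases i <;> simp [hu]

/-- The matrices `p q` for representatives `q` of the Siegel parabolic subgroup. -/
def orthRepOne (A : Matrix (Fin 2) (Fin 2) ℤ_[p]) : Option ℤ_[p] →
    Matrix (Fin 2 ⊕ Fin 2) (Fin 2 ⊕ Fin 2) ℤ_[p]
  | none => levi A * diagonal (Sum.elim ![1, (p : ℤ_[p])] ![(p : ℤ_[p]), (p : ℤ_[p]) ^ 2])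
  | some b => levi A * unip b *
      diagonal (Sum.elim ![(p : ℤ_[p]), (p : ℤ_[p]) ^ 2] ![1, (p : ℤ_[p])])

theorem diagonal_isometry (d : Fin 2 ⊕ Fin 2 → ℤ_[p]) {c : ℤ_[p]}
    (h1 : d (.inl 0) * d (.inr 1) = c) (h2 : d (.inl 1) * d (.inr 0) = c) :
    (diagonal d)ᵀ * orth ℤ_[p] * diagonal d = c • orth ℤ_[p] := by
  ext (i | i) (j | j) <;> fin_cases i <;> fin_cases j <;>
    simp [orth, J] <;> first | linear_combination h1 | linear_combination h2

theorem orthRepOne_isometry {A : Matrix (Fin 2) (Fin 2) ℤ_[p]} (hA : A.det = 1)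
    (o : Option ℤ_[p]) : (orthRepOne A o)ᵀ * orth ℤ_[p] * orthRepOne A o
      = (p : ℤ_[p]) ^ 2 • orth ℤ_[p] := by
  have hl : (levi A)ᵀ * orth ℤ_[p] * levi A = orth ℤ_[p] := by rw [levi_isometry, hA, one_smul]
  cases o with
  | none =>
    refine isometry_smul_mul hl (diagonal_isometry _ ?_ ?_) <;> simp [pow_two]
  | some b =>
    have hd : (diagonal (Sum.elim ![(p : ℤ_[p]), (p : ℤ_[p]) ^ 2] ![1, (p : ℤ_[p])]))ᵀ * orth ℤ_[p] *
        diagonal (Sum.elim ![(p : ℤ_[p]), (p : ℤ_[p]) ^ 2] ![1, (p : ℤ_[p])])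
          = (p : ℤ_[p]) ^ 2 • orth ℤ_[p] := by
      refine diagonal_isometry _ ?_ ?_ <;> simp [pow_two]
    have hu : (unip b)ᵀ * orth ℤ_[p] * unip b = orth ℤ_[p] := unip_isometry b
    rw [orthRepOne, Matrix.mul_assoc (levi A)]
    exact isometry_smul_mul hl (isometry_smul_mul hu hd)

/-- All rows but the first are divisible by `p`. The quadratic relation divided by `p` says that the
product of the form `r` and the last row over `p` vanishes modulo `p`, so the last row is divisible
by `p²`. -/
theorem exists_eq_orthRepOne_none
    {B : Matrix (Fin 2 ⊕ Fin 2) (Fin 2 ⊕ Fin 2) ℤ_[p]}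
    (hB : Bᵀ * orth ℤ_[p] * B = (p : ℤ_[p]) ^ 2 • orth ℤ_[p]) {r : Fin 2 ⊕ Fin 2 → ZMod p}
    (hr : r ≠ 0)
    (hBr : B.map (PadicInt.toZMod (p := p)) = vecMulVec (Pi.single (.inl 0) 1) r) :
    ∃ κ, B = diagonal (Sum.elim ![1, (p : ℤ_[p])] ![(p : ℤ_[p]), (p : ℤ_[p]) ^ 2]) * κ := by
  rw [exists_eq_diagonal_mul_iff]
  have h0 : ∀ j, PadicInt.toZMod (B (.inl 0) j) = r j := fun j => by
    simpa [vecMulVec_apply] using congrFun (congrFun hBr (.inl 0)) j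
  have hdvd : ∀ i, i ≠ .inl 0 → ∀ j, ∃ b, B i j = p * b := fun i hi j => by
    have := congrFun (congrFun hBr i) j
    rw [vecMulVec_apply, Pi.single_eq_of_ne hi, zero_mul] at this
    exact (toZMod_eq_zero_iff _).1 this
  choose b1 hb1 using hdvd (.inl 1) (by simp)
  choose b2 hb2 using hdvd (.inr 0) (by simp)
  choose b3 hb3 using hdvd (.inr 1) (by simp)
  have e1 : B (.inl 1) = (p : ℤ_[p]) • b1 := funext hb1
  have e2 : B (.inr 0) = (p : ℤ_[p]) • b2 := funext hb2
  have e3 : B (.inr 1) = (p : ℤ_[p]) • b3 := funext hb3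
  have key : (fun j => PadicInt.toZMod (b3 j)) = 0 := by
    refine eq_zero_of_dotProduct_mul_dotProduct hr fun ξ => ?_
    have h1 := orth_quadratic hB fun j => lift (ξ j)
    rw [e1, e2, e3] at h1
    simp only [smul_dotProduct, smul_eq_mul] at h1
    have h2 := mul_left_cancel₀ (coe_p_ne_zero (p := p)) ((by linear_combination h1 :
      (p : ℤ_[p]) * ((B (.inl 0) ⬝ᵥ fun j => lift (ξ j)) * (b3 ⬝ᵥ fun j => lift (ξ j)))
        = p * (p * ((b1 ⬝ᵥ fun j => lift (ξ j)) * (b2 ⬝ᵥ fun j => lift (ξ j))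
          + (lift (ξ (.inl 0)) * lift (ξ (.inr 1)) - lift (ξ (.inl 1)) * lift (ξ (.inr 0)))))))
    have h3 := congrArg (PadicInt.toZMod (p := p)) h2
    rw [map_mul, map_mul, map_natCast, CharP.cast_eq_zero, zero_mul, toZMod_dotProduct,
      toZMod_dotProduct] at h3
    simpa only [h0] using h3
  rintro (i | i) j <;> fin_cases i
  · simp
  · simp [hb1]
  · simp [hb2]
  · have : PadicInt.toZMod (b3 j) = 0 := congrFun key j
    rw [toZMod_eq_zero_iff] at this
    simp only [Fin.mk_one, Sum.elim_inr, hb3]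
    simpa [pow_two] using mul_dvd_mul_left (p : ℤ_[p]) this

theorem symp_orth_isometry (R : Type*) [CommRing R] : (symp R)ᵀ * orth R * symp R = orth R := by
  simp [symp, orth, fromBlocks_transpose, fromBlocks_multiply]

/-- The symplectic matrix is also an isometry of the orthogonal form and exchanges the two row
blocks up to sign, so this is `exists_eq_orthRepOne_none` again. -/
theorem exists_eq_orthRepOne_some
    {B : Matrix (Fin 2 ⊕ Fin 2) (Fin 2 ⊕ Fin 2) ℤ_[p]}
    (hB : Bᵀ * orth ℤ_[p] * B = (p : ℤ_[p]) ^ 2 • orth ℤ_[p]) {r : Fin 2 ⊕ Fin 2 → ZMod p}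
    (hr : r ≠ 0)
    (hBr : B.map (PadicInt.toZMod (p := p)) = vecMulVec (Pi.single (.inr 0) 1) r) :
    ∃ κ, B = diagonal (Sum.elim ![(p : ℤ_[p]), (p : ℤ_[p]) ^ 2] ![1, (p : ℤ_[p])]) * κ := by
  have hs : symp ℤ_[p] * B = fromRows B.toRows₂ (-B.toRows₁) := by
    conv_lhs => rw [← fromRows_toRows B, symp, fromBlocks_mul_fromRows]
    simp
  have h := exists_eq_orthRepOne_none (isometry_smul_mul (symp_orth_isometry _) hB) hr (by
    rw [Matrix.map_mul, hBr, map_symp, mul_vecMulVec]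
    congr 1
    ext (i | i) <;> fin_cases i <;> simp [symp, mulVec, dotProduct, Fintype.sum_sum_type])
  rw [exists_eq_diagonal_mul_iff, hs] at h
  rw [exists_eq_diagonal_mul_iff]
  rintro (i | i) j
  · have := h (.inr i) j
    fin_cases i
    · simpa using this
    · simpa using this
  · have := h (.inl i) j
    fin_cases i
    · simp
    · simpa using this

end OrthogonalCosets

/-! ### Cosets in the first Hecke set of `H` -/

section OrthogonalCosetsOne

variable {p : ℕ} [Fact p.Prime]

/-- The isotropic vectors `(a, 0)` and `(b a, a)`. -/
def isotropicVec (a : Fin 2 → ZMod p) : Option (ZMod p) → Fin 2 ⊕ Fin 2 → ZMod p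
  | none => Sum.elim a 0
  | some b => Sum.elim (b • a) a

theorem isotropicVec_ne_zero {a : Fin 2 → ZMod p} (ha : a ≠ 0) (o : Option (ZMod p)) :
    isotropicVec a o ≠ 0 := by
  intro h
  apply ha
  ext i
  cases o with
  | none => exact congrFun h (.inl i)
  | some b => exact congrFun h (.inr i)

theorem isotropicVec_injective {a a' : Fin 2 → ZMod p} (ha : a ≠ 0) (ha' : a' ≠ 0)
    {o o' : Option (ZMod p)} (h : isotropicVec a o = isotropicVec a' o') : a = a' ∧ o = o' := by
  have hl : ∀ i, isotropicVec a o (.inl i) = isotropicVec a' o' (.inl i) := fun i => congrFun h _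
  have hr : ∀ i, isotropicVec a o (.inr i) = isotropicVec a' o' (.inr i) := fun i => congrFun h _
  cases o <;> cases o' <;> simp only [isotropicVec, Sum.elim_inl, Sum.elim_inr] at hl hr
  · exact ⟨funext hl, rfl⟩
  · exact absurd (funext fun i => (hr i).symm) ha'
  · exact absurd (funext hr) ha
  · obtain rfl : a = a' := funext hr
    obtain ⟨i, hi⟩ := Function.ne_iff.1 ha
    refine ⟨rfl, congrArg some (mul_right_cancel₀ hi (hl i))⟩

/-- The quadratic form is the determinant of the matrix whose columns are the two halves of `x`.
Isotropy therefore means that the halves are proportional, with ratio `b` or, if the second half is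
zero, `none`. -/
theorem exists_isotropicVec_eq {x : Fin 2 ⊕ Fin 2 → ZMod p} (hx : x ≠ 0)
    (h : x (.inl 0) * x (.inr 1) - x (.inl 1) * x (.inr 0) = 0) :
    ∃ a : Fin 2 → ZMod p, a ≠ 0 ∧ ∃ o, isotropicVec a o = x := by
  by_cases h0 : (fun i => x (.inr i)) = 0
  · refine ⟨fun i => x (.inl i), fun h1 => hx ?_, none, ?_⟩
    · ext (i | i)
      · exact congrFun h1 i
      · exact congrFun h0 i
    · ext (i | i)
      · rfl
      · exact (congrFun h0 i).symm
  · refine ⟨fun i => x (.inr i), h0, ?_⟩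
    by_cases h1 : x (.inr 0) = 0
    · have h2 : x (.inr 1) ≠ 0 := fun h2 => h0 (by ext i; fin_cases i <;> simp [h1, h2])
      refine ⟨some (x (.inl 1) / x (.inr 1)), ?_⟩
      ext (i | i)
      · fin_cases i
        · simp only [isotropicVec, Fin.zero_eta, Sum.elim_inl, Pi.smul_apply, h1, smul_zero]
          rw [h1, mul_zero, sub_zero] at h
          exact ((mul_eq_zero.1 h).resolve_right h2).symm
        · simp [isotropicVec, h2]
      · rfl
    · refine ⟨some (x (.inl 0) / x (.inr 0)), ?_⟩
      ext (i | i)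
      · fin_cases i
        · simp [isotropicVec, h1]
        · simp only [isotropicVec, Fin.mk_one, Sum.elim_inl, Pi.smul_apply, smul_eq_mul]
          field_simp
          linear_combination h
      · rfl

theorem orthRepOne_reduction {A : Matrix (Fin 2) (Fin 2) ℤ_[p]} {a : Fin 2 → ZMod p}
    (hAa : ∀ i, PadicInt.toZMod (A i 0) = a i) (o : Option (ZMod p)) :
    ∃ e ≠ 0, (orthRepOne A (o.map lift)).map (PadicInt.toZMod (p := p))
      = vecMulVec (isotropicVec a o) e := by
  cases o with
  | none =>
    refine ⟨Pi.single (.inl 0) 1, by simp, ?_⟩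
    ext (i | i) (j | j) <;> fin_cases j <;> simp [orthRepOne, isotropicVec, vecMulVec_apply, levi, hAa]
  | some b =>
    refine ⟨Pi.single (.inr 0) 1, by simp, ?_⟩
    ext (i | i) (j | j) <;> fin_cases j <;>
      simp [orthRepOne, isotropicVec, vecMulVec_apply, levi, unip, hAa, fromBlocks_multiply]

/-- In rank one the coset is determined by the image line. The integral isometry `levi A` or `levi A
* unip (lift b)` carries a standard isotropic vector to the given one and reduces the claim to the
diagonal cases. -/
theorem exists_eq_orthRepOne_mul_iff {A : Matrix (Fin 2) (Fin 2) ℤ_[p]} (hA : A.det = 1)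
    {a : Fin 2 → ZMod p} (hAa : ∀ i, PadicInt.toZMod (A i 0) = a i) (o : Option (ZMod p))
    {B : Matrix (Fin 2 ⊕ Fin 2) (Fin 2 ⊕ Fin 2) ℤ_[p]}
    (hB : Bᵀ * orth ℤ_[p] * B = (p : ℤ_[p]) ^ 2 • orth ℤ_[p])
    (hr : (B.map (PadicInt.toZMod (p := p))).rank = 1) :
    (∃ κ, B = orthRepOne A (o.map lift) * κ) ↔
      ∃ r, B.map (PadicInt.toZMod (p := p)) = vecMulVec (isotropicVec a o) r := by
  have hl : (levi A)ᵀ * orth ℤ_[p] * levi A = orth ℤ_[p] := by rw [levi_isometry, hA, one_smul]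
  constructor
  · rintro ⟨κ, rfl⟩
    obtain ⟨e, -, he⟩ := orthRepOne_reduction hAa o
    rw [Matrix.map_mul, he, vecMulVec_mul]
    exact ⟨_, rfl⟩
  · rintro ⟨r, h⟩
    have hr0 : r ≠ 0 := by
      rintro rfl
      rw [h, vecMulVec_zero, rank_zero] at hr
      exact zero_ne_one hr
    have main : ∀ (k : Matrix (Fin 2 ⊕ Fin 2) (Fin 2 ⊕ Fin 2) ℤ_[p]) (i : Fin 2 ⊕ Fin 2),
        kᵀ * orth ℤ_[p] * k = orth ℤ_[p] →
        k.map (PadicInt.toZMod (p := p)) *ᵥ Pi.single i 1 = isotropicVec a o →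
        ∃ k' : Matrix (Fin 2 ⊕ Fin 2) (Fin 2 ⊕ Fin 2) ℤ_[p],
          k * k' = 1 ∧ (k' * B)ᵀ * orth ℤ_[p] * (k' * B) = (p : ℤ_[p]) ^ 2 • orth ℤ_[p] ∧
          (k' * B).map (PadicInt.toZMod (p := p)) = vecMulVec (Pi.single i 1) r := by
      intro k i hk hki
      obtain ⟨k', hk1, hk2, hk3⟩ := isometry_inverse (orth_mul_orth _) hk
      refine ⟨k', hk2, isometry_smul_mul hk3 hB, ?_⟩
      rw [Matrix.map_mul, h, mul_vecMulVec, ← hki, mulVec_mulVec, ← Matrix.map_mul, hk1,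
        Matrix.map_one _ (map_zero _) (map_one _), one_mulVec]
    cases o with
    | none =>
      obtain ⟨k', hk', hiso, hred⟩ := main (levi A) (.inl 0) hl (by
        ext (i | i) <;> simp [levi, isotropicVec, hAa])
      obtain ⟨κ, hκ⟩ := exists_eq_orthRepOne_none hiso hr0 hred
      refine ⟨κ, ?_⟩
      simp only [Option.map_none, orthRepOne]
      rw [Matrix.mul_assoc, ← hκ, ← Matrix.mul_assoc, hk', Matrix.one_mul]
    | some b =>
      have hu : (unip (lift b))ᵀ * orth ℤ_[p] * unip (lift b) = orth ℤ_[p] := unip_isometry _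
      obtain ⟨k', hk', hiso, hred⟩ := main (levi A * unip (lift b)) (.inr 0)
        (by
          rw [transpose_mul]
          calc _ = (unip (lift b))ᵀ * ((levi A)ᵀ * orth ℤ_[p] * levi A) * unip (lift b) := by
                simp only [Matrix.mul_assoc]
            _ = _ := by rw [hl, hu])
        (by
          ext (i | i) <;>
            simp [levi, unip, isotropicVec, hAa, fromBlocks_multiply])
      obtain ⟨κ, hκ⟩ := exists_eq_orthRepOne_some hiso hr0 hred
      refine ⟨κ, ?_⟩
      simp only [Option.map_some, orthRepOne]
      rw [Matrix.mul_assoc (levi A * unip (lift b)), ← hκ, ← Matrix.mul_assoc, hk', Matrix.one_mul]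

open Classical in
-- The image line is isotropic, and each of its `p - 1` generators is `isotropicVec a o` for exactly
-- one pair `(a, o)`.
theorem sum_orthRepOne
    {A : {a : Fin 2 → ZMod p // a ≠ 0} → Matrix (Fin 2) (Fin 2) ℤ_[p]}
    (hA : ∀ a, (A a).det = 1) (hAa : ∀ a i, PadicInt.toZMod (A a i 0) = a.1 i)
    {B : Matrix (Fin 2 ⊕ Fin 2) (Fin 2 ⊕ Fin 2) ℤ_[p]}
    (hB : Bᵀ * orth ℤ_[p] * B = (p : ℤ_[p]) ^ 2 • orth ℤ_[p])
    (hr : (B.map (PadicInt.toZMod (p := p))).rank = 1) :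
    ∑ j : {a : Fin 2 → ZMod p // a ≠ 0} × Option (ZMod p),
      (if ∃ κ : Matrix (Fin 2 ⊕ Fin 2) (Fin 2 ⊕ Fin 2) ℤ_[p],
        B = orthRepOne (A j.1) (j.2.map lift) * κ then ((p : ℂ) - 1)⁻¹ else 0) = 1 := by
  obtain ⟨a₀, P₀, hAP, ⟨N₀, hN⟩, M₀, hM⟩ := exists_rank_factorization _ hr
  have hAP' : B.map (PadicInt.toZMod (p := p)) = vecMulVec (fun i => a₀ i 0) (P₀ 0) := by
    rw [hAP]
    ext i j
    simp [mul_apply, vecMulVec_apply]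
  have ha₀ : (fun i => a₀ i 0) ≠ 0 := fun h => by
    have : a₀ = 0 := by ext i j; rw [Subsingleton.elim j 0]; exact congrFun h i
    rw [this, Matrix.mul_zero] at hN
    exact zero_ne_one hN
  have hP₀ : P₀ 0 ≠ 0 := fun h => by
    have : P₀ = 0 := by ext i j; rw [Subsingleton.elim i 0]; exact congrFun h j
    rw [this, Matrix.zero_mul] at hM
    exact zero_ne_one hM
  have hcard : (Finset.univ.filter fun a : {a : Fin 2 ⊕ Fin 2 → ZMod p // a ≠ 0} =>
      ∃ r, vecMulVec (fun i => a₀ i 0) (P₀ 0) = vecMulVec a.1 r).card = p - 1 := by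
    convert card_parallel ha₀ hP₀
  have hcard2 : (Finset.univ.filter fun j : {a : Fin 2 → ZMod p // a ≠ 0} × Option (ZMod p) =>
      ∃ κ : Matrix (Fin 2 ⊕ Fin 2) (Fin 2 ⊕ Fin 2) ℤ_[p],
        B = orthRepOne (A j.1) (j.2.map lift) * κ).card = p - 1 := by
    rw [← hcard]
    refine Finset.card_bij (fun j _ => ⟨_, isotropicVec_ne_zero j.1.2 j.2⟩) ?_ ?_ ?_
    · intro j hj
      rw [Finset.mem_filter, exists_eq_orthRepOne_mul_iff (hA _) (hAa _) _ hB hr] at hj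
      rw [Finset.mem_filter, ← hAP']
      exact ⟨Finset.mem_univ _, hj.2⟩
    · intro j _ j' _ h
      have := isotropicVec_injective j.1.2 j'.1.2 (congrArg Subtype.val h)
      exact Prod.ext (Subtype.ext this.1) this.2
    · rintro ⟨x, hx⟩ h
      rw [Finset.mem_filter, ← hAP'] at h
      obtain ⟨-, r, hxr⟩ := h
      have hr0 : r ≠ 0 := by
        rintro rfl
        rw [hxr, vecMulVec_zero, rank_zero] at hr
        exact zero_ne_one hr
      obtain ⟨j, hj⟩ := Function.ne_iff.1 hr0
      -- Evaluating the quadratic relation at a basis vector not killed by `r` shows that the image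
      -- line is isotropic.
      have hq := congrArg (PadicInt.toZMod (p := p)) (orth_quadratic hB (Pi.single j 1))
      have he : ∀ i, PadicInt.toZMod (B i j) = x i * r j := fun i => congrFun (congrFun hxr i) j
      simp only [dotProduct_single_one, map_sub, map_mul, he, map_pow, map_natCast,
        CharP.cast_eq_zero] at hq
      obtain ⟨a, ha, o, hao⟩ := exists_isotropicVec_eq hx (by
        have h1 : (r j * r j) * (x (.inl 0) * x (.inr 1) - x (.inl 1) * x (.inr 0)) = 0 := by
          linear_combination hq
        exact (mul_eq_zero.1 h1).resolve_left (mul_ne_zero hj hj))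
      refine ⟨(⟨a, ha⟩, o), ?_, Subtype.ext hao⟩
      rw [Finset.mem_filter, exists_eq_orthRepOne_mul_iff (hA _) (hAa _) _ hB hr]
      exact ⟨Finset.mem_univ _, r, by rw [hxr, hao]⟩
  rw [← Finset.sum_filter, Finset.sum_const]
  rw [show Finset.card _ = p - 1 by convert hcard2, nsmul_eq_mul,
    Nat.cast_sub (Fact.out : p.Prime).one_lt.le, Nat.cast_one]
  refine mul_inv_cancel₀ (sub_ne_zero.2 ?_)
  exact_mod_cast (Fact.out : p.Prime).ne_one

end OrthogonalCosetsOne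

/-! ### Cosets in the second Hecke set of `H` -/

section OrthogonalCosetsTwo

variable {p : ℕ} [Fact p.Prime]

theorem parallel_of_dvd {n : Type*} [Fintype n] {P Q : Matrix (Fin 2) n ℤ_[p]}
    (h : ∀ ξ : n → ℤ_[p], (p : ℤ_[p]) ∣ (P *ᵥ ξ) 0 * (Q *ᵥ ξ) 1 - (P *ᵥ ξ) 1 * (Q *ᵥ ξ) 0)
    (ξ : n → ZMod p) : (P.map (PadicInt.toZMod (p := p)) *ᵥ ξ) 0
      * (Q.map (PadicInt.toZMod (p := p)) *ᵥ ξ) 1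
      - (P.map (PadicInt.toZMod (p := p)) *ᵥ ξ) 1
      * (Q.map (PadicInt.toZMod (p := p)) *ᵥ ξ) 0 = 0 := by
  have h1 : ∀ (M : Matrix (Fin 2) n ℤ_[p]) (i : Fin 2), (M.map (PadicInt.toZMod (p := p)) *ᵥ ξ) i
      = PadicInt.toZMod ((M *ᵥ fun j => lift (ξ j)) i) := by
    intro M i
    simp [mulVec, dotProduct]
  rw [h1, h1, h1, h1, ← map_mul, ← map_mul, ← map_sub, toZMod_eq_zero_iff]
  exact h _

/-- Representatives `p q` with `q = diag(p⁻¹, p⁻¹; p, p)` or `q = (1 b/p; 0 1)`. -/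
def orthRepUnip (b : ZMod p) : Matrix (Fin 2 ⊕ Fin 2) (Fin 2 ⊕ Fin 2) ℤ_[p] :=
  if b = 0 then fromBlocks 1 0 0 ((p : ℤ_[p]) ^ 2 • 1)
  else fromBlocks ((p : ℤ_[p]) • 1) (lift b • 1) 0 ((p : ℤ_[p]) • 1)

/-- Representatives `p q` with `q = (p b/p; 0 1/p)`. -/
def orthRepScalar (b : ℤ_[p]) : Matrix (Fin 2 ⊕ Fin 2) (Fin 2 ⊕ Fin 2) ℤ_[p] :=
  fromBlocks ((p : ℤ_[p]) ^ 2 • 1) (b • 1) 0 1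

/-- Representatives `p q` with `q = diag(A d, A d)` where `d = (p⁻¹ 0; c p)`. -/
def orthRepLevi (A : Matrix (Fin 2) (Fin 2) ℤ_[p]) (c : ℤ_[p]) :
    Matrix (Fin 2 ⊕ Fin 2) (Fin 2 ⊕ Fin 2) ℤ_[p] :=
  levi (A * !![1, 0; p * c, (p : ℤ_[p]) ^ 2])

theorem orthRepUnip_isometry (b : ZMod p) : (orthRepUnip b)ᵀ * orth ℤ_[p] * orthRepUnip b
    = (p : ℤ_[p]) ^ 2 • orth ℤ_[p] := by
  unfold orthRepUnip
  split_ifs <;> simp [orth, fromBlocks_transpose, fromBlocks_multiply, fromBlocks_smul, smul_smul,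
    pow_two, mul_comm]

theorem orthRepScalar_isometry (b : ℤ_[p]) : (orthRepScalar b)ᵀ * orth ℤ_[p] * orthRepScalar b
    = (p : ℤ_[p]) ^ 2 • orth ℤ_[p] := by
  simp [orthRepScalar, orth, fromBlocks_transpose, fromBlocks_multiply, fromBlocks_smul]

theorem orthRepLevi_isometry {A : Matrix (Fin 2) (Fin 2) ℤ_[p]} (hA : A.det = 1) (c : ℤ_[p]) :
    (orthRepLevi A c)ᵀ * orth ℤ_[p] * orthRepLevi A c = (p : ℤ_[p]) ^ 2 • orth ℤ_[p] := by
  rw [orthRepLevi, levi_isometry, det_mul, hA, det_fin_two]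
  simp

/-- For `b ≠ 0` the condition is `P = b Q` modulo `p`, and for the diagonal representative at `b =
0` it is `Q = 0`. With the convention `0⁻¹ = 0` both read `Q = b⁻¹ P`. -/
theorem fromRows_smul_eq_orthRepUnip_mul_iff {n : Type*} (b : ZMod p)
    (P Q : Matrix (Fin 2) n ℤ_[p]) :
    (∃ κ : Matrix (Fin 2 ⊕ Fin 2) n ℤ_[p],
      fromRows P ((p : ℤ_[p]) • Q) = orthRepUnip b * κ) ↔
      Q.map (PadicInt.toZMod (p := p)) = b⁻¹ • P.map (PadicInt.toZMod (p := p)) := by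
  have hp := coe_p_ne_zero (p := p)
  have hcancel : ∀ M N : Matrix (Fin 2) n ℤ_[p], (p : ℤ_[p]) • M = (p : ℤ_[p]) • N → M = N :=
    fun M N h => by ext i j; exact mul_left_cancel₀ hp (congrFun (congrFun h i) j)
  unfold orthRepUnip
  split_ifs with hb
  · rw [hb, _root_.inv_zero, zero_smul, map_toZMod_eq_zero_iff]
    constructor
    · rintro ⟨κ, hκ⟩
      rw [← fromRows_toRows κ, fromBlocks_mul_fromRows, fromRows_ext_iff] at hκ
      refine ⟨κ.toRows₂, hcancel _ _ ?_⟩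
      rw [hκ.2, smul_smul, ← pow_two]
      simp
    · rintro ⟨B, rfl⟩
      refine ⟨fromRows P B, ?_⟩
      rw [fromBlocks_mul_fromRows, smul_smul, ← pow_two]
      simp
  · have hiff : Q.map (PadicInt.toZMod (p := p)) = b⁻¹ • P.map (PadicInt.toZMod (p := p)) ↔
        ∃ B : Matrix (Fin 2) n ℤ_[p], P - lift b • Q = (p : ℤ_[p]) • B := by
      rw [← map_toZMod_eq_zero_iff, eq_inv_smul_iff₀ hb, ← sub_eq_zero, ← neg_eq_zero, neg_sub]
      refine Eq.congr ?_ rfl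
      ext i j
      simp
    rw [hiff]
    constructor
    · rintro ⟨κ, hκ⟩
      rw [← fromRows_toRows κ, fromBlocks_mul_fromRows, fromRows_ext_iff] at hκ
      obtain ⟨h1, h2⟩ := hκ
      simp only [Matrix.one_mul, Matrix.zero_mul, zero_add, Matrix.smul_mul] at h1 h2
      rw [hcancel _ _ h2, h1]
      exact ⟨κ.toRows₁, by simp⟩
    · rintro ⟨B, hB⟩
      refine ⟨fromRows B Q, ?_⟩
      rw [fromBlocks_mul_fromRows]
      simp only [Matrix.one_mul, Matrix.zero_mul, zero_add, Matrix.smul_mul]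
      rw [← hB]
      simp

theorem fromRows_eq_orthRepScalar_mul_iff {n : Type*} (b : ℤ_[p]) (P Q : Matrix (Fin 2) n ℤ_[p]) :
    (∃ κ : Matrix (Fin 2 ⊕ Fin 2) n ℤ_[p], fromRows P Q = orthRepScalar b * κ) ↔
      ∃ D : Matrix (Fin 2) n ℤ_[p], P = (p : ℤ_[p]) ^ 2 • D + b • Q := by
  unfold orthRepScalar
  constructor
  · rintro ⟨κ, hκ⟩
    rw [← fromRows_toRows κ, fromBlocks_mul_fromRows, fromRows_ext_iff] at hκ
    obtain ⟨h1, h2⟩ := hκ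
    simp only [Matrix.one_mul, Matrix.zero_mul, zero_add, Matrix.smul_mul] at h1 h2
    exact ⟨κ.toRows₁, by rw [h1, h2]⟩
  · rintro ⟨D, hD⟩
    refine ⟨fromRows D Q, ?_⟩
    rw [fromBlocks_mul_fromRows]
    simp only [Matrix.one_mul, Matrix.zero_mul, zero_add, Matrix.smul_mul]
    rw [← hD]

theorem orth_quadratic_rows {B : Matrix (Fin 2 ⊕ Fin 2) (Fin 2 ⊕ Fin 2) ℤ_[p]}
    (hB : Bᵀ * orth ℤ_[p] * B = (p : ℤ_[p]) ^ 2 • orth ℤ_[p]) (ξ : Fin 2 ⊕ Fin 2 → ℤ_[p]) :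
    ∃ q, (B.toRows₁ *ᵥ ξ) 0 * (B.toRows₂ *ᵥ ξ) 1 - (B.toRows₁ *ᵥ ξ) 1 * (B.toRows₂ *ᵥ ξ) 0
      = (p : ℤ_[p]) * (p * q) :=
  ⟨_, (orth_quadratic hB ξ).trans (by rw [pow_two, mul_assoc])⟩

/-- With `p Q` as lower block, the quadratic relation divided by `p` makes `Q` and the upper block
parallel at every vector modulo `p`, hence proportional. The parameter is the inverse of the ratio.
-/
theorem existsUnique_orthRepUnip {B : Matrix (Fin 2 ⊕ Fin 2) (Fin 2 ⊕ Fin 2) ℤ_[p]}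
    (hB : Bᵀ * orth ℤ_[p] * B = (p : ℤ_[p]) ^ 2 • orth ℤ_[p])
    (h2 : B.toRows₂.map (PadicInt.toZMod (p := p)) = 0)
    {M : Matrix (Fin 2 ⊕ Fin 2) (Fin 2) (ZMod p)}
    (hM : B.toRows₁.map (PadicInt.toZMod (p := p)) * M = 1) :
    ∃! b : ZMod p, ∃ κ, B = orthRepUnip b * κ := by
  obtain ⟨Q, hQ⟩ := (map_toZMod_eq_zero_iff _).1 h2
  have hBQ : B = fromRows B.toRows₁ ((p : ℤ_[p]) • Q) := by rw [← hQ, fromRows_toRows]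
  have hiff : ∀ b : ZMod p, (∃ κ, B = orthRepUnip b * κ) ↔
      Q.map (PadicInt.toZMod (p := p)) = b⁻¹ • B.toRows₁.map (PadicInt.toZMod (p := p)) := by
    intro b
    conv_lhs => rw [hBQ]
    exact fromRows_smul_eq_orthRepUnip_mul_iff _ _ _
  simp only [hiff]
  obtain ⟨c, hc, hu⟩ := existsUnique_eq_smul_of_parallel (Q.map (PadicInt.toZMod (p := p)))
    (B.toRows₁.map (PadicInt.toZMod (p := p))) hM (parallel_of_dvd fun ξ => by
      obtain ⟨q, hq⟩ := orth_quadratic_rows hB ξ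
      rw [hQ] at hq
      simp only [smul_mulVec, Pi.smul_apply, smul_eq_mul] at hq
      refine ⟨-q, mul_left_cancel₀ (coe_p_ne_zero (p := p)) ?_⟩
      linear_combination -hq)
  refine ⟨c⁻¹, by simpa using hc, fun b hb => ?_⟩
  rw [← hu _ hb, inv_inv]

/-- The upper block is a multiple of the lower one modulo `p²`. The two digits of the factor come
from two uses of the parallelism argument: first modulo `p`, then on the difference divided by `p`.
-/
theorem existsUnique_orthRepScalar {B : Matrix (Fin 2 ⊕ Fin 2) (Fin 2 ⊕ Fin 2) ℤ_[p]}
    (hB : Bᵀ * orth ℤ_[p] * B = (p : ℤ_[p]) ^ 2 • orth ℤ_[p])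
    {M : Matrix (Fin 2 ⊕ Fin 2) (Fin 2) (ZMod p)}
    (hM : B.toRows₂.map (PadicInt.toZMod (p := p)) * M = 1) :
    ∃! b : ZMod p × ZMod p, ∃ κ, B = orthRepScalar (lift b.1 + (p : ℤ_[p]) * lift b.2) * κ := by
  have hp := coe_p_ne_zero (p := p)
  have hiff : ∀ b : ℤ_[p], (∃ κ, B = orthRepScalar b * κ) ↔
      ∃ D, B.toRows₁ = (p : ℤ_[p]) ^ 2 • D + b • B.toRows₂ := by
    intro b
    conv_lhs => rw [← fromRows_toRows B]
    exact fromRows_eq_orthRepScalar_mul_iff _ _ _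
  simp only [hiff]
  obtain ⟨b₀, hb₀, hu₀⟩ := existsUnique_eq_smul_of_parallel
    (B.toRows₁.map (PadicInt.toZMod (p := p)))
    (B.toRows₂.map (PadicInt.toZMod (p := p))) hM (parallel_of_dvd fun ξ => by
      obtain ⟨q, hq⟩ := orth_quadratic_rows hB ξ
      exact ⟨_, hq⟩)
  obtain ⟨P, hP⟩ := (map_toZMod_eq_zero_iff (B.toRows₁ - lift b₀ • B.toRows₂)).1 (by
    rw [Matrix.map_sub _ (map_sub _), hb₀, sub_eq_zero]
    ext i j
    simp)
  have hP' : B.toRows₁ = (p : ℤ_[p]) • P + lift b₀ • B.toRows₂ := by rw [← hP]; simp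
  obtain ⟨b₁, hb₁, hu₁⟩ := existsUnique_eq_smul_of_parallel
    (P.map (PadicInt.toZMod (p := p)))
    (B.toRows₂.map (PadicInt.toZMod (p := p))) hM (parallel_of_dvd fun ξ => by
      obtain ⟨q, hq⟩ := orth_quadratic_rows hB ξ
      rw [hP'] at hq
      simp only [add_mulVec, smul_mulVec, Pi.smul_apply, smul_eq_mul, Pi.add_apply] at hq
      refine ⟨q, mul_left_cancel₀ hp ?_⟩
      linear_combination hq)
  have hiff1 : ∀ b : ZMod p, (∃ D, B.toRows₁ = (p : ℤ_[p]) ^ 2 • D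
      + (lift b₀ + (p : ℤ_[p]) * lift b) • B.toRows₂) ↔
      P.map (PadicInt.toZMod (p := p)) = b • B.toRows₂.map (PadicInt.toZMod (p := p)) := by
    intro b
    have h1 : P.map (PadicInt.toZMod (p := p)) = b • B.toRows₂.map (PadicInt.toZMod (p := p)) ↔
        ∃ D, P - lift b • B.toRows₂ = (p : ℤ_[p]) • D := by
      rw [← map_toZMod_eq_zero_iff, ← sub_eq_zero]
      refine Eq.congr ?_ rfl
      ext i j
      simp
    rw [h1]
    refine exists_congr fun D => ?_
    conv_lhs => rw [hP']
    constructor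
    · intro h
      ext i j
      have := congrFun (congrFun h i) j
      apply mul_left_cancel₀ hp
      simp only [Matrix.add_apply, Matrix.smul_apply, Matrix.sub_apply, smul_eq_mul] at this ⊢
      linear_combination this
    · intro h
      ext i j
      have := congrFun (congrFun h i) j
      simp at this ⊢
      linear_combination (p : ℤ_[p]) * this
  refine ⟨(b₀, b₁), (hiff1 b₁).2 hb₁, ?_⟩
  rintro ⟨c₀, c₁⟩ hc
  have h0 : c₀ = b₀ := by
    obtain ⟨D, hD⟩ := hc
    refine hu₀ c₀ ?_
    simp only
    rw [hD]
    ext i j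
    simp
  subst h0
  have h1 := hu₁ c₁ ((hiff1 c₁).1 hc)
  rw [h1]

theorem exists_right_inverse_of_rank {F n : Type*} [Field F] [Fintype n] [DecidableEq n]
    {P : Matrix (Fin 2) n F} (hP : P.rank = 2) : ∃ M : Matrix n (Fin 2) F, P * M = 1 := by
  obtain ⟨a, P₀, rfl, ⟨N, hN⟩, M, hM⟩ := exists_rank_factorization P hP
  refine ⟨M * N, ?_⟩
  rw [Matrix.mul_assoc, ← Matrix.mul_assoc P₀, hM, Matrix.one_mul]
  exact mul_eq_one_comm.1 hN

/-- This is the case of a lower block of rank one modulo `p`, with image line spanned by `a`. After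
`levi A⁻¹` that line is the first axis, and the second row of each block is divisible by `p`. The
pair of first rows has rank two, and the quadratic relation divided by `p` makes the pair of second
rows over `p` a multiple `c` of it. -/
theorem existsUnique_orthRepLevi {A : Matrix (Fin 2) (Fin 2) ℤ_[p]} (hA : A.det = 1)
    {a : Fin 2 → ZMod p} (hAa : ∀ i, PadicInt.toZMod (A i 0) = a i)
    {B : Matrix (Fin 2 ⊕ Fin 2) (Fin 2 ⊕ Fin 2) ℤ_[p]}
    (hB : Bᵀ * orth ℤ_[p] * B = (p : ℤ_[p]) ^ 2 • orth ℤ_[p])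
    (hr : (B.map (PadicInt.toZMod (p := p))).rank = 2) {r : Fin 2 ⊕ Fin 2 → ZMod p} (hr0 : r ≠ 0)
    (h2 : B.toRows₂.map (PadicInt.toZMod (p := p)) = vecMulVec a r) :
    ∃! c : ZMod p, ∃ κ, B = orthRepLevi A (lift c) * κ := by
  have hp := coe_p_ne_zero (p := p)
  obtain ⟨A', hA'⟩ : ∃ A', A' * A = 1 := ⟨A⁻¹, nonsing_inv_mul _ (by rw [hA]; exact isUnit_one)⟩
  have hA'' : A * A' = 1 := mul_eq_one_comm.1 hA'
  have hdA' : A'.det = 1 := by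
    have := congrArg det hA'
    rwa [det_mul, hA, mul_one, det_one] at this
  have hl : (levi A')ᵀ * orth ℤ_[p] * levi A' = orth ℤ_[p] := by
    rw [levi_isometry, hdA', one_smul]
  set C := levi A' * B with hC
  have hCB : levi A * C = B := by
    rw [hC, ← Matrix.mul_assoc, ← levi_mul, hA'', levi_one, Matrix.one_mul]
  have hCiso := isometry_smul_mul hl hB
  rw [← hC] at hCiso
  have hCr : ∀ i j, PadicInt.toZMod (C (.inr i) j) = (Pi.single 0 1 : Fin 2 → ZMod p) i * r j := by
    intro i j
    have h3 : C.toRows₂ = A' * B.toRows₂ := by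
      rw [hC]
      conv_lhs => rw [← fromRows_toRows B, levi, fromBlocks_mul_fromRows]
      simp
    have h4 : C.toRows₂.map (PadicInt.toZMod (p := p)) = vecMulVec (Pi.single 0 1) r := by
      have ha : A.map (PadicInt.toZMod (p := p)) *ᵥ Pi.single 0 1 = a := by
        ext i; simp [hAa]
      rw [h3, Matrix.map_mul, h2, mul_vecMulVec, ← ha, mulVec_mulVec, ← Matrix.map_mul, hA',
        Matrix.map_one _ (map_zero _) (map_one _), one_mulVec]
    exact congrFun (congrFun h4 i) j
  have hq1 : ∀ j, PadicInt.toZMod (C (.inr 0) j) = r j := fun j => by simpa using hCr 0 j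
  have hq2 : ∀ j, ∃ b, C (.inr 1) j = p * b := fun j =>
    (toZMod_eq_zero_iff _).1 (by simpa using hCr 1 j)
  choose q2 hq2 using hq2
  have eq2 : C (.inr 1) = (p : ℤ_[p]) • q2 := funext hq2
  -- Modulo `p` the quadratic relation reduces to the product of the second upper row and the first
  -- lower row, and the latter is `r`, which is nonzero.
  have hp2' : (fun j => PadicInt.toZMod (C (.inl 1) j)) = 0 := by
    refine eq_zero_of_dotProduct_mul_dotProduct hr0 fun ξ => ?_
    have h1 := congrArg (PadicInt.toZMod (p := p)) (orth_quadratic hCiso fun j => lift (ξ j))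
    rw [eq2, smul_dotProduct, smul_eq_mul] at h1
    simp only [map_sub, map_mul, toZMod_dotProduct, map_pow, map_natCast, CharP.cast_eq_zero,
      hq1] at h1
    linear_combination -h1
  have hp2 : ∀ j, ∃ b, C (.inl 1) j = p * b := fun j =>
    (toZMod_eq_zero_iff _).1 (congrFun hp2' j)
  choose p2 hp2 using hp2
  have ep2 : C (.inl 1) = (p : ℤ_[p]) • p2 := funext hp2
  -- The rows are regrouped across the blocks: `P₁` consists of the first rows, and `P₂` of the
  -- second rows divided by `p`.
  set P₁ : Matrix (Fin 2) (Fin 2 ⊕ Fin 2) ℤ_[p] := of ![C (.inl 0), C (.inr 0)] with hP₁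
  set P₂ : Matrix (Fin 2) (Fin 2 ⊕ Fin 2) ℤ_[p] := of ![p2, q2] with hP₂
  have hrank : (P₁.map (PadicInt.toZMod (p := p))).rank = 2 := by
    refine le_antisymm ((rank_le_card_height _).trans_eq (Fintype.card_fin 2)) ?_
    have hE : C.map (PadicInt.toZMod (p := p))
        = (fromRows !![1, 0; 0, 0] !![0, 1; 0, 0] : Matrix (Fin 2 ⊕ Fin 2) (Fin 2) (ZMod p))
          * P₁.map (PadicInt.toZMod (p := p)) := by
      ext (i | i) j <;> fin_cases i <;>
        simp [mul_apply, Fin.sum_univ_two, hP₁, hp2, hq2]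
    have h3 : (B.map (PadicInt.toZMod (p := p))).rank
        ≤ (P₁.map (PadicInt.toZMod (p := p))).rank := by
      rw [← hCB, Matrix.map_mul, hE]
      exact (rank_mul_le_right _ _).trans (rank_mul_le_right _ _)
    exact hr.symm.le.trans h3
  obtain ⟨M, hM⟩ := exists_right_inverse_of_rank hrank
  have hiff : ∀ c : ZMod p, (∃ κ, B = orthRepLevi A (lift c) * κ) ↔
      P₂.map (PadicInt.toZMod (p := p)) = c • P₁.map (PadicInt.toZMod (p := p)) := by
    intro c
    have h1 : P₂.map (PadicInt.toZMod (p := p)) = c • P₁.map (PadicInt.toZMod (p := p)) ↔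
        ∃ D, P₂ - lift c • P₁ = (p : ℤ_[p]) • D := by
      rw [← map_toZMod_eq_zero_iff, ← sub_eq_zero]
      refine Eq.congr ?_ rfl
      ext i j
      simp
    have h3 : ∀ κ, B = orthRepLevi A (lift c) * κ ↔
        C = levi !![1, 0; p * lift c, (p : ℤ_[p]) ^ 2] * κ := by
      intro κ
      rw [orthRepLevi, levi_mul]
      constructor
      · intro h
        rw [hC, h, ← Matrix.mul_assoc, ← Matrix.mul_assoc, ← levi_mul, hA', levi_one,
          Matrix.one_mul]
      · intro h
        rw [Matrix.mul_assoc, ← h, hCB]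
    rw [h1]
    simp only [h3]
    constructor
    · rintro ⟨κ, hκ⟩
      have hκ' : ∀ i j, C i j = (levi !![1, 0; p * lift c, (p : ℤ_[p]) ^ 2] * κ) i j :=
        fun i j => congrFun (congrFun hκ i) j
      refine ⟨of ![κ (.inl 1), κ (.inr 1)], ?_⟩
      ext i j
      apply mul_left_cancel₀ hp
      fin_cases i
      · have e0 := hκ' (.inl 0) j
        have e1 := hκ' (.inl 1) j
        simp [levi, mul_apply, Fintype.sum_sum_type, Fin.sum_univ_two] at e0 e1
        change (p : ℤ_[p]) * (p2 j - lift c * C (.inl 0) j) = p * (p * κ (.inl 1) j)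
        rw [mul_sub, ← hp2, e1, e0]
        ring
      · have e0 := hκ' (.inr 0) j
        have e1 := hκ' (.inr 1) j
        simp [levi, mul_apply, Fintype.sum_sum_type, Fin.sum_univ_two] at e0 e1
        change (p : ℤ_[p]) * (q2 j - lift c * C (.inr 0) j) = p * (p * κ (.inr 1) j)
        rw [mul_sub, ← hq2, e1, e0]
        ring
    · rintro ⟨D, hD⟩
      have hD' : ∀ i j, P₂ i j - lift c * P₁ i j = p * D i j :=
        fun i j => congrFun (congrFun hD i) j
      refine ⟨fromRows (of ![C (.inl 0), D 0]) (of ![C (.inr 0), D 1]), ?_⟩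
      ext (i | i) j <;> fin_cases i <;>
        simp [levi, mul_apply, Fintype.sum_sum_type, Fin.sum_univ_two, hp2, hq2]
      · have := hD' 0 j
        simp [hP₁, hP₂] at this
        linear_combination (p : ℤ_[p]) * this
      · have := hD' 1 j
        simp [hP₁, hP₂] at this
        linear_combination (p : ℤ_[p]) * this
  simp only [hiff]
  refine existsUnique_eq_smul_of_parallel _ _ hM (parallel_of_dvd fun ξ => ?_)
  have h1 := orth_quadratic hCiso ξ
  rw [ep2, eq2, smul_dotProduct, smul_dotProduct, smul_eq_mul, smul_eq_mul] at h1
  refine ⟨-(ξ (.inl 0) * ξ (.inr 1) - ξ (.inl 1) * ξ (.inr 0)), mul_left_cancel₀ hp ?_⟩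
  simp only [hP₁, hP₂, mulVec, of_apply, cons_val_zero, cons_val_one]
  linear_combination -h1

theorem orthRepLevi_reduction {A : Matrix (Fin 2) (Fin 2) ℤ_[p]}
    {a : Fin 2 → ZMod p} (hAa : ∀ i, PadicInt.toZMod (A i 0) = a i) (c : ℤ_[p])
    (κ : Matrix (Fin 2 ⊕ Fin 2) (Fin 2 ⊕ Fin 2) ℤ_[p]) :
    ∃ r r', (orthRepLevi A c * κ).map (PadicInt.toZMod (p := p))
      = fromRows (vecMulVec a r) (vecMulVec a r') := by
  refine ⟨fun j => PadicInt.toZMod (κ (.inl 0) j), fun j => PadicInt.toZMod (κ (.inr 0) j), ?_⟩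
  ext (i | i) j <;>
    simp [orthRepLevi, levi, mul_apply, Fintype.sum_sum_type, Fin.sum_univ_two, hAa,
      vecMulVec_apply]

theorem orthRepUnip_reduction (b : ZMod p)
    {B κ : Matrix (Fin 2 ⊕ Fin 2) (Fin 2 ⊕ Fin 2) ℤ_[p]} (h : B = orthRepUnip b * κ) :
    B.toRows₂.map (PadicInt.toZMod (p := p)) = 0 := by
  rw [h]
  ext i j
  unfold orthRepUnip
  split_ifs <;> simp [mul_apply, Fintype.sum_sum_type, Matrix.one_apply]

theorem orthRepScalar_reduction (b : ℤ_[p])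
    {B κ : Matrix (Fin 2 ⊕ Fin 2) (Fin 2 ⊕ Fin 2) ℤ_[p]} (h : B = orthRepScalar b * κ) :
    B.toRows₁.map (PadicInt.toZMod (p := p))
      = PadicInt.toZMod b • B.toRows₂.map (PadicInt.toZMod (p := p)) := by
  rw [h]
  ext i j
  simp [orthRepScalar, mul_apply, Fintype.sum_sum_type, Matrix.one_apply]

open Classical in
-- The three families correspond to a lower block of rank `0`, `2` and `1` modulo `p`. Total rank
-- two excludes the overlaps, so exactly one family contributes. The last one is indexed by
-- generators of a line and carries the weight `1/(p - 1)`.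
theorem sum_orthRepTwo
    {A : {a : Fin 2 → ZMod p // a ≠ 0} → Matrix (Fin 2) (Fin 2) ℤ_[p]}
    (hA : ∀ a, (A a).det = 1) (hAa : ∀ a i, PadicInt.toZMod (A a i 0) = a.1 i)
    {B : Matrix (Fin 2 ⊕ Fin 2) (Fin 2 ⊕ Fin 2) ℤ_[p]}
    (hB : Bᵀ * orth ℤ_[p] * B = (p : ℤ_[p]) ^ 2 • orth ℤ_[p])
    (hr : (B.map (PadicInt.toZMod (p := p))).rank = 2) :
    (∑ b : ZMod p, if ∃ κ : Matrix (Fin 2 ⊕ Fin 2) (Fin 2 ⊕ Fin 2) ℤ_[p],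
        B = orthRepUnip b * κ then (1 : ℂ) else 0)
      + ((∑ b : ZMod p × ZMod p, if ∃ κ : Matrix (Fin 2 ⊕ Fin 2) (Fin 2 ⊕ Fin 2) ℤ_[p],
        B = orthRepScalar (lift b.1 + (p : ℤ_[p]) * lift b.2) * κ then (1 : ℂ) else 0)
      + ∑ j : {a : Fin 2 → ZMod p // a ≠ 0} × ZMod p,
        if ∃ κ : Matrix (Fin 2 ⊕ Fin 2) (Fin 2 ⊕ Fin 2) ℤ_[p],
          B = orthRepLevi (A j.1) (lift j.2) * κ then ((p : ℂ) - 1)⁻¹ else 0) = 1 := by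
  have hBr : B.map (PadicInt.toZMod (p := p))
      = fromRows (B.toRows₁.map (PadicInt.toZMod (p := p)))
        (B.toRows₂.map (PadicInt.toZMod (p := p))) := by
    ext (i | i) j <;> rfl
  have hB1 : ∀ {C : Matrix (Fin 2 ⊕ Fin 2) (Fin 1) (ZMod p)}
      {D : Matrix (Fin 1) (Fin 2 ⊕ Fin 2) (ZMod p)},
      B.map (PadicInt.toZMod (p := p)) ≠ C * D := by
    intro C D h
    rw [h] at hr
    have := ((rank_mul_le_left C D).trans (rank_le_card_width C)).trans_eq (Fintype.card_fin 1)
    omega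
  have hvec : ∀ {m : Type} (u : m → ZMod p) (v : Fin 2 ⊕ Fin 2 → ZMod p), vecMulVec u v
      = (of fun i (_ : Fin 1) => u i) * (of fun (_ : Fin 1) j => v j) := by
    intro m u v
    ext i j
    simp [vecMulVec_apply, mul_apply]
  have hLevi : ∀ {a : {a : Fin 2 → ZMod p // a ≠ 0}} {c : ZMod p}
      {κ : Matrix (Fin 2 ⊕ Fin 2) (Fin 2 ⊕ Fin 2) ℤ_[p]}, B = orthRepLevi (A a) (lift c) * κ →
      ∃ r r', B.toRows₁.map (PadicInt.toZMod (p := p)) = vecMulVec a.1 r ∧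
        B.toRows₂.map (PadicInt.toZMod (p := p)) = vecMulVec a.1 r' := by
    intro a c κ h
    obtain ⟨r, r', h1⟩ := orthRepLevi_reduction (hAa a) (lift c) κ
    rw [← h, hBr, fromRows_ext_iff] at h1
    exact ⟨r, r', h1⟩
  by_cases hQ : B.toRows₂.map (PadicInt.toZMod (p := p)) = 0
  · have hP : (B.toRows₁.map (PadicInt.toZMod (p := p))).rank = 2 := by
      refine le_antisymm ((rank_le_card_height _).trans_eq (Fintype.card_fin 2)) ?_
      refine hr.symm.le.trans ?_
      rw [hBr, hQ, show fromRows (B.toRows₁.map (PadicInt.toZMod (p := p))) 0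
        = (fromRows 1 0 : Matrix (Fin 2 ⊕ Fin 2) (Fin 2) (ZMod p))
          * B.toRows₁.map (PadicInt.toZMod (p := p)) by rw [fromRows_mul]; simp]
      exact rank_mul_le_right _ _
    obtain ⟨M, hM⟩ := exists_right_inverse_of_rank hP
    rw [sum_ite_of_existsUnique (existsUnique_orthRepUnip hB hQ hM),
      Finset.sum_eq_zero, Finset.sum_eq_zero, add_zero, add_zero]
    · rintro ⟨a, c⟩ -
      rw [if_neg]
      rintro ⟨κ, h⟩
      obtain ⟨r, r', h1, h2⟩ := hLevi h
      refine hB1 (C := of fun i (_ : Fin 1) => Sum.elim a.1 0 i)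
        (D := of fun (_ : Fin 1) j => r j) ?_
      rw [← hvec, hBr, hQ, h1]
      ext (i | i) j <;> simp [vecMulVec_apply]
    · rintro b -
      rw [if_neg]
      rintro ⟨κ, h⟩
      have h1 := orthRepScalar_reduction _ h
      rw [hQ, smul_zero] at h1
      rw [h1, rank_zero] at hP
      exact absurd hP (by norm_num)
  · rw [Finset.sum_eq_zero (s := Finset.univ) (f := fun b : ZMod p => _), zero_add]
    swap
    · rintro b -
      rw [if_neg]
      rintro ⟨κ, h⟩
      exact hQ (orthRepUnip_reduction b h)
    by_cases hQ2 : (B.toRows₂.map (PadicInt.toZMod (p := p))).rank = 2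
    · obtain ⟨M, hM⟩ := exists_right_inverse_of_rank hQ2
      rw [sum_ite_of_existsUnique (existsUnique_orthRepScalar hB hM), Finset.sum_eq_zero, add_zero]
      rintro ⟨a, c⟩ -
      rw [if_neg]
      rintro ⟨κ, h⟩
      obtain ⟨r, r', h1, h2⟩ := hLevi h
      have h3 := rank_vecMulVec_le a.1 r'
      rw [← h2, hQ2] at h3
      omega
    · have hQ1 : (B.toRows₂.map (PadicInt.toZMod (p := p))).rank = 1 := by
        have h1 := (rank_le_card_height (B.toRows₂.map (PadicInt.toZMod (p := p)))).trans_eq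
          (Fintype.card_fin 2)
        have h2 : (B.toRows₂.map (PadicInt.toZMod (p := p))).rank ≠ 0 := fun h => by
          obtain ⟨a₀, P₀, hAP, -⟩ := exists_rank_factorization _ h
          refine hQ (hAP.trans ?_)
          ext i j
          simp [mul_apply]
        omega
      obtain ⟨a₀, P₀, hAP, ⟨N₀, hN⟩, M₀, hM⟩ := exists_rank_factorization _ hQ1
      have hAP' : B.toRows₂.map (PadicInt.toZMod (p := p))
          = vecMulVec (fun i => a₀ i 0) (P₀ 0) := by
        rw [hAP]
        ext i j
        simp [mul_apply, vecMulVec_apply]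
      have ha₀ : (fun i => a₀ i 0) ≠ 0 := fun h => hQ (by rw [hAP', h, zero_vecMulVec])
      have hP₀ : P₀ 0 ≠ 0 := fun h => hQ (by
        rw [hAP', h]
        ext i j
        simp [vecMulVec_apply])
      rw [Finset.sum_eq_zero (s := Finset.univ) (f := fun b : ZMod p × ZMod p => _), zero_add]
      swap
      · rintro b -
        rw [if_neg]
        rintro ⟨κ, h⟩
        have h1 := orthRepScalar_reduction _ h
        set c := PadicInt.toZMod (lift b.1 + (p : ℤ_[p]) * lift b.2)
        refine hB1 (C := of fun i (_ : Fin 1) => Sum.elim (fun i => c * a₀ i 0)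
          (fun i => a₀ i 0) i) (D := of fun (_ : Fin 1) j => P₀ 0 j) ?_
        rw [← hvec, hBr, h1, hAP']
        ext (i | i) j <;> simp [vecMulVec_apply, mul_assoc]
      rw [Fintype.sum_prod_type]
      have hinner : ∀ a : {a : Fin 2 → ZMod p // a ≠ 0},
          (∑ c : ZMod p, if ∃ κ : Matrix (Fin 2 ⊕ Fin 2) (Fin 2 ⊕ Fin 2) ℤ_[p],
            B = orthRepLevi (A a) (lift c) * κ then ((p : ℂ) - 1)⁻¹ else 0)
          = if ∃ r : Fin 2 ⊕ Fin 2 → ZMod p, vecMulVec (fun i => a₀ i 0) (P₀ 0) = vecMulVec a.1 r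
            then ((p : ℂ) - 1)⁻¹ else 0 := by
        intro a
        rw [← hAP']
        split_ifs with h
        · obtain ⟨r, hr1⟩ := h
          refine sum_ite_of_existsUnique (existsUnique_orthRepLevi (hA a) (hAa a) hB hr ?_ hr1) _
          rintro rfl
          exact hQ (hr1.trans (by ext i j; simp [vecMulVec_apply]))
        · refine Finset.sum_eq_zero fun c _ => if_neg ?_
          rintro ⟨κ, h1⟩
          obtain ⟨r, r', h1, h2⟩ := hLevi h1
          exact h ⟨r', h2⟩
      have hcard : (Finset.univ.filter fun a : {a : Fin 2 → ZMod p // a ≠ 0} =>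
          ∃ r, vecMulVec (fun i => a₀ i 0) (P₀ 0) = vecMulVec a.1 r).card = p - 1 := by
        convert card_parallel ha₀ hP₀
      rw [Finset.sum_congr rfl fun a _ => hinner a, ← Finset.sum_filter, Finset.sum_const]
      rw [show Finset.card _ = p - 1 by convert hcard, nsmul_eq_mul,
        Nat.cast_sub (Fact.out : p.Prime).one_lt.le, Nat.cast_one]
      refine mul_inv_cancel₀ (sub_ne_zero.2 ?_)
      exact_mod_cast (Fact.out : p.Prime).ne_one

end OrthogonalCosetsTwo

/-! ### Conductor and orthogonality for `ψ` -/

section Character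

variable {p : ℕ} [Fact p.Prime]

theorem psi_eq_of_norm_sub_le {x : ℚ_[p]} {m : ℤ} {k : ℕ} (h : ‖x - m / (p : ℚ_[p]) ^ k‖ ≤ 1) :
    psi p x = Complex.exp (-(2 * Real.pi * Complex.I) * (m / (p : ℂ) ^ k)) :=
  psiFun_eq_of_norm_sub_le h

/-- Up to an integral element `x` is `m / p ^ k`, and the exponential is `1` only if this fraction
is an integer. -/
theorem psi_eq_one_iff (x : ℚ_[p]) : psi p x = 1 ↔ ‖x‖ ≤ 1 := by
  have hp0 : (p : ℚ_[p]) ≠ 0 := coe_p_ne_zero'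
  have hpC : (p : ℂ) ≠ 0 := by exact_mod_cast (Fact.out : p.Prime).ne_zero
  constructor
  · intro h
    obtain ⟨m, k, hx⟩ := exists_norm_sub_le x
    rw [psi_eq_of_norm_sub_le hx, Complex.exp_eq_one_iff] at h
    obtain ⟨n, hn⟩ := h
    have hm : (m : ℂ) = -n * p ^ k := by
      have h2 : (2 * Real.pi * Complex.I : ℂ) ≠ 0 := Complex.two_pi_I_ne_zero
      have h3 : (m : ℂ) / p ^ k = -n := by
        apply mul_left_cancel₀ h2
        linear_combination -hn
      rw [← h3]
      field_simp
    have hm' : m = -n * p ^ k := by exact_mod_cast hm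
    have e : (m : ℚ_[p]) / (p : ℚ_[p]) ^ k = ((-n : ℤ) : ℚ_[p]) := by
      rw [hm']
      push_cast
      field_simp
    rw [e] at hx
    have : x = (x - ((-n : ℤ) : ℚ_[p])) + ((-n : ℤ) : ℚ_[p]) := by ring
    rw [this]
    exact (IsUltrametricDist.norm_add_le_max _ _).trans (max_le hx (Padic.norm_int_le_one _))
  · intro h
    have h1 : ‖x - ((0 : ℤ) : ℚ_[p]) / (p : ℚ_[p]) ^ 0‖ ≤ 1 := by simpa using h
    rw [psi_eq_of_norm_sub_le h1]
    simp

theorem psi_coe (x : ℤ_[p]) : psi p (x : ℚ_[p]) = 1 := (psi_eq_one_iff _).2 x.2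

theorem lift_add_sub (b c : ZMod p) : ∃ d : ℤ_[p], lift (b + c) = lift b + lift c + p * d := by
  obtain ⟨d, hd⟩ := (toZMod_eq_iff (lift (b + c)) (lift b + lift c)).1 (by simp)
  exact ⟨d, by linear_combination hd⟩

/-- The character `b ↦ ψ(-b t)` of `𝔽_p` attached to `t ∈ p⁻¹ ℤ_p`. -/
def reducedChar (t : ℚ_[p]) (ht : ‖(p : ℚ_[p]) * t‖ ≤ 1) : AddChar (ZMod p) ℂ where
  toFun b := psi p (-(lift b * t))
  map_zero_eq_one' := by simp [lift]
  map_add_eq_mul' b c := by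
    obtain ⟨d, hd⟩ := lift_add_sub b c
    rw [hd, ← AddChar.map_add_eq_mul]
    have : -(((lift b + lift c + p * d : ℤ_[p]) : ℚ_[p]) * t)
        = -(lift b * t) + -(lift c * t) + -(d * (p * t)) := by
      push_cast
      ring
    rw [this, AddChar.map_add_eq_mul _ _ (-(d * (p * t) : ℚ_[p])), (psi_eq_one_iff (-_)).2, mul_one]
    rw [norm_neg, norm_mul]
    exact mul_le_one₀ d.2 (norm_nonneg _) ht

open Classical in
-- This is orthogonality for the character `reducedChar` of `𝔽_p`. Whether that character is trivial
-- is decided by its value at `1`.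
theorem sum_psi_lift {t : ℚ_[p]} (ht : ‖(p : ℚ_[p]) * t‖ ≤ 1) :
    ∑ b : ZMod p, psi p (-(lift b * t)) = if ‖t‖ ≤ 1 then (p : ℂ) else 0 := by
  have h := AddChar.sum_eq_ite (reducedChar t ht)
  have h1 : reducedChar t ht = 0 ↔ ‖t‖ ≤ 1 := by
    constructor
    · intro h
      have h2 : psi p (-(lift (1 : ZMod p) * t)) = 1 := by
        change reducedChar t ht 1 = 1
        rw [h]
        rfl
      rw [psi_eq_one_iff, norm_neg] at h2
      have : lift (1 : ZMod p) = 1 := by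
        have : Fact (1 < p) := ⟨(Fact.out : p.Prime).one_lt⟩
        rw [lift, ZMod.val_one]
        simp
      simpa [this] using h2
    · intro h
      ext b
      change psi p (-(lift b * t)) = 1
      rw [psi_eq_one_iff, norm_neg, norm_mul]
      exact mul_le_one₀ (lift b).2 (norm_nonneg _) h
  simp only [h1, ZMod.card] at h
  exact h

end Character

/-! ### Volumes and dual lattices in `M₂(ℚ_p)` -/

section Volume

variable {p : ℕ} [Fact p.Prime]

instance : (matHaar p).IsAddHaarMeasure := by unfold matHaar; infer_instance

instance : (matHaar p).Regular := by unfold matHaar; infer_instance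

theorem matHaar_intMat : matHaar p (intMat p (Fin 2) (Fin 2)) = 1 :=
  Measure.addHaarMeasure_self

instance : LocallyCompactSpace (Matrix (Fin 2) (Fin 2) ℚ_[p]) :=
  inferInstanceAs (LocallyCompactSpace (Fin 2 → Fin 2 → ℚ_[p]))

/-- The diagonal matrix with entry `u` in the row `i` and all other diagonal entries `1`. -/
def diagUnit (i : Fin 2) : ℚ_[p]ˣ →* GL (Fin 2) ℚ_[p] :=
  Units.map ((diagonalRingHom (Fin 2) ℚ_[p]).toMonoidHom.comp
    (MonoidHom.mulSingle (fun _ : Fin 2 => ℚ_[p]) i))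

theorem coe_diagUnit (i : Fin 2) (u : ℚ_[p]ˣ) :
    (diagUnit i u : Matrix (Fin 2) (Fin 2) ℚ_[p]) = diagonal (Pi.mulSingle i (u : ℚ_[p])) := rfl

variable (p) in
/-- The prime `p` as a unit of `ℚ_p`. -/
def pUnit : ℚ_[p]ˣ := Units.mk0 (p : ℚ_[p]) coe_p_ne_zero'

open scoped Pointwise in
theorem mem_diagUnit_smul_intMat_iff (i : Fin 2) (z : Matrix (Fin 2) (Fin 2) ℚ_[p]) :
    z ∈ diagUnit i (pUnit p) • intMat p (Fin 2) (Fin 2) ↔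
      ∃ A : Matrix (Fin 2) (Fin 2) ℤ_[p], z = A.map (algebraMap ℤ_[p] ℚ_[p]) ∧
        ∀ j, (p : ℤ_[p]) ∣ A i j := by
  rw [Set.mem_smul_set]
  constructor
  · rintro ⟨_, ⟨B, rfl⟩, rfl⟩
    refine ⟨diagonal (Pi.mulSingle i (p : ℤ_[p])) * B, ?_, fun j => by simp [diagonal_mul]⟩
    ext k j
    by_cases hk : k = i
    · subst hk
      simp [Units.smul_def, coe_diagUnit, pUnit]
    · simp [Units.smul_def, coe_diagUnit, pUnit, hk]
  · rintro ⟨A, rfl, hA⟩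
    choose c hc using hA
    refine ⟨_, ⟨A.updateRow i c, rfl⟩, ?_⟩
    ext k j
    by_cases hk : k = i
    · subst hk
      simp [Units.smul_def, coe_diagUnit, pUnit, hc]
    · simp [Units.smul_def, coe_diagUnit, pUnit, hk]

open scoped Pointwise in
-- The lattice `M₂(ℤ_p)` is the disjoint union of `p²` translates of the sublattice of matrices
-- whose row `i` is divisible by `p`, one for each value of that row modulo `p`.
theorem distribHaarChar_diagUnit (i : Fin 2) :
    distribHaarChar (Matrix (Fin 2) (Fin 2) ℚ_[p]) (diagUnit i (pUnit p)) = ((p : NNReal) ^ 2)⁻¹ := by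
  set g := diagUnit i (pUnit p) with hg
  let C : (Fin 2 → ZMod p) → Matrix (Fin 2) (Fin 2) ℚ_[p] := fun c =>
    (updateRow 0 i fun j => lift (c j) : Matrix (Fin 2) (Fin 2) ℤ_[p]).map (algebraMap ℤ_[p] ℚ_[p])
  have hmem : ∀ c z, z ∈ C c +ᵥ (g • intMat p (Fin 2) (Fin 2)) ↔
      ∃ A : Matrix (Fin 2) (Fin 2) ℤ_[p], z = A.map (algebraMap ℤ_[p] ℚ_[p]) ∧
        ∀ j, PadicInt.toZMod (A i j) = c j := by
    intro c z
    rw [Set.mem_vadd_set_iff_neg_vadd_mem, hg, mem_diagUnit_smul_intMat_iff]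
    constructor
    · rintro ⟨A, hA, h⟩
      refine ⟨(updateRow 0 i fun j => lift (c j)) + A, ?_, ?_⟩
      · rw [Matrix.map_add _ (map_add _), ← hA, vadd_eq_add]
        simp [C]
      · intro j
        simp [(toZMod_eq_zero_iff _).2 (h j)]
    · rintro ⟨A, rfl, h⟩
      refine ⟨A - updateRow 0 i fun j => lift (c j), ?_, ?_⟩
      · rw [Matrix.map_sub _ (map_sub _), vadd_eq_add]
        simp only [C]
        abel
      · intro j
        rw [← toZMod_eq_zero_iff]
        simp [h]
  have hU : intMat p (Fin 2) (Fin 2) = ⋃ c, (C c +ᵥ (g • intMat p (Fin 2) (Fin 2))) := by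
    ext z
    simp only [Set.mem_iUnion, hmem]
    constructor
    · rintro ⟨A, rfl⟩
      exact ⟨fun j => PadicInt.toZMod (A i j), A, rfl, fun j => rfl⟩
    · rintro ⟨c, A, rfl, -⟩
      exact ⟨A, rfl⟩
  have hdisj : Pairwise (Function.onFun Disjoint
      fun c => C c +ᵥ (g • intMat p (Fin 2) (Fin 2))) := by
    intro c c' hcc
    refine Set.disjoint_left.2 fun z hz hz' => hcc ?_
    obtain ⟨A, rfl, hA⟩ := (hmem _ _).1 hz
    obtain ⟨A', hAA, hA'⟩ := (hmem _ _).1 hz'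
    have := emb_injective hAA
    subst this
    ext j
    rw [← hA, ← hA']
  have hopen : IsOpen (g • intMat p (Fin 2) (Fin 2)) := (isOpen_intMat p _ _).smul g
  have h1 := matHaar_intMat (p := p)
  conv_lhs at h1 => rw [hU]
  rw [measure_iUnion hdisj fun c => (hopen.vadd (C c)).measurableSet, tsum_fintype] at h1
  simp only [measure_vadd, Finset.sum_const, Finset.card_univ, nsmul_eq_mul] at h1
  rw [← distribHaarChar_mul, matHaar_intMat, mul_one, Fintype.card_fun, ZMod.card,
    Fintype.card_fin] at h1
  have h2 : ((p ^ 2 : ℕ) : NNReal) * distribHaarChar (Matrix (Fin 2) (Fin 2) ℚ_[p]) g = 1 := by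
    exact_mod_cast h1
  push_cast at h2
  exact eq_inv_of_mul_eq_one_right h2

/-- The invertible matrix over `ℚ_p` attached to an integral matrix of determinant one. -/
def specialUnit (A : Matrix (Fin 2) (Fin 2) ℤ_[p]) (hA : A.det = 1) : GL (Fin 2) ℚ_[p] :=
  GeneralLinearGroup.map (algebraMap ℤ_[p] ℚ_[p])
    (Matrix.nonsingInvUnit A (by rw [hA]; exact isUnit_one))

theorem coe_specialUnit (A : Matrix (Fin 2) (Fin 2) ℤ_[p]) (hA : A.det = 1) :
    (specialUnit A hA : Matrix (Fin 2) (Fin 2) ℚ_[p]) = A.map (algebraMap ℤ_[p] ℚ_[p]) := rfl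

open scoped Pointwise in
theorem distribHaarChar_specialUnit (A : Matrix (Fin 2) (Fin 2) ℤ_[p]) (hA : A.det = 1) :
    distribHaarChar (Matrix (Fin 2) (Fin 2) ℚ_[p]) (specialUnit A hA) = 1 := by
  refine distribHaarChar_eq_of_measure_smul_eq_mul (μ := matHaar p)
    (s := intMat p (Fin 2) (Fin 2)) (by simp [matHaar_intMat]) (by simp [matHaar_intMat]) ?_
  rw [ENNReal.coe_one, one_mul]
  congr 1
  ext z
  rw [Set.mem_smul_set]
  constructor
  · rintro ⟨w, hw, rfl⟩
    exact mul_mem_intMat (emb_mem_intMat A) hw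
  · intro hz
    refine ⟨(specialUnit A hA)⁻¹ • z, mul_mem_intMat ?_ hz, smul_inv_smul _ _⟩
    rw [specialUnit, ← map_inv]
    exact emb_mem_intMat _

open scoped Pointwise in
-- The set is `g⁻¹ M₂(ℤ_p)` with `g` a diagonal matrix times `ᵗA`. The unimodular factor preserves
-- volumes, and each diagonal entry scales a row of two entries, whence the factor `2` in the
-- exponent.
theorem matHaar_real_preimage {A : Matrix (Fin 2) (Fin 2) ℤ_[p]} (hA : A.det = 1) (i j : ℤ) :
    (matHaar p).real {z | (A.map (algebraMap ℤ_[p] ℚ_[p])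
      * diagonal ![(p : ℚ_[p]) ^ i, (p : ℚ_[p]) ^ j])ᵀ * z ∈ intMat p (Fin 2) (Fin 2)}
      = (p : ℝ) ^ (2 * (i + j)) := by
  have hAt : Aᵀ.det = 1 := by rw [det_transpose, hA]
  set g : GL (Fin 2) ℚ_[p] := diagUnit 0 (pUnit p) ^ i * diagUnit 1 (pUnit p) ^ j
    * specialUnit Aᵀ hAt with hg
  have hgc : (g : Matrix (Fin 2) (Fin 2) ℚ_[p]) = (A.map (algebraMap ℤ_[p] ℚ_[p])
      * diagonal ![(p : ℚ_[p]) ^ i, (p : ℚ_[p]) ^ j])ᵀ := by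
    rw [hg, Units.val_mul, Units.val_mul, coe_specialUnit, ← map_zpow, ← map_zpow, coe_diagUnit,
      coe_diagUnit, transpose_mul, diagonal_transpose, Matrix.transpose_map, diagonal_mul_diagonal]
    congr 2
    ext k
    fin_cases k <;> simp [pUnit]
  have hset : {z | (A.map (algebraMap ℤ_[p] ℚ_[p])
      * diagonal ![(p : ℚ_[p]) ^ i, (p : ℚ_[p]) ^ j])ᵀ * z ∈ intMat p (Fin 2) (Fin 2)}
      = g⁻¹ • intMat p (Fin 2) (Fin 2) := by
    ext z
    rw [← hgc, Set.mem_smul_set_iff_inv_smul_mem, inv_inv]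
    rfl
  have h := distribHaarChar_mul (matHaar p) g⁻¹ (intMat p (Fin 2) (Fin 2))
  rw [matHaar_intMat, mul_one] at h
  rw [hset, measureReal_def, ← h, hg, map_inv, map_mul, map_mul, map_zpow, map_zpow,
    distribHaarChar_diagUnit, distribHaarChar_diagUnit, distribHaarChar_specialUnit, mul_one,
    ENNReal.coe_toReal]
  have hp : (p : ℝ) ≠ 0 := by exact_mod_cast (Fact.out : p.Prime).ne_zero
  push_cast
  rw [← zpow_natCast, ← _root_.zpow_neg, ← _root_.zpow_mul, ← _root_.zpow_mul, ← zpow_add₀ hp, ← _root_.zpow_neg]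
  congr 1
  push_cast
  ring

/-- The integral of an additive character over a subgroup. -/
theorem integral_addChar_mul_indicator (S : AddSubgroup (Matrix (Fin 2) (Fin 2) ℚ_[p]))
    (hS : MeasurableSet (S : Set (Matrix (Fin 2) (Fin 2) ℚ_[p])))
    (χ : AddChar (Matrix (Fin 2) (Fin 2) ℚ_[p]) ℂ) [Decidable (∀ z ∈ S, χ z = 1)] :
    ∫ z, χ z * (S : Set (Matrix (Fin 2) (Fin 2) ℚ_[p])).indicator 1 z ∂matHaar p
      = if ∀ z ∈ S, χ z = 1 then ((matHaar p).real S : ℂ) else 0 := by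
  split_ifs with h
  · have : ∀ z, χ z * (S : Set (Matrix (Fin 2) (Fin 2) ℚ_[p])).indicator 1 z
        = (S : Set (Matrix (Fin 2) (Fin 2) ℚ_[p])).indicator (fun _ => (1 : ℂ)) z := by
      intro z
      by_cases hz : z ∈ S
      · simp [hz, h z hz]
      · simp [hz]
    simp only [this]
    rw [integral_indicator hS]
    simp
  · push Not at h
    obtain ⟨z₀, hz₀, h1⟩ := h
    set I := ∫ z, χ z * (S : Set (Matrix (Fin 2) (Fin 2) ℚ_[p])).indicator 1 z ∂matHaar p with hI
    -- Translation by `z₀` preserves `S` and multiplies the integral by `χ z₀ ≠ 1`.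
    have h2 : I = χ z₀ * I := by
      rw [hI, ← integral_const_mul]
      rw [← integral_add_left_eq_self _ z₀]
      congr 1
      ext z
      rw [AddChar.map_add_eq_mul, mul_assoc]
      congr 2
      have : z₀ + z ∈ S ↔ z ∈ S := S.add_mem_cancel_left hz₀
      by_cases hz : z ∈ S
      · simp [hz, this.2 hz]
      · simp [hz, mt this.1 hz]
    have h3 : (χ z₀ - 1) * I = 0 := by linear_combination -h2
    exact (mul_eq_zero.1 h3).resolve_left (sub_ne_zero.2 h1)

/-- The matrices `z` with `δ z` integral. -/
def integralPreimage (δ : Matrix (Fin 2) (Fin 2) ℚ_[p]) :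
    AddSubgroup (Matrix (Fin 2) (Fin 2) ℚ_[p]) where
  carrier := {z | δ * z ∈ intMat p (Fin 2) (Fin 2)}
  zero_mem' := ⟨0, by ext; simp⟩
  add_mem' := by
    rintro a b ⟨A, hA⟩ ⟨B, hB⟩
    refine ⟨A + B, ?_⟩
    simp only at hA hB ⊢
    rw [Matrix.map_add _ (map_add _), hA, hB, Matrix.mul_add]
  neg_mem' := by
    rintro a ⟨A, hA⟩
    refine ⟨-A, ?_⟩
    simp only at hA ⊢
    rw [Matrix.mul_neg, ← hA]
    ext
    simp

theorem mem_integralPreimage {δ z : Matrix (Fin 2) (Fin 2) ℚ_[p]} :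
    z ∈ integralPreimage δ ↔ δ * z ∈ intMat p (Fin 2) (Fin 2) := Iff.rfl

theorem measurableSet_integralPreimage (δ : Matrix (Fin 2) (Fin 2) ℚ_[p]) :
    MeasurableSet (integralPreimage δ : Set (Matrix (Fin 2) (Fin 2) ℚ_[p])) :=
  ((isOpen_intMat p (Fin 2) (Fin 2)).preimage
    (continuous_const.matrix_mul continuous_id)).measurableSet

/-- The character `z ↦ ψ(Tr(ᵗz y))`. -/
def traceChar (y : Matrix (Fin 2) (Fin 2) ℚ_[p]) : AddChar (Matrix (Fin 2) (Fin 2) ℚ_[p]) ℂ :=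
  (psi p).compAddMonoidHom
    { toFun := fun z => trace (zᵀ * y)
      map_zero' := by simp
      map_add' := fun a b => by simp [Matrix.add_mul] }

theorem traceChar_apply (y z : Matrix (Fin 2) (Fin 2) ℚ_[p]) :
    traceChar y z = psi p (trace (zᵀ * y)) := rfl

/-- `M₂(ℤ_p)` is self-dual: the elementary matrices `z` isolate the entries of `y`, and `ψ` is
trivial exactly on `ℤ_p`. -/
theorem forall_traceChar_eq_one_iff (y : Matrix (Fin 2) (Fin 2) ℚ_[p]) :
    (∀ z ∈ intMat p (Fin 2) (Fin 2), traceChar y z = 1) ↔ y ∈ intMat p (Fin 2) (Fin 2) := by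
  simp only [traceChar_apply, psi_eq_one_iff]
  constructor
  · intro h
    rw [mem_intMat_iff]
    intro i j
    have := h _ (emb_mem_intMat (Matrix.single i j 1))
    simpa [trace, mul_apply, Matrix.single_apply, Fin.sum_univ_two, ite_and] using this
  · intro hy z hz
    have hzt : zᵀ ∈ intMat p (Fin 2) (Fin 2) :=
      mem_intMat_iff.2 fun i j => mem_intMat_iff.1 hz j i
    have h := mem_intMat_iff.1 (mul_mem_intMat hzt hy)
    rw [trace_fin_two]
    exact (IsUltrametricDist.norm_add_le_max _ _).trans (max_le (h 0 0) (h 1 1))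

end Volume

/-! ### The Weil representation on `φ₀` -/

section Weil

variable {p : ℕ} [Fact p.Prime]

theorem mem_intMat_fromRows {m₁ m₂ n : Type*} {A : Matrix m₁ n ℚ_[p]} {B : Matrix m₂ n ℚ_[p]} :
    fromRows A B ∈ intMat p (m₁ ⊕ m₂) n ↔ A ∈ intMat p m₁ n ∧ B ∈ intMat p m₂ n := by
  simp [mem_intMat_iff]

theorem mem_intMat_fromCols {m n₁ n₂ : Type*} {A : Matrix m n₁ ℚ_[p]} {B : Matrix m n₂ ℚ_[p]} :
    fromCols A B ∈ intMat p m (n₁ ⊕ n₂) ↔ A ∈ intMat p m n₁ ∧ B ∈ intMat p m n₂ := by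
  simp [mem_intMat_iff, forall_and]

theorem transpose_mem_intMat_iff {m n : Type*} {A : Matrix m n ℚ_[p]} :
    Aᵀ ∈ intMat p n m ↔ A ∈ intMat p m n := by
  simp only [mem_intMat_iff, transpose_apply]
  exact forall_comm

theorem neg_mem_intMat_iff {m n : Type*} {A : Matrix m n ℚ_[p]} :
    -A ∈ intMat p m n ↔ A ∈ intMat p m n := by
  simp [mem_intMat_iff]

theorem J_mem_intMat : J ℚ_[p] ∈ intMat p (Fin 2) (Fin 2) :=
  mem_intMat_iff.2 fun i j => by fin_cases i <;> fin_cases j <;> simp [J]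

theorem J_mul_mem_intMat_iff {n : Type*} {A : Matrix (Fin 2) n ℚ_[p]} :
    J ℚ_[p] * A ∈ intMat p (Fin 2) n ↔ A ∈ intMat p (Fin 2) n := by
  refine ⟨fun h => ?_, fun h => mul_mem_intMat J_mem_intMat h⟩
  have := mul_mem_intMat J_mem_intMat h
  rwa [← Matrix.mul_assoc, J_mul_J, Matrix.neg_mul, Matrix.one_mul, neg_mem_intMat_iff] at this

/-- `M₂(ℤ_p)` is self-dual and has volume one, and `J` preserves it. Hence the transform of the
characteristic function is again a characteristic function. -/
theorem partialFourierInv_phi0 (X : Matrix (Fin 2 ⊕ Fin 2) (Fin 2) ℚ_[p]) :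
    partialFourierInv (phi0 p) X = (intMat p (Fin 2 ⊕ Fin 2) (Fin 2)).indicator 1 X := by
  classical
  have hX : X ∈ intMat p (Fin 2 ⊕ Fin 2) (Fin 2) ↔
      X.toRows₁ ∈ intMat p (Fin 2) (Fin 2) ∧ X.toRows₂ ∈ intMat p (Fin 2) (Fin 2) := by
    rw [← mem_intMat_fromRows, fromRows_toRows]
  unfold partialFourierInv
  by_cases h1 : X.toRows₁ ∈ intMat p (Fin 2) (Fin 2)
  · have h : ∀ y, psi p (-trace (X.toRows₂ᵀ * J ℚ_[p] * y)) * phi0 p (fromCols X.toRows₁ y)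
        = traceChar (J ℚ_[p] * X.toRows₂) y
          * (integralPreimage (1 : Matrix (Fin 2) (Fin 2) ℚ_[p]) :
            Set (Matrix (Fin 2) (Fin 2) ℚ_[p])).indicator 1 y := by
      intro y
      congr 1
      · rw [traceChar_apply, ← trace_transpose (yᵀ * _), transpose_mul, transpose_mul,
          transpose_transpose, ← trace_neg]
        congr 2
        have : (J ℚ_[p])ᵀ = -J ℚ_[p] := by
          ext i j; fin_cases i <;> fin_cases j <;> simp [J]
        rw [this]
        simp
      · unfold phi0
        simp only [Set.indicator, SetLike.mem_coe, mem_integralPreimage, Matrix.one_mul,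
          mem_intMat_fromCols, h1, true_and]
        rfl
    simp only [h]
    rw [integral_addChar_mul_indicator _ (measurableSet_integralPreimage _)]
    simp only [mem_integralPreimage, Matrix.one_mul]
    rw [forall_traceChar_eq_one_iff, J_mul_mem_intMat_iff]
    have hvol : (matHaar p).real (integralPreimage (1 : Matrix (Fin 2) (Fin 2) ℚ_[p]) :
        Set (Matrix (Fin 2) (Fin 2) ℚ_[p])) = 1 := by
      have : (integralPreimage (1 : Matrix (Fin 2) (Fin 2) ℚ_[p]) :
        Set (Matrix (Fin 2) (Fin 2) ℚ_[p])) = intMat p (Fin 2) (Fin 2) := by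
        ext z; simp [mem_integralPreimage]
      rw [this, measureReal_def, matHaar_intMat, ENNReal.toReal_one]
    rw [hvol, Set.indicator_apply, hX]
    simp [h1]
  · have h : ∀ y, psi p (-trace (X.toRows₂ᵀ * J ℚ_[p] * y)) * phi0 p (fromCols X.toRows₁ y) = 0 := by
      intro y
      unfold phi0
      rw [Set.indicator_of_notMem (by simp [mem_intMat_fromCols, h1]), mul_zero]
    simp only [h, integral_zero]
    rw [Set.indicator_of_notMem (by simp [hX, h1])]

theorem weilH_phi0 (h : H p) (X : Matrix (Fin 2) (Fin 2 ⊕ Fin 2) ℚ_[p]) :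
    weilH h (phi0 p) X = ∫ z, psi p (trace (zᵀ * J ℚ_[p] * X.toCols₂)) *
      (intMat p (Fin 2 ⊕ Fin 2) (Fin 2)).indicator 1
        (((h : GL (Fin 2 ⊕ Fin 2) ℚ_[p]) : Matrix (Fin 2 ⊕ Fin 2) (Fin 2 ⊕ Fin 2) ℚ_[p])ᵀ * fromRows X.toCols₁ z)
        ∂matHaar p := by
  unfold weilH partialFourier linearAction
  simp only [partialFourierInv_phi0]
  rfl

theorem weilG_phi0 (g : G p) (X : Matrix (Fin 2) (Fin 2 ⊕ Fin 2) ℚ_[p]) :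
    weilG g (phi0 p) X = (intMat p (Fin 2) (Fin 2 ⊕ Fin 2)).indicator 1
      (X * ((g : GL (Fin 2 ⊕ Fin 2) ℚ_[p]) : Matrix (Fin 2 ⊕ Fin 2) (Fin 2 ⊕ Fin 2) ℚ_[p])) :=
  rfl

/-- The integral `4 × 2` matrices are stable under `ᵗu` and its inverse, so `u` fixes the transform
of `φ₀`. This makes the coset decomposition applicable. -/
theorem weilH_phi0_mul_right (X : Matrix (Fin 2) (Fin 2 ⊕ Fin 2) ℚ_[p]) (h : H p)
    {u : H p} (hu : u ∈ integralPoints (formH p)) :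
    weilH (h * u) (phi0 p) X = weilH h (phi0 p) X := by
  rw [mem_integralPoints_iff] at hu
  rw [weilH_phi0, weilH_phi0]
  congr 1
  ext z
  congr 1
  refine Set.indicator_eq_indicator ?_ rfl
  rw [Subgroup.coe_mul, Units.val_mul, transpose_mul, Matrix.mul_assoc]
  set Z := ((h : GL (Fin 2 ⊕ Fin 2) ℚ_[p]) : Matrix (Fin 2 ⊕ Fin 2) (Fin 2 ⊕ Fin 2) ℚ_[p])ᵀ * fromRows X.toCols₁ z
  constructor
  · intro h1
    have h2 := mul_mem_intMat (transpose_mem_intMat_iff.2 hu.2) h1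
    rwa [← Matrix.mul_assoc, ← transpose_mul, ← Units.val_mul, mul_inv_cancel, Units.val_one,
      transpose_one, Matrix.one_mul] at h2
  · exact fun h1 => mul_mem_intMat (transpose_mem_intMat_iff.2 hu.1) h1

theorem weilG_phi0_mul_right (X : Matrix (Fin 2) (Fin 2 ⊕ Fin 2) ℚ_[p]) (g : G p)
    {u : G p} (hu : u ∈ integralPoints (formG p)) :
    weilG (g * u) (phi0 p) X = weilG g (phi0 p) X := by
  rw [mem_integralPoints_iff] at hu
  rw [weilG_phi0, weilG_phi0]
  refine Set.indicator_eq_indicator ?_ rfl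
  rw [Subgroup.coe_mul, Units.val_mul, ← Matrix.mul_assoc]
  constructor
  · intro h1
    have h2 := mul_mem_intMat h1 hu.2
    rwa [Matrix.mul_assoc, ← Units.val_mul, mul_inv_cancel, Units.val_one, Matrix.mul_one] at h2
  · exact fun h1 => mul_mem_intMat h1 hu.1

/-- The pairing `Tr(ᵗx J y)` of the two blocks of `(x, y)`. -/
def pairing {R : Type*} [CommRing R] (X : Matrix (Fin 2) (Fin 2 ⊕ Fin 2) R) : R :=
  trace (X.toCols₁ᵀ * J R * X.toCols₂)

open Classical in
/-- The action of an element of the Siegel parabolic subgroup on `φ₀`. -/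
theorem weilH_phi0_parabolic {h : H p} {α δ : Matrix (Fin 2) (Fin 2) ℚ_[p]} {b : ℚ_[p]}
    (hh : ((h : GL (Fin 2 ⊕ Fin 2) ℚ_[p]) : Matrix (Fin 2 ⊕ Fin 2) (Fin 2 ⊕ Fin 2) ℚ_[p]) = fromBlocks α (b • δ) 0 δ)
    (hα : δ.det • α = δ) (hδ : δ.det ≠ 0) (X : Matrix (Fin 2) (Fin 2 ⊕ Fin 2) ℚ_[p]) :
    weilH h (phi0 p) X = if αᵀ * X ∈ intMat p (Fin 2) (Fin 2 ⊕ Fin 2) then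
      ((matHaar p).real {z | δᵀ * z ∈ intMat p (Fin 2) (Fin 2)} : ℂ) * psi p (-(b * pairing X))
      else 0 := by
  set x := X.toCols₁ with hx
  set y := X.toCols₂ with hy
  have hX : αᵀ * X ∈ intMat p (Fin 2) (Fin 2 ⊕ Fin 2) ↔
      αᵀ * x ∈ intMat p (Fin 2) (Fin 2) ∧ αᵀ * y ∈ intMat p (Fin 2) (Fin 2) := by
    rw [← mem_intMat_fromCols, ← mul_fromCols, hx, hy, fromCols_toCols]
  have hZ : ∀ z, (fromBlocks α (b • δ) 0 δ)ᵀ * fromRows x z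
      = fromRows (αᵀ * x) (δᵀ * (b • x + z)) := by
    intro z
    rw [fromBlocks_transpose, fromBlocks_mul_fromRows]
    simp [Matrix.mul_add]
  rw [weilH_phi0, hh]
  simp only [← hx, ← hy, hZ]
  by_cases h1 : αᵀ * x ∈ intMat p (Fin 2) (Fin 2)
  -- In the variable `b x + z` the support condition no longer involves `b`, and the character
  -- splits off the factor `ψ(-b Tr(ᵗx J y))`.
  · have h2 : ∀ z, psi p (trace (zᵀ * J ℚ_[p] * y)) *
        (intMat p (Fin 2 ⊕ Fin 2) (Fin 2)).indicator 1 (fromRows (αᵀ * x) (δᵀ * (b • x + z)))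
        = psi p (-(b * pairing X)) * (fun w => traceChar (J ℚ_[p] * y) w *
          (integralPreimage δᵀ : Set (Matrix (Fin 2) (Fin 2) ℚ_[p])).indicator 1 w)
            (b • x + z) := by
      intro z
      simp only
      rw [← mul_assoc]
      congr 1
      · rw [AddChar.map_add_eq_mul, ← mul_assoc, traceChar_apply, traceChar_apply,
          ← AddChar.map_add_eq_mul, transpose_smul, Matrix.smul_mul, trace_smul, smul_eq_mul,
          Matrix.mul_assoc zᵀ]
        rw [pairing, ← hx, ← hy, Matrix.mul_assoc xᵀ, neg_add_cancel, AddChar.map_zero_eq_one,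
          one_mul]
      · refine Set.indicator_eq_indicator ?_ rfl
        rw [mem_intMat_fromRows]
        simp only [h1, true_and, SetLike.mem_coe, mem_integralPreimage]
    simp only [h2]
    rw [integral_const_mul, integral_add_left_eq_self (fun w => traceChar (J ℚ_[p] * y) w *
          (integralPreimage δᵀ : Set (Matrix (Fin 2) (Fin 2) ℚ_[p])).indicator 1 w),
      integral_addChar_mul_indicator _ (measurableSet_integralPreimage _)]
    -- Since `δ J ᵗα = J`, the character in the variable `ᵗδ z` is the one attached to `J ᵗα y`, and
    -- self-duality of `M₂(ℤ_p)` applies.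
    have h3 : (∀ z ∈ integralPreimage δᵀ, traceChar (J ℚ_[p] * y) z = 1) ↔
        αᵀ * y ∈ intMat p (Fin 2) (Fin 2) := by
      rw [← J_mul_mem_intMat_iff, ← forall_traceChar_eq_one_iff]
      have hdet : δᵀ.det ≠ 0 := by rwa [det_transpose]
      have key : ∀ z, traceChar (J ℚ_[p] * y) z = traceChar (J ℚ_[p] * (αᵀ * y)) (δᵀ * z) := by
        intro z
        rw [traceChar_apply, traceChar_apply, transpose_mul, transpose_transpose,
          Matrix.mul_assoc zᵀ, ← Matrix.mul_assoc (J _), ← Matrix.mul_assoc δ]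
        have : δ * (J ℚ_[p] * αᵀ) = J ℚ_[p] := by
          have h4 := transpose_mul_J_mul δᵀ
          rw [transpose_transpose, det_transpose] at h4
          have h5 : δᵀ = δ.det • αᵀ := by rw [← transpose_smul, hα]
          rw [h5, Matrix.mul_smul, Matrix.mul_assoc] at h4
          exact smul_right_injective _ hδ h4
        rw [this]
      constructor
      · intro h z hz
        have e : δᵀ * (δᵀ⁻¹ * z) = z := by
          rw [← Matrix.mul_assoc, mul_nonsing_inv _ hdet.isUnit, Matrix.one_mul]
        rw [← e, ← key]
        exact h _ (by rw [mem_integralPreimage, e]; exact hz)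
      · intro h z hz
        rw [key]
        exact h _ hz
    simp only [h3, hX, h1, true_and]
    split_ifs with h6
    · rw [mul_comm]; rfl
    · rw [mul_zero]
  · have h2 : ∀ z, psi p (trace (zᵀ * J ℚ_[p] * y)) *
        (intMat p (Fin 2 ⊕ Fin 2) (Fin 2)).indicator 1 (fromRows (αᵀ * x) (δᵀ * (b • x + z)))
        = 0 := by
      intro z
      rw [Set.indicator_of_notMem (by simp [mem_intMat_fromRows, h1]), mul_zero]
    simp only [h2, integral_zero]
    rw [if_neg]
    rw [hX]
    exact fun h => h1 h.1

end Weil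

/-! ### Transport to `formG` and `formH`; left translations -/

section Transport

variable {p : ℕ} [Fact p.Prime] {n : Type*} [Fintype n] [DecidableEq n]

open Classical in
-- The form over `ℚ_p` is only propositionally the image of the integral one, and the group depends
-- on it. The coset formula is therefore restated with a free form, to which the equality is then
-- applied.
theorem setIntegral_heckeSet_of_eq {S T : Matrix n n ℤ_[p]} (hT : T * S = 1)
    {S' : Matrix n n ℚ_[p]} (hS' : S' = S.map (algebraMap ℤ_[p] ℚ_[p]))
    {i : ℕ} {ι : Type*} [Fintype ι]
    (R : ι → Matrix n n ℤ_[p]) (hR : ∀ j, (R j)ᵀ * S * R j = (p : ℤ_[p]) ^ 2 • S)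
    (hrank : ∀ j, ((R j).map (PadicInt.toZMod (p := p))).rank = i) (w : ι → ℂ)
    (hw : ∀ A : Matrix n n ℤ_[p], Aᵀ * S * A = (p : ℤ_[p]) ^ 2 • S →
      (A.map (PadicInt.toZMod (p := p))).rank = i →
      ∑ j, (if ∃ κ : Matrix n n ℤ_[p], A = R j * κ then w j else 0) = 1) :
    ∃ r : ι → isometryGroup S', (∀ j, ((r j : GL n ℚ_[p]) : Matrix n n ℚ_[p])
        = (p : ℚ_[p])⁻¹ • (R j).map (algebraMap ℤ_[p] ℚ_[p])) ∧
      ∀ f : isometryGroup S' → ℂ, (∀ g, ∀ k ∈ integralPoints S', f (g * k) = f g) →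
        IntegrableOn f (heckeSet S' i) (normalizedHaar S') ∧
          ∫ g in heckeSet S' i, f g ∂normalizedHaar S' = ∑ j, w j * f (r j) := by
  subst hS'
  exact ⟨fun j => scaledIsometry hT (R j) (hR j), fun j => rfl,
    fun f hf => setIntegral_heckeSet hT R hR hrank w hw f hf⟩

theorem mul_mem_heckeSet {S : Matrix n n ℚ_[p]} {i : ℕ} {u g : isometryGroup S}
    (hu : u ∈ integralPoints S) (hg : g ∈ heckeSet S i) : u * g ∈ heckeSet S i := by
  obtain ⟨U, hU⟩ := hu
  obtain ⟨A, hA, hr⟩ := hg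
  refine ⟨(U : Matrix n n ℤ_[p]) * A, ?_, ?_⟩
  · rw [Matrix.map_mul, hA, Subgroup.coe_mul, Units.val_mul, Matrix.mul_smul]
    congr 2
    exact congrArg Units.val hU
  · rw [Matrix.map_mul, rank_mul_eq_right_of_isUnit_det _ _ ?_, hr]
    have h1 : IsUnit (U : Matrix n n ℤ_[p]).det := (Matrix.isUnit_iff_isUnit_det _).1 U.isUnit
    have := h1.map (PadicInt.toZMod (p := p))
    rwa [RingHom.map_det] at this

/-- The Hecke set is stable under the integral points on the left, and Haar measure is left
invariant. -/
theorem setIntegral_heckeSet_mul_left {S : Matrix n n ℚ_[p]} {i : ℕ} {u : isometryGroup S}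
    (hu : u ∈ integralPoints S) (f : isometryGroup S → ℂ) :
    ∫ g in heckeSet S i, f (u * g) ∂normalizedHaar S
      = ∫ g in heckeSet S i, f g ∂normalizedHaar S := by
  have hpre : (fun g => u * g) ⁻¹' heckeSet S i = heckeSet S i := by
    ext g
    refine ⟨fun h => ?_, fun h => mul_mem_heckeSet hu h⟩
    have := mul_mem_heckeSet ((integralPoints S).inv_mem hu) h
    rwa [inv_mul_cancel_left] at this
  have := (measurePreserving_mul_left (normalizedHaar S) u).setIntegral_preimage_emb
    (measurableEmbedding_mulLeft u) f (heckeSet S i)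
  rwa [hpre] at this

end Transport

/-! ### Values at `X = p⁻¹ Y`, and vanishing when `p X` is not integral -/

section Values

variable {p : ℕ} [Fact p.Prime]

theorem integral_specialUnit_mul {B : Matrix (Fin 2) (Fin 2) ℤ_[p]} (hB : B.det = 1)
    (f : Matrix (Fin 2) (Fin 2) ℚ_[p] → ℂ) :
    ∫ z, f (B.map (algebraMap ℤ_[p] ℚ_[p]) * z) ∂matHaar p = ∫ z, f z ∂matHaar p := by
  set g := specialUnit B hB
  have hmap : (matHaar p).map (fun z => g • z) = matHaar p := by
    ext s hs
    rw [Measure.map_apply (continuous_const_smul g).measurable hs, Set.preimage_smul,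
      ← distribHaarChar_mul, map_inv, distribHaarChar_specialUnit]
    simp
  conv_rhs => rw [← hmap]
  exact ((Homeomorph.smul g).measurableEmbedding.integral_map f).symm

/-- The substitution of `ᵗB z` for `z` preserves the measure, and it preserves the pairing because
`B J ᵗB = J` for determinant one. -/
theorem weilH_levi_mul {B : Matrix (Fin 2) (Fin 2) ℤ_[p]} (hB : B.det = 1) {u : H p}
    (hu : ((u : GL (Fin 2 ⊕ Fin 2) ℚ_[p]) : Matrix (Fin 2 ⊕ Fin 2) (Fin 2 ⊕ Fin 2) ℚ_[p])
      = (levi B).map (algebraMap ℤ_[p] ℚ_[p])) (h : H p)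
    (X : Matrix (Fin 2) (Fin 2 ⊕ Fin 2) ℚ_[p]) :
    weilH (u * h) (phi0 p) X
      = weilH h (phi0 p) ((B.map (algebraMap ℤ_[p] ℚ_[p]))ᵀ * X) := by
  rw [weilH_phi0, weilH_phi0]
  have hBt : Bᵀ.det = 1 := by rw [det_transpose, hB]
  set b := B.map (algebraMap ℤ_[p] ℚ_[p]) with hb
  have hbt : Bᵀ.map (algebraMap ℤ_[p] ℚ_[p]) = bᵀ := Matrix.transpose_map
  have hbd : bᵀ.det = 1 := by
    rw [← hbt]
    have := (RingHom.map_det (algebraMap ℤ_[p] ℚ_[p]) Bᵀ).symm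
    rw [hBt, map_one] at this
    exact this
  have hJ : b * J ℚ_[p] * bᵀ = J ℚ_[p] := by
    have := transpose_mul_J_mul bᵀ
    rwa [transpose_transpose, hbd, one_smul] at this
  refine Eq.trans ?_ (integral_specialUnit_mul hBt _)
  refine integral_congr_ae (Filter.Eventually.of_forall fun z => ?_)
  simp only
  rw [hbt, show (bᵀ * X).toCols₂ = bᵀ * X.toCols₂ from rfl,
    show (bᵀ * X).toCols₁ = bᵀ * X.toCols₁ from rfl]
  have h1 : zᵀ * J ℚ_[p] * X.toCols₂ = (bᵀ * z)ᵀ * J ℚ_[p] * (bᵀ * X.toCols₂) := by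
    rw [transpose_mul, transpose_transpose]
    calc zᵀ * J ℚ_[p] * X.toCols₂ = zᵀ * (b * J ℚ_[p] * bᵀ) * X.toCols₂ := by rw [hJ]
      _ = _ := by simp only [Matrix.mul_assoc]
  have h2 : ((u * h : GL (Fin 2 ⊕ Fin 2) ℚ_[p]) :
        Matrix (Fin 2 ⊕ Fin 2) (Fin 2 ⊕ Fin 2) ℚ_[p])ᵀ * fromRows X.toCols₁ z
      = ((h : GL (Fin 2 ⊕ Fin 2) ℚ_[p]) : Matrix (Fin 2 ⊕ Fin 2) (Fin 2 ⊕ Fin 2) ℚ_[p])ᵀ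
        * fromRows (bᵀ * X.toCols₁) (bᵀ * z) := by
    rw [Units.val_mul, transpose_mul, hu, Matrix.mul_assoc, map_levi, ← hb, levi,
      fromBlocks_transpose, fromBlocks_mul_fromRows]
    simp
  rw [← h1, ← h2]
  rfl

theorem exists_leviIsometry {B : Matrix (Fin 2) (Fin 2) ℤ_[p]} (hB : B.det = 1) :
    ∃ u ∈ integralPoints (formH p),
      ((u : GL (Fin 2 ⊕ Fin 2) ℚ_[p]) : Matrix (Fin 2 ⊕ Fin 2) (Fin 2 ⊕ Fin 2) ℚ_[p])
      = (levi B).map (algebraMap ℤ_[p] ℚ_[p]) := by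
  have key : ∀ S' : Matrix (Fin 2 ⊕ Fin 2) (Fin 2 ⊕ Fin 2) ℚ_[p],
      S' = (orth ℤ_[p]).map (algebraMap ℤ_[p] ℚ_[p]) → ∃ u ∈ integralPoints S',
      ((u : GL (Fin 2 ⊕ Fin 2) ℚ_[p]) : Matrix (Fin 2 ⊕ Fin 2) (Fin 2 ⊕ Fin 2) ℚ_[p])
      = (levi B).map (algebraMap ℤ_[p] ℚ_[p]) := by
    rintro _ rfl
    refine ⟨isometryOfMatrix (emb_mul_eq_one (orth_mul_orth ℤ_[p]))
      ((levi B).map (algebraMap ℤ_[p] ℚ_[p])) ?_, ?_, rfl⟩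
    · rw [← Matrix.transpose_map, ← Matrix.map_mul, ← Matrix.map_mul, levi_isometry, hB, one_smul]
    · rw [mem_integralPoints_iff_mem_intMat (orth_mul_orth ℤ_[p])]
      exact emb_mem_intMat _
  exact key _ (formH_eq p)

/-- The factor `ᵗB` is absorbed by left translation by `levi B`, an integral point. This permits
normalising the rows of `X`. -/
theorem setIntegral_weilH_transpose_mul {B : Matrix (Fin 2) (Fin 2) ℤ_[p]} (hB : B.det = 1)
    (i : ℕ) (X : Matrix (Fin 2) (Fin 2 ⊕ Fin 2) ℚ_[p]) :
    ∫ h in heckeSet (formH p) i,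
        weilH h (phi0 p) ((B.map (algebraMap ℤ_[p] ℚ_[p]))ᵀ * X) ∂normalizedHaar (formH p)
      = ∫ h in heckeSet (formH p) i, weilH h (phi0 p) X ∂normalizedHaar (formH p) := by
  obtain ⟨u, hu, hc⟩ := exists_leviIsometry hB
  rw [← setIntegral_heckeSet_mul_left hu (fun h => weilH h (phi0 p) X)]
  simp only [weilH_levi_mul hB hc]

theorem transpose_mul_mem_intMat_iff {B : Matrix (Fin 2) (Fin 2) ℤ_[p]} (hB : B.det = 1)
    {n : Type*} (X : Matrix (Fin 2) n ℚ_[p]) :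
    (B.map (algebraMap ℤ_[p] ℚ_[p]))ᵀ * X ∈ intMat p (Fin 2) n ↔ X ∈ intMat p (Fin 2) n := by
  have hBt : Bᵀ.det = 1 := by rw [det_transpose, hB]
  refine ⟨fun h => ?_, fun h => mul_mem_intMat (transpose_mem_intMat_iff.2 (emb_mem_intMat B)) h⟩
  have h1 := mul_mem_intMat (emb_mem_intMat Bᵀ⁻¹) h
  rwa [← Matrix.mul_assoc, ← Matrix.transpose_map, ← Matrix.map_mul,
    nonsing_inv_mul _ (by rw [hBt]; exact isUnit_one), Matrix.map_one _ (map_zero _) (map_one _),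
    Matrix.one_mul] at h1

theorem weilG_phi0_transpose_mul {B : Matrix (Fin 2) (Fin 2) ℤ_[p]} (hB : B.det = 1)
    (g : G p) (X : Matrix (Fin 2) (Fin 2 ⊕ Fin 2) ℚ_[p]) :
    weilG g (phi0 p) ((B.map (algebraMap ℤ_[p] ℚ_[p]))ᵀ * X) = weilG g (phi0 p) X := by
  rw [weilG_phi0, weilG_phi0]
  refine Set.indicator_eq_indicator ?_ rfl
  rw [Matrix.mul_assoc, transpose_mul_mem_intMat_iff hB]

theorem phi0_transpose_mul {B : Matrix (Fin 2) (Fin 2) ℤ_[p]} (hB : B.det = 1)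
    (X : Matrix (Fin 2) (Fin 2 ⊕ Fin 2) ℚ_[p]) :
    phi0 p ((B.map (algebraMap ℤ_[p] ℚ_[p]))ᵀ * X) = phi0 p X := by
  unfold phi0
  exact Set.indicator_eq_indicator (transpose_mul_mem_intMat_iff hB X) rfl

/-- The divisibility of all entries of a matrix. -/
def DvdMat {R m n : Type*} [CommRing R] (c : R) (A : Matrix m n R) : Prop := ∀ i j, c ∣ A i j

theorem inv_pow_smul_emb_mem_intMat_iff {m n : Type*} (k : ℕ) (A : Matrix m n ℤ_[p]) :
    ((p : ℚ_[p]) ^ k)⁻¹ • A.map (algebraMap ℤ_[p] ℚ_[p]) ∈ intMat p m n ↔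
      DvdMat ((p : ℤ_[p]) ^ k) A := by
  rw [mem_intMat_iff]
  refine forall_congr' fun i => forall_congr' fun j => ?_
  exact norm_coe_le_one_of_dvd_iff k (A i j)

open Classical in
theorem weilG_phi0_apply {r : G p} {R : Matrix (Fin 2 ⊕ Fin 2) (Fin 2 ⊕ Fin 2) ℤ_[p]}
    (hr : ((r : GL (Fin 2 ⊕ Fin 2) ℚ_[p]) : Matrix (Fin 2 ⊕ Fin 2) (Fin 2 ⊕ Fin 2) ℚ_[p])
      = (p : ℚ_[p])⁻¹ • R.map (algebraMap ℤ_[p] ℚ_[p]))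
    (Y : Matrix (Fin 2) (Fin 2 ⊕ Fin 2) ℤ_[p]) :
    weilG r (phi0 p) ((p : ℚ_[p])⁻¹ • Y.map (algebraMap ℤ_[p] ℚ_[p]))
      = if DvdMat ((p : ℤ_[p]) ^ 2) (Y * R) then 1 else 0 := by
  rw [weilG_phi0, hr, Matrix.smul_mul, Matrix.mul_smul, smul_smul, ← mul_inv, ← pow_two,
    ← Matrix.map_mul, Set.indicator_apply, inv_pow_smul_emb_mem_intMat_iff]
  rfl

/-- The matrix `p r⁻¹` is integral too, so integrality of `X r` implies that of `p X = (X r) (p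
r⁻¹)`. -/
theorem weilG_phi0_eq_zero {r : G p} {R : Matrix (Fin 2 ⊕ Fin 2) (Fin 2 ⊕ Fin 2) ℤ_[p]}
    (hr : ((r : GL (Fin 2 ⊕ Fin 2) ℚ_[p]) : Matrix (Fin 2 ⊕ Fin 2) (Fin 2 ⊕ Fin 2) ℚ_[p])
      = (p : ℚ_[p])⁻¹ • R.map (algebraMap ℤ_[p] ℚ_[p]))
    {X : Matrix (Fin 2) (Fin 2 ⊕ Fin 2) ℚ_[p]}
    (hX : (p : ℚ_[p]) • X ∉ intMat p (Fin 2) (Fin 2 ⊕ Fin 2)) : weilG r (phi0 p) X = 0 := by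
  rw [weilG_phi0]
  refine Set.indicator_of_notMem (fun h => hX ?_) _
  have hinv := coe_inv_isometryGroup (S := formG p) (T := -formG p) (by
    rw [formG_eq, map_symp]; exact neg_symp_mul_symp _) r
  have hint : (p : ℚ_[p]) • (((r : GL (Fin 2 ⊕ Fin 2) ℚ_[p])⁻¹ : GL (Fin 2 ⊕ Fin 2) ℚ_[p]) :
      Matrix (Fin 2 ⊕ Fin 2) (Fin 2 ⊕ Fin 2) ℚ_[p])
      ∈ intMat p (Fin 2 ⊕ Fin 2) (Fin 2 ⊕ Fin 2) := by
    have hG : formG p ∈ intMat p (Fin 2 ⊕ Fin 2) (Fin 2 ⊕ Fin 2) := by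
      rw [formG_eq]; exact emb_mem_intMat _
    rw [hinv, hr, transpose_smul, Matrix.mul_smul, Matrix.smul_mul, smul_smul,
      mul_inv_cancel₀ coe_p_ne_zero', one_smul]
    exact mul_mem_intMat (mul_mem_intMat (neg_mem_intMat_iff.2 hG)
      (transpose_mem_intMat_iff.2 (emb_mem_intMat _))) hG
  have := mul_mem_intMat h hint
  rwa [Matrix.mul_smul, Matrix.mul_assoc, ← Units.val_mul, mul_inv_cancel, Units.val_one,
    Matrix.mul_one] at this

/-- For `2 × 2` matrices the parabolic relation `δ = J⁻¹ ᵗα⁻¹ J` reads `δ = det δ • α`. The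
hypothesis is this relation for the integral matrices `A = p α` and `D = p δ`. -/
theorem det_inv_smul_smul {A D : Matrix (Fin 2) (Fin 2) ℤ_[p]}
    (hA : D.det • A = (p : ℤ_[p]) ^ 2 • D) :
    ((p : ℚ_[p])⁻¹ • D.map (algebraMap ℤ_[p] ℚ_[p])).det •
      ((p : ℚ_[p])⁻¹ • A.map (algebraMap ℤ_[p] ℚ_[p]))
      = (p : ℚ_[p])⁻¹ • D.map (algebraMap ℤ_[p] ℚ_[p]) := by
  have hp := coe_p_ne_zero' (p := p)
  have h1 := congrArg (fun M : Matrix (Fin 2) (Fin 2) ℤ_[p] =>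
    M.map (algebraMap ℤ_[p] ℚ_[p])) hA
  simp only [emb_smul] at h1
  have h2 : (D.map (algebraMap ℤ_[p] ℚ_[p])).det = ((D.det : ℤ_[p]) : ℚ_[p]) :=
    (RingHom.map_det (algebraMap ℤ_[p] ℚ_[p]) D).symm
  rw [det_smul, h2, Fintype.card_fin, smul_comm, mul_smul, h1, smul_smul (_ ^ 2)]
  push_cast
  rw [inv_pow, inv_mul_cancel₀ (pow_ne_zero 2 hp), one_smul]

theorem det_inv_smul_ne_zero {D : Matrix (Fin 2) (Fin 2) ℤ_[p]} (hD : D.det ≠ 0) :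
    ((p : ℚ_[p])⁻¹ • D.map (algebraMap ℤ_[p] ℚ_[p])).det ≠ 0 := by
  have h2 : (D.map (algebraMap ℤ_[p] ℚ_[p])).det = ((D.det : ℤ_[p]) : ℚ_[p]) :=
    (RingHom.map_det (algebraMap ℤ_[p] ℚ_[p]) D).symm
  rw [det_smul, h2]
  exact mul_ne_zero (pow_ne_zero _ (inv_ne_zero coe_p_ne_zero'))
    fun h => hD (Subtype.ext h)

/-- On the support `p⁻¹ ᵗA X` is integral. The relation between `A` and `D` says that the transposed
adjugate of `D` times `ᵗA` is `p²`, so `p X` is integral. -/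
theorem weilH_phi0_eq_zero {h : H p} {A D : Matrix (Fin 2) (Fin 2) ℤ_[p]} {b : ℚ_[p]}
    (hh : ((h : GL (Fin 2 ⊕ Fin 2) ℚ_[p]) : Matrix (Fin 2 ⊕ Fin 2) (Fin 2 ⊕ Fin 2) ℚ_[p])
      = fromBlocks ((p : ℚ_[p])⁻¹ • A.map (algebraMap ℤ_[p] ℚ_[p]))
        (b • ((p : ℚ_[p])⁻¹ • D.map (algebraMap ℤ_[p] ℚ_[p]))) 0
        ((p : ℚ_[p])⁻¹ • D.map (algebraMap ℤ_[p] ℚ_[p])))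
    (hA : D.det • A = (p : ℤ_[p]) ^ 2 • D) (hD : D.det ≠ 0)
    {X : Matrix (Fin 2) (Fin 2 ⊕ Fin 2) ℚ_[p]}
    (hX : (p : ℚ_[p]) • X ∉ intMat p (Fin 2) (Fin 2 ⊕ Fin 2)) : weilH h (phi0 p) X = 0 := by
  rw [weilH_phi0_parabolic hh (det_inv_smul_smul hA) (det_inv_smul_ne_zero hD), if_neg]
  intro h1
  refine hX ?_
  have h2 : (adjugate D)ᵀ * Aᵀ = (p : ℤ_[p]) ^ 2 • 1 := by
    refine smul_right_injective _ hD ?_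
    simp only
    rw [← Matrix.mul_smul, ← transpose_smul, hA, ← transpose_mul, Matrix.smul_mul, mul_adjugate,
      transpose_smul, transpose_smul, transpose_one, smul_comm]
  have h3 := mul_mem_intMat (emb_mem_intMat (adjugate D)ᵀ) h1
  have h4 := congrArg (fun M : Matrix (Fin 2) (Fin 2) ℤ_[p] =>
    M.map (algebraMap ℤ_[p] ℚ_[p])) h2
  simp only [emb_smul, Matrix.map_mul] at h4
  rw [Matrix.map_one _ (map_zero _) (map_one _)] at h4
  rw [transpose_smul, ← Matrix.transpose_map (M := A), Matrix.smul_mul, Matrix.mul_smul,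
    ← Matrix.mul_assoc, h4, Matrix.smul_mul, Matrix.one_mul, smul_smul] at h3
  convert h3 using 2
  push_cast
  field_simp [coe_p_ne_zero' (p := p)]

theorem pairing_smul {R : Type*} [CommRing R] (c : R) (X : Matrix (Fin 2) (Fin 2 ⊕ Fin 2) R) :
    pairing (c • X) = c ^ 2 * pairing X := by
  have h1 : (c • X).toCols₁ = c • X.toCols₁ := rfl
  have h2 : (c • X).toCols₂ = c • X.toCols₂ := rfl
  rw [pairing, h1, h2, transpose_smul, Matrix.smul_mul, Matrix.smul_mul, Matrix.mul_smul, smul_smul,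
    trace_smul, pairing, smul_eq_mul, pow_two]

theorem pairing_eq {R : Type*} [CommRing R] (X : Matrix (Fin 2) (Fin 2 ⊕ Fin 2) R) :
    pairing X = X 0 (.inl 0) * X 1 (.inr 0) + X 0 (.inl 1) * X 1 (.inr 1)
      - X 1 (.inl 0) * X 0 (.inr 0) - X 1 (.inl 1) * X 0 (.inr 1) := by
  simp [pairing, trace_fin_two, mul_apply, Fin.sum_univ_two, J]
  ring

theorem pairing_map (Y : Matrix (Fin 2) (Fin 2 ⊕ Fin 2) ℤ_[p]) :
    pairing (Y.map (algebraMap ℤ_[p] ℚ_[p])) = ((pairing Y : ℤ_[p]) : ℚ_[p]) := by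
  rw [pairing_eq, pairing_eq]
  simp

open Classical in
-- The elementary divisors `pⁱ` and `pʲ` of `δ` supply the volume `|det δ|⁻² = p ^ (2 (i + j))`.
theorem weilH_phi0_apply {h : H p} {A D B : Matrix (Fin 2) (Fin 2) ℤ_[p]} {b : ℚ_[p]}
    (hh : ((h : GL (Fin 2 ⊕ Fin 2) ℚ_[p]) : Matrix (Fin 2 ⊕ Fin 2) (Fin 2 ⊕ Fin 2) ℚ_[p])
      = fromBlocks ((p : ℚ_[p])⁻¹ • A.map (algebraMap ℤ_[p] ℚ_[p]))
        (b • ((p : ℚ_[p])⁻¹ • D.map (algebraMap ℤ_[p] ℚ_[p]))) 0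
        ((p : ℚ_[p])⁻¹ • D.map (algebraMap ℤ_[p] ℚ_[p])))
    (hA : D.det • A = (p : ℤ_[p]) ^ 2 • D) (hD : D.det ≠ 0) (hB : B.det = 1) {i j : ℤ}
    (hDB : (p : ℚ_[p])⁻¹ • D.map (algebraMap ℤ_[p] ℚ_[p]) = B.map (algebraMap ℤ_[p] ℚ_[p])
      * diagonal ![(p : ℚ_[p]) ^ i, (p : ℚ_[p]) ^ j])
    (Y : Matrix (Fin 2) (Fin 2 ⊕ Fin 2) ℤ_[p]) :
    weilH h (phi0 p) ((p : ℚ_[p])⁻¹ • Y.map (algebraMap ℤ_[p] ℚ_[p]))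
      = if DvdMat ((p : ℤ_[p]) ^ 2) (Aᵀ * Y) then (p : ℂ) ^ (2 * (i + j)) *
        psi p (-(b * (((p : ℚ_[p]) ^ 2)⁻¹ * pairing Y))) else 0 := by
  rw [weilH_phi0_parabolic hh (det_inv_smul_smul hA) (det_inv_smul_ne_zero hD), hDB,
    matHaar_real_preimage hB, pairing_smul, inv_pow, pairing_map, transpose_smul, Matrix.smul_mul,
    Matrix.mul_smul, smul_smul, ← mul_inv, ← pow_two, ← Matrix.transpose_map, ← Matrix.map_mul,
    inv_pow_smul_emb_mem_intMat_iff]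
  push_cast
  rfl

end Values

/-! ### Ranks of the representatives modulo `p` -/

section Ranks

variable {p : ℕ} [Fact p.Prime]

theorem rank_vecMulVec_eq_one {F m n : Type*} [Field F] [Fintype m] [Fintype n] [DecidableEq m]
    [DecidableEq n] {u : m → F} {v : n → F} (hu : u ≠ 0) (hv : v ≠ 0) :
    (vecMulVec u v).rank = 1 := by
  refine le_antisymm (rank_vecMulVec_le _ _) (Nat.one_le_iff_ne_zero.2 fun h => ?_)
  obtain ⟨a, P, hAP, -⟩ := exists_rank_factorization _ h
  obtain ⟨i, hi⟩ := Function.ne_iff.1 hu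
  obtain ⟨j, hj⟩ := Function.ne_iff.1 hv
  have := congrFun (congrFun hAP i) j
  rw [vecMulVec_apply, mul_apply] at this
  exact mul_ne_zero hi hj (by simpa using this)

theorem rank_orthRepOne {A : Matrix (Fin 2) (Fin 2) ℤ_[p]} {a : Fin 2 → ZMod p} (ha : a ≠ 0)
    (hAa : ∀ i, PadicInt.toZMod (A i 0) = a i) (o : Option (ZMod p)) :
    ((orthRepOne A (o.map lift)).map (PadicInt.toZMod (p := p))).rank = 1 := by
  obtain ⟨e, he, h⟩ := orthRepOne_reduction hAa o
  rw [h, rank_vecMulVec_eq_one (isotropicVec_ne_zero ha o) he]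

theorem rank_orthRepUnip (b : ZMod p) :
    ((orthRepUnip b).map (PadicInt.toZMod (p := p))).rank = 2 := by
  by_cases hb : b = 0
  · have h : (orthRepUnip b).map (PadicInt.toZMod (p := p))
        = (fromRows 1 0 : Matrix (Fin 2 ⊕ Fin 2) (Fin 2) (ZMod p))
          * (fromCols 1 0 : Matrix (Fin 2) (Fin 2 ⊕ Fin 2) (ZMod p)) := by
      ext (i | i) (j | j) <;> simp [orthRepUnip, hb, mul_apply, one_apply, apply_ite]
    rw [h]
    exact rank_eq_of_left_right_inverse
      (N := (fromCols 1 0 : Matrix (Fin 2) (Fin 2 ⊕ Fin 2) (ZMod p)))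
      (M := (fromRows 1 0 : Matrix (Fin 2 ⊕ Fin 2) (Fin 2) (ZMod p)))
      (by simp [fromCols_mul_fromRows]) (by simp [fromCols_mul_fromRows])
  · have h : (orthRepUnip b).map (PadicInt.toZMod (p := p))
        = (fromRows (b • 1) 0 : Matrix (Fin 2 ⊕ Fin 2) (Fin 2) (ZMod p))
          * (fromCols 0 1 : Matrix (Fin 2) (Fin 2 ⊕ Fin 2) (ZMod p)) := by
      ext (i | i) (j | j) <;> fin_cases i <;> fin_cases j <;> simp [orthRepUnip, hb, mul_apply]
    rw [h]
    exact rank_eq_of_left_right_inverse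
      (N := (fromCols (b⁻¹ • 1) 0 : Matrix (Fin 2) (Fin 2 ⊕ Fin 2) (ZMod p)))
      (M := (fromRows 0 1 : Matrix (Fin 2 ⊕ Fin 2) (Fin 2) (ZMod p)))
      (by simp [fromCols_mul_fromRows, smul_smul, hb]) (by simp [fromCols_mul_fromRows])

theorem rank_orthRepScalar (b : ℤ_[p]) :
    ((orthRepScalar b).map (PadicInt.toZMod (p := p))).rank = 2 := by
  have h : (orthRepScalar b).map (PadicInt.toZMod (p := p))
      = (fromRows (PadicInt.toZMod b • 1) 1 : Matrix (Fin 2 ⊕ Fin 2) (Fin 2) (ZMod p))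
        * (fromCols 0 1 : Matrix (Fin 2) (Fin 2 ⊕ Fin 2) (ZMod p)) := by
    ext (i | i) (j | j) <;> fin_cases i <;> fin_cases j <;> simp [orthRepScalar, mul_apply]
  rw [h]
  exact rank_eq_of_left_right_inverse
    (N := (fromCols 0 1 : Matrix (Fin 2) (Fin 2 ⊕ Fin 2) (ZMod p)))
    (M := (fromRows 0 1 : Matrix (Fin 2 ⊕ Fin 2) (Fin 2) (ZMod p)))
    (by simp [fromCols_mul_fromRows]) (by simp [fromCols_mul_fromRows])

theorem rank_orthRepLevi {A : Matrix (Fin 2) (Fin 2) ℤ_[p]} (hA : A.det = 1) (c : ℤ_[p]) :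
    ((orthRepLevi A c).map (PadicInt.toZMod (p := p))).rank = 2 := by
  obtain ⟨k', hk, -, -⟩ := isometry_inverse (orth_mul_orth _)
    (show (levi A)ᵀ * orth ℤ_[p] * levi A = orth ℤ_[p] by rw [levi_isometry, hA, one_smul])
  have h : (levi !![1, 0; p * c, (p : ℤ_[p]) ^ 2]).map (PadicInt.toZMod (p := p))
      = (fromRows !![1, 0; 0, 0] !![0, 1; 0, 0] : Matrix (Fin 2 ⊕ Fin 2) (Fin 2) (ZMod p))
        * (fromCols !![1, 0; 0, 0] !![0, 0; 1, 0] : Matrix (Fin 2) (Fin 2 ⊕ Fin 2) (ZMod p)) := by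
    ext (i | i) (j | j) <;> fin_cases i <;> fin_cases j <;>
      simp [levi]
  have hk' : k'.map (PadicInt.toZMod (p := p)) * (levi A).map (PadicInt.toZMod (p := p)) = 1 := by
    rw [← Matrix.map_mul, hk, Matrix.map_one _ (map_zero _) (map_one _)]
  have hN : (fromCols !![1, 0; 0, 0] !![0, 0; 1, 0] : Matrix (Fin 2) (Fin 2 ⊕ Fin 2) (ZMod p))
      * (fromRows !![1, 0; 0, 0] !![0, 1; 0, 0] : Matrix (Fin 2 ⊕ Fin 2) (Fin 2) (ZMod p)) = 1 := by
    rw [fromCols_mul_fromRows]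
    ext i j
    fin_cases i <;> fin_cases j <;> simp
  rw [orthRepLevi, levi_mul, Matrix.map_mul, h, ← Matrix.mul_assoc]
  refine rank_eq_of_left_right_inverse
    (N := (fromCols !![1, 0; 0, 0] !![0, 0; 1, 0] : Matrix (Fin 2) (Fin 2 ⊕ Fin 2) (ZMod p))
      * k'.map (PadicInt.toZMod (p := p))) ?_ hN
  rw [Matrix.mul_assoc, ← Matrix.mul_assoc (k'.map _), hk', Matrix.one_mul, hN]

theorem rank_sympRepOne {k : Matrix (Fin 2 ⊕ Fin 2) (Fin 2 ⊕ Fin 2) ℤ_[p]}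
    {a : Fin 2 ⊕ Fin 2 → ZMod p} (ha : a ≠ 0)
    (hka : k.map (PadicInt.toZMod (p := p)) *ᵥ Pi.single (.inl 0) 1 = a) (c : ℤ_[p]) :
    ((k * sympRepOne c).map (PadicInt.toZMod (p := p))).rank = 1 := by
  rw [Matrix.map_mul, sympRepOne_reduction, mul_vecMulVec, hka]
  exact rank_vecMulVec_eq_one ha (by simp)

theorem rank_sympRepTwo {k : Matrix (Fin 2 ⊕ Fin 2) (Fin 2 ⊕ Fin 2) ℤ_[p]}
    {a : Matrix (Fin 2 ⊕ Fin 2) (Fin 2) (ZMod p)}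
    {N : Matrix (Fin 2) (Fin 2 ⊕ Fin 2) (ZMod p)} (hN : N * a = 1)
    (hka : (k.map (PadicInt.toZMod (p := p))).toCols₁ = a) (S : Matrix (Fin 2) (Fin 2) ℤ_[p]) :
    ((k * sympRepTwo S).map (PadicInt.toZMod (p := p))).rank = 2 := by
  have h : k.map (PadicInt.toZMod (p := p))
      * (fromRows 1 0 : Matrix (Fin 2 ⊕ Fin 2) (Fin 2) (ZMod p)) = a := by
    rw [← hka]
    ext i j
    simp [mul_apply, one_apply]
  rw [Matrix.map_mul, sympRepTwo_reduction, ← Matrix.mul_assoc, h]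
  exact rank_eq_of_left_right_inverse hN
    (M := (fromRows 1 0 : Matrix (Fin 2 ⊕ Fin 2) (Fin 2) (ZMod p))) (by simp [fromCols_mul_fromRows])

end Ranks

/-! ### Contribution of each representative for `H` -/

section RepresentativeValues

variable {p : ℕ} [Fact p.Prime]

theorem emb_mul_diagonal {A : Matrix (Fin 2) (Fin 2) ℤ_[p]} {d : Fin 2 → ℤ_[p]} {i j : ℤ}
    (h0 : (p : ℚ_[p])⁻¹ * d 0 = (p : ℚ_[p]) ^ i) (h1 : (p : ℚ_[p])⁻¹ * d 1 = (p : ℚ_[p]) ^ j) :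
    (p : ℚ_[p])⁻¹ • (A * diagonal d).map (algebraMap ℤ_[p] ℚ_[p])
      = A.map (algebraMap ℤ_[p] ℚ_[p]) * diagonal ![(p : ℚ_[p]) ^ i, (p : ℚ_[p]) ^ j] := by
  ext k l
  fin_cases l
  · simp [← h0, -Matrix.map_mul]
    ring
  · simp [← h1, -Matrix.map_mul]
    ring

open Classical in
theorem weilH_orthRepOne_none {A : Matrix (Fin 2) (Fin 2) ℤ_[p]} (hA : A.det = 1) {h : H p}
    (hh : ((h : GL (Fin 2 ⊕ Fin 2) ℚ_[p]) : Matrix (Fin 2 ⊕ Fin 2) (Fin 2 ⊕ Fin 2) ℚ_[p])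
      = (p : ℚ_[p])⁻¹ • (orthRepOne A none).map (algebraMap ℤ_[p] ℚ_[p])) :
    (∀ X, (p : ℚ_[p]) • X ∉ intMat p (Fin 2) (Fin 2 ⊕ Fin 2) → weilH h (phi0 p) X = 0) ∧
    ∀ Y : Matrix (Fin 2) (Fin 2 ⊕ Fin 2) ℤ_[p],
      weilH h (phi0 p) ((p : ℚ_[p])⁻¹ • Y.map (algebraMap ℤ_[p] ℚ_[p]))
      = if DvdMat ((p : ℤ_[p]) ^ 2) ((A * diagonal ![1, (p : ℤ_[p])])ᵀ * Y)
        then (p : ℂ) ^ 2 else 0 := by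
  have hp := coe_p_ne_zero (p := p)
  have hp' := coe_p_ne_zero' (p := p)
  have hh' : ((h : GL (Fin 2 ⊕ Fin 2) ℚ_[p]) : Matrix (Fin 2 ⊕ Fin 2) (Fin 2 ⊕ Fin 2) ℚ_[p])
      = fromBlocks ((p : ℚ_[p])⁻¹ • (A * diagonal ![1, (p : ℤ_[p])]).map (algebraMap ℤ_[p] ℚ_[p]))
        ((0 : ℚ_[p]) • ((p : ℚ_[p])⁻¹ • (A * diagonal ![(p : ℤ_[p]), (p : ℤ_[p]) ^ 2]).map
          (algebraMap ℤ_[p] ℚ_[p]))) 0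
        ((p : ℚ_[p])⁻¹ • (A * diagonal ![(p : ℤ_[p]), (p : ℤ_[p]) ^ 2]).map
          (algebraMap ℤ_[p] ℚ_[p])) := by
    rw [hh]
    ext (i | i) (j | j) <;> simp [-Matrix.map_mul, orthRepOne, levi]
  have hdet : (A * diagonal ![(p : ℤ_[p]), (p : ℤ_[p]) ^ 2]).det = (p : ℤ_[p]) ^ 3 := by
    rw [det_mul, hA, det_diagonal]
    simp [Fin.prod_univ_two]
    ring
  have hD : (A * diagonal ![(p : ℤ_[p]), (p : ℤ_[p]) ^ 2]).det ≠ 0 := by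
    rw [hdet]; exact pow_ne_zero _ hp
  have hAD : (A * diagonal ![(p : ℤ_[p]), (p : ℤ_[p]) ^ 2]).det • (A * diagonal ![1, (p : ℤ_[p])])
      = (p : ℤ_[p]) ^ 2 • (A * diagonal ![(p : ℤ_[p]), (p : ℤ_[p]) ^ 2]) := by
    rw [hdet]
    ext i j
    fin_cases j <;> simp <;> ring
  refine ⟨fun X hX => weilH_phi0_eq_zero hh' hAD hD hX, fun Y => ?_⟩
  -- Here `δ` is `A` times `diag(1, p)`, which gives the volume `p²`.
  rw [weilH_phi0_apply hh' hAD hD hA (i := 0) (j := 1) (emb_mul_diagonal (by simp [hp'])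
    (by simp [hp', pow_two]))]
  simp

open Classical in
theorem weilH_orthRepOne_some {A : Matrix (Fin 2) (Fin 2) ℤ_[p]} (hA : A.det = 1) (b : ℤ_[p])
    {h : H p}
    (hh : ((h : GL (Fin 2 ⊕ Fin 2) ℚ_[p]) : Matrix (Fin 2 ⊕ Fin 2) (Fin 2 ⊕ Fin 2) ℚ_[p])
      = (p : ℚ_[p])⁻¹ • (orthRepOne A (some b)).map (algebraMap ℤ_[p] ℚ_[p])) :
    (∀ X, (p : ℚ_[p]) • X ∉ intMat p (Fin 2) (Fin 2 ⊕ Fin 2) → weilH h (phi0 p) X = 0) ∧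
    ∀ Y : Matrix (Fin 2) (Fin 2 ⊕ Fin 2) ℤ_[p],
      weilH h (phi0 p) ((p : ℚ_[p])⁻¹ • Y.map (algebraMap ℤ_[p] ℚ_[p]))
      = if DvdMat ((p : ℤ_[p]) ^ 2) ((A * diagonal ![(p : ℤ_[p]), (p : ℤ_[p]) ^ 2])ᵀ * Y)
        then ((p : ℂ) ^ 2)⁻¹ * psi p (-(b * (((p : ℚ_[p]) ^ 2)⁻¹ * pairing Y))) else 0 := by
  have hp := coe_p_ne_zero (p := p)
  have hp' := coe_p_ne_zero' (p := p)
  have hh' : ((h : GL (Fin 2 ⊕ Fin 2) ℚ_[p]) : Matrix (Fin 2 ⊕ Fin 2) (Fin 2 ⊕ Fin 2) ℚ_[p])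
      = fromBlocks ((p : ℚ_[p])⁻¹ • (A * diagonal ![(p : ℤ_[p]), (p : ℤ_[p]) ^ 2]).map
          (algebraMap ℤ_[p] ℚ_[p]))
        ((b : ℚ_[p]) • ((p : ℚ_[p])⁻¹ • (A * diagonal ![1, (p : ℤ_[p])]).map
          (algebraMap ℤ_[p] ℚ_[p]))) 0
        ((p : ℚ_[p])⁻¹ • (A * diagonal ![1, (p : ℤ_[p])]).map (algebraMap ℤ_[p] ℚ_[p])) := by
    rw [hh]
    ext (i | i) (j | j) <;> simp [-Matrix.map_mul, orthRepOne, levi, unip, fromBlocks_multiply]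
    ring
  have hdet : (A * diagonal ![1, (p : ℤ_[p])]).det = (p : ℤ_[p]) := by
    rw [det_mul, hA, det_diagonal]
    simp [Fin.prod_univ_two]
  have hD : (A * diagonal ![1, (p : ℤ_[p])]).det ≠ 0 := by
    rw [hdet]; exact hp
  have hAD : (A * diagonal ![1, (p : ℤ_[p])]).det • (A * diagonal ![(p : ℤ_[p]), (p : ℤ_[p]) ^ 2])
      = (p : ℤ_[p]) ^ 2 • (A * diagonal ![1, (p : ℤ_[p])]) := by
    rw [hdet]
    ext i j
    fin_cases j <;> simp <;> ring
  refine ⟨fun X hX => weilH_phi0_eq_zero hh' hAD hD hX, fun Y => ?_⟩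
  -- Here `δ` is `A` times `diag(p⁻¹, 1)`, which gives the volume `p⁻²`.
  rw [weilH_phi0_apply hh' hAD hD hA (i := -1) (j := 0) (emb_mul_diagonal (by simp)
    (by simp [hp']))]
  rw [show (2 * (-1 + 0) : ℤ) = -(2 : ℕ) by norm_num, _root_.zpow_neg, zpow_natCast]

open Classical in
theorem weilH_orthRepUnip (b : ZMod p) {h : H p}
    (hh : ((h : GL (Fin 2 ⊕ Fin 2) ℚ_[p]) : Matrix (Fin 2 ⊕ Fin 2) (Fin 2 ⊕ Fin 2) ℚ_[p])
      = (p : ℚ_[p])⁻¹ • (orthRepUnip b).map (algebraMap ℤ_[p] ℚ_[p])) :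
    (∀ X, (p : ℚ_[p]) • X ∉ intMat p (Fin 2) (Fin 2 ⊕ Fin 2) → weilH h (phi0 p) X = 0) ∧
    ∀ Y : Matrix (Fin 2) (Fin 2 ⊕ Fin 2) ℤ_[p],
      weilH h (phi0 p) ((p : ℚ_[p])⁻¹ • Y.map (algebraMap ℤ_[p] ℚ_[p]))
      = if b = 0 then if DvdMat ((p : ℤ_[p]) ^ 2) Y then (p : ℂ) ^ 4 else 0
        else if DvdMat (p : ℤ_[p]) Y then
          psi p (-(lift b * ((p : ℚ_[p])⁻¹ * (((p : ℚ_[p]) ^ 2)⁻¹ * pairing Y)))) else 0 := by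
  have hp := coe_p_ne_zero (p := p)
  have hp' := coe_p_ne_zero' (p := p)
  split_ifs with hb
  · have hh' : ((h : GL (Fin 2 ⊕ Fin 2) ℚ_[p]) : Matrix (Fin 2 ⊕ Fin 2) (Fin 2 ⊕ Fin 2) ℚ_[p])
        = fromBlocks ((p : ℚ_[p])⁻¹ • (1 : Matrix (Fin 2) (Fin 2) ℤ_[p]).map
            (algebraMap ℤ_[p] ℚ_[p]))
          ((0 : ℚ_[p]) • ((p : ℚ_[p])⁻¹ • ((p : ℤ_[p]) ^ 2 • (1 : Matrix (Fin 2) (Fin 2) ℤ_[p])).map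
            (algebraMap ℤ_[p] ℚ_[p]))) 0
          ((p : ℚ_[p])⁻¹ • ((p : ℤ_[p]) ^ 2 • (1 : Matrix (Fin 2) (Fin 2) ℤ_[p])).map
            (algebraMap ℤ_[p] ℚ_[p])) := by
      rw [hh]
      ext (i | i) (j | j) <;> simp [orthRepUnip, hb]
    have hdet : ((p : ℤ_[p]) ^ 2 • (1 : Matrix (Fin 2) (Fin 2) ℤ_[p])).det = (p : ℤ_[p]) ^ 4 := by
      rw [det_smul, det_one, Fintype.card_fin]
      ring
    have hD : ((p : ℤ_[p]) ^ 2 • (1 : Matrix (Fin 2) (Fin 2) ℤ_[p])).det ≠ 0 := by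
      rw [hdet]; exact pow_ne_zero _ hp
    have hAD : ((p : ℤ_[p]) ^ 2 • (1 : Matrix (Fin 2) (Fin 2) ℤ_[p])).det
        • (1 : Matrix (Fin 2) (Fin 2) ℤ_[p])
        = (p : ℤ_[p]) ^ 2 • ((p : ℤ_[p]) ^ 2 • (1 : Matrix (Fin 2) (Fin 2) ℤ_[p])) := by
      rw [hdet, smul_smul]
      ring_nf
    refine ⟨fun X hX => weilH_phi0_eq_zero hh' hAD hD hX, fun Y => ?_⟩
    rw [weilH_phi0_apply hh' hAD hD (det_one) (i := 1) (j := 1) (by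
      ext i j
      fin_cases i <;> fin_cases j <;> simp [hp', pow_two])]
    norm_num
  · have hh' : ((h : GL (Fin 2 ⊕ Fin 2) ℚ_[p]) : Matrix (Fin 2 ⊕ Fin 2) (Fin 2 ⊕ Fin 2) ℚ_[p])
        = fromBlocks ((p : ℚ_[p])⁻¹ • ((p : ℤ_[p]) • (1 : Matrix (Fin 2) (Fin 2) ℤ_[p])).map
            (algebraMap ℤ_[p] ℚ_[p]))
          ((lift b * (p : ℚ_[p])⁻¹ : ℚ_[p]) •
            ((p : ℚ_[p])⁻¹ • ((p : ℤ_[p]) • (1 : Matrix (Fin 2) (Fin 2) ℤ_[p])).map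
            (algebraMap ℤ_[p] ℚ_[p]))) 0
          ((p : ℚ_[p])⁻¹ • ((p : ℤ_[p]) • (1 : Matrix (Fin 2) (Fin 2) ℤ_[p])).map
            (algebraMap ℤ_[p] ℚ_[p])) := by
      rw [hh]
      ext (i | i) (j | j) <;> fin_cases i <;> fin_cases j <;> simp [orthRepUnip, hb, hp', mul_comm]
    have hdet : ((p : ℤ_[p]) • (1 : Matrix (Fin 2) (Fin 2) ℤ_[p])).det = (p : ℤ_[p]) ^ 2 := by
      rw [det_smul, det_one, Fintype.card_fin, mul_one]
    have hD : ((p : ℤ_[p]) • (1 : Matrix (Fin 2) (Fin 2) ℤ_[p])).det ≠ 0 := by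
      rw [hdet]; exact pow_ne_zero _ hp
    have hAD : ((p : ℤ_[p]) • (1 : Matrix (Fin 2) (Fin 2) ℤ_[p])).det
        • ((p : ℤ_[p]) • (1 : Matrix (Fin 2) (Fin 2) ℤ_[p]))
        = (p : ℤ_[p]) ^ 2 • ((p : ℤ_[p]) • (1 : Matrix (Fin 2) (Fin 2) ℤ_[p])) := by
      rw [hdet]
    refine ⟨fun X hX => weilH_phi0_eq_zero hh' hAD hD hX, fun Y => ?_⟩
    rw [weilH_phi0_apply hh' hAD hD (det_one) (i := 0) (j := 0) (by
      ext i j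
      fin_cases i <;> fin_cases j <;> simp [hp'])]
    have hdvd : DvdMat ((p : ℤ_[p]) ^ 2) (((p : ℤ_[p]) • (1 : Matrix (Fin 2) (Fin 2) ℤ_[p]))ᵀ * Y) ↔
        DvdMat (p : ℤ_[p]) Y := by
      simp only [DvdMat, transpose_smul, transpose_one, Matrix.smul_mul, Matrix.one_mul,
        Matrix.smul_apply, smul_eq_mul, p_mul_dvd_p_sq_iff]
    simp only [hdvd]
    simp [mul_assoc]

open Classical in
theorem weilH_orthRepScalar (b : ℤ_[p]) {h : H p}
    (hh : ((h : GL (Fin 2 ⊕ Fin 2) ℚ_[p]) : Matrix (Fin 2 ⊕ Fin 2) (Fin 2 ⊕ Fin 2) ℚ_[p])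
      = (p : ℚ_[p])⁻¹ • (orthRepScalar b).map (algebraMap ℤ_[p] ℚ_[p])) :
    (∀ X, (p : ℚ_[p]) • X ∉ intMat p (Fin 2) (Fin 2 ⊕ Fin 2) → weilH h (phi0 p) X = 0) ∧
    ∀ Y : Matrix (Fin 2) (Fin 2 ⊕ Fin 2) ℤ_[p],
      weilH h (phi0 p) ((p : ℚ_[p])⁻¹ • Y.map (algebraMap ℤ_[p] ℚ_[p]))
      = ((p : ℂ) ^ 4)⁻¹ * psi p (-(b * (((p : ℚ_[p]) ^ 2)⁻¹ * pairing Y))) := by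
  have hp := coe_p_ne_zero (p := p)
  have hp' := coe_p_ne_zero' (p := p)
  have hh' : ((h : GL (Fin 2 ⊕ Fin 2) ℚ_[p]) : Matrix (Fin 2 ⊕ Fin 2) (Fin 2 ⊕ Fin 2) ℚ_[p])
      = fromBlocks ((p : ℚ_[p])⁻¹ • ((p : ℤ_[p]) ^ 2 • (1 : Matrix (Fin 2) (Fin 2) ℤ_[p])).map
          (algebraMap ℤ_[p] ℚ_[p]))
        ((b : ℚ_[p]) • ((p : ℚ_[p])⁻¹ • (1 : Matrix (Fin 2) (Fin 2) ℤ_[p]).map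
          (algebraMap ℤ_[p] ℚ_[p]))) 0
        ((p : ℚ_[p])⁻¹ • (1 : Matrix (Fin 2) (Fin 2) ℤ_[p]).map (algebraMap ℤ_[p] ℚ_[p])) := by
    rw [hh]
    ext (i | i) (j | j) <;> fin_cases i <;> fin_cases j <;> simp [orthRepScalar, mul_comm]
  have hD : (1 : Matrix (Fin 2) (Fin 2) ℤ_[p]).det ≠ 0 := by
    rw [det_one]; exact one_ne_zero
  have hAD : (1 : Matrix (Fin 2) (Fin 2) ℤ_[p]).det • ((p : ℤ_[p]) ^ 2 •
      (1 : Matrix (Fin 2) (Fin 2) ℤ_[p])) = (p : ℤ_[p]) ^ 2 • (1 : Matrix (Fin 2) (Fin 2) ℤ_[p]) := by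
    rw [det_one, one_smul]
  refine ⟨fun X hX => weilH_phi0_eq_zero hh' hAD hD hX, fun Y => ?_⟩
  rw [weilH_phi0_apply hh' hAD hD (det_one) (i := -1) (j := -1) (by
    ext i j
    fin_cases i <;> fin_cases j <;> simp), if_pos]
  · congr 1
  · intro i j
    rw [transpose_smul, transpose_one, Matrix.smul_mul, Matrix.one_mul]
    exact dvd_mul_right _ _

open Classical in
theorem weilH_orthRepLevi {A : Matrix (Fin 2) (Fin 2) ℤ_[p]} (hA : A.det = 1) (c : ℤ_[p])
    {h : H p}
    (hh : ((h : GL (Fin 2 ⊕ Fin 2) ℚ_[p]) : Matrix (Fin 2 ⊕ Fin 2) (Fin 2 ⊕ Fin 2) ℚ_[p])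
      = (p : ℚ_[p])⁻¹ • (orthRepLevi A c).map (algebraMap ℤ_[p] ℚ_[p])) :
    (∀ X, (p : ℚ_[p]) • X ∉ intMat p (Fin 2) (Fin 2 ⊕ Fin 2) → weilH h (phi0 p) X = 0) ∧
    ∀ Y : Matrix (Fin 2) (Fin 2 ⊕ Fin 2) ℤ_[p],
      weilH h (phi0 p) ((p : ℚ_[p])⁻¹ • Y.map (algebraMap ℤ_[p] ℚ_[p]))
      = if DvdMat ((p : ℤ_[p]) ^ 2) ((A * !![1, 0; p * c, (p : ℤ_[p]) ^ 2])ᵀ * Y)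
        then (1 : ℂ) else 0 := by
  have hp := coe_p_ne_zero (p := p)
  have hp' := coe_p_ne_zero' (p := p)
  set D := A * !![1, 0; p * c, (p : ℤ_[p]) ^ 2] with hDdef
  -- The triangular matrix is unimodular times `diag(1, p²)`. After division by `p` the exponents
  -- `-1` and `1` cancel, so the volume is one.
  have hD1 : D = (A * !![1, 0; p * c, 1]) * diagonal ![1, (p : ℤ_[p]) ^ 2] := by
    rw [Matrix.mul_assoc, hDdef]
    congr 1
    ext i j
    fin_cases i <;> fin_cases j <;> simp
  have hh' : ((h : GL (Fin 2 ⊕ Fin 2) ℚ_[p]) : Matrix (Fin 2 ⊕ Fin 2) (Fin 2 ⊕ Fin 2) ℚ_[p])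
      = fromBlocks ((p : ℚ_[p])⁻¹ • D.map (algebraMap ℤ_[p] ℚ_[p]))
        ((0 : ℚ_[p]) • ((p : ℚ_[p])⁻¹ • D.map (algebraMap ℤ_[p] ℚ_[p]))) 0
        ((p : ℚ_[p])⁻¹ • D.map (algebraMap ℤ_[p] ℚ_[p])) := by
    rw [hh]
    ext (i | i) (j | j) <;> simp [orthRepLevi, levi, ← hDdef]
  have hdet : D.det = (p : ℤ_[p]) ^ 2 := by
    rw [hDdef, det_mul, hA, det_fin_two]
    simp
  have hD : D.det ≠ 0 := by
    rw [hdet]; exact pow_ne_zero _ hp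
  have hAD : D.det • D = (p : ℤ_[p]) ^ 2 • D := by rw [hdet]
  have hB : (A * !![1, 0; p * c, 1]).det = 1 := by
    rw [det_mul, hA, det_fin_two]
    simp
  refine ⟨fun X hX => weilH_phi0_eq_zero hh' hAD hD hX, fun Y => ?_⟩
  rw [weilH_phi0_apply hh' hAD hD hB (i := -1) (j := 1) (by
    rw [hD1]
    exact emb_mul_diagonal (by simp) (by simp [hp', pow_two]))]
  simp

end RepresentativeValues

/-! ### The four integrals as finite sums -/

section HeckeSums

variable {p : ℕ} [Fact p.Prime]

variable (p) in
/-- The bases of the isotropic planes of `𝔽_p⁴`. -/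
abbrev IsotropicFrame := {a : Matrix (Fin 2 ⊕ Fin 2) (Fin 2) (ZMod p) //
  aᵀ * symp (ZMod p) * a = 0 ∧ ∃ N : Matrix (Fin 2) (Fin 2 ⊕ Fin 2) (ZMod p), N * a = 1}

open Classical in
-- The alternative is exhaustive: an `X` with `p X` not integral is outside the support of every
-- term, and every other `X` is `p⁻¹ Y`.
theorem setIntegral_weilG_one
    {k : {a : Fin 2 ⊕ Fin 2 → ZMod p // a ≠ 0} → Matrix (Fin 2 ⊕ Fin 2) (Fin 2 ⊕ Fin 2) ℤ_[p]}
    (hk : ∀ a, (k a)ᵀ * symp ℤ_[p] * k a = symp ℤ_[p])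
    (hka : ∀ a, (k a).map (PadicInt.toZMod (p := p)) *ᵥ Pi.single (.inl 0) 1 = a.1)
    (X : Matrix (Fin 2) (Fin 2 ⊕ Fin 2) ℚ_[p]) :
    IntegrableOn (fun g : G p => weilG g (phi0 p) X) (heckeSet (formG p) 1)
        (normalizedHaar (formG p)) ∧
      ((p : ℚ_[p]) • X ∉ intMat p (Fin 2) (Fin 2 ⊕ Fin 2) →
        ∫ g in heckeSet (formG p) 1, weilG g (phi0 p) X ∂normalizedHaar (formG p) = 0) ∧
      ∀ Y : Matrix (Fin 2) (Fin 2 ⊕ Fin 2) ℤ_[p],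
        X = (p : ℚ_[p])⁻¹ • Y.map (algebraMap ℤ_[p] ℚ_[p]) →
        ∫ g in heckeSet (formG p) 1, weilG g (phi0 p) X ∂normalizedHaar (formG p)
          = ((p : ℂ) - 1)⁻¹ * ∑ a, ∑ c : ZMod p,
            if DvdMat ((p : ℤ_[p]) ^ 2) (Y * (k a * sympRepOne (lift c))) then 1 else 0 := by
  obtain ⟨r, hr, hint⟩ := setIntegral_heckeSet_of_eq (neg_symp_mul_symp ℤ_[p]) (formG_eq p) (i := 1)
    (fun j : {a : Fin 2 ⊕ Fin 2 → ZMod p // a ≠ 0} × ZMod p => k j.1 * sympRepOne (lift j.2))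
    (fun j => isometry_smul_mul (hk j.1) (sympRepOne_isometry _))
    (fun j => rank_sympRepOne j.1.2 (hka j.1) _) (fun _ => ((p : ℂ) - 1)⁻¹)
    (fun A hA hA1 => sum_sympRepOne hk hka hA hA1)
  obtain ⟨h1, h2⟩ := hint (fun g => weilG g (phi0 p) X) fun g u hu => weilG_phi0_mul_right X g hu
  refine ⟨h1, fun hX => ?_, fun Y hY => ?_⟩
  · rw [h2]
    exact Finset.sum_eq_zero fun j _ => by rw [weilG_phi0_eq_zero (hr j) hX, mul_zero]
  · rw [h2, ← Finset.mul_sum, Fintype.sum_prod_type]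
    simp only [hY, weilG_phi0_apply (hr _)]

open Classical in
theorem setIntegral_weilG_two
    {k : IsotropicFrame p → Matrix (Fin 2 ⊕ Fin 2) (Fin 2 ⊕ Fin 2) ℤ_[p]}
    (hk : ∀ a, (k a)ᵀ * symp ℤ_[p] * k a = symp ℤ_[p])
    (hka : ∀ a, ((k a).map (PadicInt.toZMod (p := p))).toCols₁ = a.1)
    (X : Matrix (Fin 2) (Fin 2 ⊕ Fin 2) ℚ_[p]) :
    IntegrableOn (fun g : G p => weilG g (phi0 p) X) (heckeSet (formG p) 2)
        (normalizedHaar (formG p)) ∧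
      ((p : ℚ_[p]) • X ∉ intMat p (Fin 2) (Fin 2 ⊕ Fin 2) →
        ∫ g in heckeSet (formG p) 2, weilG g (phi0 p) X ∂normalizedHaar (formG p) = 0) ∧
      ∀ Y : Matrix (Fin 2) (Fin 2 ⊕ Fin 2) ℤ_[p],
        X = (p : ℚ_[p])⁻¹ • Y.map (algebraMap ℤ_[p] ℚ_[p]) →
        ∫ g in heckeSet (formG p) 2, weilG g (phi0 p) X ∂normalizedHaar (formG p)
          = (Nat.card (GL (Fin 2) (ZMod p)) : ℂ)⁻¹ * ∑ a,
            ∑ S : {S : Matrix (Fin 2) (Fin 2) (ZMod p) // Sᵀ = S},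
            if DvdMat ((p : ℤ_[p]) ^ 2) (Y * (k a * sympRepTwo (S.1.map lift))) then 1 else 0 := by
  obtain ⟨r, hr, hint⟩ := setIntegral_heckeSet_of_eq (neg_symp_mul_symp ℤ_[p]) (formG_eq p) (i := 2)
    (fun j : IsotropicFrame p × {S : Matrix (Fin 2) (Fin 2) (ZMod p) // Sᵀ = S} =>
      k j.1 * sympRepTwo (j.2.1.map lift))
    (fun j => isometry_smul_mul (hk j.1) (sympRepTwo_isometry (by
      rw [← Matrix.transpose_map, j.2.2])))
    (fun j => rank_sympRepTwo j.1.2.2.choose_spec (hka j.1) _)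
    (fun _ => (Nat.card (GL (Fin 2) (ZMod p)) : ℂ)⁻¹)
    (fun A hA hA1 => sum_sympRepTwo hk hka hA hA1)
  obtain ⟨h1, h2⟩ := hint (fun g => weilG g (phi0 p) X) fun g u hu => weilG_phi0_mul_right X g hu
  refine ⟨h1, fun hX => ?_, fun Y hY => ?_⟩
  · rw [h2]
    exact Finset.sum_eq_zero fun j _ => by rw [weilG_phi0_eq_zero (hr j) hX, mul_zero]
  · rw [h2, ← Finset.mul_sum, Fintype.sum_prod_type]
    simp only [hY, weilG_phi0_apply (hr _)]

open Classical in
theorem setIntegral_weilH_one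
    {A : {a : Fin 2 → ZMod p // a ≠ 0} → Matrix (Fin 2) (Fin 2) ℤ_[p]}
    (hA : ∀ a, (A a).det = 1) (hAa : ∀ a i, PadicInt.toZMod (A a i 0) = a.1 i)
    (X : Matrix (Fin 2) (Fin 2 ⊕ Fin 2) ℚ_[p]) :
    IntegrableOn (fun h : H p => weilH h (phi0 p) X) (heckeSet (formH p) 1)
        (normalizedHaar (formH p)) ∧
      ((p : ℚ_[p]) • X ∉ intMat p (Fin 2) (Fin 2 ⊕ Fin 2) →
        ∫ h in heckeSet (formH p) 1, weilH h (phi0 p) X ∂normalizedHaar (formH p) = 0) ∧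
      ∀ Y : Matrix (Fin 2) (Fin 2 ⊕ Fin 2) ℤ_[p],
        X = (p : ℚ_[p])⁻¹ • Y.map (algebraMap ℤ_[p] ℚ_[p]) →
        ∫ h in heckeSet (formH p) 1, weilH h (phi0 p) X ∂normalizedHaar (formH p)
          = ((p : ℂ) - 1)⁻¹ * ∑ a,
            ((if DvdMat ((p : ℤ_[p]) ^ 2) ((A a * diagonal ![1, (p : ℤ_[p])])ᵀ * Y)
              then (p : ℂ) ^ 2 else 0)
            + ∑ c : ZMod p,
              if DvdMat ((p : ℤ_[p]) ^ 2) ((A a * diagonal ![(p : ℤ_[p]), (p : ℤ_[p]) ^ 2])ᵀ * Y)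
              then ((p : ℂ) ^ 2)⁻¹ * psi p (-(lift c * (((p : ℚ_[p]) ^ 2)⁻¹ * pairing Y)))
              else 0) := by
  obtain ⟨r, hr, hint⟩ := setIntegral_heckeSet_of_eq (orth_mul_orth ℤ_[p]) (formH_eq p) (i := 1)
    (fun j : {a : Fin 2 → ZMod p // a ≠ 0} × Option (ZMod p) => orthRepOne (A j.1) (j.2.map lift))
    (fun j => orthRepOne_isometry (hA j.1) _)
    (fun j => rank_orthRepOne j.1.2 (hAa j.1) _) (fun _ => ((p : ℂ) - 1)⁻¹)
    (fun B hB hB1 => sum_orthRepOne hA hAa hB hB1)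
  obtain ⟨h1, h2⟩ := hint (fun h => weilH h (phi0 p) X) fun g u hu => weilH_phi0_mul_right X g hu
  refine ⟨h1, fun hX => ?_, fun Y hY => ?_⟩
  · rw [h2]
    refine Finset.sum_eq_zero fun j _ => ?_
    obtain ⟨a, _ | c⟩ := j
    · rw [(weilH_orthRepOne_none (hA a) (hr (a, none))).1 X hX, mul_zero]
    · rw [(weilH_orthRepOne_some (hA a) (lift c) (hr (a, some c))).1 X hX, mul_zero]
  · rw [h2, ← Finset.mul_sum, Fintype.sum_prod_type]
    simp only [Fintype.sum_option, hY, fun a => (weilH_orthRepOne_none (hA a) (hr (a, none))).2 Y,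
      fun a c => (weilH_orthRepOne_some (hA a) (lift c) (hr (a, some c))).2 Y]

open Classical in
theorem setIntegral_weilH_two
    {A : {a : Fin 2 → ZMod p // a ≠ 0} → Matrix (Fin 2) (Fin 2) ℤ_[p]}
    (hA : ∀ a, (A a).det = 1) (hAa : ∀ a i, PadicInt.toZMod (A a i 0) = a.1 i)
    (X : Matrix (Fin 2) (Fin 2 ⊕ Fin 2) ℚ_[p]) :
    IntegrableOn (fun h : H p => weilH h (phi0 p) X) (heckeSet (formH p) 2)
        (normalizedHaar (formH p)) ∧
      ((p : ℚ_[p]) • X ∉ intMat p (Fin 2) (Fin 2 ⊕ Fin 2) →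
        ∫ h in heckeSet (formH p) 2, weilH h (phi0 p) X ∂normalizedHaar (formH p) = 0) ∧
      ∀ Y : Matrix (Fin 2) (Fin 2 ⊕ Fin 2) ℤ_[p],
        X = (p : ℚ_[p])⁻¹ • Y.map (algebraMap ℤ_[p] ℚ_[p]) →
        ∫ h in heckeSet (formH p) 2, weilH h (phi0 p) X ∂normalizedHaar (formH p)
          = (∑ b : ZMod p, if b = 0 then if DvdMat ((p : ℤ_[p]) ^ 2) Y then (p : ℂ) ^ 4 else 0
              else if DvdMat (p : ℤ_[p]) Y then
                psi p (-(lift b * ((p : ℚ_[p])⁻¹ * (((p : ℚ_[p]) ^ 2)⁻¹ * pairing Y)))) else 0)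
            + (∑ b : ZMod p, ∑ c : ZMod p, ((p : ℂ) ^ 4)⁻¹ *
              psi p (-((lift b + (p : ℤ_[p]) * lift c : ℤ_[p])
                * (((p : ℚ_[p]) ^ 2)⁻¹ * pairing Y)))
            + ((p : ℂ) - 1)⁻¹ * ∑ a, ∑ c : ZMod p,
              if DvdMat ((p : ℤ_[p]) ^ 2) ((A a * !![1, 0; p * lift c, (p : ℤ_[p]) ^ 2])ᵀ * Y)
              then (1 : ℂ) else 0) := by
  obtain ⟨r, hr, hint⟩ := setIntegral_heckeSet_of_eq (orth_mul_orth ℤ_[p]) (formH_eq p) (i := 2)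
    -- The weights below follow this decomposition: only the third family repeats cosets, once for
    -- each generator of a line.
    (Sum.elim orthRepUnip (Sum.elim
      (fun b : ZMod p × ZMod p => orthRepScalar (lift b.1 + (p : ℤ_[p]) * lift b.2))
      (fun j : {a : Fin 2 → ZMod p // a ≠ 0} × ZMod p => orthRepLevi (A j.1) (lift j.2))))
    (by
      rintro (b | b | j)
      · exact orthRepUnip_isometry b
      · exact orthRepScalar_isometry _
      · exact orthRepLevi_isometry (hA j.1) _)
    (by
      rintro (b | b | j)
      · exact rank_orthRepUnip b
      · exact rank_orthRepScalar _
      · exact rank_orthRepLevi (hA j.1) _)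
    (Sum.elim (fun _ => 1) (Sum.elim (fun _ => 1) fun _ => ((p : ℂ) - 1)⁻¹))
    (fun B hB hB2 => by
      rw [Fintype.sum_sum_type, Fintype.sum_sum_type]
      exact sum_orthRepTwo hA hAa hB hB2)
  obtain ⟨h1, h2⟩ := hint (fun h => weilH h (phi0 p) X) fun g u hu => weilH_phi0_mul_right X g hu
  have h3 : ∀ j : {a : Fin 2 → ZMod p // a ≠ 0} × ZMod p,
      ((r (.inr (.inr j)) : GL (Fin 2 ⊕ Fin 2) ℚ_[p]) :
        Matrix (Fin 2 ⊕ Fin 2) (Fin 2 ⊕ Fin 2) ℚ_[p])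
      = (p : ℚ_[p])⁻¹ • (orthRepLevi (A j.1) (lift j.2)).map (algebraMap ℤ_[p] ℚ_[p]) :=
    fun j => hr (.inr (.inr j))
  refine ⟨h1, fun hX => ?_, fun Y hY => ?_⟩
  · rw [h2]
    refine Finset.sum_eq_zero fun j _ => ?_
    obtain b | b | j := j
    · rw [(weilH_orthRepUnip b (hr (.inl b))).1 X hX, mul_zero]
    · rw [(weilH_orthRepScalar _ (hr (.inr (.inl b)))).1 X hX, mul_zero]
    · rw [(weilH_orthRepLevi (hA j.1) (lift j.2) (h3 j)).1 X hX, mul_zero]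
  · rw [h2, Fintype.sum_sum_type, Fintype.sum_sum_type]
    rw [hY]
    have e1 := fun b => (weilH_orthRepUnip b (hr (.inl b))).2 Y
    have e2 := fun b : ZMod p × ZMod p => (weilH_orthRepScalar _ (hr (.inr (.inl b)))).2 Y
    have e3 := fun j : {a : Fin 2 → ZMod p // a ≠ 0} × ZMod p =>
      (weilH_orthRepLevi (hA j.1) (lift j.2) (h3 j)).2 Y
    simp only [Sum.elim_inl, Sum.elim_inr, one_mul, ← Finset.mul_sum, e1, e2, e3,
      Fintype.sum_prod_type]

end HeckeSums

/-! ### Counting isotropic frames in a kernel -/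

section IsotropicCounting

variable {p : ℕ} [Fact p.Prime]

theorem ncard_submodule {V : Type*} [AddCommGroup V] [Module (ZMod p) V] [Finite V]
    (K : Submodule (ZMod p) V) :
    (K : Set V).ncard = p ^ Module.finrank (ZMod p) K := by
  have := Fintype.ofFinite K
  rw [← Nat.card_coe_set_eq]
  change Nat.card K = _
  rw [Nat.card_eq_fintype_card, Module.card_eq_pow_finrank (K := ZMod p), ZMod.card]

theorem finrank_ker_mulVecLin {m n : Type*} [Fintype m] [Fintype n] [DecidableEq n]
    (W : Matrix m n (ZMod p)) :
    Module.finrank (ZMod p) (LinearMap.ker W.mulVecLin) + W.rank = Fintype.card n := by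
  have := LinearMap.finrank_range_add_finrank_ker W.mulVecLin
  rw [Module.finrank_fintype_fun_eq_card] at this
  rw [add_comm]
  exact this

/-- The functional is not zero on `K`, so its restriction is onto the field. -/
theorem finrank_inf_ker_add_one {V : Type*} [AddCommGroup V] [Module (ZMod p) V] [Finite V]
    (K : Submodule (ZMod p) V) (f : V →ₗ[ZMod p] ZMod p) {y : V} (hy : y ∈ K) (hf : f y ≠ 0) :
    Module.finrank (ZMod p) (K ⊓ LinearMap.ker f : Submodule (ZMod p) V) + 1
      = Module.finrank (ZMod p) K := by
  have h1 := LinearMap.finrank_range_add_finrank_ker (f.domRestrict K)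
  have h2 : LinearMap.range (f.domRestrict K) = ⊤ := by
    rw [LinearMap.range_eq_top]
    intro c
    exact ⟨(c / f y) • ⟨y, hy⟩, by simp [hf]⟩
  have h3 : Submodule.map K.subtype (LinearMap.ker (f.domRestrict K)) = K ⊓ LinearMap.ker f := by
    ext x
    simp only [Submodule.mem_map, LinearMap.mem_ker, Submodule.mem_inf]
    constructor
    · rintro ⟨z, hz, rfl⟩
      exact ⟨z.2, hz⟩
    · rintro ⟨hx, hfx⟩
      exact ⟨⟨x, hx⟩, hfx, rfl⟩
  rw [← h3, Submodule.finrank_map_subtype_eq, ← h1, h2, finrank_top, Module.finrank_self, add_comm]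

/-- The functional `y ↦ ᵗx (0 1₂; -1₂ 0) y`. -/
def sympFunctional (x : Fin 2 ⊕ Fin 2 → ZMod p) : (Fin 2 ⊕ Fin 2 → ZMod p) →ₗ[ZMod p] ZMod p where
  toFun y := (x ᵥ* symp (ZMod p)) ⬝ᵥ y
  map_add' _ _ := dotProduct_add _ _ _
  map_smul' _ _ := dotProduct_smul _ _ _

theorem sympFunctional_apply (x y : Fin 2 ⊕ Fin 2 → ZMod p) :
    sympFunctional x y = (x ᵥ* symp (ZMod p)) ⬝ᵥ y := rfl

theorem sympFunctional_eq (x y : Fin 2 ⊕ Fin 2 → ZMod p) :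
    sympFunctional x y = x (.inl 0) * y (.inr 0) + x (.inl 1) * y (.inr 1)
      - x (.inr 0) * y (.inl 0) - x (.inr 1) * y (.inl 1) := by
  simp [sympFunctional_apply, symp, vecMul, dotProduct, Fintype.sum_sum_type, Fin.sum_univ_two,
    one_apply]
  ring

theorem sympFunctional_self (x : Fin 2 ⊕ Fin 2 → ZMod p) : sympFunctional x x = 0 := by
  rw [sympFunctional_eq]
  ring

theorem exists_left_inverse_of_mulVec {a : Matrix (Fin 2 ⊕ Fin 2) (Fin 2) (ZMod p)}
    (h : ∀ ξ, a *ᵥ ξ = 0 → ξ = 0) :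
    ∃ N : Matrix (Fin 2) (Fin 2 ⊕ Fin 2) (ZMod p), N * a = 1 := by
  obtain ⟨g, hg⟩ := LinearMap.exists_leftInverse_of_injective (Matrix.toLin' a)
    (LinearMap.ker_eq_bot'.2 fun ξ hξ => h ξ (by simpa using hξ))
  refine ⟨LinearMap.toMatrix' g, ?_⟩
  have := congrArg LinearMap.toMatrix' hg
  rwa [LinearMap.toMatrix'_comp, LinearMap.toMatrix'_toLin', LinearMap.toMatrix'_id] at this

theorem exists_left_inverse_iff (a : Matrix (Fin 2 ⊕ Fin 2) (Fin 2) (ZMod p)) :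
    (∃ N : Matrix (Fin 2) (Fin 2 ⊕ Fin 2) (ZMod p), N * a = 1) ↔
      aᵀ 0 ≠ 0 ∧ aᵀ 1 ∉ Submodule.span (ZMod p) {aᵀ 0} := by
  constructor
  · rintro ⟨N, hN⟩
    have hN' : ∀ i j, N i ⬝ᵥ aᵀ j = (1 : Matrix (Fin 2) (Fin 2) (ZMod p)) i j :=
      fun i j => congrFun (congrFun hN i) j
    refine ⟨fun h => ?_, fun h => ?_⟩
    · have := hN' 0 0
      rw [h] at this
      simp at this
    · obtain ⟨c, hc⟩ := Submodule.mem_span_singleton.1 h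
      have h0 := hN' 1 0
      have h1 := hN' 1 1
      rw [← hc, dotProduct_smul, h0] at h1
      simp at h1
  · rintro ⟨h0, h1⟩
    refine exists_left_inverse_of_mulVec fun ξ hξ => ?_
    have hξ' : ξ 0 • aᵀ 0 + ξ 1 • aᵀ 1 = 0 := by
      ext i
      have := congrFun hξ i
      simp only [mulVec, dotProduct, Fin.sum_univ_two, Pi.zero_apply] at this
      simp only [Pi.add_apply, Pi.smul_apply, transpose_apply, smul_eq_mul, Pi.zero_apply]
      linear_combination this
    have hξ1 : ξ 1 = 0 := by
      by_contra h
      refine h1 (Submodule.mem_span_singleton.2 ⟨-(ξ 0 / ξ 1), ?_⟩)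
      have : aᵀ 1 = (ξ 1)⁻¹ • (ξ 1 • aᵀ 1) := by rw [smul_smul, inv_mul_cancel₀ h, one_smul]
      rw [this, eq_neg_of_add_eq_zero_right hξ', smul_neg, smul_smul, neg_smul]
      congr 2
      ring
    rw [hξ1, zero_smul, add_zero] at hξ'
    have hξ0 := (smul_eq_zero.1 hξ').resolve_right h0
    ext i
    fin_cases i <;> assumption

theorem isotropic_iff (a : Matrix (Fin 2 ⊕ Fin 2) (Fin 2) (ZMod p)) :
    aᵀ * symp (ZMod p) * a = 0 ↔ sympFunctional (aᵀ 0) (aᵀ 1) = 0 := by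
  rw [sympFunctional_eq]
  constructor
  · intro h
    have := congrFun (congrFun h 0) 1
    rw [transpose_mul_symp_mul_apply] at this
    simpa using this
  · intro h
    simp only [transpose_apply] at h
    ext i j
    rw [transpose_mul_symp_mul_apply]
    fin_cases i <;> fin_cases j <;> simp
    · ring
    · linear_combination h
    · linear_combination -h
    · ring

/-- Isotropic frames with columns in the kernel of `W`, by their columns. -/
def frameEquiv (W : Matrix (Fin 2) (Fin 2 ⊕ Fin 2) (ZMod p)) :
    {a : IsotropicFrame p // W * a.1 = 0} ≃
      Σ x : {x : Fin 2 ⊕ Fin 2 → ZMod p // x ∈ LinearMap.ker W.mulVecLin ∧ x ≠ 0},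
        (((LinearMap.ker W.mulVecLin ⊓ LinearMap.ker (sympFunctional x.1) :
            Submodule (ZMod p) (Fin 2 ⊕ Fin 2 → ZMod p)) : Set (Fin 2 ⊕ Fin 2 → ZMod p)) \
          (Submodule.span (ZMod p) {x.1} : Set (Fin 2 ⊕ Fin 2 → ZMod p)) :
            Set (Fin 2 ⊕ Fin 2 → ZMod p)) where
  toFun a := ⟨⟨a.1.1ᵀ 0, funext fun i => congrFun (congrFun a.2 i) 0,
      ((exists_left_inverse_iff _).1 a.1.2.2).1⟩,
    ⟨a.1.1ᵀ 1, ⟨funext fun i => congrFun (congrFun a.2 i) 1, (isotropic_iff _).1 a.1.2.1⟩,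
      ((exists_left_inverse_iff _).1 a.1.2.2).2⟩⟩
  invFun x := ⟨⟨(of ![x.1.1, x.2.1])ᵀ, (isotropic_iff _).2 x.2.2.1.2,
      (exists_left_inverse_iff _).2 ⟨x.1.2.2, x.2.2.2⟩⟩, by
    ext i j
    fin_cases j
    · exact congrFun x.1.2.1 i
    · exact congrFun x.2.2.1.1 i⟩
  left_inv a := by
    apply Subtype.ext
    apply Subtype.ext
    ext i j
    fin_cases j <;> rfl
  right_inv x := rfl


theorem exists_vecMul_of_ker_le {W : Matrix (Fin 2) (Fin 2 ⊕ Fin 2) (ZMod p)}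
    {f : Fin 2 ⊕ Fin 2 → ZMod p} (h : ∀ x, W *ᵥ x = 0 → f ⬝ᵥ x = 0) : ∃ y, f = y ᵥ* W := by
  obtain ⟨r, hr⟩ : ∃ r, W.rank = r := ⟨_, rfl⟩
  obtain ⟨a, P, hW, ⟨N, hN⟩, M, hM⟩ := exists_rank_factorization W hr
  refine ⟨f ᵥ* M ᵥ* N, ?_⟩
  have hNW : N * W = P := by rw [hW, ← Matrix.mul_assoc, hN, Matrix.one_mul]
  rw [vecMul_vecMul _ N W, hNW, vecMul_vecMul]
  ext j
  have h1 := h (Pi.single j 1 - (M * P) *ᵥ Pi.single j 1) (by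
    rw [mulVec_sub, mulVec_mulVec, hW, Matrix.mul_assoc a, ← Matrix.mul_assoc P, hM, Matrix.one_mul,
      sub_self])
  rw [dotProduct_sub, dotProduct_mulVec f (M * P)] at h1
  simpa [sub_eq_zero] using h1

/-- The left side is an alternating `2 × 2` matrix, hence a multiple of `J`. The pairing `Tr(ᵗx J
y)` that governs `ψ` on the `H` side is thus the symplectic product of the two rows, which governs
isotropy on the `G` side. -/
theorem mul_symp_mul_transpose {R : Type*} [CommRing R] (W : Matrix (Fin 2) (Fin 2 ⊕ Fin 2) R) :
    W * symp R * Wᵀ = pairing W • J R := by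
  ext i j
  rw [pairing_eq]
  fin_cases i <;> fin_cases j <;>
    simp [symp, J, Matrix.mul_apply, Fintype.sum_sum_type, Fin.sum_univ_two, one_apply] <;> ring

theorem symp_mul_symp (R : Type*) [CommRing R] : symp R * symp R = -1 := by
  have := neg_symp_mul_symp R
  rw [Matrix.neg_mul] at this
  rw [← this, neg_neg]

theorem transpose_symp (R : Type*) [CommRing R] : (symp R)ᵀ = -symp R := by
  rw [symp, fromBlocks_transpose, fromBlocks_neg]
  simp

/-- The radical of the alternating form restricted to the kernel of `W`. -/
theorem radical_iff (W : Matrix (Fin 2) (Fin 2 ⊕ Fin 2) (ZMod p)) (x : Fin 2 ⊕ Fin 2 → ZMod p) :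
    (x ∈ LinearMap.ker W.mulVecLin ∧ ∀ y ∈ LinearMap.ker W.mulVecLin, sympFunctional x y = 0) ↔
      ∃ y, pairing W • y = 0 ∧ (W * symp (ZMod p))ᵀ *ᵥ y = x := by
  simp only [LinearMap.mem_ker, mulVecLin_apply, sympFunctional_apply]
  -- The orthogonal complement of the kernel is the image of `ᵗ(W symp)`. On that image `W` acts as
  -- `pairing W • J` up to sign, so the complement lies in the kernel or meets it only in zero.
  have key : ∀ y, W *ᵥ ((W * symp (ZMod p))ᵀ *ᵥ y) = 0 ↔ pairing W • y = 0 := by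
    intro y
    rw [mulVec_mulVec, transpose_mul, transpose_symp, Matrix.neg_mul, Matrix.mul_neg,
      ← Matrix.mul_assoc, mul_symp_mul_transpose, neg_mulVec, neg_eq_zero, smul_mulVec]
    constructor
    · intro h
      have h0 := congrFun h 0
      have h1 := congrFun h 1
      simp [J, dotProduct, Fin.sum_univ_two] at h0 h1
      ext i
      fin_cases i <;> simp <;> tauto
    · intro h
      rw [← mulVec_smul, h, mulVec_zero]
  constructor
  · rintro ⟨hx, h⟩
    obtain ⟨y, hy⟩ := exists_vecMul_of_ker_le h
    have hx' : (W * symp (ZMod p))ᵀ *ᵥ (-y) = x := by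
      rw [mulVec_transpose, ← vecMul_vecMul, neg_vecMul, ← hy, neg_vecMul, vecMul_vecMul,
        symp_mul_symp, vecMul_neg, vecMul_one, neg_neg]
    exact ⟨-y, (key _).1 (by rwa [hx']), hx'⟩
  · rintro ⟨y, hy, rfl⟩
    refine ⟨(key y).2 hy, fun z hz => ?_⟩
    rw [mulVec_transpose, vecMul_vecMul, Matrix.mul_assoc, symp_mul_symp, Matrix.mul_neg,
      Matrix.mul_one, vecMul_neg, neg_dotProduct, ← dotProduct_mulVec, hz, dotProduct_zero, neg_zero]

/-- `pairing W • J` is then invertible and factors through `W`. -/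
theorem rank_eq_two_of_pairing_ne_zero {W : Matrix (Fin 2) (Fin 2 ⊕ Fin 2) (ZMod p)}
    (hW : pairing W ≠ 0) : W.rank = 2 := by
  refine le_antisymm (by simpa using W.rank_le_card_height) ?_
  have h1 : (pairing W • J (ZMod p)).rank = 2 := by
    rw [rank_of_isUnit, Fintype.card_fin]
    rw [isUnit_iff_isUnit_det, det_smul]
    simp [J, det_fin_two, hW]
  refine h1.symm.le.trans ?_
  rw [← mul_symp_mul_transpose, Matrix.mul_assoc]
  exact rank_mul_le_left _ _

theorem ncard_radical (W : Matrix (Fin 2) (Fin 2 ⊕ Fin 2) (ZMod p)) :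
    {x | x ∈ LinearMap.ker W.mulVecLin ∧
      ∀ y ∈ LinearMap.ker W.mulVecLin, sympFunctional x y = 0}.ncard
      = if pairing W = 0 then p ^ W.rank else 1 := by
  simp only [radical_iff]
  split_ifs with h
  · have : {x | ∃ y, pairing W • y = 0 ∧ (W * symp (ZMod p))ᵀ *ᵥ y = x}
        = (LinearMap.range (W * symp (ZMod p))ᵀ.mulVecLin : Set _) := by
      ext x
      simp only [h, zero_smul, true_and]
      rfl
    rw [this, ncard_submodule]
    congr 1
    change (W * symp (ZMod p))ᵀ.rank = _
    rw [rank_transpose, rank_mul_eq_left_of_isUnit_det]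
    refine isUnit_iff_isUnit_det _ |>.1 (IsUnit.of_mul_eq_one (-symp (ZMod p)) ?_)
    rw [Matrix.mul_neg, symp_mul_symp, neg_neg]
  · have : {x | ∃ y, pairing W • y = 0 ∧ (W * symp (ZMod p))ᵀ *ᵥ y = x} = {0} := by
      ext x
      constructor
      · rintro ⟨y, hy, rfl⟩
        rw [(smul_eq_zero.1 hy).resolve_left h, mulVec_zero]
        rfl
      · rintro rfl
        exact ⟨0, smul_zero _, mulVec_zero _⟩
    rw [this, Set.ncard_singleton]

open Classical in
-- For a fixed first column `x`, the second one ranges over the vectors of the kernel orthogonal to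
-- `x`, except for the `p` multiples of `x`.
theorem card_frames_eq_sum (W : Matrix (Fin 2) (Fin 2 ⊕ Fin 2) (ZMod p)) :
    (Nat.card {a : IsotropicFrame p // W * a.1 = 0} : ℂ) =
      ∑ x : {x : Fin 2 ⊕ Fin 2 → ZMod p // x ∈ LinearMap.ker W.mulVecLin ∧ x ≠ 0},
        ((p : ℂ) ^ Module.finrank (ZMod p) (LinearMap.ker W.mulVecLin ⊓
          LinearMap.ker (sympFunctional x.1) : Submodule (ZMod p) (Fin 2 ⊕ Fin 2 → ZMod p)) - p) := by
  rw [Nat.card_congr (frameEquiv W), Nat.card_sigma, Nat.cast_sum]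
  refine Finset.sum_congr rfl fun x _ => ?_
  have hle : Submodule.span (ZMod p) {x.1} ≤
      LinearMap.ker W.mulVecLin ⊓ LinearMap.ker (sympFunctional x.1) := by
    rw [Submodule.span_singleton_le_iff_mem]
    exact ⟨x.2.1, sympFunctional_self _⟩
  have := Set.ncard_sdiff_add_ncard_of_subset (SetLike.coe_subset_coe.2 hle) (Set.toFinite _)
  rw [ncard_submodule, ncard_submodule, finrank_span_singleton x.2.2, pow_one] at this
  rw [Nat.card_coe_set_eq, eq_sub_iff_add_eq]
  exact_mod_cast this

open Classical in
-- The kernel has dimension `d + 1`. The condition of orthogonality to `x` is empty if `x` is in the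
-- radical and cuts out a hyperplane of the kernel otherwise. The two summands are these two kinds
-- of first column.
theorem card_frames_ker {W : Matrix (Fin 2) (Fin 2 ⊕ Fin 2) (ZMod p)} {d : ℕ} (hd : W.rank + d = 3) :
    (Nat.card {a : IsotropicFrame p // W * a.1 = 0} : ℂ) =
      ((if pairing W = 0 then (p : ℂ) ^ W.rank else 1) - 1) * ((p : ℂ) ^ (d + 1) - p) +
      ((p : ℂ) ^ (d + 1) - if pairing W = 0 then (p : ℂ) ^ W.rank else 1) * ((p : ℂ) ^ d - p) := by
  have hK : Module.finrank (ZMod p) (LinearMap.ker W.mulVecLin) = d + 1 := by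
    have := finrank_ker_mulVecLin W
    simp only [Fintype.card_sum, Fintype.card_fin] at this
    omega
  set K := LinearMap.ker W.mulVecLin with hKdef
  set Rad : Set (Fin 2 ⊕ Fin 2 → ZMod p) := {x | x ∈ K ∧ ∀ y ∈ K, sympFunctional x y = 0} with hRad
  have hR : (Rad.ncard : ℂ) = if pairing W = 0 then (p : ℂ) ^ W.rank else 1 := by
    rw [hRad, hKdef, ncard_radical]
    split_ifs <;> push_cast <;> rfl
  have hKc : ((K : Set (Fin 2 ⊕ Fin 2 → ZMod p)).ncard : ℂ) = (p : ℂ) ^ (d + 1) := by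
    rw [ncard_submodule, hK]
    push_cast
    rfl
  rw [← hR, ← hKc, card_frames_eq_sum]
  have hterm : ∀ x : {x : Fin 2 ⊕ Fin 2 → ZMod p // x ∈ K ∧ x ≠ 0},
      ((p : ℂ) ^ Module.finrank (ZMod p) (K ⊓ LinearMap.ker (sympFunctional x.1) :
        Submodule (ZMod p) (Fin 2 ⊕ Fin 2 → ZMod p)) - p) =
      ((p : ℂ) ^ d - p) + if x.1 ∈ Rad then (p : ℂ) ^ (d + 1) - (p : ℂ) ^ d else 0 := by
    intro x
    split_ifs with hx
    · rw [inf_eq_left.2 fun y hy => hx.2 y hy, hK]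
      ring
    · have : ∃ y ∈ K, sympFunctional x.1 y ≠ 0 := by
        by_contra! h
        exact hx ⟨x.2.1, h⟩
      obtain ⟨y, hy, hy'⟩ := this
      have := finrank_inf_ker_add_one K _ hy hy'
      rw [show Module.finrank (ZMod p) (K ⊓ LinearMap.ker (sympFunctional x.1) :
        Submodule (ZMod p) (Fin 2 ⊕ Fin 2 → ZMod p)) = d by omega, add_zero]
  rw [Finset.sum_congr rfl fun x _ => hterm x, Finset.sum_add_distrib, Finset.sum_const,
    ← Finset.sum_filter, Finset.sum_const]
  have h0K : (0 : Fin 2 ⊕ Fin 2 → ZMod p) ∈ K := K.zero_mem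
  have h0R : (0 : Fin 2 ⊕ Fin 2 → ZMod p) ∈ Rad := ⟨h0K, fun y _ => by simp [sympFunctional_eq]⟩
  have c1 : ((Finset.univ : Finset {x : Fin 2 ⊕ Fin 2 → ZMod p // x ∈ K ∧ x ≠ 0}).card : ℂ)
      = (K : Set (Fin 2 ⊕ Fin 2 → ZMod p)).ncard - 1 := by
    have h1 := Set.ncard_sdiff_singleton_add_one (s := (K : Set (Fin 2 ⊕ Fin 2 → ZMod p))) h0K
    rw [← h1, Finset.card_univ, ← Nat.card_eq_fintype_card]
    push_cast
    rw [add_sub_cancel_right, ← Nat.card_coe_set_eq]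
    rfl
  have c2 : (({x | x.1 ∈ Rad} : Finset {x : Fin 2 ⊕ Fin 2 → ZMod p // x ∈ K ∧ x ≠ 0}).card : ℂ)
      = Rad.ncard - 1 := by
    have h1 := Set.ncard_sdiff_singleton_add_one h0R
    rw [← h1]
    push_cast
    rw [add_sub_cancel_right, ← Set.ncard_coe_finset,
      ← Set.ncard_image_of_injective _ Subtype.val_injective]
    congr 2
    ext x
    simp only [Finset.coe_filter, Finset.mem_univ, true_and, Set.mem_image, Set.mem_ofPred_eq,
      Set.mem_sdiff, Set.mem_singleton_iff]
    constructor
    · rintro ⟨z, hz, rfl⟩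
      exact ⟨hz, z.2.2⟩
    · rintro ⟨hx, hx0⟩
      exact ⟨⟨x, hx.1, hx0⟩, hx, rfl⟩
  rw [nsmul_eq_mul, nsmul_eq_mul, c1, c2, ← hKc]
  ring

end IsotropicCounting

/-! ### Divisibility by `p²` and reduction modulo `p` -/

section Divisibility

variable {p : ℕ} [Fact p.Prime]

theorem DvdMat.mul_left {R l m n : Type*} [CommRing R] [Fintype m] {c : R} {A : Matrix m n R}
    (h : DvdMat c A) (B : Matrix l m R) : DvdMat c (B * A) := fun i j => by
  rw [Matrix.mul_apply]
  exact Finset.dvd_sum fun t _ => (h t j).mul_left _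

theorem dvdMat_mul_left_iff {R m n : Type*} [CommRing R] [Fintype m] [DecidableEq m] {c : R}
    {B B' : Matrix m m R} (hB : B' * B = 1) (A : Matrix m n R) :
    DvdMat c (B * A) ↔ DvdMat c A := by
  refine ⟨fun h => ?_, fun h => h.mul_left B⟩
  have := h.mul_left B'
  rwa [← Matrix.mul_assoc, hB, Matrix.one_mul] at this

theorem dvdMat_p_iff {m n : Type*} (A : Matrix m n ℤ_[p]) :
    DvdMat (p : ℤ_[p]) A ↔ A.map (PadicInt.toZMod (p := p)) = 0 := by
  rw [← Matrix.ext_iff]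
  simp only [DvdMat, Matrix.map_apply, Matrix.zero_apply, toZMod_eq_zero_iff]

theorem dvdMat_sq_smul_iff {m n : Type*} (A : Matrix m n ℤ_[p]) :
    DvdMat ((p : ℤ_[p]) ^ 2) ((p : ℤ_[p]) • A) ↔ A.map (PadicInt.toZMod (p := p)) = 0 := by
  rw [← dvdMat_p_iff]
  refine forall₂_congr fun i j => ?_
  rw [Matrix.smul_apply, smul_eq_mul, pow_two]
  exact mul_dvd_mul_iff_left coe_p_ne_zero

theorem DvdMat.of_sq {m n : Type*} {A : Matrix m n ℤ_[p]} (h : DvdMat ((p : ℤ_[p]) ^ 2) A) :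
    A.map (PadicInt.toZMod (p := p)) = 0 :=
  (dvdMat_p_iff A).1 fun i j => (Dvd.intro_left ((p : ℤ_[p]) ^ 1) (by ring)).trans (h i j)

/-- Modulo `p` only the first column of `A` survives in `A E`. -/
theorem map_first_col_transpose_mul {n : Type*} {A E : Matrix (Fin 2) (Fin 2) ℤ_[p]}
    {a : Fin 2 → ZMod p} (ha : ∀ i, PadicInt.toZMod (A i 0) = a i)
    (hE : E.map (PadicInt.toZMod (p := p)) = !![1, 0; 0, 0]) (V : Matrix (Fin 2) n ℤ_[p]) :
    ((A * E)ᵀ * V).map (PadicInt.toZMod (p := p)) = 0 ↔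
      a ᵥ* V.map (PadicInt.toZMod (p := p)) = 0 := by
  have h1 : (A * E).map (PadicInt.toZMod (p := p)) = (of ![a, 0])ᵀ := by
    rw [Matrix.map_mul, hE]
    ext i j
    fin_cases j <;> simp [Matrix.mul_apply, Fin.sum_univ_two, ha]
  rw [Matrix.map_mul, Matrix.transpose_map, h1, transpose_transpose]
  constructor
  · intro h
    ext j
    simpa [Matrix.mul_apply, vecMul, dotProduct] using congrFun (congrFun h 0) j
  · intro h
    ext i j
    have := congrFun h j
    simp only [vecMul, dotProduct] at this
    fin_cases i <;> simp [Matrix.mul_apply]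
    simpa using this

theorem map_diagonal_one_p :
    (diagonal ![1, (p : ℤ_[p])]).map (PadicInt.toZMod (p := p)) = !![1, 0; 0, 0] := by
  ext i j
  fin_cases i <;> fin_cases j <;> simp

theorem map_diagonal_p_sq :
    (diagonal ![(p : ℤ_[p]), (p : ℤ_[p]) ^ 2]).map (PadicInt.toZMod (p := p)) = 0 := by
  ext i j
  fin_cases i <;> fin_cases j <;> simp

theorem diagonal_p_sq_eq :
    (diagonal ![(p : ℤ_[p]), (p : ℤ_[p]) ^ 2]) = (p : ℤ_[p]) • diagonal ![1, (p : ℤ_[p])] := by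
  ext i j
  fin_cases i <;> fin_cases j <;> simp [pow_two]

theorem map_lower_unipotent (c : ℤ_[p]) :
    (!![1, 0; p * c, (p : ℤ_[p]) ^ 2]).map (PadicInt.toZMod (p := p)) = !![1, 0; 0, 0] := by
  ext i j
  fin_cases i <;> fin_cases j <;> simp

theorem map_mul_sympRepOne {k : Matrix (Fin 2 ⊕ Fin 2) (Fin 2 ⊕ Fin 2) ℤ_[p]}
    {a : Fin 2 ⊕ Fin 2 → ZMod p}
    (hka : k.map (PadicInt.toZMod (p := p)) *ᵥ Pi.single (.inl 0) 1 = a) (c : ℤ_[p])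
    (V : Matrix (Fin 2) (Fin 2 ⊕ Fin 2) ℤ_[p]) :
    (V * (k * sympRepOne c)).map (PadicInt.toZMod (p := p)) = 0 ↔
      V.map (PadicInt.toZMod (p := p)) *ᵥ a = 0 := by
  rw [Matrix.map_mul, Matrix.map_mul, sympRepOne_reduction, mul_vecMulVec, hka, mul_vecMulVec]
  constructor
  · intro h
    ext i
    simpa [vecMulVec_apply] using congrFun (congrFun h i) (.inl 0)
  · intro h
    rw [h]
    ext i j
    simp [vecMulVec_apply]

theorem map_mul_sympRepTwo {k : Matrix (Fin 2 ⊕ Fin 2) (Fin 2 ⊕ Fin 2) ℤ_[p]}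
    {a : Matrix (Fin 2 ⊕ Fin 2) (Fin 2) (ZMod p)}
    (hka : (k.map (PadicInt.toZMod (p := p))).toCols₁ = a) (S : Matrix (Fin 2) (Fin 2) ℤ_[p])
    (V : Matrix (Fin 2) (Fin 2 ⊕ Fin 2) ℤ_[p]) :
    (V * (k * sympRepTwo S)).map (PadicInt.toZMod (p := p)) = 0 ↔
      V.map (PadicInt.toZMod (p := p)) * a = 0 := by
  have h1 : (k * sympRepTwo S).map (PadicInt.toZMod (p := p))
      = fromCols a (0 : Matrix (Fin 2 ⊕ Fin 2) (Fin 2) (ZMod p)) := by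
    rw [Matrix.map_mul, sympRepTwo, fromBlocks_map]
    ext i (j | j) <;>
      simp [← hka, Matrix.mul_apply, Fintype.sum_sum_type, one_apply, fromBlocks, toCols₁,
        apply_ite (PadicInt.toZMod (p := p))]
  rw [Matrix.map_mul, h1, mul_fromCols, Matrix.mul_zero]
  constructor
  · intro h
    have := congrArg toCols₁ h
    rwa [toCols₁_fromCols] at this
  · intro h
    rw [h]
    ext i (j | j) <;> rfl

end Divisibility

/-! ### Sums over kernels and character sums -/

section Sums

variable {p : ℕ} [Fact p.Prime]

theorem sum_ite_ker {V W : Type*} [AddCommGroup V] [Module (ZMod p) V] [AddCommGroup W]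
    [Module (ZMod p) W] [Finite V] [Fintype {a : V // a ≠ 0}] (f : V →ₗ[ZMod p] W) {d : ℕ}
    (hd : Module.finrank (ZMod p) (LinearMap.ker f) = d)
    {P : {a : V // a ≠ 0} → Prop} [DecidablePred P] (hP : ∀ a, P a ↔ f a.1 = 0) (c : ℂ) :
    ∑ a, (if P a then c else 0) = ((p : ℂ) ^ d - 1) * c := by
  have h1 := Set.ncard_sdiff_singleton_add_one (s := (LinearMap.ker f : Set V))
    (LinearMap.ker f).zero_mem
  rw [ncard_submodule, hd] at h1
  have h2 : (Finset.univ.filter P).card = ((LinearMap.ker f : Set V) \ {0}).ncard := by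
    rw [← Set.ncard_coe_finset, ← Set.ncard_image_of_injective _ Subtype.val_injective]
    congr 1
    ext x
    simp only [Finset.coe_filter, Finset.mem_univ, true_and, Set.mem_image, Set.mem_ofPred_eq,
      Set.mem_sdiff, Set.mem_singleton_iff, SetLike.mem_coe, LinearMap.mem_ker, hP]
    constructor
    · rintro ⟨z, hz, rfl⟩
      exact ⟨hz, z.2⟩
    · rintro ⟨hx, hx0⟩
      exact ⟨⟨x, hx0⟩, hx, rfl⟩
  rw [← Finset.sum_filter, Finset.sum_const, h2, nsmul_eq_mul, eq_comm]
  congr 1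
  rw [sub_eq_iff_eq_add]
  exact_mod_cast h1.symm

theorem sum_ite_mulVec {W : Matrix (Fin 2) (Fin 2 ⊕ Fin 2) (ZMod p)} {d : ℕ}
    (hd : W.rank + d = 3) [Fintype {a : Fin 2 ⊕ Fin 2 → ZMod p // a ≠ 0}]
    {P : {a : Fin 2 ⊕ Fin 2 → ZMod p // a ≠ 0} → Prop} [DecidablePred P]
    (hP : ∀ a, P a ↔ W *ᵥ a.1 = 0) (c : ℂ) :
    ∑ a, (if P a then c else 0) = ((p : ℂ) ^ (d + 1) - 1) * c := by
  refine sum_ite_ker W.mulVecLin ?_ (by simpa using hP) c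
  have h2 := finrank_ker_mulVecLin W
  simp only [Fintype.card_sum, Fintype.card_fin] at h2
  omega

theorem sum_ite_vecMul {W : Matrix (Fin 2) (Fin 2 ⊕ Fin 2) (ZMod p)} {d : ℕ}
    (hd : W.rank + d = 2) [Fintype {a : Fin 2 → ZMod p // a ≠ 0}]
    {P : {a : Fin 2 → ZMod p // a ≠ 0} → Prop} [DecidablePred P]
    (hP : ∀ a, P a ↔ a.1 ᵥ* W = 0) (c : ℂ) :
    ∑ a, (if P a then c else 0) = ((p : ℂ) ^ d - 1) * c := by
  refine sum_ite_ker Wᵀ.mulVecLin ?_ (by simpa [mulVec_transpose] using hP) c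
  have h2 := finrank_ker_mulVecLin Wᵀ
  rw [rank_transpose] at h2
  simp only [Fintype.card_fin] at h2
  omega

theorem sum_ite_frames (W : Matrix (Fin 2) (Fin 2 ⊕ Fin 2) (ZMod p)) [Fintype (IsotropicFrame p)]
    {P : IsotropicFrame p → Prop} [DecidablePred P] (hP : ∀ a, P a ↔ W * a.1 = 0) (c : ℂ) :
    ∑ a, (if P a then c else 0) = Nat.card {a : IsotropicFrame p // W * a.1 = 0} * c := by
  rw [← Finset.sum_filter, Finset.sum_const, nsmul_eq_mul, ← Fintype.card_subtype,
    ← Nat.card_eq_fintype_card, Nat.card_congr (Equiv.subtypeEquivRight hP)]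

/-- Symmetric matrices of size two, by their entries. -/
def symmetricEquiv : {S : Matrix (Fin 2) (Fin 2) (ZMod p) // Sᵀ = S} ≃
    ZMod p × ZMod p × ZMod p where
  toFun S := (S.1 0 0, S.1 0 1, S.1 1 1)
  invFun x := ⟨!![x.1, x.2.1; x.2.1, x.2.2], by
    ext i j
    fin_cases i <;> fin_cases j <;> rfl⟩
  left_inv S := by
    apply Subtype.ext
    have h : S.1 1 0 = S.1 0 1 := congrFun (congrFun S.2 0) 1
    ext i j
    fin_cases i <;> fin_cases j <;> simp [h]
  right_inv x := rfl

theorem card_nonzero_vectors :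
    (Fintype.card {a : Fin 2 → ZMod p // a ≠ 0} : ℂ) = (p : ℂ) ^ 2 - 1 := by
  rw [Fintype.card_subtype_compl, Fintype.card_subtype_eq, Fintype.card_fun, ZMod.card,
    Fintype.card_fin, Nat.cast_sub (Nat.one_le_pow _ _ (Fact.out : p.Prime).pos)]
  push_cast
  rfl

theorem card_GL_two :
    (Nat.card (GL (Fin 2) (ZMod p)) : ℂ) = ((p : ℂ) ^ 2 - 1) * ((p : ℂ) ^ 2 - p) := by
  rw [Matrix.card_GL_field, Fin.prod_univ_two, ZMod.card]
  have hp := (Fact.out : p.Prime).one_le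
  rw [Nat.cast_mul, Nat.cast_sub, Nat.cast_sub]
  · push_cast
    simp
  · simpa using Nat.le_self_pow two_ne_zero p
  · simpa using Nat.one_le_pow 2 p (Fact.out : p.Prime).pos

open Classical in
-- The elements `b + p c` represent the residues modulo `p²`, and the sum factors. The sum over `c`
-- forces `p t` to be integral, and the one over `b` then forces `t` to be.
theorem sum_sum_psi_lift {t : ℚ_[p]} (ht : ‖(p : ℚ_[p]) ^ 2 * t‖ ≤ 1) :
    ∑ b : ZMod p, ∑ c : ZMod p, ((p : ℂ) ^ 4)⁻¹ *
      psi p (-((lift b + (p : ℤ_[p]) * lift c : ℤ_[p]) * t))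
      = if ‖t‖ ≤ 1 then ((p : ℂ) ^ 2)⁻¹ else 0 := by
  have hp : (p : ℂ) ≠ 0 := Nat.cast_ne_zero.2 (Fact.out : p.Prime).ne_zero
  have h1 : ∀ b c : ZMod p, psi p (-((lift b + (p : ℤ_[p]) * lift c : ℤ_[p]) * t))
      = psi p (-(lift b * t)) * psi p (-(lift c * (p * t))) := by
    intro b c
    rw [← AddChar.map_add_eq_mul]
    congr 1
    push_cast
    ring
  simp only [h1, ← Finset.mul_sum]
  rw [← Finset.sum_mul, sum_psi_lift (t := (p : ℚ_[p]) * t) (by rwa [← mul_assoc, ← pow_two])]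
  by_cases h : ‖(p : ℚ_[p]) * t‖ ≤ 1
  · rw [if_pos h, sum_psi_lift h]
    split_ifs <;> field_simp
    simp
  · rw [if_neg h, mul_zero, mul_zero, if_neg]
    intro ht'
    refine h ?_
    rw [norm_mul]
    exact mul_le_one₀ (Padic.norm_p_lt_one.le) (norm_nonneg _) ht'

end Sums

/-! ### The relations at an integral argument -/

section IntegralArgument

variable {p : ℕ} [Fact p.Prime]

theorem eq_zero_of_rank_eq_zero {F m n : Type*} [Field F] [Fintype m] [Fintype n] [DecidableEq m]
    [DecidableEq n] {A : Matrix m n F} (hA : A.rank = 0) : A = 0 := by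
  obtain ⟨a, P, h, -⟩ := exists_rank_factorization A hA
  ext i j
  simp [h]

theorem inv_sq_mul_pairing_smul (V : Matrix (Fin 2) (Fin 2 ⊕ Fin 2) ℤ_[p]) :
    ((p : ℚ_[p]) ^ 2)⁻¹ * ((pairing ((p : ℤ_[p]) • V) : ℤ_[p]) : ℚ_[p])
      = ((pairing V : ℤ_[p]) : ℚ_[p]) := by
  have hp : (p : ℚ_[p]) ≠ 0 := coe_p_ne_zero'
  rw [pairing_smul]
  push_cast
  field_simp

theorem toZMod_pairing (V : Matrix (Fin 2) (Fin 2 ⊕ Fin 2) ℤ_[p]) :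
    PadicInt.toZMod (pairing V) = pairing (V.map (PadicInt.toZMod (p := p))) := by
  rw [pairing_eq, pairing_eq]
  simp

variable {V : Matrix (Fin 2) (Fin 2 ⊕ Fin 2) ℤ_[p]} {d : ℕ}

open Classical in
-- For `Y = p V` only `V` modulo `p` matters: the condition is that `a` lies in its kernel, and `c`
-- is free.
theorem sum_sympRepOne_smul
    {k : {a : Fin 2 ⊕ Fin 2 → ZMod p // a ≠ 0} → Matrix (Fin 2 ⊕ Fin 2) (Fin 2 ⊕ Fin 2) ℤ_[p]}
    (hka : ∀ a, (k a).map (PadicInt.toZMod (p := p)) *ᵥ Pi.single (.inl 0) 1 = a.1)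
    (hd : (V.map (PadicInt.toZMod (p := p))).rank + d = 3) :
    ∑ a, ∑ c : ZMod p, (if DvdMat ((p : ℤ_[p]) ^ 2)
      (((p : ℤ_[p]) • V) * (k a * sympRepOne (lift c))) then (1 : ℂ) else 0)
      = ((p : ℂ) ^ (d + 1) - 1) * p := by
  rw [Finset.sum_comm]
  have h : ∀ c : ZMod p, ∑ a, (if DvdMat ((p : ℤ_[p]) ^ 2)
      (((p : ℤ_[p]) • V) * (k a * sympRepOne (lift c))) then (1 : ℂ) else 0)
      = (p : ℂ) ^ (d + 1) - 1 := by
    intro c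
    rw [sum_ite_mulVec hd, mul_one]
    intro a
    rw [Matrix.smul_mul, dvdMat_sq_smul_iff, map_mul_sympRepOne (hka a)]
  rw [Finset.sum_congr rfl fun c _ => h c, Finset.sum_const, Finset.card_univ, ZMod.card,
    nsmul_eq_mul, mul_comm]

open Classical in
theorem sum_sympRepTwo_smul
    {k : IsotropicFrame p → Matrix (Fin 2 ⊕ Fin 2) (Fin 2 ⊕ Fin 2) ℤ_[p]}
    (hka : ∀ a, ((k a).map (PadicInt.toZMod (p := p))).toCols₁ = a.1)
    (V : Matrix (Fin 2) (Fin 2 ⊕ Fin 2) ℤ_[p]) :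
    ∑ a, ∑ S : {S : Matrix (Fin 2) (Fin 2) (ZMod p) // Sᵀ = S},
      (if DvdMat ((p : ℤ_[p]) ^ 2)
        (((p : ℤ_[p]) • V) * (k a * sympRepTwo (S.1.map lift))) then (1 : ℂ) else 0)
      = (p : ℂ) ^ 3 *
        Nat.card {a : IsotropicFrame p // V.map (PadicInt.toZMod (p := p)) * a.1 = 0} := by
  rw [Finset.sum_comm]
  have h : ∀ S : {S : Matrix (Fin 2) (Fin 2) (ZMod p) // Sᵀ = S},
      ∑ a, (if DvdMat ((p : ℤ_[p]) ^ 2)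
        (((p : ℤ_[p]) • V) * (k a * sympRepTwo (S.1.map lift))) then (1 : ℂ) else 0)
      = Nat.card {a : IsotropicFrame p // V.map (PadicInt.toZMod (p := p)) * a.1 = 0} := by
    intro S
    rw [sum_ite_frames (V.map (PadicInt.toZMod (p := p))), mul_one]
    intro a
    rw [Matrix.smul_mul, dvdMat_sq_smul_iff, map_mul_sympRepTwo (hka a)]
  rw [Finset.sum_congr rfl fun c _ => h c, Finset.sum_const, Finset.card_univ,
    Fintype.card_congr symmetricEquiv, Fintype.card_prod, Fintype.card_prod, ZMod.card,
    nsmul_eq_mul]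
  push_cast
  ring

variable {A : {a : Fin 2 → ZMod p // a ≠ 0} → Matrix (Fin 2) (Fin 2) ℤ_[p]}

open Classical in
-- In the second family the condition holds automatically and `ψ` is trivial, because `pairing Y =
-- p² pairing V`.
theorem sum_orthRepOne_smul (hAa : ∀ a i, PadicInt.toZMod (A a i 0) = a.1 i)
    (hd : (V.map (PadicInt.toZMod (p := p))).rank + d = 2) :
    ∑ a, ((if DvdMat ((p : ℤ_[p]) ^ 2) ((A a * diagonal ![1, (p : ℤ_[p])])ᵀ * ((p : ℤ_[p]) • V))
        then (p : ℂ) ^ 2 else 0)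
      + ∑ c : ZMod p, if DvdMat ((p : ℤ_[p]) ^ 2)
          ((A a * diagonal ![(p : ℤ_[p]), (p : ℤ_[p]) ^ 2])ᵀ * ((p : ℤ_[p]) • V))
        then ((p : ℂ) ^ 2)⁻¹ * psi p (-(lift c * (((p : ℚ_[p]) ^ 2)⁻¹ *
          pairing ((p : ℤ_[p]) • V)))) else 0)
      = ((p : ℂ) ^ d - 1) * p ^ 2 + ((p : ℂ) ^ 2 - 1) * (p : ℂ)⁻¹ := by
  have hp : (p : ℂ) ≠ 0 := Nat.cast_ne_zero.2 (Fact.out : p.Prime).ne_zero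
  rw [Finset.sum_add_distrib, sum_ite_vecMul hd fun a => by
    rw [Matrix.mul_smul, dvdMat_sq_smul_iff, map_first_col_transpose_mul (hAa a) map_diagonal_one_p]]
  congr 1
  have h : ∀ (a) (c : ZMod p), (if DvdMat ((p : ℤ_[p]) ^ 2)
          ((A a * diagonal ![(p : ℤ_[p]), (p : ℤ_[p]) ^ 2])ᵀ * ((p : ℤ_[p]) • V))
        then ((p : ℂ) ^ 2)⁻¹ * psi p (-(lift c * (((p : ℚ_[p]) ^ 2)⁻¹ *
          pairing ((p : ℤ_[p]) • V)))) else 0) = ((p : ℂ) ^ 2)⁻¹ := by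
    intro a c
    rw [if_pos, inv_sq_mul_pairing_smul, ← PadicInt.coe_mul, ← PadicInt.coe_neg, psi_coe, mul_one]
    rw [Matrix.mul_smul, dvdMat_sq_smul_iff, Matrix.map_mul, Matrix.transpose_map, Matrix.map_mul,
      map_diagonal_p_sq, Matrix.mul_zero, transpose_zero, Matrix.zero_mul]
  simp only [h, Finset.sum_const, Finset.card_univ, ZMod.card, nsmul_eq_mul]
  rw [show ∀ x : ℂ, (Fintype.card {a : Fin 2 → ZMod p // a ≠ 0} : ℂ) * x = (p ^ 2 - 1) * x by
    intro x; rw [← card_nonzero_vectors]]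
  field_simp

open Classical in
theorem sum_orthRepTwo_smul (hAa : ∀ a i, PadicInt.toZMod (A a i 0) = a.1 i)
    (hd : (V.map (PadicInt.toZMod (p := p))).rank + d = 2) :
    (∑ b : ZMod p, if b = 0 then
        if DvdMat ((p : ℤ_[p]) ^ 2) ((p : ℤ_[p]) • V) then (p : ℂ) ^ 4 else 0
      else if DvdMat (p : ℤ_[p]) ((p : ℤ_[p]) • V) then
        psi p (-(lift b * ((p : ℚ_[p])⁻¹ * (((p : ℚ_[p]) ^ 2)⁻¹ * pairing ((p : ℤ_[p]) • V))))) else 0)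
      + (∑ b : ZMod p, ∑ c : ZMod p, ((p : ℂ) ^ 4)⁻¹ *
        psi p (-((lift b + (p : ℤ_[p]) * lift c : ℤ_[p])
          * (((p : ℚ_[p]) ^ 2)⁻¹ * pairing ((p : ℤ_[p]) • V))))
      + ((p : ℂ) - 1)⁻¹ * ∑ a, ∑ c : ZMod p,
        if DvdMat ((p : ℤ_[p]) ^ 2)
          ((A a * !![1, 0; p * lift c, (p : ℤ_[p]) ^ 2])ᵀ * ((p : ℤ_[p]) • V))
        then (1 : ℂ) else 0)
      = ((if d = 2 then (p : ℂ) ^ 4 else 0)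
        + ((if pairing (V.map (PadicInt.toZMod (p := p))) = 0 then (p : ℂ) else 0) - 1))
        + (((p : ℂ) ^ 2)⁻¹ + ((p : ℂ) - 1)⁻¹ * (((p : ℂ) ^ d - 1) * p)) := by
  have hp : (p : ℂ) ≠ 0 := Nat.cast_ne_zero.2 (Fact.out : p.Prime).ne_zero
  congr 1
  · have hint : ‖(p : ℚ_[p]) * ((p : ℚ_[p])⁻¹ * (((p : ℚ_[p]) ^ 2)⁻¹ *
        pairing ((p : ℤ_[p]) • V)))‖ ≤ 1 := by
      rw [inv_sq_mul_pairing_smul, mul_inv_cancel_left₀ coe_p_ne_zero']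
      exact (pairing V).2
    have h1 := sum_psi_lift hint
    have h2 : ‖(p : ℚ_[p])⁻¹ * (((p : ℚ_[p]) ^ 2)⁻¹ * pairing ((p : ℤ_[p]) • V))‖ ≤ 1 ↔
        pairing (V.map (PadicInt.toZMod (p := p))) = 0 := by
      rw [inv_sq_mul_pairing_smul, ← toZMod_pairing, toZMod_eq_zero_iff]
      simpa using norm_coe_le_one_of_dvd_iff 1 (pairing V)
    simp only [h2] at h1
    rw [← h1]
    have hp' : DvdMat (p : ℤ_[p]) ((p : ℤ_[p]) • V) := fun i j => Dvd.intro _ rfl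
    simp only [if_pos hp']
    -- The index `b = 0` stands for the diagonal representative. Adding `ψ(0) = 1` in its place
    -- completes the other terms to a full character sum, which accounts for the `-1`.
    rw [← Finset.add_sum_erase _ _ (Finset.mem_univ (0 : ZMod p)), if_pos rfl,
      ← Finset.add_sum_erase _ (fun b : ZMod p => psi p _) (Finset.mem_univ (0 : ZMod p))]
    have h0 : psi p (-(lift (0 : ZMod p) * ((p : ℚ_[p])⁻¹ * (((p : ℚ_[p]) ^ 2)⁻¹ *
        pairing ((p : ℤ_[p]) • V))))) = 1 := by
      obtain ⟨e, he⟩ := (toZMod_eq_zero_iff (lift (0 : ZMod p))).1 (toZMod_lift _)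
      rw [inv_sq_mul_pairing_smul, he, ← psi_coe (-(e * pairing V))]
      congr 1
      push_cast
      have := coe_p_ne_zero' (p := p)
      field_simp
    rw [h0]
    have h3 : DvdMat ((p : ℤ_[p]) ^ 2) ((p : ℤ_[p]) • V) ↔ d = 2 := by
      rw [dvdMat_sq_smul_iff]
      constructor
      · intro h
        rw [h, rank_zero] at hd
        omega
      · intro h
        exact eq_zero_of_rank_eq_zero (by omega)
    rw [show ∀ x : ℂ, 1 + x - 1 = x by intro x; ring]
    congr 1
    · simp only [h3]
    · exact Finset.sum_congr rfl fun b hb => if_neg (Finset.ne_of_mem_erase hb)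
  · congr 1
    · rw [inv_sq_mul_pairing_smul, sum_sum_psi_lift, if_pos (pairing V).2]
      rw [norm_mul]
      refine mul_le_one₀ ?_ (norm_nonneg _) (pairing V).2
      rw [norm_pow]
      exact pow_le_one₀ (norm_nonneg _) Padic.norm_p_lt_one.le
    · congr 1
      rw [Finset.sum_comm]
      have h : ∀ c : ZMod p, ∑ a, (if DvdMat ((p : ℤ_[p]) ^ 2)
          ((A a * !![1, 0; p * lift c, (p : ℤ_[p]) ^ 2])ᵀ * ((p : ℤ_[p]) • V))
          then (1 : ℂ) else 0) = (p : ℂ) ^ d - 1 := by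
        intro c
        rw [sum_ite_vecMul hd, mul_one]
        intro a
        rw [Matrix.mul_smul, dvdMat_sq_smul_iff,
          map_first_col_transpose_mul (hAa a) (map_lower_unipotent _)]
      rw [Finset.sum_congr rfl fun c _ => h c, Finset.sum_const, Finset.card_univ, ZMod.card,
        nsmul_eq_mul, mul_comm]

/-- The relations between the integrals over the double cosets of `G` and of `H` at the
argument `X`. -/
def HeckeRelations (X : Matrix (Fin 2) (Fin 2 ⊕ Fin 2) ℚ_[p]) : Prop :=
  ∫ g in heckeSet (formG p) 1, weilG g (phi0 p) X ∂normalizedHaar (formG p)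
    = (p : ℂ) * ∫ h in heckeSet (formH p) 1, weilH h (phi0 p) X ∂normalizedHaar (formH p)
      + ((p : ℂ) ^ 2 - 1) * phi0 p X ∧
  ∫ g in heckeSet (formG p) 2, weilG g (phi0 p) X ∂normalizedHaar (formG p)
    = ((p : ℂ) ^ 2 - p) * ∫ h in heckeSet (formH p) 1, weilH h (phi0 p) X ∂normalizedHaar (formH p)
      + (p : ℂ) ^ 2 * ∫ h in heckeSet (formH p) 2, weilH h (phi0 p) X ∂normalizedHaar (formH p)

theorem exists_representatives (p : ℕ) [Fact p.Prime] :
    (∃ k : {a : Fin 2 ⊕ Fin 2 → ZMod p // a ≠ 0} → Matrix (Fin 2 ⊕ Fin 2) (Fin 2 ⊕ Fin 2) ℤ_[p],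
      (∀ a, (k a)ᵀ * symp ℤ_[p] * k a = symp ℤ_[p]) ∧
      ∀ a, (k a).map (PadicInt.toZMod (p := p)) *ᵥ Pi.single (.inl 0) 1 = a.1) ∧
    (∃ k : IsotropicFrame p → Matrix (Fin 2 ⊕ Fin 2) (Fin 2 ⊕ Fin 2) ℤ_[p],
      (∀ a, (k a)ᵀ * symp ℤ_[p] * k a = symp ℤ_[p]) ∧
      ∀ a, ((k a).map (PadicInt.toZMod (p := p))).toCols₁ = a.1) ∧
    ∃ A : {a : Fin 2 → ZMod p // a ≠ 0} → Matrix (Fin 2) (Fin 2) ℤ_[p],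
      (∀ a, (A a).det = 1) ∧ ∀ a i, PadicInt.toZMod (A a i 0) = a.1 i := by
  refine ⟨?_, ?_, ?_⟩
  · choose k hk using fun a : {a : Fin 2 ⊕ Fin 2 → ZMod p // a ≠ 0} => exists_symplectic_col a.1 a.2
    exact ⟨k, fun a => (hk a).1, fun a => (hk a).2⟩
  · have h : ∀ a : IsotropicFrame p, HasSympLift a.1 := fun a =>
      hasSympLift a.1 a.2.1 a.2.2
    choose k hk using h
    exact ⟨k, fun a => (hk a).1, fun a => (hk a).2⟩
  · choose A hA using fun a : {a : Fin 2 → ZMod p // a ≠ 0} => exists_specialLinear_col a.1 a.2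
    exact ⟨A, fun a => (hA a).1, fun a => (hA a).2⟩

theorem heckeRelations_of_smul_notMem {X : Matrix (Fin 2) (Fin 2 ⊕ Fin 2) ℚ_[p]}
    (hX : (p : ℚ_[p]) • X ∉ intMat p (Fin 2) (Fin 2 ⊕ Fin 2)) : HeckeRelations X := by
  obtain ⟨⟨k, hk, hka⟩, ⟨l, hl, hla⟩, A, hA, hAa⟩ := exists_representatives p
  have h0 : phi0 p X = 0 := Set.indicator_of_notMem (fun h => hX (by
    rw [mem_intMat_iff] at h ⊢
    intro i j
    rw [Matrix.smul_apply, norm_smul]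
    exact mul_le_one₀ Padic.norm_p_lt_one.le (norm_nonneg _) (h i j))) _
  rw [HeckeRelations, (setIntegral_weilG_one hk hka X).2.1 hX,
    (setIntegral_weilG_two hl hla X).2.1 hX, (setIntegral_weilH_one hA hAa X).2.1 hX,
    (setIntegral_weilH_two hA hAa X).2.1 hX, h0]
  simp

/-- All four integrals are explicit in `d`, the corank of `X` modulo `p`, and in whether its pairing
vanishes modulo `p`. A nonzero pairing forces rank two, so four cases remain for the second
relation. -/
theorem heckeRelations_of_mem {X : Matrix (Fin 2) (Fin 2 ⊕ Fin 2) ℚ_[p]}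
    (hX : X ∈ intMat p (Fin 2) (Fin 2 ⊕ Fin 2)) : HeckeRelations X := by
  classical
  obtain ⟨⟨k, hk, hka⟩, ⟨l, hl, hla⟩, A, hA, hAa⟩ := exists_representatives p
  have h0 : phi0 p X = 1 := Set.indicator_of_mem hX _
  obtain ⟨V, hV⟩ := hX
  have hY : X = (p : ℚ_[p])⁻¹ • ((p : ℤ_[p]) • V).map (algebraMap ℤ_[p] ℚ_[p]) := by
    rw [← hV]
    ext i j
    simp only [Matrix.smul_apply, Matrix.map_apply, smul_eq_mul, map_mul]
    exact (inv_mul_cancel_left₀ coe_p_ne_zero' _).symm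
  have hle : (V.map (PadicInt.toZMod (p := p))).rank ≤ 2 := by
    simpa using (V.map (PadicInt.toZMod (p := p))).rank_le_card_height
  obtain ⟨d, hd⟩ := Nat.exists_eq_add_of_le hle
  have hd3 : (V.map (PadicInt.toZMod (p := p))).rank + (d + 1) = 3 := by omega
  have hp : (p : ℂ) ≠ 0 := Nat.cast_ne_zero.2 (Fact.out : p.Prime).ne_zero
  have hp1 : (p : ℂ) - 1 ≠ 0 := sub_ne_zero.2 (Nat.cast_ne_one.2 (Fact.out : p.Prime).one_lt.ne')
  have hp2 : (p : ℂ) + 1 ≠ 0 := by exact_mod_cast Nat.succ_ne_zero p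
  have hGL : (Nat.card (GL (Fin 2) (ZMod p)) : ℂ)⁻¹
      = (((p : ℂ) - 1) * (p + 1) * (p * (p - 1)))⁻¹ := by
    rw [card_GL_two]
    ring
  rw [HeckeRelations, (setIntegral_weilG_one hk hka X).2.2 _ hY,
    (setIntegral_weilG_two hl hla X).2.2 _ hY, (setIntegral_weilH_one hA hAa X).2.2 _ hY,
    (setIntegral_weilH_two hA hAa X).2.2 _ hY, h0, sum_sympRepOne_smul hka hd3,
    sum_sympRepTwo_smul hla, sum_orthRepOne_smul hAa hd.symm, sum_orthRepTwo_smul hAa hd.symm,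
    card_frames_ker hd3, hGL]
  constructor
  · field_simp
    ring
  · obtain hd' | hd' | hd' : d = 0 ∨ d = 1 ∨ d = 2 := by omega
    · have hs : (V.map (PadicInt.toZMod (p := p))).rank = 2 := by omega
      by_cases hτ : pairing (V.map (PadicInt.toZMod (p := p))) = 0
      · simp only [hs, hd', if_pos hτ]
        norm_num
        field_simp
        ring
      · simp only [hs, hd', if_neg hτ]
        norm_num
        field_simp
        ring
    all_goals
      have hτ : pairing (V.map (PadicInt.toZMod (p := p))) = 0 := by
        by_contra h
        have := rank_eq_two_of_pairing_ne_zero h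
        omega
    · have hs : (V.map (PadicInt.toZMod (p := p))).rank = 1 := by omega
      simp only [hs, hd', if_pos hτ]
      norm_num
      field_simp
      ring
    · have hs : (V.map (PadicInt.toZMod (p := p))).rank = 0 := by omega
      simp only [hs, hd', if_pos hτ]
      norm_num
      field_simp
      ring

end IntegralArgument

/-! ### Tools for a nonintegral argument, and `Y` of rank two modulo `p` -/

section NonIntegralArgument

variable {p : ℕ} [Fact p.Prime]

theorem p_sq_dvd_p_mul_iff (x : ℤ_[p]) : (p : ℤ_[p]) ^ 2 ∣ p * x ↔ (p : ℤ_[p]) ∣ x := by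
  rw [pow_two]
  exact mul_dvd_mul_iff_left coe_p_ne_zero

theorem dvdMat_sq_mul_sympRepOne_iff (Z : Matrix (Fin 2) (Fin 2 ⊕ Fin 2) ℤ_[p]) (c : ℤ_[p]) :
    DvdMat ((p : ℤ_[p]) ^ 2) (Z * sympRepOne c) ↔
      ∀ i, (p : ℤ_[p]) ^ 2 ∣ Z i (.inl 0) + p * (c * Z i (.inr 0)) ∧
        (p : ℤ_[p]) ∣ Z i (.inl 1) ∧ (p : ℤ_[p]) ∣ Z i (.inr 1) := by
  refine forall_congr' fun i => ?_
  have h1 : (Z * sympRepOne c) i (.inl 0) = Z i (.inl 0) + p * (c * Z i (.inr 0)) := by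
    simp [sympRepOne, Matrix.mul_apply, Fintype.sum_sum_type, Fin.sum_univ_two]
    ring
  have h2 : (Z * sympRepOne c) i (.inl 1) = p * Z i (.inl 1) := by
    simp [sympRepOne, Matrix.mul_apply, Fintype.sum_sum_type, Fin.sum_univ_two, mul_comm]
  have h3 : (Z * sympRepOne c) i (.inr 0) = p ^ 2 * Z i (.inr 0) := by
    simp [sympRepOne, Matrix.mul_apply, Fintype.sum_sum_type, Fin.sum_univ_two, mul_comm]
  have h4 : (Z * sympRepOne c) i (.inr 1) = p * Z i (.inr 1) := by
    simp [sympRepOne, Matrix.mul_apply, Fintype.sum_sum_type, Fin.sum_univ_two, mul_comm]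
  rw [Sum.forall, Fin.forall_fin_two, Fin.forall_fin_two, h1, h2, h3, h4, p_sq_dvd_p_mul_iff,
    p_sq_dvd_p_mul_iff]
  have : (p : ℤ_[p]) ^ 2 ∣ p ^ 2 * Z i (.inr 0) := Dvd.intro _ rfl
  tauto

theorem dvdMat_sq_mul_sympRepTwo_iff (P Q S : Matrix (Fin 2) (Fin 2) ℤ_[p]) :
    DvdMat ((p : ℤ_[p]) ^ 2) (fromCols P Q * sympRepTwo S) ↔
      DvdMat ((p : ℤ_[p]) ^ 2) (P + (p : ℤ_[p]) • (Q * S)) := by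
  have h : fromCols P Q * sympRepTwo S
      = fromCols (P + (p : ℤ_[p]) • (Q * S)) ((p : ℤ_[p]) ^ 2 • Q) := by
    rw [sympRepTwo, fromCols_mul_fromBlocks]
    simp
  rw [h]
  constructor
  · exact fun h i j => h i (.inl j)
  · rintro h i (j | j)
    · exact h i j
    · exact Dvd.intro _ rfl

theorem mul_symp_mul_transpose_of_isometry {R : Type*} [CommRing R]
    {k : Matrix (Fin 2 ⊕ Fin 2) (Fin 2 ⊕ Fin 2) R} (hk : kᵀ * symp R * k = symp R) :
    k * symp R * kᵀ = symp R := by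
  have h1 : (-symp R * kᵀ * symp R) * k = 1 := by
    rw [Matrix.mul_assoc, Matrix.mul_assoc, ← Matrix.mul_assoc kᵀ, hk, neg_symp_mul_symp]
  have h2 := mul_eq_one_comm.1 h1
  have h4 : k * symp R * kᵀ = (k * (-symp R * kᵀ * symp R)) * symp R := by
    simp only [Matrix.mul_assoc, Matrix.neg_mul, symp_mul_symp, Matrix.mul_neg, Matrix.mul_one,
      neg_neg]
  rw [h4, h2, Matrix.one_mul]

/-- The pairing is the symplectic product of the two rows, which `k` preserves. -/
theorem pairing_mul_isometry {k : Matrix (Fin 2 ⊕ Fin 2) (Fin 2 ⊕ Fin 2) ℤ_[p]}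
    (hk : kᵀ * symp ℤ_[p] * k = symp ℤ_[p]) (Y : Matrix (Fin 2) (Fin 2 ⊕ Fin 2) ℤ_[p]) :
    pairing (Y * k) = pairing Y := by
  have h3 := mul_symp_mul_transpose_of_isometry hk
  have h5 : pairing (Y * k) • J ℤ_[p] = pairing Y • J ℤ_[p] := by
    rw [← mul_symp_mul_transpose, ← mul_symp_mul_transpose, transpose_mul]
    calc Y * k * symp ℤ_[p] * (kᵀ * Yᵀ) = Y * (k * symp ℤ_[p] * kᵀ) * Yᵀ := by
          simp only [Matrix.mul_assoc]
      _ = _ := by rw [h3]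
  simpa [J] using congrFun (congrFun h5 0) 1

theorem dvdMat_transpose_mul_iff {R n : Type*} [CommRing R] {c : R} {A : Matrix (Fin 2) (Fin 2) R}
    (hA : A.det = 1) (Y : Matrix (Fin 2) n R) : DvdMat c (Aᵀ * Y) ↔ DvdMat c Y :=
  dvdMat_mul_left_iff (B' := A.adjugateᵀ) (by
    rw [← transpose_mul, mul_adjugate, hA, one_smul, transpose_one]) Y

theorem map_eq_zero_of_dvdMat_sq {n : Type*} {A : Matrix (Fin 2) (Fin 2) ℤ_[p]} (hA : A.det = 1)
    {Y : Matrix (Fin 2) n ℤ_[p]}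
    (h : DvdMat ((p : ℤ_[p]) ^ 2) ((A * diagonal ![1, (p : ℤ_[p])])ᵀ * Y)) :
    Y.map (PadicInt.toZMod (p := p)) = 0 := by
  rw [← dvdMat_p_iff, ← dvdMat_transpose_mul_iff hA]
  rw [transpose_mul, diagonal_transpose, Matrix.mul_assoc] at h
  intro i j
  have h1 := h i j
  rw [diagonal_mul] at h1
  fin_cases i
  · refine (dvd_pow_self (p : ℤ_[p]) two_ne_zero).trans ?_
    simpa using h1
  · exact (p_sq_dvd_p_mul_iff _).1 h1

theorem dvdMat_sq_transpose_diagonal_iff {n : Type*} {A : Matrix (Fin 2) (Fin 2) ℤ_[p]}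
    {a : Fin 2 → ZMod p} (ha : ∀ i, PadicInt.toZMod (A i 0) = a i) (Y : Matrix (Fin 2) n ℤ_[p]) :
    DvdMat ((p : ℤ_[p]) ^ 2) ((A * diagonal ![(p : ℤ_[p]), (p : ℤ_[p]) ^ 2])ᵀ * Y) ↔
      a ᵥ* Y.map (PadicInt.toZMod (p := p)) = 0 := by
  rw [diagonal_p_sq_eq, Matrix.mul_smul, transpose_smul, Matrix.smul_mul, dvdMat_sq_smul_iff,
    map_first_col_transpose_mul ha map_diagonal_one_p]

variable {Y : Matrix (Fin 2) (Fin 2 ⊕ Fin 2) ℤ_[p]}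
  {A : {a : Fin 2 → ZMod p // a ≠ 0} → Matrix (Fin 2) (Fin 2) ℤ_[p]}

theorem norm_inv_sq_mul_pairing_le_one_iff (Y : Matrix (Fin 2) (Fin 2 ⊕ Fin 2) ℤ_[p]) :
    ‖((p : ℚ_[p]) ^ 2)⁻¹ * pairing Y‖ ≤ 1 ↔ (p : ℤ_[p]) ^ 2 ∣ pairing Y :=
  norm_coe_le_one_of_dvd_iff 2 _

theorem norm_sq_mul_inv_sq_mul_pairing_le_one (Y : Matrix (Fin 2) (Fin 2 ⊕ Fin 2) ℤ_[p]) :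
    ‖(p : ℚ_[p]) ^ 2 * (((p : ℚ_[p]) ^ 2)⁻¹ * pairing Y)‖ ≤ 1 := by
  rw [mul_inv_cancel_left₀ (pow_ne_zero 2 coe_p_ne_zero')]
  exact (pairing Y).2

open Classical in
-- The representatives indexed by `none` require `Y` to vanish modulo `p`, so only the other family
-- is left.
theorem sum_orthRepOne_of_ne_zero (hA : ∀ a, (A a).det = 1)
    (hAa : ∀ a i, PadicInt.toZMod (A a i 0) = a.1 i)
    (hY : Y.map (PadicInt.toZMod (p := p)) ≠ 0) {d : ℕ}
    (hd : (Y.map (PadicInt.toZMod (p := p))).rank + d = 2) :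
    ∑ a, ((if DvdMat ((p : ℤ_[p]) ^ 2) ((A a * diagonal ![1, (p : ℤ_[p])])ᵀ * Y)
        then (p : ℂ) ^ 2 else 0)
      + ∑ c : ZMod p, if DvdMat ((p : ℤ_[p]) ^ 2)
          ((A a * diagonal ![(p : ℤ_[p]), (p : ℤ_[p]) ^ 2])ᵀ * Y)
        then ((p : ℂ) ^ 2)⁻¹ * psi p (-(lift c * (((p : ℚ_[p]) ^ 2)⁻¹ * pairing Y))) else 0)
      = ((p : ℂ) ^ d - 1) * (((p : ℂ) ^ 2)⁻¹ *
        ∑ c : ZMod p, psi p (-(lift c * (((p : ℚ_[p]) ^ 2)⁻¹ * pairing Y)))) := by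
  rw [Finset.mul_sum, Finset.mul_sum, Finset.sum_add_distrib, Finset.sum_comm]
  rw [Finset.sum_eq_zero fun a _ => if_neg fun h => hY (map_eq_zero_of_dvdMat_sq (hA a) h), zero_add]
  refine Finset.sum_congr rfl fun c _ => ?_
  exact sum_ite_vecMul hd (fun a => dvdMat_sq_transpose_diagonal_iff (hAa a) Y) _

open Classical in
theorem sum_orthRepTwo_of_ne_zero (hY : Y.map (PadicInt.toZMod (p := p)) ≠ 0) :
    (∑ b : ZMod p, if b = 0 then
        if DvdMat ((p : ℤ_[p]) ^ 2) Y then (p : ℂ) ^ 4 else 0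
      else if DvdMat (p : ℤ_[p]) Y then
        psi p (-(lift b * ((p : ℚ_[p])⁻¹ * (((p : ℚ_[p]) ^ 2)⁻¹ * pairing Y)))) else 0)
      + (∑ b : ZMod p, ∑ c : ZMod p, ((p : ℂ) ^ 4)⁻¹ *
        psi p (-((lift b + (p : ℤ_[p]) * lift c : ℤ_[p])
          * (((p : ℚ_[p]) ^ 2)⁻¹ * pairing Y)))
      + ((p : ℂ) - 1)⁻¹ * ∑ a, ∑ c : ZMod p,
        if DvdMat ((p : ℤ_[p]) ^ 2) ((A a * !![1, 0; p * lift c, (p : ℤ_[p]) ^ 2])ᵀ * Y)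
        then (1 : ℂ) else 0)
      = (if (p : ℤ_[p]) ^ 2 ∣ pairing Y then ((p : ℂ) ^ 2)⁻¹ else 0)
      + ((p : ℂ) - 1)⁻¹ * ∑ a, ∑ c : ZMod p,
        if DvdMat ((p : ℤ_[p]) ^ 2) ((A a * !![1, 0; p * lift c, (p : ℤ_[p]) ^ 2])ᵀ * Y)
        then (1 : ℂ) else 0 := by
  rw [sum_sum_psi_lift (norm_sq_mul_inv_sq_mul_pairing_le_one Y)]
  simp only [norm_inv_sq_mul_pairing_le_one_iff]
  rw [Finset.sum_eq_zero, zero_add]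
  intro b _
  rw [if_neg fun h : DvdMat ((p : ℤ_[p]) ^ 2) Y => hY h.of_sq,
    if_neg fun h : DvdMat (p : ℤ_[p]) Y => hY ((dvdMat_p_iff Y).1 h), ite_self]

theorem vecMul_eq_zero_iff_of_rank {W : Matrix (Fin 2) (Fin 2 ⊕ Fin 2) (ZMod p)}
    (hW : W.rank = 2) {a : Fin 2 → ZMod p} (h : a ᵥ* W = 0) : a = 0 := by
  obtain ⟨N, hN⟩ := exists_right_inverse_of_rank hW
  rw [← vecMul_one a, ← hN, ← vecMul_vecMul, h, zero_vecMul]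

theorem map_smul_p {m n : Type*} (M : Matrix m n ℤ_[p]) :
    ((p : ℤ_[p]) • M).map (PadicInt.toZMod (p := p)) = 0 := by
  ext i j
  simp

theorem map_fromCols {R S m n₁ n₂ : Type*} (f : R → S) (P : Matrix m n₁ R) (Q : Matrix m n₂ R) :
    (fromCols P Q).map f = fromCols (P.map f) (Q.map f) := by
  ext i (j | j) <;> rfl

theorem isUnit_det_of_rank_fromCols {Q : Matrix (Fin 2) (Fin 2) (ZMod p)}
    (h : (fromCols (0 : Matrix (Fin 2) (Fin 2) (ZMod p)) Q).rank = 2) : IsUnit Q.det := by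
  obtain ⟨N, hN⟩ := exists_right_inverse_of_rank h
  rw [← fromRows_toRows N, fromCols_mul_fromRows, Matrix.zero_mul, zero_add] at hN
  exact isUnit_det_of_right_inverse hN

/-- The only candidate is `-Q⁻¹ P`. It is symmetric exactly when `P ᵗQ - Q ᵗP`, which is the pairing
times `J`, vanishes. -/
theorem symmetric_solution_iff {P Q : Matrix (Fin 2) (Fin 2) (ZMod p)} (hQ : IsUnit Q.det) :
    (∃! S : {S : Matrix (Fin 2) (Fin 2) (ZMod p) // Sᵀ = S}, P + Q * S.1 = 0) ↔
      pairing (fromCols P Q) = 0 := by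
  have key : ∀ S, P + Q * S = 0 ↔ S = -(Q⁻¹ * P) := by
    intro S
    constructor
    · intro h
      rw [← nonsing_inv_mul_cancel_left Q S hQ, eq_neg_of_add_eq_zero_right h, Matrix.mul_neg]
    · rintro rfl
      rw [Matrix.mul_neg, mul_nonsing_inv_cancel_left _ _ hQ, add_neg_cancel]
  have h1 : P * Qᵀ - Q * Pᵀ = pairing (fromCols P Q) • J (ZMod p) := by
    rw [← mul_symp_mul_transpose, symp, fromCols_mul_fromBlocks, transpose_fromCols,
      fromCols_mul_fromRows]
    simp only [Matrix.mul_zero, Matrix.mul_one, Matrix.mul_neg, zero_add, add_zero, Matrix.neg_mul]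
    abel
  have h2 : pairing (fromCols P Q) = 0 ↔ P * Qᵀ = Q * Pᵀ := by
    rw [← sub_eq_zero (a := P * Qᵀ), h1]
    constructor
    · intro h
      rw [h, zero_smul]
    · intro h
      simpa [J] using congrFun (congrFun h 0) 1
  have h3 : (-(Q⁻¹ * P))ᵀ = -(Q⁻¹ * P) ↔ P * Qᵀ = Q * Pᵀ := by
    obtain ⟨T, hT⟩ : ∃ T, Q⁻¹ * P = T := ⟨_, rfl⟩
    have hP : P = Q * T := by rw [← hT, mul_nonsing_inv_cancel_left Q P hQ]
    rw [hT, transpose_neg, neg_inj, hP, transpose_mul, Matrix.mul_assoc]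
    constructor
    · intro h
      rw [h]
    · intro h
      have hQ' : IsUnit Qᵀ.det := by rwa [det_transpose]
      have h4 := congrArg (Q⁻¹ * ·) h
      simp only [nonsing_inv_mul_cancel_left Q _ hQ] at h4
      have h5 := congrArg (· * Qᵀ⁻¹) h4
      simp only [mul_nonsing_inv_cancel_right Qᵀ _ hQ'] at h5
      exact h5.symm
  rw [h2, ← h3]
  constructor
  · rintro ⟨S, hS, -⟩
    rw [← (key S.1).1 hS, S.2]
  · intro h
    exact ⟨⟨_, h⟩, (key _).2 rfl, fun S hS => Subtype.ext ((key _).1 hS)⟩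

/-- If `Y` kills the isotropic plane modulo `p`, the left block of `Y k` is divisible by `p`. One
division turns the condition on `S` into a linear equation over `𝔽_p`, and one factor `p` splits off
the pairing, which `k` preserves. -/
theorem exists_frame_reduction {k : Matrix (Fin 2 ⊕ Fin 2) (Fin 2 ⊕ Fin 2) ℤ_[p]}
    (hk : kᵀ * symp ℤ_[p] * k = symp ℤ_[p]) {a : Matrix (Fin 2 ⊕ Fin 2) (Fin 2) (ZMod p)}
    (hka : (k.map (PadicInt.toZMod (p := p))).toCols₁ = a)
    (ha : Y.map (PadicInt.toZMod (p := p)) * a = 0) :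
    ∃ P Q : Matrix (Fin 2) (Fin 2) ℤ_[p], Y * k = fromCols ((p : ℤ_[p]) • P) Q ∧
      pairing Y = p * pairing (fromCols P Q) ∧
      (fromCols (0 : Matrix (Fin 2) (Fin 2) (ZMod p)) (Q.map (PadicInt.toZMod (p := p)))).rank
        = (Y.map (PadicInt.toZMod (p := p))).rank ∧
      ∀ S : Matrix (Fin 2) (Fin 2) (ZMod p),
        DvdMat ((p : ℤ_[p]) ^ 2) (Y * (k * sympRepTwo (S.map lift))) ↔
          P.map (PadicInt.toZMod (p := p)) + Q.map (PadicInt.toZMod (p := p)) * S = 0 := by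
  have h1 : (Y * k).toCols₁.map (PadicInt.toZMod (p := p)) = 0 := by
    rw [← ha, ← hka]
    ext i j
    simp [Matrix.mul_apply, toCols₁]
  obtain ⟨P, hP⟩ := (map_toZMod_eq_zero_iff _).1 h1
  have h2 : Y * k = fromCols ((p : ℤ_[p]) • P) (Y * k).toCols₂ := by
    rw [← hP, fromCols_toCols]
  obtain ⟨Q, hQ⟩ : ∃ Q, (Y * k).toCols₂ = Q := ⟨_, rfl⟩
  rw [hQ] at h2
  refine ⟨P, Q, h2, ?_, ?_, fun S => ?_⟩
  · rw [← pairing_mul_isometry hk, h2]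
    simp [pairing_eq]
    ring
  · obtain ⟨k', h3, h4, -⟩ := isometry_inverse (neg_symp_mul_symp ℤ_[p]) hk
    have h5 : IsUnit (k.map (PadicInt.toZMod (p := p))).det := by
      refine isUnit_det_of_right_inverse (B := k'.map (PadicInt.toZMod (p := p))) ?_
      rw [← Matrix.map_mul, h4, Matrix.map_one _ (map_zero _) (map_one _)]
    rw [← rank_mul_eq_left_of_isUnit_det _ (Y.map (PadicInt.toZMod (p := p))) h5, ← Matrix.map_mul,
      h2, map_fromCols, map_smul_p]
  · rw [← Matrix.mul_assoc, h2, dvdMat_sq_mul_sympRepTwo_iff, ← smul_add, dvdMat_sq_smul_iff,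
      Matrix.map_add _ (map_add _), Matrix.map_mul]
    have : (S.map lift).map (PadicInt.toZMod (p := p)) = S := by
      ext i j
      simp [toZMod_lift]
    rw [this]

open Classical in
-- In rank two the block `Q` is invertible modulo `p`, so there is at most one `S`, and it exists
-- exactly when `p²` divides the pairing of `Y`.
theorem sum_sympRepTwo_of_rank_two
    {k : IsotropicFrame p → Matrix (Fin 2 ⊕ Fin 2) (Fin 2 ⊕ Fin 2) ℤ_[p]}
    (hk : ∀ a, (k a)ᵀ * symp ℤ_[p] * k a = symp ℤ_[p])
    (hka : ∀ a, ((k a).map (PadicInt.toZMod (p := p))).toCols₁ = a.1)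
    (hY : (Y.map (PadicInt.toZMod (p := p))).rank = 2) :
    ∑ a, ∑ S : {S : Matrix (Fin 2) (Fin 2) (ZMod p) // Sᵀ = S},
      (if DvdMat ((p : ℤ_[p]) ^ 2) (Y * (k a * sympRepTwo (S.1.map lift))) then (1 : ℂ) else 0)
      = Nat.card {a : IsotropicFrame p // Y.map (PadicInt.toZMod (p := p)) * a.1 = 0} *
        if (p : ℤ_[p]) ^ 2 ∣ pairing Y then 1 else 0 := by
  rw [← sum_ite_frames (Y.map (PadicInt.toZMod (p := p))) (P := fun a =>
    Y.map (PadicInt.toZMod (p := p)) * a.1 = 0) fun a => Iff.rfl]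
  refine Finset.sum_congr rfl fun a _ => ?_
  by_cases ha : Y.map (PadicInt.toZMod (p := p)) * a.1 = 0
  · rw [if_pos ha]
    obtain ⟨P, Q, -, h2, h3, h4⟩ := exists_frame_reduction (hk a) (hka a) ha
    have h5 := symmetric_solution_iff (P := P.map (PadicInt.toZMod (p := p)))
      (isUnit_det_of_rank_fromCols (h3.trans hY))
    rw [← map_fromCols, ← toZMod_pairing, toZMod_eq_zero_iff, ← p_sq_dvd_p_mul_iff, ← h2] at h5
    simp only [h4]
    split_ifs with h
    · exact sum_ite_of_existsUnique (h5.2 h) 1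
    · refine Finset.sum_eq_zero fun S _ => if_neg fun hS => h (h5.1 ⟨S, hS, fun S' hS' => ?_⟩)
      have hQ := isUnit_det_of_rank_fromCols (h3.trans hY)
      apply Subtype.ext
      rw [← nonsing_inv_mul_cancel_left _ S'.1 hQ, ← nonsing_inv_mul_cancel_left _ S.1 hQ,
        eq_neg_of_add_eq_zero_right hS, eq_neg_of_add_eq_zero_right hS']
  · rw [if_neg ha]
    exact Finset.sum_eq_zero fun S _ =>
      if_neg fun h => ha ((map_mul_sympRepTwo (hka a) _ _).1 h.of_sq)

/-- The condition leaves only one column of `Y k` nonzero modulo `p`, which is impossible in rank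
two. -/
theorem not_dvdMat_mul_sympRepOne {k : Matrix (Fin 2 ⊕ Fin 2) (Fin 2 ⊕ Fin 2) ℤ_[p]}
    (hk : kᵀ * symp ℤ_[p] * k = symp ℤ_[p])
    (hY : (Y.map (PadicInt.toZMod (p := p))).rank = 2) (c : ℤ_[p]) :
    ¬ DvdMat ((p : ℤ_[p]) ^ 2) (Y * (k * sympRepOne c)) := by
  intro h
  rw [← Matrix.mul_assoc, dvdMat_sq_mul_sympRepOne_iff] at h
  obtain ⟨k', h3, h4, -⟩ := isometry_inverse (neg_symp_mul_symp ℤ_[p]) hk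
  have h5 : IsUnit (k.map (PadicInt.toZMod (p := p))).det := by
    refine isUnit_det_of_right_inverse (B := k'.map (PadicInt.toZMod (p := p))) ?_
    rw [← Matrix.map_mul, h4, Matrix.map_one _ (map_zero _) (map_one _)]
  rw [← rank_mul_eq_left_of_isUnit_det _ (Y.map (PadicInt.toZMod (p := p))) h5,
    ← Matrix.map_mul] at hY
  have h6 : (Y * k).map (PadicInt.toZMod (p := p))
      = vecMulVec (fun i => PadicInt.toZMod ((Y * k) i (.inr 0))) (Pi.single (.inr 0) 1) := by
    ext i j
    have h7 : PadicInt.toZMod ((Y * k) i (.inl 0)) = 0 := by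
      rw [toZMod_eq_zero_iff, ← dvd_add_left (c := (p : ℤ_[p]) * (c * (Y * k) i (.inr 0)))
        (Dvd.intro _ rfl)]
      exact (dvd_pow_self _ two_ne_zero).trans (h i).1
    have h8 := (toZMod_eq_zero_iff _).2 (h i).2.1
    have h9 := (toZMod_eq_zero_iff _).2 (h i).2.2
    rw [vecMulVec_apply, Matrix.map_apply]
    obtain j | j := j <;> fin_cases j <;> simp [h7, h8, h9]
  have := rank_vecMulVec_le (fun i => PadicInt.toZMod ((Y * k) i (.inr 0)))
    (Pi.single (.inr 0) 1 : Fin 2 ⊕ Fin 2 → ZMod p)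
  rw [← h6, hY] at this
  omega

/-- The kernel is itself an isotropic plane, and the frames are its bases. -/
theorem card_frames_rank_two {W : Matrix (Fin 2) (Fin 2 ⊕ Fin 2) (ZMod p)} (hW : W.rank = 2)
    (hτ : pairing W = 0) : (Nat.card {a : IsotropicFrame p // W * a.1 = 0} : ℂ)
      = Nat.card (GL (Fin 2) (ZMod p)) := by
  rw [card_frames_ker (d := 1) (by omega), hW, if_pos hτ, card_GL_two]
  ring

/-- Both first integrals vanish. The second ones are the indicator of `p² ∣ pairing Y`, with factor
`1` for `G` and `p⁻²` for `H`. -/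
theorem heckeRelations_of_rank_two (hY : (Y.map (PadicInt.toZMod (p := p))).rank = 2) :
    HeckeRelations ((p : ℚ_[p])⁻¹ • Y.map (algebraMap ℤ_[p] ℚ_[p])) := by
  classical
  obtain ⟨⟨k, hk, hka⟩, ⟨l, hl, hla⟩, A, hA, hAa⟩ := exists_representatives p
  have hY0 : Y.map (PadicInt.toZMod (p := p)) ≠ 0 := by
    intro h
    rw [h, rank_zero] at hY
    omega
  have h0 : phi0 p ((p : ℚ_[p])⁻¹ • Y.map (algebraMap ℤ_[p] ℚ_[p])) = 0 := by
    refine Set.indicator_of_notMem (fun h => hY0 ((dvdMat_p_iff Y).1 ?_)) _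
    have := (inv_pow_smul_emb_mem_intMat_iff 1 Y).1
    rw [pow_one, pow_one] at this
    exact this h
  rw [HeckeRelations, (setIntegral_weilG_one hk hka _).2.2 _ rfl,
    (setIntegral_weilG_two hl hla _).2.2 _ rfl, (setIntegral_weilH_one hA hAa _).2.2 _ rfl,
    (setIntegral_weilH_two hA hAa _).2.2 _ rfl, h0, sum_orthRepTwo_of_ne_zero hY0,
    sum_orthRepOne_of_ne_zero hA hAa hY0 (d := 0) (by omega), sum_sympRepTwo_of_rank_two hl hla hY]
  have hp : (p : ℂ) ≠ 0 := Nat.cast_ne_zero.2 (Fact.out : p.Prime).ne_zero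
  constructor
  · rw [Finset.sum_eq_zero fun a _ => Finset.sum_eq_zero fun c _ => if_neg
      (not_dvdMat_mul_sympRepOne (hk a) hY _)]
    simp
  · rw [Finset.sum_eq_zero fun a _ => Finset.sum_eq_zero fun c _ => if_neg fun h =>
      a.2 (vecMul_eq_zero_iff_of_rank hY
        ((map_first_col_transpose_mul (hAa a) (map_lower_unipotent _) Y).1 h.of_sq))]
    split_ifs with h
    · rw [card_frames_rank_two hY, mul_one, inv_mul_cancel₀
        (Nat.cast_ne_zero.2 Nat.card_pos.ne')]
      · simp [hp]
      · rw [← toZMod_pairing, toZMod_eq_zero_iff]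
        exact (dvd_pow_self _ two_ne_zero).trans h
    · simp

end NonIntegralArgument

/-! ### `Y` of rank one modulo `p`: normal form and single terms -/

section RankOne

variable {p : ℕ} [Fact p.Prime]

theorem heckeRelations_transpose_mul_iff {B : Matrix (Fin 2) (Fin 2) ℤ_[p]} (hB : B.det = 1)
    (X : Matrix (Fin 2) (Fin 2 ⊕ Fin 2) ℚ_[p]) :
    HeckeRelations ((B.map (algebraMap ℤ_[p] ℚ_[p]))ᵀ * X) ↔ HeckeRelations X := by
  simp only [HeckeRelations, setIntegral_weilH_transpose_mul hB, weilG_phi0_transpose_mul hB,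
    phi0_transpose_mul hB]

theorem isometry_map_toZMod {k : Matrix (Fin 2 ⊕ Fin 2) (Fin 2 ⊕ Fin 2) ℤ_[p]}
    (hk : kᵀ * symp ℤ_[p] * k = symp ℤ_[p]) :
    (k.map (PadicInt.toZMod (p := p)))ᵀ * symp (ZMod p) * k.map (PadicInt.toZMod (p := p))
      = symp (ZMod p) := by
  have h : (symp ℤ_[p]).map (PadicInt.toZMod (p := p)) = symp (ZMod p) := by
    ext (i | i) (j | j) <;> simp [symp, one_apply, apply_ite (PadicInt.toZMod (p := p))]
  rw [← h, ← Matrix.transpose_map, ← Matrix.map_mul, ← Matrix.map_mul, hk]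

theorem vecMul_symp {R : Type*} [CommRing R] (x : Fin 2 ⊕ Fin 2 → R) :
    x ᵥ* symp R = Sum.elim (fun i => -x (.inr i)) fun i => x (.inl i) := by
  ext (i | i) <;>
    simp [symp, vecMul, dotProduct, Fintype.sum_sum_type, one_apply]

/-- A row vector has, after multiplication by a symplectic matrix, a multiple of the dual of the
first basis vector as its value exactly when its symplectic dual is a multiple of the first
column. -/
theorem vecMul_eq_single_iff {F : Type*} [Field F]
    {k : Matrix (Fin 2 ⊕ Fin 2) (Fin 2 ⊕ Fin 2) F} (hk : kᵀ * symp F * k = symp F)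
    {a : Fin 2 ⊕ Fin 2 → F} (hka : k *ᵥ Pi.single (.inl 0) 1 = a) (v : Fin 2 ⊕ Fin 2 → F) (β : F) :
    v ᵥ* k = Pi.single (.inr 0) β ↔ -(v ᵥ* symp F) = β • a := by
  have h1 : -(v ᵥ* symp F) = k *ᵥ (-((v ᵥ* k) ᵥ* symp F)) := by
    rw [← vecMul_transpose, neg_vecMul, vecMul_vecMul, vecMul_vecMul, ← Matrix.mul_assoc,
      mul_symp_mul_transpose_of_isometry hk]
  have h2 : ∀ x y, k *ᵥ x = k *ᵥ y → x = y := by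
    intro x y h
    have := congrArg ((-symp F * kᵀ * symp F) *ᵥ ·) h
    simp only [mulVec_mulVec] at this
    have h3 : (-symp F * kᵀ * symp F) * k = 1 := by
      rw [Matrix.mul_assoc, Matrix.mul_assoc, ← Matrix.mul_assoc kᵀ, hk, neg_symp_mul_symp]
    simpa only [h3, one_mulVec] using this
  have h4 : -((Pi.single (.inr 0) β : Fin 2 ⊕ Fin 2 → F) ᵥ* symp F) = Pi.single (.inl 0) β := by
    rw [vecMul_symp]
    ext (i | i) <;> fin_cases i <;> simp
  have h5 : (Pi.single (.inl 0) β : Fin 2 ⊕ Fin 2 → F) = β • Pi.single (.inl 0) 1 := by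
    rw [← Pi.single_smul, smul_eq_mul, mul_one]
  have h6 : ∀ x : Fin 2 ⊕ Fin 2 → F, -(x ᵥ* symp F) ᵥ* symp F = x := by
    intro x
    rw [neg_vecMul, vecMul_vecMul, symp_mul_symp, vecMul_neg, vecMul_one, neg_neg]
  rw [h1, ← hka, ← mulVec_smul, ← h5]
  constructor
  · intro h
    rw [h, h4]
  · intro h
    rw [← h6 (v ᵥ* k), h2 _ _ h, ← h4, h6]

/-- The number of symmetric matrices with a prescribed value at a nonzero row vector. -/
theorem card_symmetric_vecMul {q : Fin 2 → ZMod p} (hq : q ≠ 0) (u : Fin 2 → ZMod p) :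
    Nat.card {S : {S : Matrix (Fin 2) (Fin 2) (ZMod p) // Sᵀ = S} // u + q ᵥ* S.1 = 0} = p := by
  have h1 : ∀ S : {S : Matrix (Fin 2) (Fin 2) (ZMod p) // Sᵀ = S}, u + q ᵥ* S.1 = 0 ↔
      (fun x : ZMod p × ZMod p × ZMod p => u 0 + (q 0 * x.1 + q 1 * x.2.1) = 0 ∧
        u 1 + (q 0 * x.2.1 + q 1 * x.2.2) = 0) (symmetricEquiv S) := by
    intro S
    have h : S.1 1 0 = S.1 0 1 := congrFun (congrFun S.2 0) 1
    rw [funext_iff, Fin.forall_fin_two]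
    simp only [Pi.add_apply, Pi.zero_apply, vecMul, dotProduct, Fin.sum_univ_two, h]
    rfl
  rw [Nat.card_congr (symmetricEquiv.subtypeEquiv (q := fun x : ZMod p × ZMod p × ZMod p =>
    u 0 + (q 0 * x.1 + q 1 * x.2.1) = 0 ∧ u 1 + (q 0 * x.2.1 + q 1 * x.2.2) = 0) h1)]
  have hp : Nat.card (ZMod p) = p := Nat.card_zmod p
  -- The entry on the diagonal left free is the upper one if `q 0 = 0` and the lower one otherwise;
  -- the two equations determine the rest.
  by_cases h0 : q 0 = 0
  · have hq1 : q 1 ≠ 0 := fun h => hq (by ext i; fin_cases i <;> assumption)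
    have hm : ∀ s : ZMod p, u 0 + (q 0 * s + q 1 * (-(u 0) / q 1)) = 0 ∧
        u 1 + (q 0 * (-(u 0) / q 1) + q 1 * (-(u 1) / q 1)) = 0 := fun s => by
      rw [h0]
      constructor <;> field_simp <;> ring
    refine (Nat.card_congr (Equiv.mk (fun x => x.1.1)
      (fun s => ⟨(s, -(u 0) / q 1, -(u 1) / q 1), hm s⟩) ?_ fun s => rfl)).trans hp
    rintro ⟨⟨s, t, r⟩, hx1, hx2⟩
    simp only [h0] at hx1 hx2
    simp only [Subtype.mk.injEq, Prod.mk.injEq, true_and]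
    constructor <;> field_simp
    · linear_combination -hx1
    · linear_combination -hx2
  · have hm : ∀ s : ZMod p, u 0 + (q 0 * ((-(u 0) - q 1 * ((-(u 1) - q 1 * s) / q 0)) / q 0)
          + q 1 * ((-(u 1) - q 1 * s) / q 0)) = 0 ∧
        u 1 + (q 0 * ((-(u 1) - q 1 * s) / q 0) + q 1 * s) = 0 := fun s => by
      constructor <;> field_simp <;> ring
    refine (Nat.card_congr (Equiv.mk (fun x => x.1.2.2)
      (fun s => ⟨((-(u 0) - q 1 * ((-(u 1) - q 1 * s) / q 0)) / q 0,
        (-(u 1) - q 1 * s) / q 0, s), hm s⟩) ?_ fun s => rfl)).trans hp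
    rintro ⟨⟨s, t, r⟩, hx1, hx2⟩
    have ht : (-(u 1) - q 1 * r) / q 0 = t := by
      field_simp
      linear_combination -hx2
    simp only [Subtype.mk.injEq, Prod.mk.injEq, and_true, ht]
    field_simp
    linear_combination -hx1

variable {v w : Fin 2 ⊕ Fin 2 → ℤ_[p]}

theorem pairing_of_smul (v w : Fin 2 ⊕ Fin 2 → ℤ_[p]) :
    pairing (of ![v, (p : ℤ_[p]) • w]) = p * pairing (of ![v, w]) := by
  simp [pairing_eq]
  ring

theorem map_of_smul (v w : Fin 2 ⊕ Fin 2 → ℤ_[p]) :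
    (of ![v, (p : ℤ_[p]) • w]).map (PadicInt.toZMod (p := p))
      = vecMulVec (Pi.single 0 1) fun j => PadicInt.toZMod (v j) := by
  ext i j
  fin_cases i <;> simp [vecMulVec_apply]

theorem rank_map_of_smul (hv : (fun j => PadicInt.toZMod (v j)) ≠ 0) (w : Fin 2 ⊕ Fin 2 → ℤ_[p]) :
    ((of ![v, (p : ℤ_[p]) • w]).map (PadicInt.toZMod (p := p))).rank = 1 := by
  rw [map_of_smul]
  exact rank_vecMulVec_eq_one (by simp) hv

theorem p_sq_dvd_pairing_of_smul_iff (v w : Fin 2 ⊕ Fin 2 → ℤ_[p]) :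
    (p : ℤ_[p]) ^ 2 ∣ pairing (of ![v, (p : ℤ_[p]) • w]) ↔
      pairing ((of ![v, w]).map (PadicInt.toZMod (p := p))) = 0 := by
  rw [pairing_of_smul, p_sq_dvd_p_mul_iff, ← toZMod_pairing, toZMod_eq_zero_iff]

theorem pairing_of_eq {R : Type*} [CommRing R] (v w : Fin 2 ⊕ Fin 2 → R) :
    pairing (of ![v, w]) = (v ᵥ* symp R) ⬝ᵥ w := by
  rw [vecMul_symp, pairing_eq]
  simp [dotProduct, Fintype.sum_sum_type, Fin.sum_univ_two]
  ring

/-- The condition for one of the coset representatives of the first Hecke set of `G`. -/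
theorem sum_dvdMat_sympRepOne_of_smul [∀ M : Matrix (Fin 2) (Fin 2 ⊕ Fin 2) ℤ_[p],
    Decidable (DvdMat ((p : ℤ_[p]) ^ 2) M)] {k : Matrix (Fin 2 ⊕ Fin 2) (Fin 2 ⊕ Fin 2) ℤ_[p]}
    (hk : kᵀ * symp ℤ_[p] * k = symp ℤ_[p]) {a : Fin 2 ⊕ Fin 2 → ZMod p}
    (hka : k.map (PadicInt.toZMod (p := p)) *ᵥ Pi.single (.inl 0) 1 = a)
    (hv : (fun j => PadicInt.toZMod (v j)) ≠ 0) {P : Prop} [Decidable P]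
    (hP : P ↔ pairing ((of ![v, w]).map (PadicInt.toZMod (p := p))) = 0 ∧
      ∃ β : ZMod p, -((fun j => PadicInt.toZMod (v j)) ᵥ* symp (ZMod p)) = β • a) :
    ∑ c : ZMod p, (if DvdMat ((p : ℤ_[p]) ^ 2)
        (of ![v, (p : ℤ_[p]) • w] * (k * sympRepOne (lift c))) then (1 : ℂ) else 0)
      = if P then 1 else 0 := by
  set v' : Fin 2 ⊕ Fin 2 → ZMod p := fun j => PadicInt.toZMod (v j) with hv'
  set w' : Fin 2 ⊕ Fin 2 → ZMod p := fun j => PadicInt.toZMod (w j) with hw'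
  have hk' := isometry_map_toZMod hk
  have hvk : ∀ j, PadicInt.toZMod ((v ᵥ* k) j)
      = (v' ᵥ* k.map (PadicInt.toZMod (p := p))) j := fun j => by
    simp [vecMul, dotProduct, hv']
  have hwa : PadicInt.toZMod ((w ᵥ* k) (.inl 0)) = w' ⬝ᵥ a := by
    rw [← hka]
    simp [vecMul, dotProduct, hw', mulVec_single]
  have hu : -(v' ᵥ* symp (ZMod p)) ≠ 0 := by
    intro h
    apply hv
    have h1 : -(v' ᵥ* symp (ZMod p)) ᵥ* symp (ZMod p) = v' := by
      rw [neg_vecMul, vecMul_vecMul, symp_mul_symp, vecMul_neg, vecMul_one, neg_neg]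
    rw [← h1, h, zero_vecMul]
  -- The symplectic dual of `v` is a nonzero multiple of `a`, so the pairing of `v` and `w` vanishes
  -- exactly when `w` is orthogonal to `a`.
  have hpair : ∀ β : ZMod p, -(v' ᵥ* symp (ZMod p)) = β • a →
      (pairing ((of ![v, w]).map (PadicInt.toZMod (p := p))) = 0 ↔ w' ⬝ᵥ a = 0) := by
    intro β hβ
    have h1 : (of ![v, w]).map (PadicInt.toZMod (p := p)) = of ![v', w'] := by
      ext i j
      fin_cases i <;> rfl
    have hβ0 : β ≠ 0 := by
      rintro rfl
      exact hu (by rw [hβ, zero_smul])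
    rw [h1, pairing_of_eq, ← neg_eq_zero, ← neg_dotProduct, hβ, smul_dotProduct, smul_eq_mul,
      mul_eq_zero, or_iff_right hβ0, dotProduct_comm]
  -- The second row of `Y` carries a factor `p`, so after division by it only the first coordinate
  -- of `w k` is constrained.
  have hcond : ∀ c : ZMod p, DvdMat ((p : ℤ_[p]) ^ 2)
      (of ![v, (p : ℤ_[p]) • w] * (k * sympRepOne (lift c))) ↔
      ((p : ℤ_[p]) ^ 2 ∣ (v ᵥ* k) (.inl 0) + p * (lift c * (v ᵥ* k) (.inr 0)) ∧
        (p : ℤ_[p]) ∣ (v ᵥ* k) (.inl 1) ∧ (p : ℤ_[p]) ∣ (v ᵥ* k) (.inr 1)) ∧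
      (p : ℤ_[p]) ∣ (w ᵥ* k) (.inl 0) := by
    intro c
    rw [← Matrix.mul_assoc, dvdMat_sq_mul_sympRepOne_iff, Fin.forall_fin_two]
    have h0 : ∀ j, (of ![v, (p : ℤ_[p]) • w] * k) 0 j = (v ᵥ* k) j := fun j => rfl
    have h1 : ∀ j, (of ![v, (p : ℤ_[p]) • w] * k) 1 j = p * (w ᵥ* k) j := fun j => by
      change (((p : ℤ_[p]) • w) ᵥ* k) j = _
      rw [smul_vecMul]
      rfl
    simp only [h0, h1]
    refine and_congr Iff.rfl ⟨fun h => ?_, fun h => ⟨?_, Dvd.intro _ rfl, Dvd.intro _ rfl⟩⟩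
    · have h2 := h.1
      rw [← mul_add, p_sq_dvd_p_mul_iff] at h2
      rwa [← dvd_add_left (c := lift c * (p * (w ᵥ* k) (.inr 0)))
        (Dvd.intro (lift c * (w ᵥ* k) (.inr 0)) (by ring))]
    · rw [← mul_add, p_sq_dvd_p_mul_iff]
      exact dvd_add h (Dvd.intro (lift c * (w ᵥ* k) (.inr 0)) (by ring))
  have hsingle : ∀ β : ZMod p, v' ᵥ* k.map (PadicInt.toZMod (p := p)) = Pi.single (.inr 0) β ↔
      -(v' ᵥ* symp (ZMod p)) = β • a := vecMul_eq_single_iff hk' hka v'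
  by_cases h : P
  · rw [if_pos h]
    obtain ⟨h1, β, hβ⟩ := hP.1 h
    have hβ0 : β ≠ 0 := by
      rintro rfl
      exact hu (by rw [hβ, zero_smul])
    have h2 := (hsingle β).2 hβ
    have hl0 : (p : ℤ_[p]) ∣ (v ᵥ* k) (.inl 0) := by
      rw [← toZMod_eq_zero_iff, hvk, h2]
      simp
    have hl1 : (p : ℤ_[p]) ∣ (v ᵥ* k) (.inl 1) := by
      rw [← toZMod_eq_zero_iff, hvk, h2]
      simp
    have hr1 : (p : ℤ_[p]) ∣ (v ᵥ* k) (.inr 1) := by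
      rw [← toZMod_eq_zero_iff, hvk, h2]
      simp
    have hr0 : PadicInt.toZMod ((v ᵥ* k) (.inr 0)) = β := by
      rw [hvk, h2]
      simp
    have hw0 : (p : ℤ_[p]) ∣ (w ᵥ* k) (.inl 0) := by
      rw [← toZMod_eq_zero_iff, hwa]
      exact (hpair β hβ).1 h1
    obtain ⟨x, hx⟩ := hl0
    -- What remains is the linear equation `x + c β = 0` modulo `p`, with `β ≠ 0`.
    have h3 : ∀ c : ZMod p, DvdMat ((p : ℤ_[p]) ^ 2)
        (of ![v, (p : ℤ_[p]) • w] * (k * sympRepOne (lift c))) ↔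
        c = -PadicInt.toZMod x / β := by
      intro c
      rw [hcond, and_iff_left hw0, and_iff_left ⟨hl1, hr1⟩, hx, ← mul_add, p_sq_dvd_p_mul_iff,
        ← toZMod_eq_zero_iff, map_add, map_mul, toZMod_lift, hr0, eq_div_iff hβ0,
        eq_neg_iff_add_eq_zero, add_comm]
    exact sum_ite_of_existsUnique (ι := ZMod p) ⟨_, (h3 _).2 rfl, fun c hc => (h3 c).1 hc⟩ 1
  · rw [if_neg h]
    refine Finset.sum_eq_zero fun c _ => if_neg fun hc => h (hP.2 ?_)
    obtain ⟨⟨h1, h2, h3⟩, h4⟩ := (hcond c).1 hc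
    have h5 : (p : ℤ_[p]) ∣ (v ᵥ* k) (.inl 0) := by
      rw [← dvd_add_left (c := (p : ℤ_[p]) * (lift c * (v ᵥ* k) (.inr 0))) (Dvd.intro _ rfl)]
      exact (dvd_pow_self _ two_ne_zero).trans h1
    rw [← toZMod_eq_zero_iff] at h2 h3 h4 h5
    rw [hvk] at h2 h3 h5
    have h6 := (hsingle ((v' ᵥ* k.map (PadicInt.toZMod (p := p))) (.inr 0))).1 (by
      ext (j | j) <;> fin_cases j <;> simp [h2, h3, h5])
    exact ⟨(hpair _ h6).2 (hwa ▸ h4), _, h6⟩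

end RankOne

/-! ### `Y` of rank one modulo `p`: sums and conclusion -/

section RankOneSums

variable {p : ℕ} [Fact p.Prime] {v w : Fin 2 ⊕ Fin 2 → ℤ_[p]}

open Classical in
-- The contributing `a` are the `p - 1` generators of the line spanned by the symplectic dual of
-- `v`, and each contributes one `c`.
theorem sum_sympRepOne_of_smul
    {k : {a : Fin 2 ⊕ Fin 2 → ZMod p // a ≠ 0} → Matrix (Fin 2 ⊕ Fin 2) (Fin 2 ⊕ Fin 2) ℤ_[p]}
    (hk : ∀ a, (k a)ᵀ * symp ℤ_[p] * k a = symp ℤ_[p])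
    (hka : ∀ a, (k a).map (PadicInt.toZMod (p := p)) *ᵥ Pi.single (.inl 0) 1 = a.1)
    (hv : (fun j => PadicInt.toZMod (v j)) ≠ 0) :
    ∑ a, ∑ c : ZMod p, (if DvdMat ((p : ℤ_[p]) ^ 2)
        (of ![v, (p : ℤ_[p]) • w] * (k a * sympRepOne (lift c))) then (1 : ℂ) else 0)
      = ((p : ℂ) - 1) *
        if pairing ((of ![v, w]).map (PadicInt.toZMod (p := p))) = 0 then 1 else 0 := by
  set u : Fin 2 ⊕ Fin 2 → ZMod p := -((fun j => PadicInt.toZMod (v j)) ᵥ* symp (ZMod p)) with hu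
  have hu0 : u ≠ 0 := by
    intro h
    apply hv
    rw [← vecMul_one fun j => PadicInt.toZMod (v j), ← neg_neg (1 : Matrix _ _ (ZMod p)),
      ← symp_mul_symp, vecMul_neg, ← vecMul_vecMul, ← neg_vecMul, ← hu, h, zero_vecMul]
  rw [Finset.sum_congr rfl fun a _ => sum_dvdMat_sympRepOne_of_smul (hk a) (hka a) hv Iff.rfl]
  by_cases hτ : pairing ((of ![v, w]).map (PadicInt.toZMod (p := p))) = 0
  · simp only [hτ, true_and, if_true]
    have h1 : Module.finrank (ZMod p) (LinearMap.ker (Submodule.span (ZMod p) {u}).mkQ) = 1 := by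
      rw [Submodule.ker_mkQ, finrank_span_singleton hu0]
    rw [sum_ite_ker (Submodule.span (ZMod p) {u}).mkQ h1, pow_one]
    intro a
    rw [Submodule.mkQ_apply, Submodule.Quotient.mk_eq_zero, Submodule.mem_span_singleton]
    constructor
    · rintro ⟨β, hβ⟩
      have hβ0 : β ≠ 0 := by
        rintro rfl
        exact hu0 (by rw [hu, hβ, zero_smul])
      exact ⟨β⁻¹, by rw [hu, hβ, smul_smul, inv_mul_cancel₀ hβ0, one_smul]⟩
    · rintro ⟨β, hβ⟩
      have hβ0 : β ≠ 0 := by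
        rintro rfl
        exact a.2 (by rw [← hβ, zero_smul])
      exact ⟨β⁻¹, by rw [← hβ, smul_smul, inv_mul_cancel₀ hβ0, one_smul]⟩
  · simp only [hτ, false_and, if_false, Finset.sum_const_zero, mul_zero]

open Classical in
-- In the reduction along a frame killed by `v`, the second row of `Q` vanishes modulo `p` and the
-- first does not. The second row of the equation says that `w` kills the frame as well, and the
-- first row has `p` symmetric solutions.
theorem sum_sympRepTwo_of_smul
    {k : IsotropicFrame p → Matrix (Fin 2 ⊕ Fin 2) (Fin 2 ⊕ Fin 2) ℤ_[p]}
    (hk : ∀ a, (k a)ᵀ * symp ℤ_[p] * k a = symp ℤ_[p])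
    (hka : ∀ a, ((k a).map (PadicInt.toZMod (p := p))).toCols₁ = a.1)
    (hv : (fun j => PadicInt.toZMod (v j)) ≠ 0) :
    ∑ a, ∑ S : {S : Matrix (Fin 2) (Fin 2) (ZMod p) // Sᵀ = S},
      (if DvdMat ((p : ℤ_[p]) ^ 2)
        (of ![v, (p : ℤ_[p]) • w] * (k a * sympRepTwo (S.1.map lift))) then (1 : ℂ) else 0)
      = Nat.card {a : IsotropicFrame p //
          (of ![v, w]).map (PadicInt.toZMod (p := p)) * a.1 = 0} * p := by
  rw [← sum_ite_frames ((of ![v, w]).map (PadicInt.toZMod (p := p))) (P := fun a =>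
    (of ![v, w]).map (PadicInt.toZMod (p := p)) * a.1 = 0) fun a => Iff.rfl]
  refine Finset.sum_congr rfl fun a _ => ?_
  have hW : (of ![v, w]).map (PadicInt.toZMod (p := p)) * a.1 = 0 ↔
      (of ![v, (p : ℤ_[p]) • w]).map (PadicInt.toZMod (p := p)) * a.1 = 0 ∧
        (fun j => PadicInt.toZMod (w j)) ᵥ* a.1 = 0 := by
    have h1 : ∀ j, ((of ![v, (p : ℤ_[p]) • w]).map (PadicInt.toZMod (p := p)) * a.1) 1 j = 0 := by
      intro j
      simp [Matrix.mul_apply]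
    constructor
    · intro h
      refine ⟨?_, congrFun h 1⟩
      ext i j
      fin_cases i
      · exact congrFun (congrFun h 0) j
      · exact h1 j
    · rintro ⟨h, h'⟩
      ext i j
      fin_cases i
      · exact congrFun (congrFun h 0) j
      · exact congrFun h' j
  by_cases ha : (of ![v, (p : ℤ_[p]) • w]).map (PadicInt.toZMod (p := p)) * a.1 = 0
  · obtain ⟨P, Q, h1, -, h3, h4⟩ := exists_frame_reduction (hk a) (hka a) ha
    rw [rank_map_of_smul hv] at h3
    have hrow : ∀ j, (p : ℤ_[p]) * (w ᵥ* k a) j = fromCols ((p : ℤ_[p]) • P) Q 1 j := by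
      intro j
      rw [← h1]
      change _ = (((p : ℤ_[p]) • w) ᵥ* k a) j
      rw [smul_vecMul]
      rfl
    have hQ1 : ∀ j, PadicInt.toZMod (Q 1 j) = 0 := fun j =>
      (toZMod_eq_zero_iff _).2 (Dvd.intro _ (hrow (.inr j)))
    have hP1 : ∀ j, PadicInt.toZMod (P 1 j) = ((fun j => PadicInt.toZMod (w j)) ᵥ* a.1) j := by
      intro j
      have h5 : (w ᵥ* k a) (.inl j) = P 1 j := mul_left_cancel₀ coe_p_ne_zero (hrow (.inl j))
      rw [← h5, ← hka a]
      simp [vecMul, dotProduct, toCols₁]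
    have hq : (fun j => PadicInt.toZMod (Q 0 j)) ≠ 0 := by
      intro hq
      have : Q.map (PadicInt.toZMod (p := p)) = 0 := by
        ext i j
        fin_cases i
        · exact congrFun hq j
        · exact hQ1 j
      rw [this, fromCols_zero, rank_zero] at h3
      exact zero_ne_one h3
    have hcond : ∀ S : {S : Matrix (Fin 2) (Fin 2) (ZMod p) // Sᵀ = S},
        DvdMat ((p : ℤ_[p]) ^ 2) (of ![v, (p : ℤ_[p]) • w] * (k a * sympRepTwo (S.1.map lift))) ↔
        (of ![v, w]).map (PadicInt.toZMod (p := p)) * a.1 = 0 ∧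
          (fun j => PadicInt.toZMod (P 0 j)) + (fun j => PadicInt.toZMod (Q 0 j)) ᵥ* S.1 = 0 := by
      intro S
      rw [h4, hW, and_iff_right ha, ← Matrix.ext_iff, Fin.forall_fin_two, and_comm, funext_iff,
        funext_iff]
      refine and_congr (forall_congr' fun j => ?_) Iff.rfl
      simp only [Matrix.add_apply, Matrix.map_apply, hP1, Matrix.mul_apply, hQ1, zero_mul,
        Finset.sum_const_zero, add_zero]
      rfl
    simp only [hcond]
    by_cases hWa : (of ![v, w]).map (PadicInt.toZMod (p := p)) * a.1 = 0
    · simp only [hWa, true_and, if_true]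
      rw [← Finset.sum_filter, Finset.sum_const, nsmul_eq_mul, mul_one, ← Fintype.card_subtype,
        ← Nat.card_eq_fintype_card, card_symmetric_vecMul hq]
    · simp only [hWa, false_and, if_false, Finset.sum_const_zero]
  · rw [if_neg fun h => ha (hW.1 h).1]
    exact Finset.sum_eq_zero fun S _ =>
      if_neg fun h => ha ((map_mul_sympRepTwo (hka a) _ _).1 h.of_sq)

open Classical in
-- If `a` annihilates `Y` modulo `p`, then `a 0 = 0` and `A 0 0 = p x`. Dividing by `p` leaves `(x +
-- c A₀₁) v + A₁₀ w = 0` modulo `p`. As `A₀₁` and `A₁₀` are units, this is solvable in `c` only if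
-- `w` is a multiple of `v`, and then uniquely.
theorem sum_lower_unipotent_of_smul {A : Matrix (Fin 2) (Fin 2) ℤ_[p]} (hA : A.det = 1)
    {a : Fin 2 → ZMod p} (ha : ∀ i, PadicInt.toZMod (A i 0) = a i)
    (hv : (fun j => PadicInt.toZMod (v j)) ≠ 0) :
    ∑ c : ZMod p, (if DvdMat ((p : ℤ_[p]) ^ 2) ((A * !![1, 0; p * lift c, (p : ℤ_[p]) ^ 2])ᵀ *
        of ![v, (p : ℤ_[p]) • w]) then (1 : ℂ) else 0)
      = if a ᵥ* (of ![v, (p : ℤ_[p]) • w]).map (PadicInt.toZMod (p := p)) = 0 then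
        if ∃ l : ZMod p, (fun j => PadicInt.toZMod (w j)) = l • fun j => PadicInt.toZMod (v j)
        then 1 else 0 else 0 := by
  set v' : Fin 2 ⊕ Fin 2 → ZMod p := fun j => PadicInt.toZMod (v j) with hv'
  set w' : Fin 2 ⊕ Fin 2 → ZMod p := fun j => PadicInt.toZMod (w j) with hw'
  by_cases h0 : a ᵥ* (of ![v, (p : ℤ_[p]) • w]).map (PadicInt.toZMod (p := p)) = 0
  · rw [if_pos h0]
    have ha0 : a 0 = 0 := by
      obtain ⟨j, hj⟩ := Function.ne_iff.1 hv
      have := congrFun h0 j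
      rw [map_of_smul] at this
      simp [vecMul, dotProduct, Fin.sum_univ_two, vecMulVec_apply] at this
      exact this.resolve_right hj
    obtain ⟨x, hx⟩ := (toZMod_eq_zero_iff _).1 ((ha 0).trans ha0)
    have hdet : PadicInt.toZMod (A 0 1) * PadicInt.toZMod (A 1 0) = -1 := by
      have := congrArg (PadicInt.toZMod (p := p)) hA
      rw [det_fin_two, map_sub, map_mul, map_mul, map_one, ha 0, ha0] at this
      linear_combination -this
    have hy : PadicInt.toZMod (A 0 1) ≠ 0 := by
      intro h
      rw [h, zero_mul] at hdet
      exact one_ne_zero (neg_eq_zero.1 hdet.symm)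
    have hz : PadicInt.toZMod (A 1 0) ≠ 0 := by
      intro h
      rw [h, mul_zero] at hdet
      exact one_ne_zero (neg_eq_zero.1 hdet.symm)
    have hcond : ∀ c : ZMod p, DvdMat ((p : ℤ_[p]) ^ 2)
        ((A * !![1, 0; p * lift c, (p : ℤ_[p]) ^ 2])ᵀ * of ![v, (p : ℤ_[p]) • w]) ↔
        (PadicInt.toZMod x + c * PadicInt.toZMod (A 0 1)) • v' + PadicInt.toZMod (A 1 0) • w'
          = 0 := by
      intro c
      have e0 : ∀ j, ((A * !![1, 0; p * lift c, (p : ℤ_[p]) ^ 2])ᵀ * of ![v, (p : ℤ_[p]) • w]) 0 j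
          = p * ((x + lift c * A 0 1) * v j + (A 1 0 + p * lift c * A 1 1) * w j) := by
        intro j
        simp [Matrix.mul_apply, Fin.sum_univ_two, hx]
        ring
      have e1 : ∀ j, ((A * !![1, 0; p * lift c, (p : ℤ_[p]) ^ 2])ᵀ * of ![v, (p : ℤ_[p]) • w]) 1 j
          = p ^ 2 * (A 0 1 * v j + A 1 1 * (p * w j)) := by
        intro j
        simp [Matrix.mul_apply, Fin.sum_univ_two]
        ring
      rw [DvdMat, Fin.forall_fin_two, funext_iff]
      simp only [e0, e1, dvd_mul_right, implies_true, and_true, p_sq_dvd_p_mul_iff,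
        ← toZMod_eq_zero_iff]
      refine forall_congr' fun j => ?_
      simp [hv', hw']
    simp only [hcond]
    split_ifs with h
    · obtain ⟨l, hl⟩ := h
      have h3 : ∀ c : ZMod p,
          (PadicInt.toZMod x + c * PadicInt.toZMod (A 0 1)) • v' + PadicInt.toZMod (A 1 0) • w' = 0 ↔
          c = -(PadicInt.toZMod x + PadicInt.toZMod (A 1 0) * l) / PadicInt.toZMod (A 0 1) := by
        intro c
        rw [hl, smul_smul, ← add_smul, smul_eq_zero_iff_left hv, eq_div_iff hy,
          eq_neg_iff_add_eq_zero]
        ring_nf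
      exact sum_ite_of_existsUnique (ι := ZMod p) ⟨_, (h3 _).2 rfl, fun c hc => (h3 c).1 hc⟩ 1
    · refine Finset.sum_eq_zero fun c _ => if_neg fun hc => h ?_
      refine ⟨-(PadicInt.toZMod x + c * PadicInt.toZMod (A 0 1)) / PadicInt.toZMod (A 1 0), ?_⟩
      have h1 := eq_neg_of_add_eq_zero_right hc
      rw [div_eq_inv_mul, ← smul_smul, neg_smul, ← h1, smul_smul, inv_mul_cancel₀ hz, one_smul]
  · rw [if_neg h0]
    exact Finset.sum_eq_zero fun c _ => if_neg fun h =>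
      h0 ((map_first_col_transpose_mul ha (map_lower_unipotent _) _).1 h.of_sq)

theorem rank_of_eq_one {F n : Type*} [Field F] [Fintype n] [DecidableEq n] {x y : n → F}
    (hx : x ≠ 0) (h : ∃ l : F, y = l • x) : (of ![x, y]).rank = 1 := by
  obtain ⟨l, rfl⟩ := h
  have : of ![x, l • x] = vecMulVec ![1, l] x := by
    ext i j
    fin_cases i <;> simp [vecMulVec_apply]
  rw [this]
  exact rank_vecMulVec_eq_one (fun h => one_ne_zero (congrFun h 0)) hx

theorem rank_of_eq_two {F n : Type*} [Field F] [Fintype n] [DecidableEq n] {x y : n → F}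
    (hx : x ≠ 0) (h : ¬∃ l : F, y = l • x) : (of ![x, y]).rank = 2 := by
  have h1 : LinearIndependent F ![x, y] := by
    rw [LinearIndependent.pair_iff]
    intro s t hst
    have ht : t = 0 := by
      by_contra ht
      refine h ⟨-(s / t), ?_⟩
      have h2 := eq_neg_of_add_eq_zero_right hst
      rw [neg_smul, div_eq_inv_mul, ← smul_smul, ← smul_neg, ← h2, smul_smul, inv_mul_cancel₀ ht,
        one_smul]
    rw [ht, zero_smul, add_zero] at hst
    exact ⟨(smul_eq_zero.1 hst).resolve_right hx, ht⟩
  simpa using LinearIndependent.rank_matrix (M := of ![x, y]) h1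

/-- The kernel is three-dimensional with a line as radical; its isotropic planes are the `p + 1`
planes through that line. -/
theorem card_frames_rank_one {W : Matrix (Fin 2) (Fin 2 ⊕ Fin 2) (ZMod p)} (hW : W.rank = 1) :
    (Nat.card {a : IsotropicFrame p // W * a.1 = 0} : ℂ)
      = (p + 1) * Nat.card (GL (Fin 2) (ZMod p)) := by
  have hτ : pairing W = 0 := by
    by_contra h
    have := rank_eq_two_of_pairing_ne_zero h
    omega
  rw [card_frames_ker (d := 2) (by omega), hW, if_pos hτ, card_GL_two]
  ring

/-- The kernel is then a nondegenerate plane and contains no isotropic plane. -/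
theorem card_frames_of_pairing_ne_zero {W : Matrix (Fin 2) (Fin 2 ⊕ Fin 2) (ZMod p)}
    (hτ : pairing W ≠ 0) : (Nat.card {a : IsotropicFrame p // W * a.1 = 0} : ℂ) = 0 := by
  rw [card_frames_ker (d := 1) (by rw [rank_eq_two_of_pairing_ne_zero hτ]), if_neg hτ]
  ring

/-- With `τ` the pairing of `(v, w)` modulo `p`, the second relation equates `p` times the number of
isotropic planes killed by `v` and `w` with `p [τ = 0] + p² [w ∈ 𝔽_p v]`. The number of planes is `p
+ 1` if `w` is a multiple of `v`; otherwise it is `1` or `0` according to whether `τ` vanishes. -/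
theorem heckeRelations_of_smul_row (hv : (fun j => PadicInt.toZMod (v j)) ≠ 0)
    (w : Fin 2 ⊕ Fin 2 → ℤ_[p]) :
    HeckeRelations ((p : ℚ_[p])⁻¹ •
      (of ![v, (p : ℤ_[p]) • w]).map (algebraMap ℤ_[p] ℚ_[p])) := by
  classical
  obtain ⟨⟨k, hk, hka⟩, ⟨l, hl, hla⟩, A, hA, hAa⟩ := exists_representatives p
  obtain ⟨Y, hYdef⟩ : ∃ Y, of ![v, (p : ℤ_[p]) • w] = Y := ⟨_, rfl⟩
  have hrank := rank_map_of_smul hv w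
  have hY0 : (of ![v, (p : ℤ_[p]) • w]).map (PadicInt.toZMod (p := p)) ≠ 0 := by
    intro h
    rw [h, rank_zero] at hrank
    omega
  have h0 : phi0 p ((p : ℚ_[p])⁻¹ •
      (of ![v, (p : ℤ_[p]) • w]).map (algebraMap ℤ_[p] ℚ_[p])) = 0 := by
    refine Set.indicator_of_notMem (fun h => hY0 ((dvdMat_p_iff _).1 ?_)) _
    have := (inv_pow_smul_emb_mem_intMat_iff 1 (of ![v, (p : ℤ_[p]) • w])).1
    rw [pow_one, pow_one] at this
    exact this h
  have hpsi : ‖(p : ℚ_[p]) * (((p : ℚ_[p]) ^ 2)⁻¹ * pairing (of ![v, (p : ℤ_[p]) • w]))‖ ≤ 1 := by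
    have : (p : ℚ_[p]) * (((p : ℚ_[p]) ^ 2)⁻¹ * pairing (of ![v, (p : ℤ_[p]) • w]))
        = pairing (of ![v, w]) := by
      have := coe_p_ne_zero' (p := p)
      rw [pairing_of_smul]
      push_cast
      field_simp
    rw [this]
    exact (pairing (of ![v, w])).2
  rw [HeckeRelations, (setIntegral_weilG_one hk hka _).2.2 _ rfl,
    (setIntegral_weilG_two hl hla _).2.2 _ rfl, (setIntegral_weilH_one hA hAa _).2.2 _ rfl,
    (setIntegral_weilH_two hA hAa _).2.2 _ rfl, h0, sum_orthRepTwo_of_ne_zero hY0,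
    sum_orthRepOne_of_ne_zero hA hAa hY0 (d := 1) (by omega), sum_sympRepOne_of_smul hk hka hv,
    sum_sympRepTwo_of_smul hl hla hv, sum_psi_lift hpsi,
    Finset.sum_congr rfl fun a _ => sum_lower_unipotent_of_smul (hA a) (hAa a) hv,
    sum_ite_vecMul (d := 1) (by omega) fun a => Iff.rfl]
  simp only [norm_inv_sq_mul_pairing_le_one_iff, p_sq_dvd_pairing_of_smul_iff]
  have hp : (p : ℂ) ≠ 0 := Nat.cast_ne_zero.2 (Fact.out : p.Prime).ne_zero
  have hp1 : (p : ℂ) - 1 ≠ 0 := sub_ne_zero.2 (Nat.cast_ne_one.2 (Fact.out : p.Prime).one_lt.ne')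
  have hGL : (Nat.card (GL (Fin 2) (ZMod p)) : ℂ) ≠ 0 := Nat.cast_ne_zero.2 Nat.card_pos.ne'
  have hW : (of ![v, w]).map (PadicInt.toZMod (p := p))
      = of ![fun j => PadicInt.toZMod (v j), fun j => PadicInt.toZMod (w j)] := by
    ext i j
    fin_cases i <;> rfl
  rw [pow_one]
  constructor
  · split_ifs
    · field_simp
      ring
    · simp
  · by_cases hl : ∃ l : ZMod p,
        (fun j => PadicInt.toZMod (w j)) = l • fun j => PadicInt.toZMod (v j)
    · have h1 := rank_of_eq_one hv hl
      rw [← hW] at h1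
      have hτ : pairing ((of ![v, w]).map (PadicInt.toZMod (p := p))) = 0 := by
        by_contra h
        have := rank_eq_two_of_pairing_ne_zero h
        omega
      rw [card_frames_rank_one h1, if_pos hτ, if_pos hτ, if_pos hl]
      field_simp
      ring
    · have h1 := rank_of_eq_two hv hl
      rw [← hW] at h1
      rw [if_neg hl]
      split_ifs with hτ
      · rw [card_frames_rank_two h1 hτ]
        field_simp
        ring
      · rw [card_frames_of_pairing_ne_zero hτ]
        simp

/-- A nonzero row vector annihilating `Y` modulo `p` is completed to a matrix of determinant one.
Acting by it makes one row of `Y` divisible by `p`, and both sides are invariant under this action.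
-/
theorem heckeRelations_of_rank_one {Y : Matrix (Fin 2) (Fin 2 ⊕ Fin 2) ℤ_[p]}
    (hY : (Y.map (PadicInt.toZMod (p := p))).rank = 1) :
    HeckeRelations ((p : ℚ_[p])⁻¹ • Y.map (algebraMap ℤ_[p] ℚ_[p])) := by
  have hex : ∃ a : Fin 2 → ZMod p, a ≠ 0 ∧ a ᵥ* Y.map (PadicInt.toZMod (p := p)) = 0 := by
    by_contra! h
    have h1 := finrank_ker_mulVecLin (Y.map (PadicInt.toZMod (p := p)))ᵀ
    rw [rank_transpose, hY, Fintype.card_fin, LinearMap.ker_eq_bot'.2, finrank_bot] at h1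
    · omega
    · intro a ha
      by_contra ha0
      exact h a ha0 (by rwa [mulVecLin_apply, mulVec_transpose] at ha)
  obtain ⟨a, ha0, ha⟩ := hex
  obtain ⟨A, hA, hAa⟩ := exists_specialLinear_col a ha0
  -- The rotation moves the column lifting `a` to second place, so that it is the second row of the
  -- product that becomes divisible by `p`.
  have hB : (A * !![0, 1; -1, 0]).det = 1 := by
    rw [det_mul, hA, det_fin_two]
    simp
  rw [← heckeRelations_transpose_mul_iff hB]
  obtain ⟨Z, hZ⟩ : ∃ Z, (A * !![0, 1; -1, 0])ᵀ * Y = Z := ⟨_, rfl⟩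
  have hXZ : ((A * !![0, 1; -1, 0]).map (algebraMap ℤ_[p] ℚ_[p]))ᵀ *
      ((p : ℚ_[p])⁻¹ • Y.map (algebraMap ℤ_[p] ℚ_[p]))
      = (p : ℚ_[p])⁻¹ • Z.map (algebraMap ℤ_[p] ℚ_[p]) := by
    rw [← hZ, Matrix.mul_smul, ← Matrix.transpose_map, ← Matrix.map_mul]
  have hZ1 : ∀ j, (p : ℤ_[p]) ∣ Z 1 j := by
    intro j
    rw [← toZMod_eq_zero_iff]
    refine Eq.trans ?_ (congrFun ha j)
    rw [← hZ]
    simp [Matrix.mul_apply, Fin.sum_univ_two, vecMul, dotProduct, hAa]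
  choose w hw using hZ1
  have hZ2 : Z = of ![Z 0, (p : ℤ_[p]) • w] := by
    ext i j
    fin_cases i
    · rfl
    · exact hw j
  rw [hXZ, hZ2]
  refine heckeRelations_of_smul_row (fun h => ?_) w
  have h1 : DvdMat (p : ℤ_[p]) Z := by
    rw [hZ2, dvdMat_p_iff, map_of_smul, h]
    ext i j
    simp [vecMulVec_apply]
  rw [← hZ, dvdMat_transpose_mul_iff hB, dvdMat_p_iff] at h1
  rw [h1, rank_zero] at hY
  exact zero_ne_one hY

theorem heckeRelations (X : Matrix (Fin 2) (Fin 2 ⊕ Fin 2) ℚ_[p]) : HeckeRelations X := by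
  by_cases hX : (p : ℚ_[p]) • X ∈ intMat p (Fin 2) (Fin 2 ⊕ Fin 2)
  · obtain ⟨Y, hY⟩ := hX
    have hXY : X = (p : ℚ_[p])⁻¹ • Y.map (algebraMap ℤ_[p] ℚ_[p]) := by
      rw [show Y.map (algebraMap ℤ_[p] ℚ_[p]) = (p : ℚ_[p]) • X from hY, smul_smul,
        inv_mul_cancel₀ coe_p_ne_zero', one_smul]
    have hle : (Y.map (PadicInt.toZMod (p := p))).rank ≤ 2 := by
      simpa using (Y.map (PadicInt.toZMod (p := p))).rank_le_card_height
    obtain h | h | h : (Y.map (PadicInt.toZMod (p := p))).rank = 0 ∨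
        (Y.map (PadicInt.toZMod (p := p))).rank = 1 ∨
        (Y.map (PadicInt.toZMod (p := p))).rank = 2 := by omega
    · refine heckeRelations_of_mem ?_
      have := (inv_pow_smul_emb_mem_intMat_iff 1 Y).2
      rw [pow_one, pow_one, ← hXY] at this
      exact this ((dvdMat_p_iff Y).2 (eq_zero_of_rank_eq_zero h))
    · rw [hXY]
      exact heckeRelations_of_rank_one h
    · rw [hXY]
      exact heckeRelations_of_rank_two h
  · exact heckeRelations_of_smul_notMem hX

end RankOneSums

end

end EichlerUnramified

theorem mainTheorem7 (p : ℕ) [Fact p.Prime] (x y : Matrix (Fin 2) (Fin 2) ℚ_[p]) :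
    ((∀ i ∈ ({1, 2} : Set ℕ),
        IntegrableOn
          (fun h : EichlerUnramified.H p =>
            EichlerUnramified.weilH h (EichlerUnramified.phi0 p) (fromCols x y))
          (EichlerUnramified.heckeSet (EichlerUnramified.formH p) i)
          (EichlerUnramified.normalizedHaar (EichlerUnramified.formH p)) ∧
        IntegrableOn
          (fun g : EichlerUnramified.G p =>
            EichlerUnramified.weilG g (EichlerUnramified.phi0 p) (fromCols x y))
          (EichlerUnramified.heckeSet (EichlerUnramified.formG p) i)
          (EichlerUnramified.normalizedHaar (EichlerUnramified.formG p))) ∧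
      EichlerUnramified.JG 1 x y =
        (p : ℂ) * EichlerUnramified.JH 1 x y
          + ((p : ℂ) ^ 2 - 1) * EichlerUnramified.phi0 p (fromCols x y) ∧
      EichlerUnramified.JG 2 x y =
        ((p : ℂ) ^ 2 - p) * EichlerUnramified.JH 1 x y
          + (p : ℂ) ^ 2 * EichlerUnramified.JH 2 x y) := by
  obtain ⟨⟨k, hk, hka⟩, ⟨l, hl, hla⟩, A, hA, hAa⟩ := EichlerUnramified.exists_representatives p
  -- `JG` and `JH` are by definition the integrals occurring in `HeckeRelations`.
  refine ⟨?_, EichlerUnramified.heckeRelations (fromCols x y)⟩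
  rintro i (rfl | rfl)
  · exact ⟨(EichlerUnramified.setIntegral_weilH_one hA hAa _).1,
      (EichlerUnramified.setIntegral_weilG_one hk hka _).1⟩
  · exact ⟨(EichlerUnramified.setIntegral_weilH_two hA hAa _).1,
      (EichlerUnramified.setIntegral_weilG_two hl hla _).1⟩
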